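/- Let $0<\alpha<1$, $\lambda\in\{1,-1\}$ and $w(x)=\lambda|x|^{-\alpha}$ on $\mathbb{R}^3$. For $h=h(x,v)$ on $\mathbb{R}^3\times\mathbb{R}^3$ put $\rho_h(x)=\int_{\mathbb{R}^3}h(x,v)\,dv$ and $\mathbf{E}_h(x)=-\int_{\mathbb{R}^3}\nabla w(x-y)\rho_h(y)\,dy$, and write $\langle t\rangle=(1+t^2)^{1/2}$. Consider the Vlasov–Riesz system $$\partial_t f+v\cdot\nabla_x f+\mathbf{E}_f\cdot\nabla_v f=0,\qquad f(0)=f_0 .$$ A global solution is a function $f\in C([0,\infty);L^\infty_{x,v}(\mathbb{R}^6))$ with $f(t)\ge 0$, with $\sup_{0\le t\le T}\|f(t)\|_{L^1_{x,v}}<\infty$ for every $T$, and with $f(0)=f_0$ a.e., which solves the equation weakly: for all $\varphi\in C_c^\infty(\mathbb{R}^6)$ and $t\ge0$, $$\int\varphi f(t)=\int\varphi f_0+\int_0^t\!\int\big(v\cdot\nabla_x\varphi+\mathbf{E}_{f(s)}(x)\cdot\nabla_v\varphi\big)f(s,x,v)\,dx\,dv\,ds .$$ All derivatives in norms are weak derivatives.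 Here $\|u\|_{W^{1,p}}=\sum_{|m|\le1}\|\nabla^m u\|_{L^p}$, $\|u\|_{W^{1,1}_xW^{1,\infty}_v}=\sum_{|m|,|m'|\le1}\|\nabla_x^m\nabla_v^{m'}u\|_{L^1_x(L^\infty_v)}$, and $W^{1,1}_vW^{1,\infty}_x$ is the same with the roles of $x$ and $v$ exchanged; an intersection carries the sum of the norms. **Theorem.** There are constants $\eta_0>0$ and $C>0$, depending only on $\alpha$ and $\lambda$, such that the following holds for every $0<\eta_*\le\eta_0$. If $f_0\ge0$ and $$\|f_0\|_{W^{1,1}_{x,v}\cap W^{1,\infty}_{x,v}}+\|f_0\|_{W^{1,1}_xW^{1,\infty}_v\cap W^{1,1}_vW^{1,\infty}_x}\le\eta_*,$$ then there is a global solution $f$ of the Vlasov–Riesz system with initial data $f_0$ such that $$\sup_{t\ge0}\langle t\rangle^3\|\rho_{f(t)}\|_{W^{1,\infty}_x(\mathbb{R}^3)}\le C\eta_*$$ and $$\sup_{t\ge0}\Big(\langle t\rangle^{1+\alpha}\|\mathbf{E}_{f}(t)\|_{L^\infty_x}+\langle t\rangle^{2+\alpha}\|\nabla\mathbf{E}_{f}(t)\|_{L^\infty_x}+\langle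 t\rangle^{3}\|\nabla^2\mathbf{E}_{f}(t)\|_{L^\infty_x}\Big)\le C\eta_* .$$ This solution is unique among all global solutions $g$ with initial data $f_0$ whose density is locally bounded, i.e. $\sup_{0\le t\le T}\|\rho_{g(t)}\|_{L^\infty_x}<\infty$ for every $T$; in particular it is the only global solution that satisfies the density estimate (with any constant). -/

import Mathlib

open MeasureTheory Set Filter Topology
open scoped ENNReal NNReal

noncomputable section

namespace VlasovRiesz

/-! ### Weak derivatives and Sobolev norms -/

section Weak

variable {V : Type*} [NormedAddCommGroup V] [NormedSpace ℝ V]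

/-- Iterated directional derivative of a (smooth) function along a list of directions. -/
def dirDeriv : List V → (V → ℝ) → V → ℝ
  | [], φ => φ
  | e :: l, φ => fun x => fderiv ℝ (dirDeriv l φ) x e

variable [MeasureSpace V] {F : Type*} [NormedAddCommGroup F] [NormedSpace ℝ F]

/-- `g` is the weak (distributional) derivative of `u` along the list of directions `l`; for
`l = []` this says that `g = u` almost everywhere. -/
def IsWeakDeriv (l : List V) (u g : V → F) : Prop :=
  LocallyIntegrable u ∧ LocallyIntegrable g ∧
    ∀ φ : V → ℝ, ContDiff ℝ (⊤ : ℕ∞) φ → HasCompactSupport φ →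
      ∫ x, dirDeriv l φ x • u x = (-1 : ℝ) ^ l.length • ∫ x, φ x • g x

/-- The value of the norm `N` on the weak derivative of `u` along the directions `l`; it is `∞` if
there is no such weak derivative. (The weak derivative is unique up to null sets, so for a norm `N`
that does not see null sets the infimum is over a single value.) -/
def weakNorm (l : List V) (N : (V → F) → ℝ≥0∞) (u : V → F) : ℝ≥0∞ :=
  ⨅ (g : V → F) (_ : IsWeakDeriv l u g), N g

end Weak

/-- The space `ℝ³`, with the Euclidean norm. -/
abbrev R3 : Type := EuclideanSpace ℝ (Fin 3)

/-- The phase space `ℝ³ × ℝ³` of pairs `(x, v)`, with Lebesgue measure. -/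
abbrev Phase : Type := R3 × R3

/-- The `i`-th standard basis vector. -/
def e (i : Fin 3) : R3 := EuclideanSpace.single i 1

/-- Directions of `∇^m` in `ℝ³`, for a multi-index `m` with `|m| ≤ 1`. -/
def dirs : Option (Fin 3) → List R3
  | none => []
  | some i => [e i]

/-- Directions of `∇_x^m` in phase space, `|m| ≤ 1`. -/
def dirsX : Option (Fin 3) → List Phase
  | none => []
  | some i => [(e i, 0)]

/-- Directions of `∇_v^m` in phase space, `|m| ≤ 1`. -/
def dirsV : Option (Fin 3) → List Phase
  | none => []
  | some i => [(0, e i)]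

/-- Directions of `∇_{(x,v)}^m` in phase space, `|m| ≤ 1`. -/
def dirsXV : Option (Fin 3 ⊕ Fin 3) → List Phase
  | none => []
  | some (Sum.inl i) => [(e i, 0)]
  | some (Sum.inr i) => [(0, e i)]

/-- The norm of `W^{1,p}(ℝ³)`. -/
def normW1 (p : ℝ≥0∞) (u : R3 → ℝ) : ℝ≥0∞ :=
  ∑ m : Option (Fin 3), weakNorm (dirs m) (fun g => eLpNorm g p volume) u

/-- The norm of `W^{1,p}_{x,v}(ℝ⁶)`. -/
def normW1Phase (p : ℝ≥0∞) (u : Phase → ℝ) : ℝ≥0∞ :=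
  ∑ m : Option (Fin 3 ⊕ Fin 3), weakNorm (dirsXV m) (fun g => eLpNorm g p volume) u

/-- The norm of `L^r_x(ℝ³; L^{r'}_v(ℝ³))`. -/
def normLxLv (r r' : ℝ≥0∞) (g : Phase → ℝ) : ℝ≥0∞ :=
  eLpNorm (fun x : R3 => eLpNorm (fun v : R3 => g (x, v)) r' volume) r volume

/-- The norm of `L^r_v(ℝ³; L^{r'}_x(ℝ³))`. -/
def normLvLx (r r' : ℝ≥0∞) (g : Phase → ℝ) : ℝ≥0∞ :=
  eLpNorm (fun v : R3 => eLpNorm (fun x : R3 => g (x, v)) r' volume) r volume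

/-- The norm of `W^{1,r}_x(ℝ³; W^{1,r'}_v(ℝ³))`: the sum of the norms of `∇_x^m ∇_v^{m'} u` in
`L^r_x L^{r'}_v` over `|m| ≤ 1`, `|m'| ≤ 1`. -/
def normWxWv (r r' : ℝ≥0∞) (u : Phase → ℝ) : ℝ≥0∞ :=
  ∑ m : Option (Fin 3), ∑ m' : Option (Fin 3),
    weakNorm (dirsX m ++ dirsV m') (normLxLv r r') u

/-- The norm of `W^{1,r}_v(ℝ³; W^{1,r'}_x(ℝ³))`. -/
def normWvWx (r r' : ℝ≥0∞) (u : Phase → ℝ) : ℝ≥0∞ :=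
  ∑ m : Option (Fin 3), ∑ m' : Option (Fin 3),
    weakNorm (dirsV m ++ dirsX m') (normLvLx r r') u

/-- The norm of the initial data: the norm of `W^{1,1}_{x,v} ∩ W^{1,∞}_{x,v}` plus the norm of
`W^{1,1}_x W^{1,∞}_v ∩ W^{1,1}_v W^{1,∞}_x`; an intersection carries the sum of the two norms. -/
def dataNorm (u : Phase → ℝ) : ℝ≥0∞ :=
  (normW1Phase 1 u + normW1Phase ∞ u) + (normWxWv 1 ∞ u + normWvWx 1 ∞ u)

/-! ### The Vlasov–Riesz system -/

/-- The interaction potential `w(x) = lam / |x|^α`. -/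
def potential (α lam : ℝ) (x : R3) : ℝ := lam / ‖x‖ ^ α

/-- The spatial density `ρ_h(x) = ∫ h(x,v) dv`. -/
def density (h : Phase → ℝ) (x : R3) : ℝ := ∫ v : R3, h (x, v)

/-- The force field `E_h(x) = - ∫ ∇w(x-y) ρ_h(y) dy`. -/
def force (α lam : ℝ) (h : Phase → ℝ) (x : R3) : R3 :=
  -∫ y : R3, density h y • gradient (potential α lam) (x - y)

/-- The Japanese bracket `⟨t⟩ = (1 + t²)^{1/2}`. -/
def bracket (t : ℝ) : ℝ := Real.sqrt (1 + t ^ 2)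

/-- `f` is a global (weak) solution, in `C([0,∞); L^∞(ℝ⁶))`, of the Vlasov–Riesz system
`∂_t f + v · ∇_x f + E_f · ∇_v f = 0`, `f(0) = f₀`. Only the values `f t` with `t ≥ 0` matter. -/
structure IsGlobalSolution (α lam : ℝ) (f₀ : Phase → ℝ)
    (f : ℝ → Lp ℝ ∞ (volume : Measure Phase)) : Prop where
  /-- `f ∈ C([0,∞); L^∞)` -/
  continuousOn : ContinuousOn f (Ici 0)
  /-- `f(t)` takes values in `[0,∞)` -/
  nonneg : ∀ t, 0 ≤ t → ∀ᵐ z, 0 ≤ f t z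
  /-- `f(t) ∈ L¹`, locally uniformly in `t`; so `ρ_f(t)` and `E_f(t)` make sense -/
  integrable : ∀ T, 0 ≤ T → ∃ M : ℝ≥0, ∀ t, 0 ≤ t → t ≤ T → eLpNorm (f t) 1 volume ≤ M
  /-- the initial condition -/
  initial : f 0 =ᵐ[volume] f₀
  /-- the equation, tested against `φ ∈ C_c^∞(ℝ⁶)` and integrated over `[0,t]`; the derivative of
  `φ` at `(x,v)` in the direction `(v, E)` is `v · ∇_x φ + E · ∇_v φ` -/
  equation : ∀ φ : Phase → ℝ, ContDiff ℝ (⊤ : ℕ∞) φ → HasCompactSupport φ → ∀ t, 0 ≤ t →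
    IntervalIntegrable
      (fun s => ∫ z, fderiv ℝ φ z (z.2, force α lam (f s) z.1) * f s z) volume 0 t ∧
    ∫ z, φ z * f t z = (∫ z, φ z * f₀ z) +
      ∫ s in (0 : ℝ)..t, ∫ z, fderiv ℝ φ z (z.2, force α lam (f s) z.1) * f s z

/-- The `L^∞` norm of a vector field on `ℝ³`. -/
def normSup (E : R3 → R3) : ℝ≥0∞ := eLpNorm E ∞ volume

/-- The `L^∞` norm of the gradient: the sum over the weak partial derivatives. -/
def normSupGrad (E : R3 → R3) : ℝ≥0∞ := ∑ i : Fin 3, weakNorm [e i] normSup E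

/-- The `L^∞` norm of the second derivative: the sum over the second weak partial derivatives. -/
def normSupHess (E : R3 → R3) : ℝ≥0∞ :=
  ∑ i : Fin 3, ∑ j : Fin 3, weakNorm [e i, e j] normSup E

end VlasovRiesz

end

noncomputable section

namespace VlasovRiesz

section

/-! ### The interaction kernel -/

section Homogeneous

variable {F : Type*} [NormedAddCommGroup F] [NormedSpace ℝ F]

/-! The mechanism is dispersion. The force is the convolution of the density with a kernel of degree
`-(1 + α)`. If the density is at most a multiple of `D (1 + t)⁻³` and the mass at most `D`,
splitting the convolution at radius `1 + t` gives `|E| ≲ D (1 + t)^(-(1+α))` and a Lipschitz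
constant `≲ D (1 + t)^(-(2+α))` (`exists_field_bounds`). Here `α < 1` makes the derivative of the
kernel locally integrable, and `α > 0` makes the force integrable in time, even after the Lipschitz
constant is multiplied by the separation `≲ 1 + t` of two trajectories. Hence for small `D` the
characteristics stay close to free ones: `X(t,z) - x - t v` has Lipschitz constant at most `t / 4`
in `z`. Conversely this closeness gives the density bound (`IsData.map_le`): for `t ≤ 1` the map is
expanded up to a constant in `x`, for `t ≥ 1` it expands `v` at rate `t`, and the two mixed norms of
the data are made for these two cases. So the set `displacements` is preserved by the map sending
trajectories to the trajectories in the force they generate, and this map is a contraction there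
(`ForceBounds.exists_fixedPoint`, `exists_dispersiveFlow`).

The flow is only known to be bi-Lipschitz, and it is never differentiated in its initial data.
Changes of variables are replaced by the behaviour of Haar measure under antilipschitz maps
(`measure_preimage_le_of_antilipschitz`). Conservation of phase space volume comes from uniqueness
for the continuity equation with a Lipschitz field (`IsNullWeakSol.ae_eq_zero`, a commutator
argument): the density of the image of Lebesgue measure and the constant `1` are both bounded weak
solutions (`IsFlow.measurePreserving`). The solution is then the Lipschitz representative `F` of the
data composed with the inverse flow (`IsData.exists_solution`).

For the gradient of the density, the flow is followed backwards from time `t`. A Gronwall estimate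
shows that the inverse flow is Lipschitz in `x` with a constant independent of `t`, and that for
fixed `x` it expands `v` like the free flow (`IsDispersiveFlow.isBackwardMap`). Integrating the
increments of `F` over `v` then costs the same factor `(1 + t)⁻³` as integrating `F` itself
(`IsBackwardMap.lintegral_sub_le`). So the density is bounded and Lipschitz at rate `(1 + t)⁻³`. For
the second derivatives of the force, the kernel of degree `-(2 + α)` is cut into a near part, whose
increments are put on the density, and a far part, whose increments stay on the kernel; both are
integrable since `2 < 2 + α < 3` (`exists_norm_convolution_sub_le`).

For uniqueness, a global solution with locally bounded density conserves mass, hence is continuous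
in time with values in `L¹`, hence generates a continuous Lipschitz force. By uniqueness for the
linear equation it is the data transported by the flow of its own force
(`IsGlobalSolution.exists_flow`). Two flows driven by the forces that they generate, with bounded
densities, coincide because the force depends in a Lipschitz way on the trajectories
(`IsFlow.eq_of_field`). -/

/-- `T` is bounded like a homogeneous function of degree `-q`, and locally Lipschitz away from the
origin like a homogeneous function. -/
structure HomLip (q C : ℝ) (T : R3 → F) : Prop where
  nonneg : 0 ≤ C
  bound : ∀ a : R3, a ≠ 0 → ‖T a‖ ≤ C * ‖a‖ ^ (-q)
  lip : ∀ a b : R3, b ≠ 0 → ‖b‖ ≤ ‖a‖ → ‖T a - T b‖ ≤ C * ‖a - b‖ * ‖b‖ ^ (-(q + 1))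

/-- After dividing by `b ^ (-q)` this is `1 - u ^ (-q) ≤ q * (u - 1)` for `u = a / b`, which follows
from `1 + x ≤ exp x` and `log u ≤ u - 1`. -/
lemma rpow_neg_sub_le {q a b : ℝ} (hq : 0 ≤ q) (hb : 0 < b) (hab : b ≤ a) :
    |a ^ (-q) - b ^ (-q)| ≤ q * (a - b) * b ^ (-(q + 1)) := by
  have ha : 0 < a := hb.trans_le hab
  have h1 : a ^ (-q) ≤ b ^ (-q) := Real.rpow_le_rpow_of_nonpos hb hab (by linarith)
  rw [abs_sub_comm, abs_of_nonneg (by linarith)]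
  have h2 : a ^ (-q) = b ^ (-q) * (a / b) ^ (-q) := by
    rw [← Real.mul_rpow hb.le (by positivity)]; congr 1; field_simp
  have h3 : 1 - q * (a / b - 1) ≤ (a / b) ^ (-q) := by
    rw [Real.rpow_def_of_pos (by positivity)]
    have := Real.add_one_le_exp (Real.log (a / b) * -q)
    have h4 := Real.log_le_sub_one_of_pos (show 0 < a / b by positivity)
    nlinarith
  have h5 : b ^ (-(q + 1)) = b ^ (-q) / b := by
    rw [show -(q + 1) = -q - 1 by ring, Real.rpow_sub hb, Real.rpow_one]
  have h6 : 0 < b ^ (-q) := Real.rpow_pos_of_pos hb _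
  rw [h2, h5]
  calc b ^ (-q) - b ^ (-q) * (a / b) ^ (-q) = b ^ (-q) * (1 - (a / b) ^ (-q)) := by ring
    _ ≤ b ^ (-q) * (q * (a / b - 1)) := by gcongr; linarith
    _ = q * (a - b) * (b ^ (-q) / b) := by field_simp

lemma homLip_norm_rpow {q : ℝ} (hq : 0 ≤ q) : HomLip q (1 + q) (fun a : R3 => ‖a‖ ^ (-q)) where
  nonneg := by linarith
  bound a ha := by
    have : 0 ≤ ‖a‖ ^ (-q) := by positivity
    rw [Real.norm_of_nonneg this]; nlinarith
  lip a b hb hab := by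
    have hb' : 0 < ‖b‖ := norm_pos_iff.2 hb
    refine (rpow_neg_sub_le hq hb' hab).trans ?_
    have := norm_sub_norm_le a b
    have h0 : 0 ≤ ‖a - b‖ := norm_nonneg _
    gcongr
    linarith

/-- Leibniz rule: since `‖b‖ ≤ ‖a‖`, all negative powers may be evaluated at `b`, and the factor `2`
counts the two terms. Building the kernels out of powers of the norm and unit vectors avoids any
differentiation of them here. -/
lemma HomLip.smul {q q' C C' : ℝ} {T : R3 → ℝ} {T' : R3 → F} (h : HomLip q C T)
    (h' : HomLip q' C' T') (hq : 0 ≤ q) :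
    HomLip (q + q') (2 * C * C') (fun a => T a • T' a) where
  nonneg := by have := h.nonneg; have := h'.nonneg; positivity
  bound a ha := by
    have ha' : 0 < ‖a‖ := norm_pos_iff.2 ha
    rw [norm_smul, neg_add, Real.rpow_add ha']
    have := h.nonneg
    have := h'.nonneg
    calc ‖T a‖ * ‖T' a‖ ≤ (C * ‖a‖ ^ (-q)) * (C' * ‖a‖ ^ (-q')) := by
          gcongr
          · exact h.bound a ha
          · exact h'.bound a ha
      _ ≤ 2 * ((C * ‖a‖ ^ (-q)) * (C' * ‖a‖ ^ (-q'))) := by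
          have : 0 ≤ (C * ‖a‖ ^ (-q)) * (C' * ‖a‖ ^ (-q')) := by positivity
          linarith
      _ = _ := by ring
  lip a b hb hab := by
    have hb' : 0 < ‖b‖ := norm_pos_iff.2 hb
    have ha : a ≠ 0 := norm_pos_iff.1 (hb'.trans_le hab)
    have := h.nonneg
    have := h'.nonneg
    have e1 : T a • T' a - T b • T' b = T a • (T' a - T' b) + (T a - T b) • T' b := by
      rw [smul_sub, sub_smul]; abel
    have e2 : ‖T a‖ ≤ C * ‖b‖ ^ (-q) := (h.bound a ha).trans (by
      gcongr 1; exact Real.rpow_le_rpow_of_nonpos hb' hab (by linarith))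
    have e3 : ‖b‖ ^ (-(q + q' + 1)) = ‖b‖ ^ (-q) * ‖b‖ ^ (-(q' + 1)) := by
      rw [← Real.rpow_add hb']; ring_nf
    have e4 : ‖b‖ ^ (-(q + q' + 1)) = ‖b‖ ^ (-(q + 1)) * ‖b‖ ^ (-q') := by
      rw [← Real.rpow_add hb']; ring_nf
    calc ‖T a • T' a - T b • T' b‖ ≤ ‖T a‖ * ‖T' a - T' b‖ + ‖T a - T b‖ * ‖T' b‖ := by
          rw [e1]; refine (norm_add_le _ _).trans ?_; rw [norm_smul, norm_smul]
      _ ≤ (C * ‖b‖ ^ (-q)) * (C' * ‖a - b‖ * ‖b‖ ^ (-(q' + 1)))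
          + (C * ‖a - b‖ * ‖b‖ ^ (-(q + 1))) * (C' * ‖b‖ ^ (-q')) := by
          gcongr
          · exact h'.lip a b hb hab
          · exact h.lip a b hb hab
          · exact h'.bound b hb
      _ = C * C' * ‖a - b‖ * (‖b‖ ^ (-q) * ‖b‖ ^ (-(q' + 1)))
          + C * C' * ‖a - b‖ * (‖b‖ ^ (-(q + 1)) * ‖b‖ ^ (-q')) := by ring
      _ = _ := by rw [← e3, ← e4]; ring

lemma HomLip.const_smul {q C : ℝ} {T : R3 → F} (h : HomLip q C T) (c : ℝ) :
    HomLip q (|c| * C) (fun a => c • T a) where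
  nonneg := mul_nonneg (abs_nonneg _) h.nonneg
  bound a ha := by
    rw [norm_smul, Real.norm_eq_abs, mul_assoc]; gcongr; exact h.bound a ha
  lip a b hb hab := by
    rw [← smul_sub, norm_smul, Real.norm_eq_abs, mul_assoc, mul_assoc, ← mul_assoc C]; gcongr
    exact h.lip a b hb hab

lemma HomLip.smul_const {q C : ℝ} {T : R3 → ℝ} (h : HomLip q C T) (w : F) :
    HomLip q (C * ‖w‖) (fun a => T a • w) where
  nonneg := mul_nonneg h.nonneg (norm_nonneg _)
  bound a ha := by
    rw [norm_smul, mul_right_comm]; gcongr; exact h.bound a ha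
  lip a b hb hab := by
    rw [← sub_smul, norm_smul]
    calc _ ≤ (C * ‖a - b‖ * ‖b‖ ^ (-(q + 1))) * ‖w‖ := by gcongr; exact h.lip a b hb hab
      _ = _ := by ring

lemma HomLip.sub {q C C' : ℝ} {T T' : R3 → F} (h : HomLip q C T) (h' : HomLip q C' T') :
    HomLip q (C + C') (fun a => T a - T' a) where
  nonneg := add_nonneg h.nonneg h'.nonneg
  bound a ha := by
    rw [add_mul]
    exact (norm_sub_le _ _).trans (add_le_add (h.bound a ha) (h'.bound a ha))
  lip a b hb hab := by
    rw [add_mul, add_mul, show T a - T' a - (T b - T' b) = (T a - T b) - (T' a - T' b) by abel]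
    exact (norm_sub_le _ _).trans (add_le_add (h.lip a b hb hab) (h'.lip a b hb hab))

lemma HomLip.congr {q C : ℝ} {T T' : R3 → F} (h : HomLip q C T) (h' : ∀ a, a ≠ 0 → T a = T' a) :
    HomLip q C T' where
  nonneg := h.nonneg
  bound a ha := by rw [← h' a ha]; exact h.bound a ha
  lip a b hb hab := by
    have ha : a ≠ 0 := norm_pos_iff.1 ((norm_pos_iff.2 hb).trans_le hab)
    rw [← h' a ha, ← h' b hb]; exact h.lip a b hb hab

/-- The unit vector field. -/
def unitField (a : R3) : R3 := ‖a‖⁻¹ • a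

/-- The difference is split into `‖a‖⁻¹ • (a - b)` and the change of the normalisation acting on
`b`; each piece is at most `‖a‖⁻¹ * ‖a - b‖`. -/
lemma homLip_unitField : HomLip 0 2 unitField where
  nonneg := by norm_num
  bound a ha := by
    have : ‖a‖ ≠ 0 := norm_ne_zero_iff.2 ha
    rw [unitField, norm_smul, norm_inv, norm_norm, inv_mul_cancel₀ this]; simp
  lip a b hb hab := by
    have hb' : 0 < ‖b‖ := norm_pos_iff.2 hb
    have ha' : 0 < ‖a‖ := hb'.trans_le hab
    have e1 : unitField a - unitField b = ‖a‖⁻¹ • (a - b) + (‖a‖⁻¹ - ‖b‖⁻¹) • b := by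
      simp only [unitField, smul_sub, sub_smul]; abel
    have e2 : |‖a‖⁻¹ - ‖b‖⁻¹| * ‖b‖ ≤ ‖a‖⁻¹ * ‖a - b‖ := by
      rw [← abs_of_pos hb', ← abs_mul, abs_of_pos hb', sub_mul, inv_mul_cancel₀ hb'.ne',
        show ‖a‖⁻¹ * ‖b‖ - 1 = ‖a‖⁻¹ * (‖b‖ - ‖a‖) by field_simp, abs_mul, abs_inv, abs_norm]
      gcongr
      rw [abs_sub_comm]; exact abs_norm_sub_norm_le a b
    rw [e1, zero_add, Real.rpow_neg_one]
    refine (norm_add_le _ _).trans ?_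
    rw [norm_smul, norm_smul, norm_inv, norm_norm, Real.norm_eq_abs]
    have e3 : ‖a‖⁻¹ * ‖a - b‖ ≤ ‖b‖⁻¹ * ‖a - b‖ := by gcongr
    linarith

lemma homLip_unitField_coord (i : Fin 3) : HomLip 0 2 (fun a => unitField a i) where
  nonneg := by norm_num
  bound a ha := (PiLp.norm_apply_le (unitField a) i).trans (homLip_unitField.bound a ha)
  lip a b hb hab := by
    have := PiLp.norm_apply_le (unitField a - unitField b) i
    exact le_trans (by simpa using this) (homLip_unitField.lip a b hb hab)

/-- Symmetric form of the Lipschitz bound, valid also at the origin. -/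
lemma HomLip.norm_sub_le {q C : ℝ} {T : R3 → F} (h : HomLip q C T) (h0 : T 0 = 0) (a b : R3) :
    ‖T a - T b‖ ≤ C * ‖a - b‖ * (‖a‖ ^ (-(q + 1)) + ‖b‖ ^ (-(q + 1))) := by
  -- When one of the points is the origin, `lip` says nothing; `T 0 = 0` and the size bound,
  -- rewritten with the exponent `q + 1`, take its place.
  have hC := h.nonneg
  have key : ∀ c : R3, ‖T c‖ ≤ C * ‖c‖ * ‖c‖ ^ (-(q + 1)) := by
    intro c
    rcases eq_or_ne c 0 with rfl | hc
    · simp [h0]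
    · have : 0 < ‖c‖ := norm_pos_iff.2 hc
      refine (h.bound c hc).trans (le_of_eq ?_)
      rw [mul_assoc]; congr 1
      nth_rw 2 [← Real.rpow_one ‖c‖]
      rw [← Real.rpow_add this]; ring_nf
  have pa : 0 ≤ ‖a‖ ^ (-(q + 1)) := by positivity
  have pb : 0 ≤ ‖b‖ ^ (-(q + 1)) := by positivity
  have p : 0 ≤ C * ‖a - b‖ := by positivity
  rcases eq_or_ne b 0 with rfl | hb
  · have := key a
    simp only [h0, sub_zero] at *
    nlinarith
  rcases eq_or_ne a 0 with rfl | ha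
  · have := key b
    simp only [h0, zero_sub, norm_neg] at *
    nlinarith
  rcases le_total ‖b‖ ‖a‖ with hab | hab
  · refine (h.lip a b hb hab).trans ?_
    gcongr; linarith
  · have := h.lip b a ha hab
    rw [norm_sub_rev, norm_sub_rev b a] at this
    refine this.trans ?_
    gcongr; linarith

end Homogeneous

/-- The interaction kernel `∇w`, in closed form. -/
def kernel (α lam : ℝ) (x : R3) : R3 := (-(lam * α) * ‖x‖ ^ (-(2 + α))) • x

/-- The partial derivative `∂_j ∇w` of the interaction kernel, in closed form. -/
def kernelDeriv (α lam : ℝ) (j : Fin 3) (x : R3) : R3 :=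
  if x = 0 then 0 else
  -(lam * α) • (‖x‖ ^ (-(2 + α)) • e j - ((2 + α) * ‖x‖ ^ (-(4 + α)) * x j) • x)

lemma hasFDerivAt_norm_rpow_neg (p : ℝ) {x : R3} (hx : x ≠ 0) :
    HasFDerivAt (fun y : R3 => ‖y‖ ^ (-p)) ((-p * ‖x‖ ^ (-(p + 2))) • innerSL ℝ x) x := by
  have hx' : 0 < ‖x‖ := norm_pos_iff.2 hx
  have h1 : HasFDerivAt (fun y : R3 => ‖y‖ ^ 2) (2 • innerSL ℝ x) x :=
    (hasStrictFDerivAt_norm_sq x).hasFDerivAt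
  have h2 := h1.rpow_const (p := -p / 2) (Or.inl (by positivity))
  have h3 : ∀ y : R3, (‖y‖ ^ 2) ^ (-p / 2) = ‖y‖ ^ (-p) := fun y => by
    rw [← Real.rpow_natCast, ← Real.rpow_mul (norm_nonneg _)]; congr 1; push_cast; ring
  simp only [h3] at h2
  have h4 : (-p / 2 * (‖x‖ ^ 2) ^ (-p / 2 - 1)) • 2 • innerSL ℝ x
      = (-p * ‖x‖ ^ (-(p + 2))) • innerSL ℝ x := by
    rw [← Real.rpow_natCast, ← Real.rpow_mul (norm_nonneg _),
      show ((2 : ℕ) : ℝ) * (-p / 2 - 1) = -(p + 2) by push_cast; ring, ← Nat.cast_smul_eq_nsmul ℝ,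
      smul_smul]
    congr 1; push_cast; ring
  rw [← h4]
  exact h2

/-- The identity includes the origin, where both sides are `0`. There the potential has value `0` by
the convention for division by zero, so differentiability would force it to tend to `0`, whereas
`‖x‖ ^ α * w(x)` is the constant `lam`; hence either `lam = 0`, or the gradient is the default value
`0`. -/
lemma gradient_potential (α lam : ℝ) (hα : 0 < α) : gradient (potential α lam) = kernel α lam := by
  funext x
  rcases eq_or_ne x 0 with rfl | hx
  · have hnd : ¬ DifferentiableAt ℝ (potential α lam) 0 ∨ lam = 0 := by
      by_cases hl : lam = 0
      · exact Or.inr hl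
      left
      intro hd
      have hc : Tendsto (potential α lam) (𝓝[≠] 0) (𝓝 0) := by
        have := hd.continuousAt.tendsto
        have h0 : potential α lam 0 = 0 := by
          simp [potential, Real.zero_rpow hα.ne']
        rw [h0] at this
        exact this.mono_left nhdsWithin_le_nhds
      have hc2 : Tendsto (fun x : R3 => ‖x‖ ^ α * potential α lam x) (𝓝[≠] 0) (𝓝 (0 * 0)) := by
        refine Tendsto.mul ?_ hc
        have : Continuous (fun x : R3 => ‖x‖ ^ α) :=
          continuous_norm.rpow_const (fun _ => Or.inr hα.le)
        have h := this.tendsto (0 : R3)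
        simp only [norm_zero, Real.zero_rpow hα.ne'] at h
        exact h.mono_left nhdsWithin_le_nhds
      have hc3 : Tendsto (fun x : R3 => ‖x‖ ^ α * potential α lam x) (𝓝[≠] 0) (𝓝 lam) := by
        refine tendsto_const_nhds.congr' ?_
        filter_upwards [self_mem_nhdsWithin] with y hy
        have : 0 < ‖y‖ := norm_pos_iff.2 hy
        have : 0 < ‖y‖ ^ α := by positivity
        simp only [potential]; field_simp
      have := tendsto_nhds_unique hc2 hc3
      simp at this
      exact hl this.symm
    rcases hnd with h | h
    · rw [gradient, fderiv_zero_of_not_differentiableAt h]; simp [kernel]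
    · have : potential α lam = fun _ => 0 := by funext y; simp [potential, h]
      rw [this]; simp [kernel, h]
  · have h1 : HasFDerivAt (potential α lam)
        (lam • ((-α * ‖x‖ ^ (-(α + 2))) • innerSL ℝ x)) x := by
      have := (hasFDerivAt_norm_rpow_neg α hx).const_smul lam
      refine this.congr_of_eventuallyEq (Eventually.of_forall fun y => ?_)
      simp only [potential, Real.rpow_neg (norm_nonneg y), div_eq_mul_inv, Pi.smul_apply,
        smul_eq_mul]
    have h2 : HasGradientAt (potential α lam) (kernel α lam x) x := by
      rw [hasGradientAt_iff_hasFDerivAt]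
      have h3 : InnerProductSpace.toDual ℝ R3 (kernel α lam x)
          = lam • ((-α * ‖x‖ ^ (-(α + 2))) • innerSL ℝ x) := by
        ext y
        simp [kernel, add_comm α 2]
        ring
      rw [h3]
      exact h1
    exact h2.gradient

lemma hasDerivAt_kernel (α lam : ℝ) (j : Fin 3) {x : R3} {θ : ℝ} (hx : x + θ • e j ≠ 0) :
    HasDerivAt (fun t : ℝ => kernel α lam (x + t • e j))
      (kernelDeriv α lam j (x + θ • e j)) θ := by
  have hl : HasDerivAt (fun t : ℝ => x + t • e j) (e j) θ := by
    simpa using ((hasDerivAt_id θ).smul_const (e j)).const_add x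
  have h1 := (hasFDerivAt_norm_rpow_neg (2 + α) hx).comp_hasDerivAt θ hl
  have h2 := (h1.const_mul (-(lam * α))).smul hl
  have h3 : inner ℝ (x + θ • e j) (e j) = (x + θ • e j) j := by
    simp [e, EuclideanSpace.inner_single_right]
  simp only [smul_apply, innerSL_apply_apply, h3, Function.comp_apply,
    smul_eq_mul] at h2
  have h4 : kernelDeriv α lam j (x + θ • e j) = (-(lam * α) * ‖x + θ • e j‖ ^ (-(2 + α))) • e j +
      (-(lam * α) * (-(2 + α) * ‖x + θ • e j‖ ^ (-(2 + α + 2)) * (x + θ • e j) j)) •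
        (x + θ • e j) := by
    rw [kernelDeriv, if_neg hx, show 2 + α + 2 = 4 + α by ring, smul_sub, smul_smul, smul_smul,
      sub_eq_add_neg, ← neg_smul]
    congr 2
    ring
  rw [h4]
  exact h2

lemma kernel_zero (α lam : ℝ) : kernel α lam 0 = 0 := by simp [kernel]

lemma kernelDeriv_zero (α lam : ℝ) (j : Fin 3) : kernelDeriv α lam j 0 = 0 := by
  simp [kernelDeriv]

lemma norm_rpow_neg_add_one {x : R3} (hx : x ≠ 0) (p : ℝ) :
    ‖x‖ ^ (-(p + 1)) = ‖x‖ ^ (-p) * ‖x‖⁻¹ := by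
  have : 0 < ‖x‖ := norm_pos_iff.2 hx
  rw [neg_add, Real.rpow_add this, Real.rpow_neg_one]

lemma exists_homLip_kernel (α lam : ℝ) (hα : 0 < α) :
    ∃ C, HomLip (1 + α) C (kernel α lam) := by
  have h := ((homLip_norm_rpow (show 0 ≤ 1 + α by linarith)).smul homLip_unitField
    (by linarith)).const_smul (-(lam * α))
  rw [add_zero] at h
  refine ⟨_, h.congr fun a ha => ?_⟩
  rw [kernel, unitField, smul_smul, smul_smul, show 2 + α = (1 + α) + 1 by ring,
    norm_rpow_neg_add_one ha, ← mul_assoc]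

/-- Both terms of the derivative are `‖x‖ ^ (-(2 + α))` times bounded expressions in the unit vector
`x / ‖x‖`, so `HomLip.smul` applies repeatedly. -/
lemma exists_homLip_kernelDeriv (α lam : ℝ) (hα : 0 < α) :
    ∃ C, ∀ j, HomLip (2 + α) C (kernelDeriv α lam j) := by
  have hq : 0 ≤ 2 + α := by linarith
  have h1 := homLip_norm_rpow hq
  have h2 := fun j => (h1.smul (homLip_unitField_coord j) hq)
  simp only [add_zero] at h2
  have h3 := fun j => (((h2 j).smul homLip_unitField hq).const_smul (2 + α))
  have h4 := fun j : Fin 3 => ((h1.smul_const (e j)).sub (by simpa only [add_zero] using h3 j)).const_smul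
    (-(lam * α))
  have he : ∀ j, ‖e j‖ = 1 := fun j => by simp [e]
  simp only [he] at h4
  refine ⟨_, fun j => (h4 j).congr fun a ha => ?_⟩
  rw [kernelDeriv, if_neg ha]
  congr 2
  simp only [unitField, PiLp.smul_apply, smul_eq_mul]
  rw [smul_smul, smul_smul, show 4 + α = (2 + α + 1) + 1 by ring,
    norm_rpow_neg_add_one ha, norm_rpow_neg_add_one ha]
  congr 1
  ring

lemma measurable_kernel (α lam : ℝ) : Measurable (kernel α lam) := by
  unfold kernel
  fun_prop

lemma measurable_kernelDeriv (α lam : ℝ) (j : Fin 3) : Measurable (kernelDeriv α lam j) := by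
  unfold kernelDeriv
  refine Measurable.ite (measurableSet_singleton 0) measurable_const ?_
  have : Measurable fun x : R3 => x j := by fun_prop
  fun_prop

end

section

/-! ### Riesz potentials of measures with bounded density -/

/-- The Riesz kernel `|u|^{-q}`, as an extended nonnegative number. -/
def riesz (q : ℝ) (u : R3) : ℝ≥0∞ := ENNReal.ofReal (‖u‖ ^ (-q))

lemma measurable_riesz (q : ℝ) : Measurable (riesz q) := by
  unfold riesz; fun_prop

lemma finrank_R3 : Module.finrank ℝ R3 = 3 := by simp

lemma exists_lintegral_riesz_ball {q : ℝ} (hq3 : q < 3) :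
    ∃ c : ℝ, 0 ≤ c ∧ ∀ R : ℝ, 0 < R →
      ∫⁻ u in Metric.ball (0 : R3) R, riesz q u = ENNReal.ofReal (c * R ^ (3 - q)) := by
  refine ⟨3 * volume.real (Metric.ball (0 : R3) 1) * (3 - q)⁻¹, ?_, fun R hR => ?_⟩
  · have : 0 ≤ (3 - q)⁻¹ := inv_nonneg.2 (by linarith)
    positivity
  have hfun : ∀ y ∈ Ioo (0 : ℝ) R, y ^ (Module.finrank ℝ R3 - 1) • y ^ (-q) = y ^ (2 - q) := by
    intro y hy
    rw [finrank_R3, smul_eq_mul, sub_eq_add_neg, Real.rpow_add hy.1]; norm_num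
  have hint : IntegrableOn (fun u : R3 => ‖u‖ ^ (-q)) (Metric.ball 0 R) := by
    rw [integrableOn_fun_norm_addHaar volume (f := fun y => y ^ (-q)),
      integrableOn_congr_fun hfun measurableSet_Ioo]
    exact (intervalIntegral.integrableOn_Ioo_rpow_iff hR).2 (by linarith)
  have h1 : ∫⁻ u in Metric.ball (0 : R3) R, riesz q u =
      ENNReal.ofReal (∫ u in Metric.ball (0 : R3) R, ‖u‖ ^ (-q)) := by
    rw [ofReal_integral_eq_lintegral_ofReal hint
      (Eventually.of_forall fun u => by positivity)]
    rfl
  rw [h1]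
  congr 1
  have h2 : ∫ u in Metric.ball (0 : R3) R, ‖u‖ ^ (-q)
      = ∫ u : R3, (Iio R).indicator (fun y => y ^ (-q)) ‖u‖ := by
    rw [← integral_indicator measurableSet_ball]
    congr 1; ext u
    by_cases hu : ‖u‖ < R <;> simp [indicator, hu]
  have h3 : ∫ y in Ioi (0 : ℝ), y ^ (Module.finrank ℝ R3 - 1) •
      (Iio R).indicator (fun y => y ^ (-q)) y = ∫ y in Ioo (0 : ℝ) R, y ^ (2 - q) := by
    have : ∀ y, y ^ (Module.finrank ℝ R3 - 1) • (Iio R).indicator (fun y => y ^ (-q)) y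
        = (Iio R).indicator (fun y => y ^ (Module.finrank ℝ R3 - 1) • y ^ (-q)) y := fun y => by
      by_cases hy : y < R <;> simp [indicator, hy]
    simp_rw [this]
    rw [setIntegral_indicator measurableSet_Iio, Ioi_inter_Iio]
    exact setIntegral_congr_fun measurableSet_Ioo hfun
  rw [h2, integral_fun_norm_addHaar, h3, ← integral_Ioc_eq_integral_Ioo,
    ← intervalIntegral.integral_of_le hR.le, integral_rpow (Or.inl (by linarith)), finrank_R3,
    Real.zero_rpow (by linarith)]
  rw [show 2 - q + 1 = 3 - q by ring]
  simp only [nsmul_eq_mul, smul_eq_mul]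
  push_cast
  ring

/-- Outside the unit ball `1 + ‖u‖ ≤ 2 * ‖u‖`, which reduces the claim to the integrability of a
power of `1 + ‖u‖`. -/
lemma lintegral_riesz_compl_ball_lt_top {q : ℝ} (hq3 : 3 < q) :
    ∫⁻ u in (Metric.ball (0 : R3) 1)ᶜ, riesz q u < ∞ := by
  have h1 : Integrable (fun u : R3 => (1 + ‖u‖) ^ (-q)) :=
    integrable_one_add_norm (by rw [finrank_R3]; exact_mod_cast hq3)
  have h2 : ∫⁻ u : R3, ENNReal.ofReal ((2 : ℝ) ^ q * (1 + ‖u‖) ^ (-q)) < ∞ :=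
    (h1.const_mul ((2 : ℝ) ^ q)).lintegral_lt_top
  refine lt_of_le_of_lt ?_ h2
  refine (setLIntegral_mono' measurableSet_ball.compl fun u hu => ?_).trans
    (setLIntegral_le_lintegral _ _)
  have hu' : 1 ≤ ‖u‖ := by simpa using hu
  refine ENNReal.ofReal_le_ofReal ?_
  have : (2 * ‖u‖) ^ (-q) ≤ (1 + ‖u‖) ^ (-q) :=
    Real.rpow_le_rpow_of_nonpos (by positivity) (by linarith) (by linarith)
  rw [Real.mul_rpow (by norm_num) (by positivity)] at this
  calc ‖u‖ ^ (-q) = 2 ^ q * (2 ^ (-q) * ‖u‖ ^ (-q)) := by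
        rw [← mul_assoc, ← Real.rpow_add (by norm_num)]; simp
    _ ≤ _ := by gcongr

lemma lintegral_riesz_sub_ball (q R : ℝ) (x : R3) :
    ∫⁻ y in Metric.ball x R, riesz q (x - y) = ∫⁻ u in Metric.ball (0 : R3) R, riesz q u := by
  rw [← lintegral_indicator measurableSet_ball, ← lintegral_indicator measurableSet_ball,
    ← lintegral_sub_left_eq_self _ x]
  congr 1; ext y
  simp [indicator, dist_eq_norm]

lemma lintegral_near_le {ν : Measure R3} {D : ℝ≥0∞} (hν : ν ≤ D • volume) (s : Set R3)
    (f : R3 → ℝ≥0∞) : ∫⁻ y in s, f y ∂ν ≤ D * ∫⁻ y in s, f y := by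
  calc ∫⁻ y in s, f y ∂ν ≤ ∫⁻ y in s, f y ∂(D • volume) :=
        lintegral_mono' (Measure.restrict_mono le_rfl hν) le_rfl
    _ = D * ∫⁻ y in s, f y := by
        rw [Measure.restrict_smul, lintegral_smul_measure, smul_eq_mul]

/-- Potential estimate: a measure with density at most `D`. -/
lemma exists_lintegral_riesz_le {q : ℝ} (hq0 : 0 ≤ q) (hq3 : q < 3) :
    ∃ c : ℝ, 0 ≤ c ∧ ∀ (ν : Measure R3) (D : ℝ), 0 ≤ D → ν ≤ ENNReal.ofReal D • volume →
      ∀ R : ℝ, 0 < R → ∀ x : R3,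
        ∫⁻ y, riesz q (x - y) ∂ν ≤
          ENNReal.ofReal (D * c * R ^ (3 - q)) + ENNReal.ofReal (R ^ (-q)) * ν univ := by
  obtain ⟨c, hc, h⟩ := exists_lintegral_riesz_ball hq3
  refine ⟨c, hc, fun ν D hD hν R hR x => ?_⟩
  -- Inside the ball of radius `R` the density bound is used, outside it only the total mass. The
  -- radius stays free: it is later taken to be `1 + t` for decay and `1` for qualitative bounds.
  rw [← lintegral_add_compl _ (measurableSet_ball (x := x) (ε := R))]
  gcongr
  · refine (lintegral_near_le hν _ _).trans ?_
    rw [lintegral_riesz_sub_ball, h R hR, ← ENNReal.ofReal_mul hD, mul_assoc]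
  · calc ∫⁻ y in (Metric.ball x R)ᶜ, riesz q (x - y) ∂ν
        ≤ ∫⁻ y in (Metric.ball x R)ᶜ, ENNReal.ofReal (R ^ (-q)) ∂ν := by
          refine setLIntegral_mono' measurableSet_ball.compl fun y hy => ?_
          have : R ≤ ‖x - y‖ := by simpa [dist_eq_norm, norm_sub_rev y x] using hy
          exact ENNReal.ofReal_le_ofReal
            (Real.rpow_le_rpow_of_nonpos hR this (by linarith))
      _ ≤ ENNReal.ofReal (R ^ (-q)) * ν univ := by
          rw [setLIntegral_const]; gcongr; exact subset_univ _

/-! ### Integrals of homogeneous kernels against a measure -/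

section Convolution

variable {Z : Type*} [MeasurableSpace Z] {μ : Measure Z} {q C : ℝ} {T : R3 → R3}

lemma HomLip.norm_le_rpow (h : HomLip q C T) (h0 : T 0 = 0) (a : R3) :
    ‖T a‖ ≤ C * ‖a‖ ^ (-q) := by
  rcases eq_or_ne a 0 with rfl | ha
  · rw [h0, norm_zero]; have := h.nonneg; positivity
  · exact h.bound a ha

lemma HomLip.enorm_le_riesz (h : HomLip q C T) (h0 : T 0 = 0) (a : R3) :
    ‖T a‖ₑ ≤ ENNReal.ofReal C * riesz q a := by
  rw [riesz, ← ENNReal.ofReal_mul h.nonneg, ← ofReal_norm]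
  exact ENNReal.ofReal_le_ofReal (h.norm_le_rpow h0 a)

lemma HomLip.lintegral_enorm_le (h : HomLip q C T) (h0 : T 0 = 0) {u : Z → R3} {S : ℝ}
    (hS : ∫⁻ z, riesz q (u z) ∂μ ≤ ENNReal.ofReal S) :
    ∫⁻ z, ‖T (u z)‖ₑ ∂μ ≤ ENNReal.ofReal (C * S) := by
  calc ∫⁻ z, ‖T (u z)‖ₑ ∂μ ≤ ∫⁻ z, ENNReal.ofReal C * riesz q (u z) ∂μ :=
        lintegral_mono fun z => h.enorm_le_riesz h0 _
    _ ≤ ENNReal.ofReal C * ENNReal.ofReal S := by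
        rw [lintegral_const_mul' _ _ ENNReal.ofReal_ne_top]; gcongr
    _ = _ := by rw [ENNReal.ofReal_mul h.nonneg]

lemma HomLip.integrable_comp (h : HomLip q C T) (h0 : T 0 = 0) (hT : Measurable T) {u : Z → R3}
    (hu : AEMeasurable u μ) {S : ℝ} (hS : ∫⁻ z, riesz q (u z) ∂μ ≤ ENNReal.ofReal S) :
    Integrable (fun z => T (u z)) μ :=
  ⟨(hT.comp_aemeasurable hu).aestronglyMeasurable,
    (h.lintegral_enorm_le h0 hS).trans_lt ENNReal.ofReal_lt_top⟩

lemma norm_integral_le_of_lintegral {f : Z → R3} {a : ℝ} (ha : 0 ≤ a)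
    (h : ∫⁻ z, ‖f z‖ₑ ∂μ ≤ ENNReal.ofReal a) : ‖∫ z, f z ∂μ‖ ≤ a := by
  have := (enorm_integral_le_lintegral_enorm f (μ := μ)).trans h
  rwa [← ofReal_norm, ENNReal.ofReal_le_ofReal_iff ha] at this

lemma HomLip.norm_integral_comp_le (h : HomLip q C T) (h0 : T 0 = 0) {u : Z → R3}
    {S : ℝ} (hS0 : 0 ≤ S) (hS : ∫⁻ z, riesz q (u z) ∂μ ≤ ENNReal.ofReal S) :
    ‖∫ z, T (u z) ∂μ‖ ≤ C * S :=
  norm_integral_le_of_lintegral (mul_nonneg h.nonneg hS0) (h.lintegral_enorm_le h0 hS)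

/-- Integrating the symmetric Lipschitz bound costs one more degree of singularity. With `q = 1 + α`
this asks for Riesz potentials of degree `2 + α < 3`, which is where `α < 1` enters; the result is a
true Lipschitz estimate, without logarithmic loss. -/
lemma HomLip.norm_integral_sub_le (h : HomLip q C T) (h0 : T 0 = 0)
    {u₁ u₂ : Z → R3}
    (hi₁ : Integrable (fun z => T (u₁ z)) μ) (hi₂ : Integrable (fun z => T (u₂ z)) μ)
    {d S₁ S₂ : ℝ} (hd : 0 ≤ d) (hdist : ∀ z, ‖u₁ z - u₂ z‖ ≤ d) (hS₁0 : 0 ≤ S₁) (hS₂0 : 0 ≤ S₂)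
    (hu₁ : AEMeasurable u₁ μ)
    (hS₁ : ∫⁻ z, riesz (q + 1) (u₁ z) ∂μ ≤ ENNReal.ofReal S₁)
    (hS₂ : ∫⁻ z, riesz (q + 1) (u₂ z) ∂μ ≤ ENNReal.ofReal S₂) :
    ‖(∫ z, T (u₁ z) ∂μ) - ∫ z, T (u₂ z) ∂μ‖ ≤ C * d * (S₁ + S₂) := by
  have hC := h.nonneg
  rw [← integral_sub hi₁ hi₂]
  refine norm_integral_le_of_lintegral (by positivity) ?_
  calc ∫⁻ z, ‖T (u₁ z) - T (u₂ z)‖ₑ ∂μ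
      ≤ ∫⁻ z, ENNReal.ofReal (C * d) * (riesz (q + 1) (u₁ z) + riesz (q + 1) (u₂ z)) ∂μ := by
        refine lintegral_mono fun z => ?_
        rw [riesz, riesz, ← ENNReal.ofReal_add (by positivity) (by positivity),
          ← ENNReal.ofReal_mul (by positivity), ← ofReal_norm]
        refine ENNReal.ofReal_le_ofReal ((h.norm_sub_le h0 _ _).trans ?_)
        gcongr
        exact hdist z
    _ ≤ ENNReal.ofReal (C * d) * (ENNReal.ofReal S₁ + ENNReal.ofReal S₂) := by
        rw [lintegral_const_mul' _ _ ENNReal.ofReal_ne_top,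
          lintegral_add_left' (f := fun z => riesz (q + 1) (u₁ z))
            ((measurable_riesz _).comp_aemeasurable hu₁)]
        gcongr
    _ = _ := by rw [← ENNReal.ofReal_add hS₁0 hS₂0, ← ENNReal.ofReal_mul (by positivity)]

end Convolution

/-! ### The force field generated by a measure -/

/-- The force field generated by a measure `ν` on `ℝ³`. -/
def field (α lam : ℝ) (ν : Measure R3) (x : R3) : R3 := -∫ y, kernel α lam (x - y) ∂ν

/-- The interaction kernel, truncated near the origin. -/
def kernelTrunc (α lam δ : ℝ) (x : R3) : R3 := (-(lam * α) * (max ‖x‖ δ) ^ (-(2 + α))) • x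

lemma continuous_kernelTrunc (α lam : ℝ) {δ : ℝ} (hδ : 0 < δ) :
    Continuous (kernelTrunc α lam δ) := by
  have : Continuous fun x : R3 => (max ‖x‖ δ) ^ (-(2 + α)) :=
    (continuous_norm.max continuous_const).rpow_const
      fun x => Or.inl (lt_max_of_lt_right hδ).ne'
  unfold kernelTrunc
  fun_prop

lemma norm_kernelTrunc_le {α : ℝ} (lam : ℝ) (hα : 0 < α) {δ : ℝ} (hδ : 0 < δ) (x : R3) :
    ‖kernelTrunc α lam δ x‖ ≤ |lam * α| * δ ^ (-(1 + α)) := by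
  have hm : 0 < max ‖x‖ δ := lt_max_of_lt_right hδ
  rw [kernelTrunc, norm_smul, norm_mul, norm_neg, Real.norm_eq_abs, mul_assoc]
  gcongr
  rw [Real.norm_of_nonneg (by positivity)]
  calc (max ‖x‖ δ) ^ (-(2 + α)) * ‖x‖ ≤ (max ‖x‖ δ) ^ (-(2 + α)) * max ‖x‖ δ := by
        gcongr; exact le_max_left _ _
    _ = (max ‖x‖ δ) ^ (-(1 + α)) := by
        nth_rw 2 [← Real.rpow_one (max ‖x‖ δ)]
        rw [← Real.rpow_add hm]; ring_nf
    _ ≤ δ ^ (-(1 + α)) :=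
        Real.rpow_le_rpow_of_nonpos hδ (le_max_right _ _) (by linarith)

lemma enorm_kernel_sub_kernelTrunc_le {α : ℝ} (lam : ℝ) (hα : 0 < α) (δ : ℝ) (x : R3) :
    ‖kernel α lam x - kernelTrunc α lam δ x‖ₑ
      ≤ ENNReal.ofReal |lam * α| * (Metric.ball (0 : R3) δ).indicator (riesz (1 + α)) x := by
  by_cases hx : ‖x‖ < δ
  · rw [indicator_of_mem (by simpa using hx), riesz, ← ENNReal.ofReal_mul (abs_nonneg _),
      ← ofReal_norm]
    refine ENNReal.ofReal_le_ofReal ?_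
    rcases eq_or_ne x 0 with rfl | hx0
    · simp only [kernel, kernelTrunc, smul_zero, sub_zero, norm_zero]; positivity
    have hx0' : 0 < ‖x‖ := norm_pos_iff.2 hx0
    rw [kernel, kernelTrunc, max_eq_right hx.le, ← sub_smul, ← mul_sub, norm_smul, norm_mul,
      norm_neg, Real.norm_eq_abs, mul_assoc]
    gcongr
    have h1 : δ ^ (-(2 + α)) ≤ ‖x‖ ^ (-(2 + α)) :=
      Real.rpow_le_rpow_of_nonpos hx0' hx.le (by linarith)
    have h2 : 0 < δ ^ (-(2 + α)) := Real.rpow_pos_of_pos (hx0'.trans hx) _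
    rw [Real.norm_of_nonneg (by linarith)]
    calc _ ≤ ‖x‖ ^ (-(2 + α)) * ‖x‖ := by gcongr; linarith
      _ = _ := by
        nth_rw 2 [← Real.rpow_one ‖x‖]
        rw [← Real.rpow_add hx0']; ring_nf
  · rw [kernel, kernelTrunc, max_eq_left (not_lt.1 hx), sub_self]; simp

/-- Weak continuity of the measures controls the field only for bounded continuous kernels.
Truncating the kernel at scale `δ` changes the field by at most a constant times `D * δ ^ (2 - α)`,
uniformly in `t` because of the common density bound, so the field is a uniform limit of continuous
functions of time. -/
lemma continuous_field_of_weak {α lam : ℝ} (hα0 : 0 < α) (hα1 : α < 1) {ν : ℝ → Measure R3} {D M : ℝ} (hD : 0 ≤ D)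
    (hν : ∀ t, ν t ≤ ENNReal.ofReal D • volume) (hM : ∀ t, ν t univ ≤ ENNReal.ofReal M)
    (hw : ∀ φ : R3 → R3, Continuous φ → (∃ B, ∀ y, ‖φ y‖ ≤ B) → Continuous fun t => ∫ y, φ y ∂ν t)
    (x : R3) : Continuous fun t => field α lam (ν t) x := by
  obtain ⟨C, hK⟩ := exists_homLip_kernel α lam hα0
  obtain ⟨c, hc, hb⟩ := exists_lintegral_riesz_ball (show 1 + α < 3 by linarith)
  obtain ⟨c', -, hb'⟩ := exists_lintegral_riesz_le (q := 1 + α) (by linarith) (by linarith)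
  have hfin : ∀ t, IsFiniteMeasure (ν t) := fun t =>
    ⟨(hM t).trans_lt ENNReal.ofReal_lt_top⟩
  have hint : ∀ t, Integrable (fun y => kernel α lam (x - y)) (ν t) := fun t => by
    refine ⟨((measurable_kernel α lam).comp (by fun_prop)).aestronglyMeasurable, ?_⟩
    have h1 := hb' (ν t) D hD (hν t) 1 one_pos x
    refine lt_of_le_of_lt (lintegral_mono fun y => hK.enorm_le_riesz (kernel_zero _ _) _) ?_
    rw [lintegral_const_mul' _ _ ENNReal.ofReal_ne_top]
    refine ENNReal.mul_lt_top ENNReal.ofReal_lt_top (h1.trans_lt ?_)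
    exact ENNReal.add_lt_top.2 ⟨ENNReal.ofReal_lt_top, ENNReal.mul_lt_top ENNReal.ofReal_lt_top
      (measure_lt_top _ _)⟩
  have hlim : Tendsto (fun n : ℕ => |lam * α| * (D * (c * (((n : ℝ) + 1)⁻¹) ^ (2 - α)))) atTop
      (𝓝 0) := by
    have h1 : Tendsto (fun n : ℕ => (((n : ℝ) + 1)⁻¹)) atTop (𝓝 0) := by
      simpa using tendsto_one_div_add_atTop_nhds_zero_nat (𝕜 := ℝ)
    have h2 := h1.rpow_const (p := 2 - α) (Or.inr (by linarith))
    rw [Real.zero_rpow (by linarith)] at h2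
    simpa using ((h2.const_mul c).const_mul D).const_mul |lam * α|
  have hunif : TendstoUniformly (fun (n : ℕ) t => -∫ y, kernelTrunc α lam ((n : ℝ) + 1)⁻¹ (x - y) ∂ν t)
      (fun t => field α lam (ν t) x) atTop := by
    rw [Metric.tendstoUniformly_iff]
    intro ε hε
    filter_upwards [hlim.eventually (gt_mem_nhds hε)] with n hn t
    have hδ : 0 < ((n : ℝ) + 1)⁻¹ := by positivity
    refine lt_of_le_of_lt ?_ hn
    rw [dist_eq_norm, field, neg_sub_neg, norm_sub_rev, ← integral_sub (hint t)]
    · refine norm_integral_le_of_lintegral (by positivity) ?_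
      calc _ ≤ ∫⁻ y, ENNReal.ofReal |lam * α| *
            (Metric.ball x ((n : ℝ) + 1)⁻¹).indicator (fun y => riesz (1 + α) (x - y)) y ∂ν t := by
            refine lintegral_mono fun y => (enorm_kernel_sub_kernelTrunc_le lam hα0 _ _).trans ?_
            gcongr
            refine le_of_eq ?_
            by_cases hy : ‖x - y‖ < ((n : ℝ) + 1)⁻¹
            · rw [indicator_of_mem (by simpa using hy),
                indicator_of_mem (by simpa [dist_eq_norm, norm_sub_rev y x] using hy)]
            · rw [indicator_of_notMem (by simpa using hy),
                indicator_of_notMem (by simpa [dist_eq_norm, norm_sub_rev y x] using hy)]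
        _ ≤ ENNReal.ofReal |lam * α| * (ENNReal.ofReal D *
            ENNReal.ofReal (c * (((n : ℝ) + 1)⁻¹) ^ (3 - (1 + α)))) := by
            rw [lintegral_const_mul' _ _ ENNReal.ofReal_ne_top,
              lintegral_indicator measurableSet_ball, ← hb _ hδ,
              ← lintegral_riesz_sub_ball _ _ x]
            gcongr
            exact lintegral_near_le (hν t) _ _
        _ = _ := by
            rw [← ENNReal.ofReal_mul hD, ← ENNReal.ofReal_mul (abs_nonneg _),
              show 3 - (1 + α) = 2 - α by ring]
    · refine Integrable.of_bound ((continuous_kernelTrunc α lam hδ).comp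
        (by fun_prop)).aestronglyMeasurable _
        (Eventually.of_forall fun y => norm_kernelTrunc_le lam hα0 hδ (x - y))
  refine hunif.continuous (Frequently.of_forall fun n => ?_)
  have hδ : 0 < ((n : ℝ) + 1)⁻¹ := by positivity
  exact (hw (fun y => kernelTrunc α lam ((n : ℝ) + 1)⁻¹ (x - y))
    ((continuous_kernelTrunc α lam hδ).comp (by fun_prop))
    ⟨_, fun y => norm_kernelTrunc_le lam hα0 hδ (x - y)⟩).neg

end

section

/-! ### Images of Haar measure under bi-Lipschitz maps -/

section Haar

variable {G : Type*} [NormedAddCommGroup G] [NormedSpace ℝ G] [FiniteDimensional ℝ G]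
  [MeasurableSpace G] [BorelSpace G]

/-- Haar measure is a multiple of the Hausdorff measure of the same dimension, and Hausdorff measure
scales by the power of the antilipschitz constant. This stands in for the change of variables
formula and needs neither derivatives nor Jacobians. -/
lemma measure_preimage_le_of_antilipschitz (μ : Measure G) [μ.IsAddHaarMeasure] {K : ℝ≥0}
    {f : G → G} (hf : AntilipschitzWith K f) (s : Set G) :
    μ (f ⁻¹' s) ≤ (K : ℝ≥0∞) ^ Module.finrank ℝ G * μ s := by
  rw [Measure.isAddLeftInvariant_eq_smul μ (Measure.hausdorffMeasure (Module.finrank ℝ G : ℝ))]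
  have h := hf.hausdorffMeasure_preimage_le (Nat.cast_nonneg (Module.finrank ℝ G)) s
  rw [ENNReal.rpow_natCast] at h
  simp only [Measure.smul_apply, ENNReal.smul_def, smul_eq_mul]
  rw [mul_left_comm]
  gcongr

lemma map_le_of_antilipschitz (μ : Measure G) [μ.IsAddHaarMeasure] {K : ℝ≥0}
    {f : G → G} (hf : AntilipschitzWith K f) (hm : Measurable f) :
    μ.map f ≤ (K : ℝ≥0∞) ^ Module.finrank ℝ G • μ := by
  refine Measure.le_iff.2 fun s hs => ?_
  rw [Measure.map_apply hm hs]
  exact measure_preimage_le_of_antilipschitz μ hf s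

end Haar

/-! ### Global solutions of ordinary differential equations -/

section ODE

variable {G : Type*} [NormedAddCommGroup G] [NormedSpace ℝ G] [CompleteSpace G]

open BoundedContinuousFunction in
/-- Global Cauchy-Lipschitz theorem. -/
theorem exists_global_solution {b : ℝ → G → G} (hb : Continuous (Function.uncurry b)) {K : ℝ≥0}
    (hK : ∀ t, LipschitzWith K (b t)) (z₀ : G) (hB : ∃ B : ℝ, ∀ t, ‖b t z₀‖ ≤ B) :
    ∃ Z : ℝ → G, Z 0 = z₀ ∧ ∀ t, 0 ≤ t → HasDerivAt Z (b t (Z t)) t := by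
  obtain ⟨B, hB⟩ := hB
  have hB0 : 0 ≤ B := (norm_nonneg _).trans (hB 0)
  -- Solutions are sought as `z₀ + exp (l * t) • u` with `u` bounded. A rate `l ≥ 2 * K` makes the
  -- Picard map contract by `1 / 2` on the whole half-line, and the `+ 1` keeps `l` positive when `K
  -- = 0`.
  set l : ℝ := 2 * K + 1 with hl
  have hl0 : 0 < l := by positivity
  let rhs : (ℝ →ᵇ G) → ℝ → G := fun u s => b s (z₀ + Real.exp (l * s) • u s)
  have rhs_cont : ∀ u, Continuous (rhs u) := fun u => by
    have : Continuous fun s : ℝ => (s, z₀ + Real.exp (l * s) • u s) := by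
      have := u.continuous
      fun_prop
    exact hb.comp this
  have exp_int : ∀ t : ℝ, 0 ≤ t → ∫ s in (0 : ℝ)..t, Real.exp (l * s) ≤ Real.exp (l * t) / l := by
    intro t ht
    rw [intervalIntegral.integral_comp_mul_left (fun x => Real.exp x) hl0.ne', integral_exp]
    simp only [mul_zero, Real.exp_zero, smul_eq_mul]
    rw [inv_mul_eq_div]
    gcongr
    linarith
  have bound_int : ∀ (g : ℝ → G) (c t : ℝ), 0 ≤ c → 0 ≤ t → (∀ s, 0 ≤ s → ‖g s‖ ≤ c * Real.exp (l * s)) →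
      ‖Real.exp (-(l * t)) • ∫ s in (0 : ℝ)..t, g s‖ ≤ c / l := by
    intro g c t hc ht hg
    have h1 : ‖∫ s in (0 : ℝ)..t, g s‖ ≤ ∫ s in (0 : ℝ)..t, c * Real.exp (l * s) := by
      refine intervalIntegral.norm_integral_le_of_norm_le ht ?_ ?_
      · exact Eventually.of_forall fun s hs => hg s hs.1.le
      · exact Continuous.intervalIntegrable (by fun_prop) _ _
    rw [intervalIntegral.integral_const_mul] at h1
    rw [norm_smul, Real.norm_of_nonneg (Real.exp_pos _).le]
    calc _ ≤ Real.exp (-(l * t)) * (c * (Real.exp (l * t) / l)) := by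
          gcongr
          exact h1.trans (by gcongr; exact exp_int t ht)
      _ = (Real.exp (-(l * t)) * Real.exp (l * t)) * (c / l) := by ring
      _ = c / l := by rw [← Real.exp_add]; simp
  have rhs_bound : ∀ u s, 0 ≤ s → ‖rhs u s‖ ≤ (B + K * ‖u‖) * Real.exp (l * s) := by
    intro u s hs
    have h1 : ‖rhs u s - b s z₀‖ ≤ K * (Real.exp (l * s) * ‖u‖) := by
      have := (hK s).dist_le_mul (z₀ + Real.exp (l * s) • u s) z₀
      rw [dist_eq_norm, dist_eq_norm, add_sub_cancel_left, norm_smul,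
        Real.norm_of_nonneg (Real.exp_pos _).le] at this
      exact this.trans (by gcongr; exact u.norm_coe_le_norm s)
    have h2 : 1 ≤ Real.exp (l * s) := Real.one_le_exp (by positivity)
    have h3 := norm_sub_norm_le (rhs u s) (b s z₀)
    have h4 := hB s
    nlinarith
  -- Bounded functions on all of `ℝ` are used, frozen for negative times by `max t 0`; only `t ≥ 0`
  -- matters.
  let Φ : (ℝ →ᵇ G) → (ℝ →ᵇ G) := fun u => ofNormedAddCommGroup
    (fun t => Real.exp (-(l * max t 0)) • ∫ s in (0 : ℝ)..(max t 0), rhs u s)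
    (by
      have h1 : Continuous fun t : ℝ => ∫ s in (0 : ℝ)..(max t 0), rhs u s :=
        intervalIntegral.continuous_parametric_intervalIntegral_of_continuous
          (f := fun _ s => rhs u s) ((rhs_cont u).comp continuous_snd) (by fun_prop)
      fun_prop)
    ((B + K * ‖u‖) / l)
    (fun t => bound_int _ _ _ (by positivity) (le_max_right _ _) (rhs_bound u))
  have hΦ : ContractingWith (1 / 2) Φ := by
    refine ⟨by norm_num, LipschitzWith.of_dist_le_mul fun u w => ?_⟩
    rw [BoundedContinuousFunction.dist_le (by positivity)]
    intro t
    simp only [Φ, coe_ofNormedAddCommGroup]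
    rw [dist_eq_norm, ← smul_sub, ← intervalIntegral.integral_sub
      ((rhs_cont u).intervalIntegrable _ _) ((rhs_cont w).intervalIntegrable _ _)]
    refine (bound_int _ (K * dist u w) _ (by positivity) (le_max_right _ _) fun s hs => ?_).trans ?_
    · have := (hK s).dist_le_mul (z₀ + Real.exp (l * s) • u s) (z₀ + Real.exp (l * s) • w s)
      rw [dist_eq_norm, dist_add_left, dist_smul₀, Real.norm_of_nonneg (Real.exp_pos _).le] at this
      refine this.trans ?_
      rw [mul_assoc, mul_comm (dist u w)]
      gcongr
      exact dist_coe_le_dist s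
    · rw [div_le_iff₀ hl0]
      have : 0 ≤ dist u w := dist_nonneg
      push_cast
      rw [hl]
      nlinarith
  obtain ⟨u, hu, -⟩ := hΦ.exists_fixedPoint 0 (edist_ne_top _ _)
  refine ⟨fun t => z₀ + ∫ s in (0 : ℝ)..t, rhs u s, by simp, fun t ht => ?_⟩
  have h1 : u t = Real.exp (-(l * t)) • ∫ s in (0 : ℝ)..t, rhs u s := by
    conv_lhs => rw [← hu.eq]
    simp only [Φ, coe_ofNormedAddCommGroup, max_eq_left ht]
  have h2 : rhs u t = b t (z₀ + ∫ s in (0 : ℝ)..t, rhs u s) := by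
    simp only [rhs]
    rw [h1, smul_smul, ← Real.exp_add]
    simp [rhs]
  have h3 := (intervalIntegral.integral_hasDerivAt_right ((rhs_cont u).intervalIntegrable 0 t)
    ((rhs_cont u).stronglyMeasurableAtFilter _ _) (rhs_cont u).continuousAt).const_add z₀
  rw [h2] at h3
  exact h3

end ODE

/-! ### The characteristic flow of a bounded Lipschitz force field -/

/-- `E` is a continuous force field, bounded by `B`, and `K`-Lipschitz in space. -/
structure IsForce (E : ℝ → R3 → R3) (B K : ℝ≥0) : Prop where
  cont : Continuous (Function.uncurry E)
  bound : ∀ t x, ‖E t x‖ ≤ B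
  lip : ∀ t, LipschitzWith K (E t)

/-- The vector field on phase space associated with the force field `E`. -/
def phaseField (E : ℝ → R3 → R3) (t : ℝ) (z : Phase) : Phase := (z.2, E t z.1)

/-- `Z` is the forward flow of the characteristic system of the force field `E`. -/
structure IsFlow (E : ℝ → R3 → R3) (Z : ℝ → Phase → Phase) : Prop where
  zero : ∀ z, Z 0 z = z
  deriv : ∀ z t, 0 ≤ t → HasDerivAt (fun s => Z s z) (phaseField E t (Z t z)) t

section Flow

variable {E : ℝ → R3 → R3} {B K : ℝ≥0} {Z : ℝ → Phase → Phase}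

lemma IsForce.continuous_phaseField (hE : IsForce E B K) :
    Continuous (Function.uncurry (phaseField E)) := by
  have : Continuous fun p : ℝ × Phase => (p.2.2, E p.1 p.2.1) := by
    have h := hE.cont.comp (show Continuous fun p : ℝ × Phase => (p.1, p.2.1) by fun_prop)
    exact (by fun_prop : Continuous fun p : ℝ × Phase => p.2.2).prodMk h
  exact this

lemma IsForce.lipschitz_phaseField (hE : IsForce E B K) (t : ℝ) :
    LipschitzWith (max 1 K) (phaseField E t) := by
  have h := LipschitzWith.prod_snd (α := R3) (β := R3)
  have h' := (hE.lip t).comp (LipschitzWith.prod_fst (α := R3) (β := R3))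
  rw [mul_one] at h'
  exact h.prodMk h'

lemma IsForce.exists_solution (hE : IsForce E B K) (z : Phase) :
    ∃ Y : ℝ → Phase, Y 0 = z ∧ ∀ t, 0 ≤ t → HasDerivAt Y (phaseField E t (Y t)) t := by
  refine exists_global_solution hE.continuous_phaseField hE.lipschitz_phaseField z
    ⟨max ‖z.2‖ B, fun t => ?_⟩
  exact max_le_max le_rfl (hE.bound t _)

lemma IsForce.exists_flow (hE : IsForce E B K) : ∃ Z, IsFlow E Z := by
  choose Y h0 hY using hE.exists_solution
  exact ⟨fun t z => Y z t, h0, fun z t ht => hY z t ht⟩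

lemma IsForce.dist_le (hE : IsForce E B K) {Y Y' : ℝ → Phase} {T : ℝ}
    (hY : ∀ t ∈ Icc 0 T, HasDerivAt Y (phaseField E t (Y t)) t)
    (hY' : ∀ t ∈ Icc 0 T, HasDerivAt Y' (phaseField E t (Y' t)) t) {t : ℝ} (ht : t ∈ Icc 0 T) :
    dist (Y t) (Y' t) ≤ Real.exp (max 1 K * t) * dist (Y 0) (Y' 0) := by
  have := dist_le_of_trajectories_ODE (v := phaseField E) (f := Y) (g := Y')
    (fun t => hE.lipschitz_phaseField t)
    (fun s hs => (hY s hs).continuousAt.continuousWithinAt)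
    (fun s hs => (hY s ⟨hs.1, hs.2.le⟩).hasDerivWithinAt)
    (fun s hs => (hY' s hs).continuousAt.continuousWithinAt)
    (fun s hs => (hY' s ⟨hs.1, hs.2.le⟩).hasDerivWithinAt) le_rfl t ht
  rw [mul_comm]
  simpa using this

/-- Time reversal of a force field. -/
lemma IsForce.reverse (hE : IsForce E B K) (T : ℝ) : IsForce (fun t => E (T - t)) B K where
  cont := hE.cont.comp (show Continuous fun p : ℝ × R3 => (T - p.1, p.2) by fun_prop)
  bound t x := hE.bound _ x
  lip t := hE.lip _

/-- Time reversal of a trajectory. -/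
lemma hasDerivAt_reverse {Y : ℝ → Phase} {T t : ℝ}
    (hY : HasDerivAt Y (phaseField E (T - t) (Y (T - t))) (T - t)) :
    HasDerivAt (fun s => ((Y (T - s)).1, -(Y (T - s)).2))
      (phaseField (fun s => E (T - s)) t ((Y (T - t)).1, -(Y (T - t)).2)) t := by
  have h := hY.scomp t ((hasDerivAt_id t).const_sub T)
  have h1 := (hasFDerivAt_fst (𝕜 := ℝ) (E := R3) (F := R3)).comp_hasDerivAt t h
  have h2 := ((hasFDerivAt_snd (𝕜 := ℝ) (E := R3) (F := R3)).comp_hasDerivAt t h).neg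
  have := h1.prodMk h2
  simpa [phaseField] using this

lemma IsFlow.dist_le (hZ : IsFlow E Z) (hE : IsForce E B K) {t : ℝ} (ht : 0 ≤ t) (z w : Phase) :
    dist (Z t z) (Z t w) ≤ Real.exp (max 1 K * t) * dist z w := by
  have := hE.dist_le (T := t) (fun s hs => hZ.deriv z s hs.1) (fun s hs => hZ.deriv w s hs.1)
    (right_mem_Icc.2 ht)
  simpa only [hZ.zero] using this

lemma dist_flip (a b : Phase) : dist ((a.1, -a.2) : Phase) (b.1, -b.2) = dist a b := by
  rw [Prod.dist_eq, Prod.dist_eq, dist_neg_neg]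

/-- The final point is taken as the initial one: reversing time and flipping the velocity turns a
trajectory into a trajectory of the time-reversed force, to which the forward Gronwall estimate
applies. -/
lemma IsFlow.dist_le_reverse (hZ : IsFlow E Z) (hE : IsForce E B K) {t : ℝ} (ht : 0 ≤ t)
    (z w : Phase) : dist z w ≤ Real.exp (max 1 K * t) * dist (Z t z) (Z t w) := by
  have key : ∀ z, ∀ s ∈ Icc 0 t, HasDerivAt (fun s => (((Z (t - s) z).1, -(Z (t - s) z).2) : Phase))
      (phaseField (fun s => E (t - s)) s ((Z (t - s) z).1, -(Z (t - s) z).2)) s :=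
    fun z s hs => hasDerivAt_reverse (Y := fun s => Z s z) (hZ.deriv z _ (by linarith [hs.2]))
  have := (hE.reverse t).dist_le (T := t) (key z) (key w) (right_mem_Icc.2 ht)
  simpa only [sub_self, sub_zero, hZ.zero, dist_flip] using this

lemma IsFlow.lipschitz (hZ : IsFlow E Z) (hE : IsForce E B K) {t : ℝ} (ht : 0 ≤ t) :
    LipschitzWith (Real.exp (max 1 K * t)).toNNReal (Z t) :=
  LipschitzWith.of_dist_le_mul fun z w => by
    rw [Real.coe_toNNReal _ (Real.exp_pos _).le]; exact hZ.dist_le hE ht z w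

lemma IsFlow.antilipschitz (hZ : IsFlow E Z) (hE : IsForce E B K) {t : ℝ} (ht : 0 ≤ t) :
    AntilipschitzWith (Real.exp (max 1 K * t)).toNNReal (Z t) :=
  AntilipschitzWith.of_le_mul_dist fun z w => by
    rw [Real.coe_toNNReal _ (Real.exp_pos _).le]; exact hZ.dist_le_reverse hE ht z w

lemma IsFlow.unique (hZ : IsFlow E Z) (hE : IsForce E B K) {Y : ℝ → Phase} {T : ℝ}
    (hY : ∀ t ∈ Icc 0 T, HasDerivAt Y (phaseField E t (Y t)) t) {t : ℝ} (ht : t ∈ Icc 0 T) :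
    Y t = Z t (Y 0) := by
  have := hE.dist_le hY (fun s hs => hZ.deriv (Y 0) s hs.1) ht
  rw [hZ.zero, dist_self, mul_zero] at this
  exact dist_le_zero.1 this

/-- A preimage of `w` is found by solving the time-reversed problem from `w` with flipped velocity;
uniqueness identifies the result, reversed again, with a trajectory of `Z`. -/
lemma IsFlow.surjective (hZ : IsFlow E Z) (hE : IsForce E B K) {t : ℝ} (ht : 0 ≤ t) :
    Function.Surjective (Z t) := by
  intro w
  obtain ⟨Y, hY0, hY⟩ := (hE.reverse t).exists_solution (w.1, -w.2)
  have h := hZ.unique hE (T := t) (Y := fun s => ((Y (t - s)).1, -(Y (t - s)).2))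
    (fun s hs => by
      have := hasDerivAt_reverse (E := fun s => E (t - s)) (Y := Y) (T := t) (t := s)
        (hY _ (by linarith [hs.2]))
      simpa only [sub_sub_cancel] using this) (right_mem_Icc.2 ht)
  refine ⟨_, h.symm.trans ?_⟩
  simp [hY0]

lemma IsFlow.injective (hZ : IsFlow E Z) (hE : IsForce E B K) {t : ℝ} (ht : 0 ≤ t) :
    Function.Injective (Z t) := (hZ.antilipschitz hE ht).injective

lemma IsFlow.continuous_time (hZ : IsFlow E Z) (z : Phase) :
    ContinuousOn (fun t => Z t z) (Ici 0) :=
  fun t ht => (hZ.deriv z t ht).continuousAt.continuousWithinAt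

/-- Nothing is prescribed about `Z` at negative times; freezing it there gives a jointly continuous
function on the whole line. -/
lemma IsFlow.continuous_max (hZ : IsFlow E Z) (hE : IsForce E B K) :
    Continuous (fun p : ℝ × Phase => Z (max p.1 0) p.2) := by
  rw [continuous_iff_continuousAt]
  rintro ⟨t, z⟩
  rw [ContinuousAt, tendsto_iff_dist_tendsto_zero]
  have h1 : Continuous fun s : ℝ => Z (max s 0) z := by
    refine (hZ.continuous_time z).comp_continuous (by fun_prop) fun s => ?_
    exact le_max_right s 0
  have h2 : Tendsto (fun p : ℝ × Phase => Real.exp (max 1 K * max p.1 0) * dist p.2 z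
      + dist (Z (max p.1 0) z) (Z (max t 0) z)) (𝓝 (t, z)) (𝓝 0) := by
    have : Continuous fun p : ℝ × Phase => Real.exp (max 1 K * max p.1 0) * dist p.2 z
      + dist (Z (max p.1 0) z) (Z (max t 0) z) := by
      have h3 : Continuous fun p : ℝ × Phase => Z (max p.1 0) z := h1.comp continuous_fst
      have h4 : Continuous fun p : ℝ × Phase => dist p.2 z := continuous_snd.dist continuous_const
      have h5 : Continuous fun p : ℝ × Phase => dist (Z (max p.1 0) z) (Z (max t 0) z) :=
        h3.dist continuous_const
      have h6 : Continuous fun p : ℝ × Phase => Real.exp (max 1 K * max p.1 0) := by fun_prop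
      exact (h6.mul h4).add h5
    have h4 := this.tendsto (t, z)
    simpa using h4
  refine squeeze_zero (fun _ => dist_nonneg) (fun p => ?_) h2
  refine (dist_triangle _ (Z (max p.1 0) z) _).trans ?_
  gcongr
  exact hZ.dist_le hE (le_max_right _ _) _ _

lemma IsFlow.velocity_eq (hZ : IsFlow E Z) (hE : IsForce E B K) {t : ℝ} (ht : 0 ≤ t) (z : Phase) :
    (Z t z).2 = z.2 + ∫ s in (0 : ℝ)..t, E s (Z s z).1 := by
  have hc : Continuous fun s : ℝ => E s (Z (max s 0) z).1 := by
    have h1 := (hZ.continuous_max hE).comp (show Continuous fun s : ℝ => (s, z) by fun_prop)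
    exact hE.cont.comp (continuous_id.prodMk (continuous_fst.comp h1))
  have h2 : ∫ s in (0 : ℝ)..t, E s (Z s z).1 = ∫ s in (0 : ℝ)..t, E s (Z (max s 0) z).1 := by
    refine intervalIntegral.integral_congr fun s hs => ?_
    rw [uIcc_of_le ht] at hs
    simp only [max_eq_left hs.1]
  rw [h2, intervalIntegral.integral_eq_sub_of_hasDerivAt (f := fun s => (Z s z).2) (fun s hs => ?_)
    (hc.intervalIntegrable _ _), hZ.zero]
  · abel
  · rw [uIcc_of_le ht] at hs
    have := (hasFDerivAt_snd (𝕜 := ℝ) (E := R3) (F := R3)).comp_hasDerivAt s (hZ.deriv z s hs.1)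
    rw [max_eq_left hs.1]
    exact this

lemma IsFlow.norm_velocity_sub_le (hZ : IsFlow E Z) (hE : IsForce E B K) {t : ℝ} (ht : 0 ≤ t)
    (z : Phase) : ‖(Z t z).2 - z.2‖ ≤ B * t := by
  rw [hZ.velocity_eq hE ht, add_sub_cancel_left]
  have := intervalIntegral.norm_integral_le_of_norm_le_const (a := 0) (b := t)
    (f := fun s => E s (Z s z).1) (C := B) (fun s _ => hE.bound _ _)
  simpa [abs_of_nonneg ht] using this

end Flow

/-- A double primitive, written as a single integral. -/
lemma hasDerivAt_integral_sub_smul {A : ℝ → R3} (hA : Continuous A) (t : ℝ) :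
    HasDerivAt (fun t => ∫ s in (0 : ℝ)..t, (t - s) • A s) (∫ s in (0 : ℝ)..t, A s) t := by
  have hA' : Continuous fun s => s • A s := by fun_prop
  have h1 : HasDerivAt (fun t => ∫ s in (0 : ℝ)..t, A s) (A t) t :=
    intervalIntegral.integral_hasDerivAt_right (hA.intervalIntegrable 0 t)
    (hA.stronglyMeasurableAtFilter _ _) hA.continuousAt
  have h2 : HasDerivAt (fun t => ∫ s in (0 : ℝ)..t, s • A s) (t • A t) t :=
    intervalIntegral.integral_hasDerivAt_right (hA'.intervalIntegrable 0 t)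
    (hA'.stronglyMeasurableAtFilter _ _) hA'.continuousAt
  have h3 := ((hasDerivAt_id t).smul h1).sub h2
  have h4 : ∀ t : ℝ, ∫ s in (0 : ℝ)..t, (t - s) • A s
      = t • (∫ s in (0 : ℝ)..t, A s) - ∫ s in (0 : ℝ)..t, s • A s := fun t => by
    rw [← intervalIntegral.integral_smul, ← intervalIntegral.integral_sub
      ((by fun_prop : Continuous fun s => t • A s).intervalIntegrable _ _)
      (hA'.intervalIntegrable _ _)]
    simp_rw [sub_smul]
  simp_rw [h4]
  have h5 : ∫ s in (0 : ℝ)..t, A s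
      = id t • A t + (1 : ℝ) • (∫ s in (0 : ℝ)..t, A s) - t • A t := by
    simp only [id, one_smul, add_sub_cancel_left]
  rw [h5]
  exact h3

end

section

instance : (volume : Measure Phase).IsAddHaarMeasure :=
  inferInstanceAs (((volume : Measure R3).prod (volume : Measure R3)).IsAddHaarMeasure)

instance : (volume : Measure Phase).IsNegInvariant :=
  have : (volume : Measure Phase).Regular := inferInstance
  Measure.IsAddHaarMeasure.isNegInvariant_of_regular volume

lemma finrank_phase : Module.finrank ℝ Phase = 6 := by simp

/-! ### Mollification on phase space -/

/-- A smooth bump function on phase space, of integral one. -/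
def bump : Phase → ℝ := (⟨1 / 2, 1, by norm_num, by norm_num⟩ : ContDiffBump (0 : Phase)).normed volume

/-- The rescaled mollifier. -/
def mollifier (ε : ℝ) (u : Phase) : ℝ := (ε ^ 6)⁻¹ * bump (ε⁻¹ • u)

lemma contDiff_bump : ContDiff ℝ (⊤ : ℕ∞) bump := ContDiffBump.contDiff_normed _

lemma hasCompactSupport_bump : HasCompactSupport bump := ContDiffBump.hasCompactSupport_normed _

lemma bump_nonneg (u : Phase) : 0 ≤ bump u := ContDiffBump.nonneg_normed _ u

lemma bump_eq_zero {u : Phase} (hu : 1 < ‖u‖) : bump u = 0 := by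
  by_contra h
  have h1 : u ∈ Function.support bump := h
  rw [bump, ContDiffBump.support_normed_eq] at h1
  simp at h1
  linarith

lemma contDiff_mollifier (ε : ℝ) : ContDiff ℝ (⊤ : ℕ∞) (mollifier ε) :=
  contDiff_const.mul (contDiff_bump.comp (contDiff_const_smul _))

lemma mollifier_nonneg {ε : ℝ} (hε : 0 < ε) (u : Phase) : 0 ≤ mollifier ε u :=
  mul_nonneg (by positivity) (bump_nonneg _)

lemma mollifier_eq_zero {ε : ℝ} (hε : 0 < ε) {u : Phase} (hu : ε < ‖u‖) : mollifier ε u = 0 := by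
  rw [mollifier, bump_eq_zero, mul_zero]
  rw [norm_smul, norm_inv, Real.norm_of_nonneg hε.le, inv_mul_eq_div, one_lt_div hε]
  exact hu

lemma hasCompactSupport_mollifier {ε : ℝ} (hε : 0 < ε) : HasCompactSupport (mollifier ε) :=
  HasCompactSupport.of_support_subset_isCompact (isCompact_closedBall 0 ε) fun u hu => by
    by_contra h
    exact hu (mollifier_eq_zero hε (by simpa using h))

lemma integral_mollifier {ε : ℝ} (hε : 0 < ε) : ∫ u, mollifier ε u = 1 := by
  simp only [mollifier]
  rw [integral_const_mul, Measure.integral_comp_inv_smul_of_nonneg volume bump hε.le, finrank_phase,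
    bump, ContDiffBump.integral_normed]
  have : ε ^ 6 ≠ 0 := by positivity
  simp [this]

lemma fderiv_mollifier (ε : ℝ) (u : Phase) :
    fderiv ℝ (mollifier ε) u = ((ε ^ 6)⁻¹ * ε⁻¹) • fderiv ℝ bump (ε⁻¹ • u) := by
  have h1 : HasFDerivAt bump (fderiv ℝ bump (ε⁻¹ • u)) (ε⁻¹ • u) :=
    (contDiff_bump.differentiable (by simp) _).hasFDerivAt
  have h2 : HasFDerivAt (fun u : Phase => ε⁻¹ • u) (ε⁻¹ • ContinuousLinearMap.id ℝ Phase) u :=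
    (hasFDerivAt_id u).const_smul ε⁻¹
  have h3 := ((h1.comp u h2).const_mul ((ε ^ 6)⁻¹)).fderiv
  have h4 : (fun y => (ε ^ 6)⁻¹ * (bump ∘ fun u : Phase => ε⁻¹ • u) y) = mollifier ε := rfl
  rw [h4] at h3
  rw [h3]
  ext v <;> simp [mul_assoc]

lemma exists_mollifier_bound : ∃ A : ℝ, 0 ≤ A ∧ ∀ ε : ℝ, 0 < ε → ∀ u : Phase,
    |mollifier ε u| ≤ A * (ε ^ 6)⁻¹ ∧ ‖fderiv ℝ (mollifier ε) u‖ ≤ A * (ε ^ 6)⁻¹ * ε⁻¹ := by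
  obtain ⟨A₁, h₁⟩ := hasCompactSupport_bump.exists_bound_of_continuous contDiff_bump.continuous
  obtain ⟨A₂, h₂⟩ := (hasCompactSupport_bump.fderiv (𝕜 := ℝ)).exists_bound_of_continuous
    (contDiff_bump.continuous_fderiv (by simp))
  refine ⟨max A₁ A₂, ((norm_nonneg _).trans (h₁ 0)).trans (le_max_left _ _), fun ε hε u => ⟨?_, ?_⟩⟩
  · rw [mollifier, abs_mul, abs_of_nonneg (by positivity : 0 ≤ (ε ^ 6)⁻¹), mul_comm]
    gcongr
    exact (h₁ _).trans (le_max_left _ _)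
  · rw [fderiv_mollifier, norm_smul, Real.norm_of_nonneg (by positivity), mul_assoc (max A₁ A₂),
      mul_comm]
    gcongr
    exact (h₂ _).trans (le_max_right _ _)

lemma fderiv_mollifier_eq_zero {ε : ℝ} (hε : 0 < ε) {u : Phase} (hu : ε < ‖u‖) :
    fderiv ℝ (mollifier ε) u = 0 := by
  have h : mollifier ε =ᶠ[𝓝 u] fun _ => 0 := by
    filter_upwards [(isOpen_lt continuous_const continuous_norm).mem_nhds hu] with y hy
    exact mollifier_eq_zero hε hy
  rw [h.fderiv_eq]
  simp

/-- At almost every point, averages with kernels concentrating at scale `ε` converge. -/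
lemma ae_tendsto_integral_kernel {g : Phase → ℝ} (hg : LocallyIntegrable g) :
    ∀ᵐ z, ∀ (ε : ℕ → ℝ) (ψ : ℕ → Phase → ℝ) (A : ℝ), (∀ n, 0 < ε n) → Tendsto ε atTop (𝓝 0) →
      (∀ n z', |ψ n z'| ≤ A * (ε n ^ 6)⁻¹) → (∀ n z', ε n < ‖z - z'‖ → ψ n z' = 0) →
      Tendsto (fun n => ∫ z', ψ n z' * (g z' - g z)) atTop (𝓝 0) := by
  -- The exceptional null set, the complement of the Lebesgue points, is fixed before the kernels
  -- are chosen, so the kernels may depend on the point `z`, as the commutator kernels do.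
  filter_upwards [IsUnifLocDoublingMeasure.ae_tendsto_average_norm_sub volume hg 1] with
    z hz ε ψ A hε hlim hA hsupp
  have h1 := hz (l := atTop) (fun _ : ℕ => z) ε
    (tendsto_nhdsWithin_iff.2 ⟨hlim, Eventually.of_forall fun n => hε n⟩)
    (Eventually.of_forall fun n => by simpa using (hε n).le)
  set c : ℝ := volume.real (Metric.ball (0 : Phase) 1)
  have hvol : ∀ n, volume.real (Metric.closedBall z (ε n)) = ε n ^ 6 * c := fun n => by
    rw [Measure.real, Measure.addHaar_closedBall _ _ (hε n).le, finrank_phase, ENNReal.toReal_mul,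
      ENNReal.toReal_ofReal (by have := hε n; positivity)]
    rfl
  have hA0 : 0 ≤ A := by
    have h := (abs_nonneg _).trans (hA 0 0)
    have := hε 0
    by_contra hneg
    have : A * (ε 0 ^ 6)⁻¹ < 0 := mul_neg_of_neg_of_pos (not_le.1 hneg) (by positivity)
    linarith
  rw [tendsto_zero_iff_norm_tendsto_zero]
  have h2 := h1.const_mul (A * c)
  rw [mul_zero] at h2
  refine squeeze_zero (fun _ => norm_nonneg _) (fun n => ?_) h2
  have hε6 : 0 < ε n ^ 6 := by have := hε n; positivity
  have hint : IntegrableOn (fun z' => ‖g z' - g z‖) (Metric.closedBall z (ε n)) :=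
    ((hg.integrableOn_isCompact (isCompact_closedBall _ _)).sub
      (integrableOn_const (by exact measure_closedBall_lt_top.ne))).norm
  rw [setAverage_eq, hvol, smul_eq_mul]
  calc ‖∫ z', ψ n z' * (g z' - g z)‖
      = ‖∫ z' in Metric.closedBall z (ε n), ψ n z' * (g z' - g z)‖ := by
        rw [setIntegral_eq_integral_of_forall_compl_eq_zero fun z' hz' => ?_]
        rw [hsupp n z' (by simpa [dist_eq_norm, norm_sub_rev] using hz'), zero_mul]
    _ ≤ ∫ z' in Metric.closedBall z (ε n), A * (ε n ^ 6)⁻¹ * ‖g z' - g z‖ := by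
        refine norm_integral_le_of_norm_le (hint.const_mul _) (Eventually.of_forall fun z' => ?_)
        rw [norm_mul]
        gcongr
        exact hA n z'
    _ = A * (ε n ^ 6)⁻¹ * ∫ z' in Metric.closedBall z (ε n), ‖g z' - g z‖ := integral_const_mul _ _
    _ ≤ A * c * ((ε n ^ 6 * c)⁻¹ * ∫ z' in Metric.closedBall z (ε n), ‖g z' - g z‖) := by
        refine le_of_eq ?_
        have hc : c ≠ 0 := by
          refine (ENNReal.toReal_pos ?_ measure_ball_lt_top.ne).ne'
          exact (Metric.measure_ball_pos _ _ one_pos).ne'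
        field_simp

/-- Convolution with a `C¹` kernel of compact support is differentiable. -/
lemma hasFDerivAt_integral_kernel {η : Phase → ℝ} (hη : ContDiff ℝ 1 η)
    (hc : HasCompactSupport η) {n : Phase → ℝ} (hn : LocallyIntegrable n) (w : Phase) :
    ∃ L : Phase →L[ℝ] ℝ, HasFDerivAt (fun w => ∫ z, η (w - z) * n z) L w ∧
      ∀ v, L v = ∫ z, fderiv ℝ η (w - z) v * n z := by
  have h1 := hc.hasFDerivAt_convolution_left (ContinuousLinearMap.mul ℝ ℝ) hη hn w
  have h2 : ∀ w, (convolution η n (ContinuousLinearMap.mul ℝ ℝ) volume) w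
      = ∫ z, η (w - z) * n z := fun w => by
    rw [convolution_eq_swap]; rfl
  refine ⟨_, (?_ : HasFDerivAt (fun w => ∫ z, η (w - z) * n z)
    (convolution (fderiv ℝ η) n ((ContinuousLinearMap.mul ℝ ℝ).precompL Phase) volume w) w),
    fun v => ?_⟩
  · have : (fun w => ∫ z, η (w - z) * n z) = convolution η n (ContinuousLinearMap.mul ℝ ℝ) volume :=
      funext fun w => (h2 w).symm
    rw [this]
    exact h1
  · rw [convolution_eq_swap, ContinuousLinearMap.integral_apply]
    · rfl
    · have hcont : Continuous (fderiv ℝ η) := hη.continuous_fderiv (by simp)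
      have := (hc.fderiv (𝕜 := ℝ)).convolutionExists_left
        ((ContinuousLinearMap.mul ℝ ℝ).precompL Phase) hcont hn w
      rw [ConvolutionExistsAt, ← integrable_comp_sub_left _ w] at this
      simpa using this

/-- A phase space field `(v, E(x))` is divergence free. -/
lemma integral_fderiv_phaseField_eq_zero {φ : Phase → ℝ} (hφ : ContDiff ℝ 1 φ)
    (hc : HasCompactSupport φ) {E : R3 → R3} (hE : Continuous E) :
    ∫ z, fderiv ℝ φ z (z.2, E z.1) = 0 := by
  have hd : Continuous (fderiv ℝ φ) := hφ.continuous_fderiv (by simp)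
  have hdc : HasCompactSupport (fderiv ℝ φ) := hc.fderiv (𝕜 := ℝ)
  have hint : ∀ b : Phase → Phase, Continuous b → Integrable fun z => fderiv ℝ φ z (b z) := by
    intro b hb
    refine Continuous.integrable_of_hasCompactSupport (by fun_prop) ?_
    refine hdc.mono fun z hz => ?_
    contrapose! hz
    simp only [Function.mem_support, not_not] at hz
    simp [hz]
  have key : ∀ (ψ : R3 → ℝ), ContDiff ℝ 1 ψ → HasCompactSupport ψ → ∀ v, ∫ x, fderiv ℝ ψ x v = 0 := by
    intro ψ hψ hψc v
    have hψd : Continuous fun x => fderiv ℝ ψ x v :=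
      (hψ.continuous_fderiv (by simp)).clm_apply continuous_const
    have h := integral_mul_fderiv_eq_neg_fderiv_mul_of_integrable (μ := (volume : Measure R3))
      (f := fun _ => (1 : ℝ)) (g := ψ) (v := v) (by simp)
      (by simpa using hψd.integrable_of_hasCompactSupport ((hψc.fderiv (𝕜 := ℝ)).mono fun x hx => by
        contrapose! hx
        simp only [Function.mem_support, not_not] at hx
        simp [hx]))
      (by simpa using hψ.continuous.integrable_of_hasCompactSupport hψc)
      (fun _ _ => by fun_prop) (fun x _ => hψ.differentiable (by simp) x)
    simpa using h
  have slice1 : ∀ v : R3, ContDiff ℝ 1 (fun x => φ (x, v)) ∧ HasCompactSupport (fun x => φ (x, v)) := by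
    intro v
    refine ⟨hφ.comp (by fun_prop), HasCompactSupport.of_support_subset_isCompact
      (hc.isCompact.image continuous_fst) fun x hx => ⟨(x, v), subset_tsupport _ hx, rfl⟩⟩
  have slice2 : ∀ x : R3, ContDiff ℝ 1 (fun v => φ (x, v)) ∧ HasCompactSupport (fun v => φ (x, v)) := by
    intro x
    refine ⟨hφ.comp (by fun_prop), HasCompactSupport.of_support_subset_isCompact
      (hc.isCompact.image continuous_snd) fun v hv => ⟨(x, v), subset_tsupport _ hv, rfl⟩⟩
  -- The first component of the field is constant along the slices of constant `v`, the second along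
  -- those of constant `x`. So each part integrates to zero slice by slice, and `E` need only be
  -- continuous.
  have hsplit : ∀ z : Phase, fderiv ℝ φ z (z.2, E z.1)
      = fderiv ℝ φ z (z.2, 0) + fderiv ℝ φ z (0, E z.1) := fun z => by
    rw [← map_add]; simp
  simp_rw [hsplit]
  have hi1 := hint (fun z => (z.2, 0)) (by fun_prop)
  have hi2 := hint (fun z => (0, E z.1)) (by fun_prop)
  rw [integral_add hi1 hi2]
  have e1 : ∫ z : Phase, fderiv ℝ φ z (z.2, 0) = 0 := by
    rw [Measure.volume_eq_prod] at hi1 ⊢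
    rw [integral_prod_symm _ hi1]
    refine (integral_congr_ae (Eventually.of_forall fun v => ?_)).trans (integral_zero R3 ℝ)
    have h := key _ (slice1 v).1 (slice1 v).2 v
    rw [← h]
    congr 1; ext x
    have hh : HasFDerivAt (fun x => φ (x, v)) ((fderiv ℝ φ (x, v)).comp
        (ContinuousLinearMap.inl ℝ R3 R3)) x :=
      ((hφ.differentiable (by simp) (x, v)).hasFDerivAt).comp x (hasFDerivAt_prodMk_left x v)
    rw [hh.fderiv]; rfl
  have e2 : ∫ z : Phase, fderiv ℝ φ z (0, E z.1) = 0 := by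
    rw [Measure.volume_eq_prod] at hi2 ⊢
    rw [integral_prod _ hi2]
    refine (integral_congr_ae (Eventually.of_forall fun x => ?_)).trans (integral_zero R3 ℝ)
    have h := key _ (slice2 x).1 (slice2 x).2 (E x)
    rw [← h]
    congr 1; ext v
    have hh : HasFDerivAt (fun v => φ (x, v)) ((fderiv ℝ φ (x, v)).comp
        (ContinuousLinearMap.inr ℝ R3 R3)) v :=
      ((hφ.differentiable (by simp) (x, v)).hasFDerivAt).comp v (hasFDerivAt_prodMk_right x v)
    rw [hh.fderiv]; rfl
  rw [e1, e2, add_zero]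

end

section

/-! ### Uniqueness for the continuity equation with a Lipschitz force field -/

/-- A bounded, weakly continuous weak solution of the continuity equation on `[0,T]`, with
vanishing initial data. -/
structure IsNullWeakSol (E : ℝ → R3 → R3) (T M : ℝ) (n : ℝ → Phase → ℝ) : Prop where
  meas : ∀ t, AEStronglyMeasurable (n t) volume
  bound : ∀ t, ∀ᵐ z, ‖n t z‖ ≤ M
  cont : ∀ φ : Phase → ℝ, Continuous φ → HasCompactSupport φ → Continuous fun t => ∫ z, φ z * n t z
  eq : ∀ φ : Phase → ℝ, ContDiff ℝ (⊤ : ℕ∞) φ → HasCompactSupport φ → ∀ t ∈ Icc 0 T,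
    ∫ z, φ z * n t z = ∫ s in (0 : ℝ)..t, ∫ z, fderiv ℝ φ z (phaseField E s z) * n s z

section

variable {E : ℝ → R3 → R3} {B K : ℝ≥0} {T M : ℝ} {n : ℝ → Phase → ℝ}

lemma IsNullWeakSol.locallyIntegrable (h : IsNullWeakSol E T M n) (t : ℝ) :
    LocallyIntegrable (n t) := by
  rw [locallyIntegrable_iff]
  intro k hk
  exact Measure.integrableOn_of_bounded hk.measure_lt_top.ne (h.meas t)
    (ae_restrict_of_ae (h.bound t))

lemma IsNullWeakSol.integrable_mul (h : IsNullWeakSol E T M n) (t : ℝ) {φ : Phase → ℝ}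
    (hφ : Integrable φ) : Integrable fun z => φ z * n t z :=
  hφ.mul_bdd (h.meas t) (h.bound t)

lemma integrable_of_continuous_of_eq_zero {φ : Phase → ℝ} (hφ : Continuous φ) {k : Set Phase}
    (hk : IsCompact k) (h : ∀ z, z ∉ k → φ z = 0) : Integrable φ :=
  hφ.integrable_of_hasCompactSupport (HasCompactSupport.of_support_subset_isCompact hk
    fun z hz => by_contra fun hz' => hz (h z hz'))

/-- Test function and time vary together. The change of the test function is measured in `L¹` on a
fixed compact set and paired with the uniform bound `M`; what remains is the weak continuity in time
for a fixed test function. -/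
lemma IsNullWeakSol.continuousAt_param (h : IsNullWeakSol E T M n) {P : Type*} [TopologicalSpace P]
    [FirstCountableTopology P] [LocallyCompactSpace P] {τ : P → ℝ} (hτ : Continuous τ)
    {φ : P → Phase → ℝ} (hφ : Continuous (Function.uncurry φ)) {k : Set Phase} (hk : IsCompact k)
    {p₀ : P} (hφk : ∀ᶠ p in 𝓝 p₀, ∀ z, z ∉ k → φ p z = 0) :
    ContinuousAt (fun p => ∫ z, φ p z * n (τ p) z) p₀ := by
  have hφp : ∀ p, Continuous (φ p) := fun p => hφ.comp (by fun_prop : Continuous fun z => (p, z))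
  have hk0 := hφk.self_of_nhds
  have h1 : Continuous fun p => ∫ z in k, ‖φ p z - φ p₀ z‖ := by
    refine continuous_parametric_integral_of_continuous ?_ hk
    have : Continuous fun q : P × Phase => φ q.1 q.2 - φ p₀ q.2 :=
      hφ.sub ((hφp p₀).comp continuous_snd)
    exact this.norm
  have h2 : Continuous fun p => ∫ z, φ p₀ z * n (τ p) z :=
    (h.cont _ (hφp p₀) (HasCompactSupport.of_support_subset_isCompact hk
      fun z hz => by_contra fun hz' => hz (hk0 z hz'))).comp hτ
  have h3 : Tendsto (fun p => M * (∫ z in k, ‖φ p z - φ p₀ z‖)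
      + ‖(∫ z, φ p₀ z * n (τ p) z) - ∫ z, φ p₀ z * n (τ p₀) z‖) (𝓝 p₀) (𝓝 0) := by
    have h4 : Continuous fun p => M * (∫ z in k, ‖φ p z - φ p₀ z‖)
      + ‖(∫ z, φ p₀ z * n (τ p) z) - ∫ z, φ p₀ z * n (τ p₀) z‖ := by fun_prop
    simpa using h4.tendsto p₀
  rw [ContinuousAt, tendsto_iff_norm_sub_tendsto_zero]
  refine squeeze_zero' (Eventually.of_forall fun _ => norm_nonneg _) ?_ h3
  filter_upwards [hφk] with p hp
  have i1 := integrable_of_continuous_of_eq_zero (hφp p) hk hp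
  have i2 := integrable_of_continuous_of_eq_zero (hφp p₀) hk hk0
  have e1 : (∫ z, φ p z * n (τ p) z) - ∫ z, φ p₀ z * n (τ p₀) z
      = (∫ z, (φ p z - φ p₀ z) * n (τ p) z)
        + ((∫ z, φ p₀ z * n (τ p) z) - ∫ z, φ p₀ z * n (τ p₀) z) := by
    simp_rw [sub_mul]
    rw [integral_sub (h.integrable_mul _ i1) (h.integrable_mul _ i2)]; ring
  rw [e1]
  refine (norm_add_le _ _).trans ?_
  gcongr
  have e2 : ∫ z in k, ‖φ p z - φ p₀ z‖ = ∫ z, ‖φ p z - φ p₀ z‖ :=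
    setIntegral_eq_integral_of_forall_compl_eq_zero fun z hz => by rw [hp z hz, hk0 z hz]; simp
  rw [e2, ← integral_const_mul]
  refine norm_integral_le_of_norm_le ((i1.sub i2).norm.const_mul _) ?_
  filter_upwards [h.bound (τ p)] with z hz
  rw [norm_mul, mul_comm]
  gcongr

/-- The commutator of mollification and transport. -/
def commutator (E : ℝ → R3 → R3) (n : ℝ → Phase → ℝ) (ε t : ℝ) (w : Phase) : ℝ :=
  ∫ z, fderiv ℝ (mollifier ε) (w - z) (phaseField E t w - phaseField E t z) * n t z

/-- The gradient of the mollifier costs `ε⁻⁷`, and the Lipschitz bound of the field gives back a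
factor `ε` on its support. -/
lemma commutator_kernel_bound (hE : IsForce E B K) {A : ℝ} (hA0 : 0 ≤ A)
    (hA : ∀ ε : ℝ, 0 < ε → ∀ u : Phase,
    |mollifier ε u| ≤ A * (ε ^ 6)⁻¹ ∧ ‖fderiv ℝ (mollifier ε) u‖ ≤ A * (ε ^ 6)⁻¹ * ε⁻¹)
    {ε : ℝ} (hε : 0 < ε) (t : ℝ) (w z : Phase) :
    |fderiv ℝ (mollifier ε) (w - z) (phaseField E t w - phaseField E t z)|
      ≤ A * max 1 K * (ε ^ 6)⁻¹ := by
  by_cases hz : ε < ‖w - z‖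
  · rw [fderiv_mollifier_eq_zero hε hz]
    simp only [zero_apply, abs_zero]
    positivity
  · have h1 := (fderiv ℝ (mollifier ε) (w - z)).le_opNorm (phaseField E t w - phaseField E t z)
    have h2 := (hE.lipschitz_phaseField t).dist_le_mul w z
    rw [dist_eq_norm, dist_eq_norm] at h2
    rw [Real.norm_eq_abs] at h1
    push_cast at h2
    calc _ ≤ (A * (ε ^ 6)⁻¹ * ε⁻¹) * (max 1 K * ε) := by
          refine h1.trans ?_
          gcongr
          · exact (hA ε hε _).2
          · exact h2.trans (mul_le_mul_of_nonneg_left (not_lt.1 hz) (by positivity))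
      _ = _ := by field_simp

/-- The kernel has size `ε⁻⁶` on a ball of volume proportional to `ε⁶`, so the bound is uniform in
`ε`. -/
lemma IsNullWeakSol.exists_commutator_bound (h : IsNullWeakSol E T M n) (hE : IsForce E B K) :
    ∃ C : ℝ, ∀ ε, 0 < ε → ∀ t w, ‖commutator E n ε t w‖ ≤ C := by
  obtain ⟨A, hA0, hA⟩ := exists_mollifier_bound
  refine ⟨A * max 1 K * M * volume.real (Metric.ball (0 : Phase) 1), fun ε hε t w => ?_⟩
  have e1 : commutator E n ε t w = ∫ z in Metric.closedBall w ε,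
      fderiv ℝ (mollifier ε) (w - z) (phaseField E t w - phaseField E t z) * n t z := by
    rw [setIntegral_eq_integral_of_forall_compl_eq_zero fun z hz => ?_, commutator]
    rw [fderiv_mollifier_eq_zero hε (by simpa [dist_eq_norm, norm_sub_rev] using hz)]
    simp
  rw [e1]
  have h2 : ∀ᵐ z ∂(volume.restrict (Metric.closedBall w ε)),
      ‖fderiv ℝ (mollifier ε) (w - z) (phaseField E t w - phaseField E t z) * n t z‖
        ≤ A * max 1 K * (ε ^ 6)⁻¹ * M := by
    filter_upwards [ae_restrict_of_ae (h.bound t)] with z hz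
    rw [norm_mul]
    have := commutator_kernel_bound hE hA0 hA hε t w z
    gcongr
    exact this
  refine (norm_setIntegral_le_of_norm_le_const_ae' measure_closedBall_lt_top
    ((ae_restrict_iff' measurableSet_closedBall).1 h2)).trans (le_of_eq ?_)
  rw [Measure.real, Measure.addHaar_closedBall _ _ hε.le, finrank_phase, ENNReal.toReal_mul,
      ENNReal.toReal_ofReal (by positivity), Measure.real]
  have : ε ^ 6 ≠ 0 := by positivity
  field_simp

lemma continuous_mollifier_kernel (hE : IsForce E B K) (ε : ℝ) :
    Continuous fun p : (ℝ × Phase) × Phase =>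
      fderiv ℝ (mollifier ε) (p.1.2 - p.2) (phaseField E p.1.1 p.1.2 - phaseField E p.1.1 p.2) := by
  have h1 : Continuous (fderiv ℝ (mollifier ε)) := (contDiff_mollifier ε).continuous_fderiv (by simp)
  have h2 : Continuous fun p : (ℝ × Phase) × Phase => phaseField E p.1.1 p.1.2 :=
    hE.continuous_phaseField.comp (show Continuous fun p : (ℝ × Phase) × Phase => (p.1.1, p.1.2) by
      fun_prop)
  have h3 : Continuous fun p : (ℝ × Phase) × Phase => phaseField E p.1.1 p.2 :=
    hE.continuous_phaseField.comp (show Continuous fun p : (ℝ × Phase) × Phase => (p.1.1, p.2) by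
      fun_prop)
  fun_prop

lemma eventually_compl_closedBall {P : Type*} [TopologicalSpace P] {w : P → Phase}
    (hw : Continuous w) (p₀ : P) (ε : ℝ) :
    ∀ᶠ p in 𝓝 p₀, ∀ z, z ∉ Metric.closedBall (w p₀) (ε + 1) → ε < ‖w p - z‖ := by
  have : ∀ᶠ p in 𝓝 p₀, dist (w p) (w p₀) < 1 :=
    hw.continuousAt.eventually (Metric.ball_mem_nhds _ one_pos)
  filter_upwards [this] with p hp z hz
  rw [Metric.mem_closedBall, not_le] at hz
  have := dist_triangle_right z (w p₀) (w p)
  rw [← dist_eq_norm]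
  rw [dist_comm (w p₀) (w p), dist_comm z (w p)] at this
  linarith

lemma IsNullWeakSol.continuous_commutator (h : IsNullWeakSol E T M n) (hE : IsForce E B K)
    {ε : ℝ} (hε : 0 < ε) : Continuous fun p : ℝ × Phase => commutator E n ε p.1 p.2 := by
  rw [continuous_iff_continuousAt]
  intro p₀
  refine h.continuousAt_param (P := ℝ × Phase) (τ := Prod.fst) continuous_fst
    (φ := fun p z => fderiv ℝ (mollifier ε) (p.2 - z) (phaseField E p.1 p.2 - phaseField E p.1 z))
    (continuous_mollifier_kernel hE ε) (isCompact_closedBall p₀.2 (ε + 1)) ?_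
  filter_upwards [eventually_compl_closedBall continuous_snd p₀ ε] with p hp z hz
  rw [fderiv_mollifier_eq_zero hε (hp z hz)]
  simp

lemma hasFDerivAt_mollifier_sub (ε : ℝ) (w z : Phase) :
    HasFDerivAt (fun z => mollifier ε (w - z)) (-fderiv ℝ (mollifier ε) (w - z)) z := by
  have h1 : HasFDerivAt (mollifier ε) (fderiv ℝ (mollifier ε) (w - z)) (w - z) :=
    ((contDiff_mollifier ε).differentiable (by simp) _).hasFDerivAt
  have h2 : HasFDerivAt (fun z => w - z) (-ContinuousLinearMap.id ℝ Phase) z :=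
    (hasFDerivAt_id z).const_sub w
  have h3 : (fderiv ℝ (mollifier ε) (w - z)).comp (-ContinuousLinearMap.id ℝ Phase)
      = -fderiv ℝ (mollifier ε) (w - z) := by
    ext <;> simp
  rw [← h3]
  exact h1.comp z h2

/-- Both `phaseField E t` and the constant field with its value at `w` are divergence free. This
cancellation allows `n t z` to be replaced by `n t z - n t w` in the commutator, which therefore
tends to `0` at every Lebesgue point, see `IsNullWeakSol.ae_tendsto_commutator`. -/
lemma integral_commutator_kernel (hE : IsForce E B K) {ε : ℝ} (hε : 0 < ε) (t : ℝ) (w : Phase) :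
    ∫ z, fderiv ℝ (mollifier ε) (w - z) (phaseField E t w - phaseField E t z) = 0 := by
  have hEt : Continuous (E t) := (hE.lip t).continuous
  have hsm : ContDiff ℝ 1 fun z => mollifier ε (w - z) :=
    ((contDiff_mollifier ε).of_le (by simp)).comp (by fun_prop)
  have hcs : HasCompactSupport fun z => mollifier ε (w - z) :=
    HasCompactSupport.of_support_subset_isCompact (isCompact_closedBall w ε) fun z hz =>
      by_contra fun hz' => hz (mollifier_eq_zero hε (by
        simpa [dist_eq_norm, norm_sub_rev] using hz'))
  have hd : ∀ z, fderiv ℝ (fun z => mollifier ε (w - z)) z = -fderiv ℝ (mollifier ε) (w - z) := by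
    exact fun z => (hasFDerivAt_mollifier_sub ε w z).fderiv
  have e1 := integral_fderiv_phaseField_eq_zero hsm hcs hEt
  have e2 := integral_fderiv_phaseField_eq_zero (E := fun _ => E t w.1)
    (φ := fun z => mollifier ε (w - z)) hsm hcs continuous_const
  have hdc : Continuous (fderiv ℝ (mollifier ε)) :=
    (contDiff_mollifier ε).continuous_fderiv (by simp)
  have key : ∀ b : Phase → Phase, Continuous b →
      Integrable fun z => fderiv ℝ (mollifier ε) (w - z) (b z) := fun b hb =>
    integrable_of_continuous_of_eq_zero (by fun_prop) (isCompact_closedBall w ε) fun z hz => by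
      rw [fderiv_mollifier_eq_zero hε (by simpa [dist_eq_norm, norm_sub_rev] using hz)]; simp
  have e3 : ∫ z, fderiv ℝ (mollifier ε) (w - z) (phaseField E t w) = 0 := by
    have hb := integral_sub_left_eq_self
      (fun u : Phase => fderiv ℝ (mollifier ε) u (phaseField E t w)) volume w
    rw [hb]
    have hL : ∀ v : Phase, ∫ u, fderiv ℝ (mollifier ε) u v = 0 := by
      intro v
      have h := integral_mul_fderiv_eq_neg_fderiv_mul_of_integrable (μ := (volume : Measure Phase))
        (f := fun _ => (1 : ℝ)) (g := mollifier ε) (v := v) (by simp)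
        (by
          simp only [one_mul]
          exact integrable_of_continuous_of_eq_zero (by fun_prop) (isCompact_closedBall 0 ε)
            fun z hz => by
              rw [fderiv_mollifier_eq_zero hε (by simpa using hz)]; simp)
        (by
          simp only [one_mul]
          exact (contDiff_mollifier ε).continuous.integrable_of_hasCompactSupport
            (hasCompactSupport_mollifier hε))
        (fun _ _ => by fun_prop) (fun x _ => (contDiff_mollifier ε).differentiable (by simp) x)
      simpa using h
    exact hL _
  simp_rw [map_sub]
  rw [integral_sub (key _ continuous_const) (key (phaseField E t) (hE.lipschitz_phaseField t).continuous),
    e3, zero_sub, neg_eq_zero]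
  simp_rw [hd] at e1
  simpa [integral_neg, phaseField] using e1

lemma IsNullWeakSol.ae_tendsto_commutator (h : IsNullWeakSol E T M n) (hE : IsForce E B K)
    {ε : ℕ → ℝ} (hε : ∀ k, 0 < ε k) (hlim : Tendsto ε atTop (𝓝 0)) (t : ℝ) :
    ∀ᵐ w, Tendsto (fun k => commutator E n (ε k) t w) atTop (𝓝 0) := by
  obtain ⟨A, hA0, hA⟩ := exists_mollifier_bound
  filter_upwards [ae_tendsto_integral_kernel (h.locallyIntegrable t)] with w hw
  have := hw ε (fun k z => fderiv ℝ (mollifier (ε k)) (w - z)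
    (phaseField E t w - phaseField E t z)) (A * max 1 K) hε hlim
    (fun k z => commutator_kernel_bound hE hA0 hA (hε k) t w z)
    (fun k z hz => by rw [fderiv_mollifier_eq_zero (hε k) hz]; simp)
  refine this.congr fun k => ?_
  have hc : Continuous fun z => fderiv ℝ (mollifier (ε k)) (w - z)
      (phaseField E t w - phaseField E t z) :=
    (continuous_mollifier_kernel hE (ε k)).comp
      (show Continuous fun z : Phase => (((t, w), z) : (ℝ × Phase) × Phase) by fun_prop)
  have hi := integrable_of_continuous_of_eq_zero hc (isCompact_closedBall w (ε k)) fun z hz => by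
    rw [fderiv_mollifier_eq_zero (hε k) (by simpa [dist_eq_norm, norm_sub_rev] using hz)]; simp
  simp_rw [mul_sub]
  rw [integral_sub (h.integrable_mul t hi) (hi.mul_const _), integral_mul_const,
    integral_commutator_kernel hE (hε k), zero_mul, sub_zero, commutator]

lemma IsNullWeakSol.ae_tendsto_mollify (h : IsNullWeakSol E T M n)
    {ε : ℕ → ℝ} (hε : ∀ k, 0 < ε k) (hlim : Tendsto ε atTop (𝓝 0)) (t : ℝ) :
    ∀ᵐ w, Tendsto (fun k => ∫ z, mollifier (ε k) (w - z) * n t z) atTop (𝓝 (n t w)) := by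
  obtain ⟨A, hA0, hA⟩ := exists_mollifier_bound
  filter_upwards [ae_tendsto_integral_kernel (h.locallyIntegrable t)] with w hw
  have := hw ε (fun k z => mollifier (ε k) (w - z)) A hε hlim
    (fun k z => (hA _ (hε k) _).1) (fun k z hz => mollifier_eq_zero (hε k) hz)
  rw [← tendsto_sub_nhds_zero_iff]
  refine this.congr fun k => ?_
  have hi : Integrable fun z => mollifier (ε k) (w - z) :=
    integrable_of_continuous_of_eq_zero ((contDiff_mollifier _).continuous.comp (by fun_prop))
      (isCompact_closedBall w (ε k)) fun z hz =>
      mollifier_eq_zero (hε k) (by simpa [dist_eq_norm, norm_sub_rev] using hz)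
  simp_rw [mul_sub]
  rw [integral_sub (h.integrable_mul t hi) (hi.mul_const _), integral_mul_const,
    integral_sub_left_eq_self (mollifier (ε k)) volume w, integral_mollifier (hε k), one_mul]

/-- The mollified solution along a trajectory. -/
lemma IsNullWeakSol.mollify_trajectory (h : IsNullWeakSol E T M n) (hE : IsForce E B K)
    {Z : ℝ → Phase → Phase} (hZ : IsFlow E Z) {ε : ℝ} (hε : 0 < ε) (hT : 0 ≤ T) (z₀ : Phase) :
    ∫ z, mollifier ε (Z T z₀ - z) * n T z
      = ∫ t in (0 : ℝ)..T, commutator E n ε t (Z (max t 0) z₀) := by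
  set w : ℝ → Phase := fun t => Z (max t 0) z₀ with hw
  have hwc : Continuous w := (hZ.continuous_max hE).comp (by fun_prop : Continuous fun t : ℝ => (t, z₀))
  have hwd : ∀ t, 0 < t → HasDerivAt w (phaseField E t (w t)) t := fun t ht => by
    have h1 := hZ.deriv z₀ t ht.le
    simp only [hw, max_eq_left ht.le]
    refine h1.congr_of_eventuallyEq ?_
    filter_upwards [lt_mem_nhds ht] with s hs
    rw [max_eq_left hs.le]
  have hmc : Continuous (mollifier ε) := (contDiff_mollifier ε).continuous
  have hdc : Continuous (fderiv ℝ (mollifier ε)) := (contDiff_mollifier ε).continuous_fderiv (by simp)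
  have hpf := hE.continuous_phaseField
  -- The two roles of time are separated: `s` moves the point along the trajectory, `t` is the time
  -- in the solution. The partial derivatives `A₁` and `A₂` are jointly continuous, so the diagonal
  -- is differentiable, and their sum there is the commutator.
  let A : ℝ → ℝ → ℝ := fun s t => ∫ z, mollifier ε (w s - z) * n t z
  let A₁ : ℝ → ℝ → ℝ := fun s t =>
    ∫ z, fderiv ℝ (mollifier ε) (w s - z) (phaseField E s (w s)) * n t z
  let A₂ : ℝ → ℝ → ℝ := fun s t =>
    ∫ z, -fderiv ℝ (mollifier ε) (w s - z) (phaseField E t z) * n t z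
  have hsupp : ∀ p₀ : ℝ × ℝ, ∀ᶠ p in 𝓝 p₀, ∀ z, z ∉ Metric.closedBall (w p₀.1) (ε + 1) →
      ε < ‖w p.1 - z‖ := fun p₀ => eventually_compl_closedBall (hwc.comp continuous_fst) p₀ ε
  have hA : Continuous (Function.uncurry A) := by
    rw [continuous_iff_continuousAt]
    intro p₀
    refine h.continuousAt_param (P := ℝ × ℝ) (τ := Prod.snd) continuous_snd
      (φ := fun p z => mollifier ε (w p.1 - z)) (by simp only [Function.uncurry_def]; fun_prop)
      (isCompact_closedBall (w p₀.1) (ε + 1)) ?_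
    filter_upwards [hsupp p₀] with p hp z hz
    exact mollifier_eq_zero hε (hp z hz)
  have hA₁ : Continuous (Function.uncurry A₁) := by
    rw [continuous_iff_continuousAt]
    intro p₀
    refine h.continuousAt_param (P := ℝ × ℝ) (τ := Prod.snd) continuous_snd
      (φ := fun p z => fderiv ℝ (mollifier ε) (w p.1 - z) (phaseField E p.1 (w p.1))) ?_
      (isCompact_closedBall (w p₀.1) (ε + 1)) ?_
    · have h1 : Continuous fun q : (ℝ × ℝ) × Phase => phaseField E q.1.1 (w q.1.1) :=
        hpf.comp (by fun_prop : Continuous fun q : (ℝ × ℝ) × Phase => (q.1.1, w q.1.1))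
      simp only [Function.uncurry_def]
      fun_prop
    filter_upwards [hsupp p₀] with p hp z hz
    rw [fderiv_mollifier_eq_zero hε (hp z hz)]; simp
  have hA₂ : Continuous (Function.uncurry A₂) := by
    rw [continuous_iff_continuousAt]
    intro p₀
    refine h.continuousAt_param (P := ℝ × ℝ) (τ := Prod.snd) continuous_snd
      (φ := fun p z => -fderiv ℝ (mollifier ε) (w p.1 - z) (phaseField E p.2 z)) ?_
      (isCompact_closedBall (w p₀.1) (ε + 1)) ?_
    · have h1 : Continuous fun q : (ℝ × ℝ) × Phase => phaseField E q.1.2 q.2 :=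
        hpf.comp (by fun_prop : Continuous fun q : (ℝ × ℝ) × Phase => (q.1.2, q.2))
      simp only [Function.uncurry_def]
      fun_prop
    filter_upwards [hsupp p₀] with p hp z hz
    rw [fderiv_mollifier_eq_zero hε (hp z hz)]; simp
  have dA₁ : ∀ s t, 0 < s → HasDerivAt (fun s => A s t) (A₁ s t) s := by
    intro s t hs
    obtain ⟨L, hL, hLv⟩ := hasFDerivAt_integral_kernel ((contDiff_mollifier ε).of_le (by simp))
      (hasCompactSupport_mollifier hε) (h.locallyIntegrable t) (w s)
    have := hL.comp_hasDerivAt s (hwd s hs)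
    rw [hLv] at this
    exact this
  have eA : ∀ s, ∀ t ∈ Icc 0 T, A s t = ∫ r in (0 : ℝ)..t, A₂ s r := by
    intro s t ht
    have hsm : ContDiff ℝ (⊤ : ℕ∞) fun z => mollifier ε (w s - z) :=
      (contDiff_mollifier ε).comp (by fun_prop)
    have hcs : HasCompactSupport fun z => mollifier ε (w s - z) :=
      HasCompactSupport.of_support_subset_isCompact (isCompact_closedBall (w s) ε) fun z hz =>
        by_contra fun hz' => hz (mollifier_eq_zero hε (by
          simpa [dist_eq_norm, norm_sub_rev] using hz'))
    have hd : ∀ z, fderiv ℝ (fun z => mollifier ε (w s - z)) z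
        = -fderiv ℝ (mollifier ε) (w s - z) := by
      exact fun z => (hasFDerivAt_mollifier_sub ε (w s) z).fderiv
    have := h.eq _ hsm hcs t ht
    simp_rw [hd] at this
    exact this
  have dA₂ : ∀ s, ∀ t ∈ Ioo 0 T, HasDerivAt (fun t => A s t) (A₂ s t) t := by
    intro s t ht
    have hc : Continuous (A₂ s) := hA₂.comp (by fun_prop : Continuous fun t : ℝ => (s, t))
    have h1 : HasDerivAt (fun t => ∫ r in (0 : ℝ)..t, A₂ s r) (A₂ s t) t :=
      intervalIntegral.integral_hasDerivAt_right (hc.intervalIntegrable 0 t)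
        (hc.stronglyMeasurableAtFilter _ _) hc.continuousAt
    refine h1.congr_of_eventuallyEq ?_
    filter_upwards [Ioo_mem_nhds ht.1 ht.2] with r hr
    exact eA s r ⟨hr.1.le, hr.2.le⟩
  have dA : ∀ t ∈ Ioo 0 T, HasDerivAt (fun t => A t t) (A₁ t t + A₂ t t) t := by
    intro t ht
    let f₁ : ℝ → ℝ → (ℝ →L[ℝ] ℝ) := fun s t => ContinuousLinearMap.toSpanSingleton ℝ (A₁ s t)
    let f₂ : ℝ → ℝ → (ℝ →L[ℝ] ℝ) := fun s t => ContinuousLinearMap.toSpanSingleton ℝ (A₂ s t)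
    have hspan : Continuous fun x : ℝ => ContinuousLinearMap.toSpanSingleton ℝ x :=
      (ContinuousLinearMap.toSpanSingletonCLE (𝕜 := ℝ) (E := ℝ)).continuous
    have hmem : ∀ᶠ v : ℝ × ℝ in 𝓝 (t, t), v ∈ Ioo (0 : ℝ) T ×ˢ Ioo (0 : ℝ) T :=
      prod_mem_nhds (Ioo_mem_nhds ht.1 ht.2) (Ioo_mem_nhds ht.1 ht.2)
    have hs := hasStrictFDerivAt_uncurry_coprod (𝕜 := ℝ) (u := (t, t)) (f := A) (f₁ := f₁)
      (f₂ := f₂)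
      (by filter_upwards [hmem] with v hv using (dA₁ v.1 v.2 hv.1.1).hasFDerivAt)
      (by filter_upwards [hmem] with v hv using (dA₂ v.1 v.2 hv.2).hasFDerivAt)
      (hspan.comp hA₁).continuousAt (hspan.comp hA₂).continuousAt
    have hd : HasDerivAt (fun s : ℝ => (s, s)) ((1 : ℝ), (1 : ℝ)) t :=
      (hasDerivAt_id t).prodMk (hasDerivAt_id t)
    have := HasFDerivAt.comp_hasDerivAt (f := fun s : ℝ => (s, s)) t hs.hasFDerivAt hd
    simpa [f₁, f₂, Function.HasUncurry.uncurry, Function.comp_def] using this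
  have hcomm : ∀ t, A₁ t t + A₂ t t = commutator E n ε t (w t) := by
    intro t
    have key : ∀ b : Phase → Phase, Continuous b →
        Integrable fun z => fderiv ℝ (mollifier ε) (w t - z) (b z) := fun b hb =>
      integrable_of_continuous_of_eq_zero (by fun_prop) (isCompact_closedBall (w t) ε) fun z hz => by
        rw [fderiv_mollifier_eq_zero hε (by simpa [dist_eq_norm, norm_sub_rev] using hz)]; simp
    simp only [A₁, A₂]
    have i1 := h.integrable_mul t (key _ (continuous_const (y := phaseField E t (w t))))
    have i2 : Integrable fun z =>
        -fderiv ℝ (mollifier ε) (w t - z) (phaseField E t z) * n t z :=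
      h.integrable_mul t (key (phaseField E t) (hE.lipschitz_phaseField t).continuous).neg
    rw [← integral_add i1 i2, commutator]
    congr 1; ext z
    rw [map_sub]; ring
  have hcc : Continuous fun t => commutator E n ε t (w t) :=
    (h.continuous_commutator hE hε).comp (by fun_prop : Continuous fun t => (t, w t))
  have hfin := intervalIntegral.integral_eq_sub_of_hasDerivAt_of_le hT
    (f := fun t => A t t) (f' := fun t => commutator E n ε t (w t))
    (hA.comp (by fun_prop : Continuous fun t : ℝ => (t, t))).continuousOn
    (fun t ht => by rw [← hcomm]; exact dA t ht) (hcc.intervalIntegrable _ _)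
  have h0 : A 0 0 = 0 := by rw [eA 0 0 ⟨le_rfl, hT⟩]; simp
  change _ = A T T - A 0 0 at hfin
  rw [h0, sub_zero] at hfin
  simp only [A, hw, max_eq_left hT] at hfin
  exact hfin.symm

/-- Uniqueness for the continuity equation. -/
theorem IsNullWeakSol.ae_eq_zero (h : IsNullWeakSol E T M n) (hE : IsForce E B K)
    (hT : 0 ≤ T) : ∀ᵐ z, n T z = 0 := by
  obtain ⟨Z, hZ⟩ := hE.exists_flow
  set ε : ℕ → ℝ := fun k => 1 / ((k : ℝ) + 1) with hεdef
  have hε : ∀ k, 0 < ε k := fun k => by positivity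
  have hlim : Tendsto ε atTop (𝓝 0) := tendsto_one_div_add_atTop_nhds_zero_nat
  -- Volume preservation is not available here, since it is deduced from this theorem; for null sets
  -- the antilipschitz bound is enough.
  have hnull : ∀ t, 0 ≤ t → ∀ p : Phase → Prop, (∀ᵐ w, p w) → ∀ᵐ z, p (Z t z) := by
    intro t ht p hp
    rw [ae_iff] at hp ⊢
    have := measure_preimage_le_of_antilipschitz volume (hZ.antilipschitz hE ht) {w | ¬ p w}
    rw [hp, mul_zero] at this
    exact le_antisymm this zero_le
  have hwc : Continuous fun p : ℝ × Phase => Z (max p.1 0) p.2 := hZ.continuous_max hE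
  obtain ⟨C, hC⟩ := h.exists_commutator_bound hE
  let F : ℕ → ℝ × Phase → ℝ≥0∞ := fun k p => ‖commutator E n (ε k) p.1 (Z (max p.1 0) p.2)‖ₑ
  have hFc : ∀ k, Continuous fun p : ℝ × Phase => commutator E n (ε k) p.1 (Z (max p.1 0) p.2) :=
    fun k => (h.continuous_commutator hE (hε k)).comp (continuous_fst.prodMk hwc)
  have hFm : ∀ k, Measurable (F k) := fun k => (hFc k).measurable.enorm
  -- On a ball of initial points the commutators are bounded and tend to `0` almost everywhere along
  -- the trajectories, so their space-time integral tends to `0`. It dominates the integral of the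
  -- mollified solution at time `T`, and Fatou's lemma passes to the limit.
  have hzero : ∀ R : ℕ, ∀ᵐ z ∂(volume.restrict (Metric.ball (0 : Phase) R)), n T (Z T z) = 0 := by
    intro R
    set μ := (volume : Measure ℝ).restrict (Icc 0 T)
    set ν := (volume : Measure Phase).restrict (Metric.ball (0 : Phase) R)
    have hν : IsFiniteMeasure ν := ⟨by simp [ν, measure_ball_lt_top]⟩
    have hFlim : Tendsto (fun k => ∫⁻ p, F k p ∂(μ.prod ν)) atTop (𝓝 0) := by
      have := tendsto_lintegral_of_dominated_convergence (μ := μ.prod ν) (F := F) (f := fun _ => 0)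
        (fun _ => ENNReal.ofReal C) hFm
        (fun k => Eventually.of_forall fun p => by
          simp only [F]
          rw [← ofReal_norm]
          exact ENNReal.ofReal_le_ofReal (hC _ (hε k) _ _))
        (by
          rw [lintegral_const]
          exact ENNReal.mul_ne_top ENNReal.ofReal_ne_top (measure_ne_top _ _)) ?_
      · simpa using this
      · have hms : MeasurableSet {p : ℝ × Phase | Tendsto (fun k => F k p) atTop (𝓝 0)} :=
          measurableSet_tendsto _ hFm
        refine (Measure.ae_prod_mem_iff_ae_ae_mem hms).2 ?_
        filter_upwards with t
        refine ae_restrict_of_ae ?_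
        filter_upwards [hnull (max t 0) (le_max_right _ _) _ (h.ae_tendsto_commutator hE hε hlim t)]
          with z hz
        have := (continuous_enorm.tendsto (0 : ℝ)).comp hz
        simpa [F, Function.comp_def] using this
    have hle : ∀ k, ∫⁻ z, ‖∫ z', mollifier (ε k) (Z T z - z') * n T z'‖ₑ ∂ν
        ≤ ∫⁻ p, F k p ∂(μ.prod ν) := by
      intro k
      rw [lintegral_prod_symm _ (hFm k).aemeasurable]
      refine lintegral_mono fun z => ?_
      rw [h.mollify_trajectory hE hZ (hε k) hT z, intervalIntegral.integral_of_le hT]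
      refine (enorm_integral_le_lintegral_enorm _).trans ?_
      exact lintegral_mono' (Measure.restrict_mono Ioc_subset_Icc_self le_rfl) le_rfl
    have hmeas : ∀ k, Measurable fun z => ‖∫ z', mollifier (ε k) (Z T z - z') * n T z'‖ₑ := by
      intro k
      have hd : Continuous fun w => ∫ z', mollifier (ε k) (w - z') * n T z' := by
        rw [continuous_iff_continuousAt]
        intro w
        obtain ⟨L, hL, -⟩ := hasFDerivAt_integral_kernel
          ((contDiff_mollifier (ε k)).of_le (by simp))
          (hasCompactSupport_mollifier (hε k)) (h.locallyIntegrable T) w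
        exact hL.continuousAt
      exact (hd.comp (hZ.lipschitz hE hT).continuous).measurable.enorm
    have hfat := lintegral_liminf_le (μ := ν) (u := atTop) hmeas
    have h0 : liminf (fun k => ∫⁻ z, ‖∫ z', mollifier (ε k) (Z T z - z') * n T z'‖ₑ ∂ν) atTop = 0 :=
      (tendsto_of_tendsto_of_tendsto_of_le_of_le tendsto_const_nhds hFlim (fun _ => zero_le)
        hle).liminf_eq
    rw [h0, nonpos_iff_eq_zero, lintegral_eq_zero_iff (Measurable.liminf hmeas)] at hfat
    filter_upwards [hfat, ae_restrict_of_ae (hnull T hT _ (h.ae_tendsto_mollify hε hlim T))]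
      with z hz1 hz2
    have h3 := ((continuous_enorm.tendsto _).comp hz2).liminf_eq
    simp only [Function.comp_def] at h3
    simp only [Pi.zero_apply] at hz1
    rw [hz1] at h3
    exact enorm_eq_zero.1 h3.symm
  have hall : ∀ᵐ z, n T (Z T z) = 0 := by
    rw [ae_iff]
    have hU : {z | ¬ n T (Z T z) = 0} ⊆ ⋃ R : ℕ, ({z | ¬ n T (Z T z) = 0} ∩ Metric.ball 0 R) := by
      intro z hz
      obtain ⟨R, hR⟩ := exists_nat_gt ‖z‖
      exact mem_iUnion.2 ⟨R, hz, by simpa using hR⟩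
    refine measure_mono_null hU (measure_iUnion_null fun R => ?_)
    have := hzero R
    rw [ae_iff, Measure.restrict_apply' measurableSet_ball] at this
    exact this
  -- So far the solution vanishes along almost every trajectory. The flow is Lipschitz, so the
  -- inverse is antilipschitz, and the null set of bad initial points has a null image.
  let e := Equiv.ofBijective (Z T) ⟨hZ.injective hE hT, hZ.surjective hE hT⟩
  have hanti : AntilipschitzWith (Real.exp (max 1 K * T)).toNNReal e.symm :=
    (hZ.lipschitz hE hT).to_rightInverse e.apply_symm_apply
  rw [ae_iff] at hall ⊢
  have := measure_preimage_le_of_antilipschitz volume hanti {z | ¬ n T (Z T z) = 0}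
  rw [hall, mul_zero] at this
  have h5 : e.symm ⁻¹' {z | ¬ n T (Z T z) = 0} = {z | ¬ n T z = 0} := by
    ext z
    have : Z T (e.symm z) = z := e.apply_symm_apply z
    simp [this]
  rw [h5] at this
  exact le_antisymm this zero_le

end

end

section

/-! ### Transport along the flow, and Liouville's theorem -/

lemma continuous_integral_mul {Ψ : ℝ → Phase → ℝ} (hΨ : Continuous (Function.uncurry Ψ))
    {k : Set Phase} (hk : IsCompact k) (hΨk : ∀ s z, z ∉ k → Ψ s z = 0) {h : Phase → ℝ} {M : ℝ}
    (hm : AEStronglyMeasurable h) (hb : ∀ᵐ z, ‖h z‖ ≤ M) :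
    Continuous fun s => ∫ z, Ψ s z * h z := by
  rw [continuous_iff_continuousAt]
  intro s₀
  have hΨs : ∀ s, Continuous (Ψ s) := fun s => hΨ.comp (by fun_prop : Continuous fun z => (s, z))
  obtain ⟨C, hC⟩ := ((isCompact_closedBall s₀ 1).prod hk).exists_bound_of_continuousOn
    (f := Function.uncurry Ψ) hΨ.continuousOn
  refine continuousAt_of_dominated (bound := k.indicator fun _ => C * M) ?_ ?_ ?_ ?_
  · exact Eventually.of_forall fun s => (hΨs s).aestronglyMeasurable.mul hm
  · filter_upwards [Metric.closedBall_mem_nhds s₀ one_pos] with s hs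
    filter_upwards [hb] with z hz
    by_cases hzk : z ∈ k
    · rw [indicator_of_mem hzk, norm_mul]
      have := hC (s, z) ⟨hs, hzk⟩
      simp only [Function.uncurry] at this
      gcongr
      exact (norm_nonneg _).trans this
    · rw [indicator_of_notMem hzk, hΨk s z hzk]; simp
  · rw [integrable_indicator_iff hk.measurableSet]
    exact integrableOn_const hk.measure_lt_top.ne
  · refine Eventually.of_forall fun z => ?_
    have : Continuous fun s => Ψ s z := hΨ.comp (by fun_prop : Continuous fun s : ℝ => (s, z))
    exact (this.mul continuous_const).continuousAt

/-- Clamping of a time to the interval `[0,T]`. -/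
def clamp (T t : ℝ) : ℝ := max (min t T) 0

lemma continuous_clamp (T : ℝ) : Continuous (clamp T) := by unfold clamp; fun_prop

lemma clamp_nonneg (T t : ℝ) : 0 ≤ clamp T t := le_max_right _ _

lemma clamp_le {T : ℝ} (hT : 0 ≤ T) (t : ℝ) : clamp T t ≤ T := max_le (min_le_right _ _) hT

lemma clamp_eq {T t : ℝ} (ht : t ∈ Icc 0 T) : clamp T t = t := by
  rw [clamp, min_eq_left ht.2, max_eq_left ht.1]

section

variable {E : ℝ → R3 → R3} {B K : ℝ≥0} {Z : ℝ → Phase → Phase}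

lemma IsFlow.continuous_clamp (hZ : IsFlow E Z) (hE : IsForce E B K) (T : ℝ) :
    Continuous fun p : ℝ × Phase => Z (clamp T p.1) p.2 := by
  have h := (hZ.continuous_max hE).comp
    (((VlasovRiesz.continuous_clamp T).comp continuous_fst).prodMk continuous_snd :
      Continuous fun p : ℝ × Phase => (clamp T p.1, p.2))
  simpa only [Function.comp_def, max_eq_left (clamp_nonneg T _)] using h

lemma IsFlow.exists_preimage_bound (hZ : IsFlow E Z) (hE : IsForce E B K) (T R : ℝ) :
    ∃ R', ∀ s ∈ Icc 0 T, ∀ z, ‖Z s z‖ ≤ R → ‖z‖ ≤ R' := by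
  have h1 : ContinuousOn (fun s => Z s 0) (Icc 0 T) :=
    (hZ.continuous_time 0).mono Icc_subset_Ici_self
  obtain ⟨C, hC⟩ := isCompact_Icc.exists_bound_of_continuousOn h1
  refine ⟨Real.exp (max 1 K * T) * (R + C), fun s hs z hz => ?_⟩
  have h2 := hZ.dist_le_reverse hE hs.1 z 0
  rw [dist_eq_norm, dist_eq_norm, sub_zero] at h2
  refine h2.trans ?_
  have h3 : ‖Z s z - Z s 0‖ ≤ R + C := (norm_sub_le _ _).trans (add_le_add hz (hC s hs))
  have h4 : 0 ≤ R + C := (norm_nonneg _).trans h3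
  gcongr
  exact hs.2

/-- One compact set of initial points serves all times in `[0, T]`; test functions composed with the
flow thus have a common compact support. -/
lemma IsFlow.exists_compact (hZ : IsFlow E Z) (hE : IsForce E B K) (T : ℝ) {k : Set Phase}
    (hk : IsCompact k) : ∃ k', IsCompact k' ∧ ∀ s ∈ Icc 0 T, ∀ z, z ∉ k' → Z s z ∉ k := by
  obtain ⟨R, hR⟩ := hk.isBounded.exists_norm_le
  obtain ⟨R', hR'⟩ := hZ.exists_preimage_bound hE T R
  refine ⟨Metric.closedBall 0 R', isCompact_closedBall _ _, fun s hs z hz hzk => hz ?_⟩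
  simpa using hR' s hs z (hR _ hzk)

lemma continuous_fderiv_phaseField (hE : IsForce E B K) {φ : Phase → ℝ} (hφ : ContDiff ℝ 1 φ) :
    Continuous fun p : ℝ × Phase => fderiv ℝ φ p.2 (phaseField E p.1 p.2) := by
  have h1 : Continuous (fderiv ℝ φ) := hφ.continuous_fderiv (by simp)
  have h2 : Continuous fun p : ℝ × Phase => phaseField E p.1 p.2 := hE.continuous_phaseField
  fun_prop

lemma IsFlow.continuous_transport (hZ : IsFlow E Z) (hE : IsForce E B K) {T : ℝ} (hT : 0 ≤ T)
    {φ : Phase → ℝ} (hφ : Continuous φ) (hc : HasCompactSupport φ) {h : Phase → ℝ} {M : ℝ}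
    (hm : AEStronglyMeasurable h) (hb : ∀ᵐ z, ‖h z‖ ≤ M) :
    Continuous fun t => ∫ z, φ (Z (clamp T t) z) * h z := by
  obtain ⟨k', hk', hk⟩ := hZ.exists_compact hE T hc.isCompact
  refine continuous_integral_mul (Ψ := fun t z => φ (Z (clamp T t) z))
    (hφ.comp (hZ.continuous_clamp hE T)) hk' (fun s z hz => ?_) hm hb
  exact image_eq_zero_of_notMem_tsupport (hk _ ⟨clamp_nonneg _ _, clamp_le hT _⟩ z hz)

lemma IsFlow.continuous_transport_deriv (hZ : IsFlow E Z) (hE : IsForce E B K) {T : ℝ} (hT : 0 ≤ T)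
    {φ : Phase → ℝ} (hφ : ContDiff ℝ 1 φ) (hc : HasCompactSupport φ) {h : Phase → ℝ} {M : ℝ}
    (hm : AEStronglyMeasurable h) (hb : ∀ᵐ z, ‖h z‖ ≤ M) :
    Continuous fun t => ∫ z, fderiv ℝ φ (Z (clamp T t) z)
      (phaseField E (clamp T t) (Z (clamp T t) z)) * h z := by
  obtain ⟨k', hk', hk⟩ := hZ.exists_compact hE T (hc.fderiv (𝕜 := ℝ)).isCompact
  refine continuous_integral_mul (Ψ := fun t z => fderiv ℝ φ (Z (clamp T t) z)
      (phaseField E (clamp T t) (Z (clamp T t) z)))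
    ((continuous_fderiv_phaseField hE hφ).comp
      (((VlasovRiesz.continuous_clamp T).comp continuous_fst).prodMk (hZ.continuous_clamp hE T)))
    hk' (fun s z hz => ?_) hm hb
  rw [image_eq_zero_of_notMem_tsupport (hk _ ⟨clamp_nonneg _ _, clamp_le hT _⟩ z hz)]
  simp

/-- Weights are transported by the flow: the weak form of the continuity equation. -/
lemma IsFlow.transport (hZ : IsFlow E Z) (hE : IsForce E B K) {t : ℝ} (ht : 0 ≤ t)
    {φ : Phase → ℝ} (hφ : ContDiff ℝ 1 φ) (hc : HasCompactSupport φ) {h : Phase → ℝ} {M : ℝ}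
    (hm : AEStronglyMeasurable h) (hb : ∀ᵐ z, ‖h z‖ ≤ M) :
    ∫ z, φ (Z t z) * h z = (∫ z, φ z * h z) +
      ∫ s in (0 : ℝ)..t, ∫ z, fderiv ℝ φ (Z s z) (phaseField E s (Z s z)) * h z := by
  have hloc : LocallyIntegrable h := by
    rw [locallyIntegrable_iff]
    intro k hk
    exact Measure.integrableOn_of_bounded hk.measure_lt_top.ne hm (ae_restrict_of_ae hb)
  obtain ⟨k', hk', hk⟩ := hZ.exists_compact hE t hc.isCompact
  obtain ⟨k'', hk'', hk2⟩ := hZ.exists_compact hE t (hc.fderiv (𝕜 := ℝ)).isCompact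
  have hZt := (hZ.lipschitz hE ht).continuous
  have i1 : Integrable fun z => φ (Z t z) * h z :=
    (integrable_of_continuous_of_eq_zero (hφ.continuous.comp hZt) hk' fun z hz =>
      image_eq_zero_of_notMem_tsupport (f := φ) (hk t ⟨ht, le_rfl⟩ z hz)).mul_bdd hm hb
  have i2 : Integrable fun z => φ z * h z :=
    (hφ.continuous.integrable_of_hasCompactSupport hc).mul_bdd hm hb
  let Ψ : ℝ → Phase → ℝ := fun s z => fderiv ℝ φ (Z (clamp t s) z)
      (phaseField E (clamp t s) (Z (clamp t s) z))
  have hΨ : Continuous (Function.uncurry Ψ) := (continuous_fderiv_phaseField hE hφ).comp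
      (((VlasovRiesz.continuous_clamp t).comp continuous_fst).prodMk (hZ.continuous_clamp hE t))
  have hΨs : ∀ s ∈ Icc 0 t, ∀ z, Ψ s z = fderiv ℝ φ (Z s z) (phaseField E s (Z s z)) :=
    fun s hs z => by simp only [Ψ, clamp_eq hs]
  have hΨ0 : ∀ s z, z ∉ k'' → Ψ s z = 0 := fun s z hz => by
    simp only [Ψ]
    rw [image_eq_zero_of_notMem_tsupport (hk2 _ ⟨clamp_nonneg _ _, clamp_le ht _⟩ z hz)]
    simp
  have ftc : ∀ z, φ (Z t z) - φ z = ∫ s in (0 : ℝ)..t, Ψ s z := by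
    intro z
    have hcz : Continuous fun s => Ψ s z := hΨ.comp (by fun_prop : Continuous fun s : ℝ => (s, z))
    rw [intervalIntegral.integral_eq_sub_of_hasDerivAt (f := fun s => φ (Z s z)) (fun s hs => ?_)
      (hcz.intervalIntegrable _ _), hZ.zero]
    rw [uIcc_of_le ht] at hs
    rw [hΨs s hs]
    exact ((hφ.differentiable (by simp) (Z s z)).hasFDerivAt).comp_hasDerivAt s (hZ.deriv z s hs.1)
  have e1 : (∫ z, φ (Z t z) * h z) - ∫ z, φ z * h z = ∫ z, ∫ s in (0 : ℝ)..t, Ψ s z * h z := by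
    rw [← integral_sub i1 i2]
    congr 1; ext z
    rw [← sub_mul, ftc z, intervalIntegral.integral_mul_const]
  obtain ⟨C, hC⟩ := ((isCompact_Icc (a := (0 : ℝ)) (b := t)).prod hk'').exists_bound_of_continuousOn
    (f := Function.uncurry Ψ) hΨ.continuousOn
  have hint : Integrable (Function.uncurry fun s z => Ψ s z * h z)
      ((volume.restrict (uIoc 0 t)).prod volume) := by
    have hdom : Integrable (fun p : ℝ × Phase => (1 : ℝ) * k''.indicator (fun _ => C * M) p.2)
        ((volume.restrict (uIoc 0 t)).prod volume) := by
      refine Integrable.mul_prod (f := fun _ : ℝ => (1 : ℝ)) (g := k''.indicator fun _ => C * M) ?_ ?_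
      · rw [uIoc_of_le ht]; exact integrableOn_const measure_Ioc_lt_top.ne
      · rw [integrable_indicator_iff hk''.measurableSet]
        exact integrableOn_const hk''.measure_lt_top.ne
    refine hdom.mono' (hΨ.aestronglyMeasurable.mul hm.comp_snd) ?_
    have hs : ∀ᵐ p ∂((volume : Measure ℝ).restrict (uIoc 0 t)).prod (volume : Measure Phase),
        p.1 ∈ uIoc 0 t :=
      Measure.quasiMeasurePreserving_fst.ae (ae_restrict_mem measurableSet_uIoc)
    have hz : ∀ᵐ p ∂((volume : Measure ℝ).restrict (uIoc 0 t)).prod (volume : Measure Phase),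
        ‖h p.2‖ ≤ M := Measure.quasiMeasurePreserving_snd.ae hb
    filter_upwards [hs, hz] with p hp1 hp2
    rw [uIoc_of_le ht] at hp1
    simp only [one_mul, Function.uncurry]
    by_cases hpk : p.2 ∈ k''
    · rw [indicator_of_mem hpk, norm_mul]
      have := hC (p.1, p.2) ⟨⟨hp1.1.le, hp1.2⟩, hpk⟩
      simp only [Function.uncurry_apply_pair] at this
      gcongr
      exact (norm_nonneg _).trans this
    · rw [indicator_of_notMem hpk, hΨ0 _ _ hpk]; simp
  rw [← intervalIntegral_integral_swap hint] at e1
  rw [← sub_eq_iff_eq_add', e1]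
  refine intervalIntegral.integral_congr fun s hs => ?_
  rw [uIcc_of_le ht] at hs
  simp only [hΨs s hs]

lemma ae_toReal_rnDeriv_le {m : Measure Phase} {C : ℝ≥0} (hm : m ≤ (C : ℝ≥0∞) • volume) :
    ∀ᵐ z, ‖(m.rnDeriv volume z).toReal‖ ≤ C := by
  have h : m.rnDeriv volume ≤ᵐ[volume] fun _ => (C : ℝ≥0∞) := by
    refine ae_le_of_forall_setLIntegral_le_of_sigmaFinite (Measure.measurable_rnDeriv _ _)
      fun s hs _ => ?_
    rw [setLIntegral_const]
    exact (Measure.setLIntegral_rnDeriv_le s).trans (hm s)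
  filter_upwards [h] with z hz
  rw [Real.norm_of_nonneg ENNReal.toReal_nonneg]
  exact ENNReal.toReal_le_of_le_ofReal C.2 (by simpa using hz)

/-- Liouville's theorem: the flow preserves the volume of phase space. -/
theorem IsFlow.measurePreserving (hZ : IsFlow E Z) (hE : IsForce E B K) {T : ℝ} (hT : 0 ≤ T) :
    MeasurePreserving (Z T) volume volume := by
  have hcont : ∀ t, 0 ≤ t → Continuous (Z t) := fun t ht => (hZ.lipschitz hE ht).continuous
  let m : ℝ → Measure Phase := fun t => volume.map (Z (clamp T t))
  let C : ℝ≥0 := (Real.exp (max 1 K * T)).toNNReal ^ 6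
  have hm : ∀ t, m t ≤ (C : ℝ≥0∞) • volume := fun t => by
    have h0 := clamp_nonneg T t
    have h1 := (hZ.antilipschitz hE h0)
    have h2 : AntilipschitzWith (Real.exp (max 1 K * T)).toNNReal (Z (clamp T t)) := by
      intro x y
      refine (h1 x y).trans ?_
      gcongr
      exact clamp_le hT t
    have := map_le_of_antilipschitz volume h2 (hcont _ h0).measurable
    rw [finrank_phase] at this
    simpa [C] using this
  have hac : ∀ t, m t ≪ volume := fun t =>
    Measure.absolutelyContinuous_of_le_smul (hm t)
  have hsf : ∀ t, SigmaFinite (m t) := fun t =>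
    haveI : IsLocallyFiniteMeasure ((C : ℝ≥0∞) • (volume : Measure Phase)) :=
      inferInstanceAs (IsLocallyFiniteMeasure (C • (volume : Measure Phase)))
    haveI := Measure.isLocallyFiniteMeasure_of_le (hm t)
    inferInstance
  have hasLD : ∀ t, (m t).HaveLebesgueDecomposition volume := fun t =>
    haveI := hsf t
    Measure.haveLebesgueDecomposition_of_sigmaFinite (m t) volume
  let d : ℝ → Phase → ℝ := fun t z => ((m t).rnDeriv volume z).toReal
  have hdm : ∀ t, AEStronglyMeasurable (d t) volume := fun t =>
    (Measure.measurable_rnDeriv _ _).ennreal_toReal.aestronglyMeasurable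
  have hdb : ∀ t, ∀ᵐ z, ‖d t z‖ ≤ C := fun t => ae_toReal_rnDeriv_le (hm t)
  have hdi : ∀ t (φ : Phase → ℝ), Continuous φ →
      ∫ z, φ z * d t z = ∫ z, φ (Z (clamp T t) z) * 1 := fun t φ hφ => by
    have := hsf t
    have := hasLD t
    have h1 := integral_rnDeriv_smul (hac t) (f := φ)
    have h2 : ∫ z, φ z ∂(m t) = ∫ z, φ (Z (clamp T t) z) :=
      integral_map (hcont _ (clamp_nonneg T t)).aemeasurable hφ.aestronglyMeasurable
    simp_rw [mul_one]
    rw [← h2, ← h1]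
    simp only [d, smul_eq_mul, mul_comm]
  have h1m : AEStronglyMeasurable (fun _ : Phase => (1 : ℝ)) volume := aestronglyMeasurable_const
  have h1b : ∀ᵐ z : Phase, ‖(1 : ℝ)‖ ≤ 1 := by simp
  -- The density `d` of the image of Lebesgue measure is bounded because the flow is antilipschitz,
  -- and it is transported by the flow. The constant `1` solves the same equation because the field
  -- is divergence free. Uniqueness then forces `d = 1`.
  have hsol : IsNullWeakSol E T (C + 1) (fun t z => d t z - 1) := by
    refine ⟨fun t => (hdm t).sub h1m, fun t => ?_, fun φ hφ hc => ?_, fun φ hφ hc t ht => ?_⟩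
    · filter_upwards [hdb t] with z hz
      exact (norm_sub_le _ _).trans (by simpa using hz)
    · have hi : Integrable φ := hφ.integrable_of_hasCompactSupport hc
      have : ∀ t, ∫ z, φ z * (d t z - 1) = (∫ z, φ (Z (clamp T t) z) * 1) - ∫ z, φ z := fun t => by
        simp_rw [mul_sub]
        rw [integral_sub (hi.mul_bdd (hdm t) (hdb t)) (by simpa using hi), hdi t φ hφ]
        simp
      simp_rw [this]
      exact (hZ.continuous_transport hE hT hφ hc h1m h1b).sub continuous_const
    · have hφ1 : ContDiff ℝ 1 φ := hφ.of_le (by simp)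
      have hi : Integrable φ := hφ.continuous.integrable_of_hasCompactSupport hc
      have h0 := hZ.transport hE ht.1 hφ1 hc h1m h1b
      simp_rw [mul_sub]
      rw [integral_sub (hi.mul_bdd (hdm t) (hdb t)) (by simpa using hi), hdi t φ hφ.continuous,
        clamp_eq ht, h0, add_sub_cancel_left]
      refine intervalIntegral.integral_congr fun s hs => ?_
      rw [uIcc_of_le ht.1] at hs
      have hs' : s ∈ Icc 0 T := ⟨hs.1, hs.2.trans ht.2⟩
      have hcs : Continuous fun z => fderiv ℝ φ z (phaseField E s z) :=
        (continuous_fderiv_phaseField hE hφ1).comp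
          (by fun_prop : Continuous fun z : Phase => (s, z))
      have his : Integrable fun z => fderiv ℝ φ z (phaseField E s z) :=
        integrable_of_continuous_of_eq_zero hcs (hc.fderiv (𝕜 := ℝ)).isCompact fun z hz => by
          rw [image_eq_zero_of_notMem_tsupport hz]; simp
      have h2 := hdi s _ hcs
      rw [clamp_eq hs'] at h2
      have e1 : ∫ z, fderiv ℝ φ z (phaseField E s z) * (d s z - 1)
          = ∫ z, fderiv ℝ φ z (phaseField E s z) * d s z := by
        have e2 : ∀ z, fderiv ℝ φ z (phaseField E s z) * (d s z - 1) =
            fderiv ℝ φ z (phaseField E s z) * d s z - fderiv ℝ φ z (phaseField E s z) :=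
          fun z => by ring
        simp only [e2]
        rw [integral_sub (his.mul_bdd (hdm s) (hdb s)) his]
        have h3 := integral_fderiv_phaseField_eq_zero hφ1 hc (hE.lip s).continuous
        simp only [phaseField] at h3 ⊢
        rw [h3, sub_zero]
      refine (e1.trans h2).symm.trans ?_
      simp only [mul_sub]
  have := hsf T
  have := hasLD T
  have hT1 := hsol.ae_eq_zero hE hT
  refine ⟨(hcont T hT).measurable, ?_⟩
  have hmT : m T = volume.map (Z T) := by simp only [m, clamp_eq (right_mem_Icc.2 hT)]
  rw [← hmT, ← Measure.withDensity_rnDeriv_eq (m T) volume (hac T)]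
  refine Eq.trans ?_ (withDensity_one (μ := (volume : Measure Phase)))
  refine withDensity_congr_ae ?_
  filter_upwards [hT1] with z hz
  have h5 : ((m T).rnDeriv volume z).toReal = 1 := by
    simp only [d] at hz; linarith
  simpa [ENNReal.toReal_eq_one_iff] using h5

end

end

section

/-! ### Mixed norms and mollification of the initial data -/

/-- The essential supremum of a slice is at most `a` exactly when the slice of `{a < ‖g‖ₑ}` is null,
and the measure of slices is a measurable function. -/
lemma measurable_eLpNorm_top_slice {g : Phase → ℝ} (hg : Measurable g) :
    Measurable fun x : R3 => eLpNorm (fun v : R3 => g (x, v)) ∞ volume := by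
  refine measurable_of_Iic fun a => ?_
  have h : (fun x : R3 => eLpNorm (fun v : R3 => g (x, v)) ∞ volume) ⁻¹' Iic a =
      (fun x : R3 => volume (Prod.mk x ⁻¹' {z : Phase | a < ‖g z‖ₑ})) ⁻¹' {0} := by
    ext x
    simp only [mem_preimage, mem_Iic, mem_singleton_iff, eLpNorm_exponent_top]
    constructor
    · intro hx
      have := ae_le_eLpNormEssSup (f := fun v : R3 => g (x, v)) (μ := volume)
      have h2 : ∀ᵐ v : R3, ¬ a < ‖g (x, v)‖ₑ := this.mono fun v hv => not_lt.2 (hv.trans hx)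
      simpa [ae_iff] using h2
    · intro hx
      refine essSup_le_of_ae_le a ?_
      have h2 : ∀ᵐ v : R3, ¬ a < ‖g (x, v)‖ₑ := by simpa [ae_iff] using hx
      exact h2.mono fun v hv => not_lt.1 hv
  rw [h]
  exact measurable_measure_prodMk_left (measurableSet_lt measurable_const hg.enorm)
    (measurableSet_singleton 0)

lemma normLxLv_congr {g g' : Phase → ℝ} (h : g =ᵐ[volume] g') (r r' : ℝ≥0∞) :
    normLxLv r r' g = normLxLv r r' g' := by
  refine eLpNorm_congr_ae ?_
  filter_upwards [Measure.ae_ae_of_ae_prod h] with x hx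
  exact eLpNorm_congr_ae hx

lemma normLxLv_one_top (g : Phase → ℝ) :
    normLxLv 1 ∞ g = ∫⁻ x : R3, eLpNorm (fun v : R3 => g (x, v)) ∞ volume := by
  simp [normLxLv, eLpNorm_one_eq_lintegral_enorm]

lemma normLvLx_eq (r r' : ℝ≥0∞) (g : Phase → ℝ) :
    normLvLx r r' g = normLxLv r r' (fun z => g z.swap) := rfl

lemma eLpNorm_top_of_continuous {g : R3 → ℝ} (hg : Continuous g) :
    eLpNorm g ∞ volume = ⨆ v, ‖g v‖ₑ := by
  refine le_antisymm ?_ (iSup_le fun v => ?_)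
  · rw [eLpNorm_exponent_top]
    exact essSup_le_of_ae_le _ (Eventually.of_forall fun v => le_iSup (fun v => ‖g v‖ₑ) v)
  · by_contra! hlt
    have ho : IsOpen {w | eLpNorm g ∞ volume < ‖g w‖ₑ} := isOpen_lt continuous_const hg.enorm
    have h1 := ho.measure_pos volume ⟨v, hlt⟩
    have h2 := ae_le_eLpNormEssSup (f := g) (μ := volume)
    rw [ae_iff] at h2
    simp only [not_le] at h2
    rw [eLpNorm_exponent_top] at h1
    exact h1.ne' h2

lemma measurable_iSup_slice {F : Type*} [NormedAddCommGroup F] {g : Phase → F} (hg : Continuous g) :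
    Measurable fun x : R3 => ⨆ v : R3, ‖g (x, v)‖ₑ :=
  (lowerSemicontinuous_iSup fun v =>
    (hg.comp (by fun_prop : Continuous fun x : R3 => (x, v))).enorm.lowerSemicontinuous).measurable

lemma measurable_iSup_slice' {F : Type*} [NormedAddCommGroup F] {g : Phase → F} (hg : Continuous g) :
    Measurable fun v : R3 => ⨆ x : R3, ‖g (x, v)‖ₑ :=
  (lowerSemicontinuous_iSup fun x =>
    (hg.comp (by fun_prop : Continuous fun v : R3 => (x, v))).enorm.lowerSemicontinuous).measurable

/-- Mollification does not increase the norm of `L^1_x(L^∞_v)`. -/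
lemma lintegral_iSup_mollify_le {g : Phase → ℝ} (hg : AEStronglyMeasurable g) {ψ : Phase → ℝ}
    (hψ : Measurable ψ) (h1 : ∫⁻ z, ‖ψ z‖ₑ = 1) :
    ∫⁻ x : R3, ⨆ v : R3, ‖∫ z, ψ ((x, v) - z) * g z‖ₑ ≤ normLxLv 1 ∞ g := by
  obtain ⟨g', hg', hgg'⟩ := hg.aemeasurable
  have e1 : ∀ w, ∫ z, ψ (w - z) * g z = ∫ z, ψ (w - z) * g' z := fun w =>
    integral_congr_ae (hgg'.mono fun z hz => by simp only [hz])
  simp only [e1]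
  rw [normLxLv_congr hgg', normLxLv_one_top]
  clear e1 hgg' hg
  set G : R3 → ℝ≥0∞ := fun x => eLpNorm (fun v : R3 => g' (x, v)) ∞ volume with hG
  have hGm : Measurable G := measurable_eLpNorm_top_slice hg'
  let ζ : R3 → ℝ≥0∞ := fun u => ∫⁻ v : R3, ‖ψ (u, v)‖ₑ
  have hζm : Measurable ζ := hψ.enorm.lintegral_prod_right'
  have hζ1 : ∫⁻ u, ζ u = 1 := by
    rw [← h1, Measure.volume_eq_prod, lintegral_prod _ hψ.enorm.aemeasurable]
  -- The right-hand side is a convolution in `x` alone, of the slicewise essential supremum `G` with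
  -- the marginal `ζ` of the mollifier. It does not depend on `v`, so the supremum over `v` is free.
  have key : ∀ x v : R3, ‖∫ z, ψ ((x, v) - z) * g' z‖ₑ ≤ ∫⁻ y, G y * ζ (x - y) := fun x v => by
    calc ‖∫ z, ψ ((x, v) - z) * g' z‖ₑ ≤ ∫⁻ z, ‖ψ ((x, v) - z) * g' z‖ₑ :=
          enorm_integral_le_lintegral_enorm _
      _ = ∫⁻ y, ∫⁻ u, ‖ψ ((x, v) - (y, u)) * g' (y, u)‖ₑ := by
          rw [Measure.volume_eq_prod, lintegral_prod]
          exact ((hψ.comp (measurable_const.sub measurable_id)).mul hg').enorm.aemeasurable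
      _ ≤ ∫⁻ y, ∫⁻ u, G y * ‖ψ (x - y, v - u)‖ₑ := by
          refine lintegral_mono fun y => lintegral_mono_ae ?_
          filter_upwards [ae_le_eLpNormEssSup (f := fun u : R3 => g' (y, u)) (μ := volume)]
            with u hu
          rw [enorm_mul, mul_comm]
          exact mul_le_mul' hu le_rfl
      _ = ∫⁻ y, G y * ζ (x - y) := by
          refine lintegral_congr fun y => ?_
          rw [lintegral_const_mul _ (by fun_prop)]
          congr 1
          exact lintegral_sub_left_eq_self (fun u => ‖ψ (x - y, u)‖ₑ) v
  calc ∫⁻ x : R3, ⨆ v : R3, ‖∫ z, ψ ((x, v) - z) * g' z‖ₑ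
      ≤ ∫⁻ x, ∫⁻ y, G y * ζ (x - y) := lintegral_mono fun x => iSup_le fun v => key x v
    _ = ∫⁻ y, ∫⁻ x, G y * ζ (x - y) := by
        refine lintegral_lintegral_swap (Measurable.aemeasurable ?_)
        exact (hGm.comp measurable_snd).mul (hζm.comp (measurable_fst.sub measurable_snd))
    _ = ∫⁻ y, G y := by
        refine lintegral_congr fun y => ?_
        rw [lintegral_const_mul _ (by fun_prop)]
        rw [lintegral_sub_right_eq_self (fun x => ζ x) y, hζ1, mul_one]

lemma lintegral_iSup_mollify_le' {g : Phase → ℝ} (hg : AEStronglyMeasurable g) {ψ : Phase → ℝ}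
    (hψ : Measurable ψ) (h1 : ∫⁻ z, ‖ψ z‖ₑ = 1) :
    ∫⁻ v : R3, ⨆ x : R3, ‖∫ z, ψ ((x, v) - z) * g z‖ₑ ≤ normLvLx 1 ∞ g := by
  have hs : MeasurePreserving (Prod.swap : Phase → Phase) volume volume :=
    Measure.measurePreserving_swap
  rw [normLvLx_eq]
  refine le_trans (le_of_eq ?_) (lintegral_iSup_mollify_le (hg.comp_measurePreserving hs)
    (hψ.comp measurable_swap) ?_)
  · refine lintegral_congr fun v => iSup_congr fun x => ?_
    congr 1
    have := hs.integral_comp MeasurableEquiv.prodComm.measurableEmbedding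
      (fun z => ψ ((x, v) - z) * g z)
    exact this.symm
  · rw [← h1]
    exact hs.lintegral_comp hψ.enorm

lemma lintegral_enorm_mollifier {ε : ℝ} (hε : 0 < ε) : ∫⁻ z, ‖mollifier ε z‖ₑ = 1 := by
  have h := ofReal_integral_norm_eq_lintegral_enorm
    ((contDiff_mollifier ε).continuous.integrable_of_hasCompactSupport (μ := volume)
      (hasCompactSupport_mollifier hε))
  rw [← h]
  simp only [Real.norm_of_nonneg (mollifier_nonneg hε _), integral_mollifier hε]
  simp

lemma norm_mollify_le {g : Phase → ℝ} {ε : ℝ} (hε : 0 < ε) (w : Phase) :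
    ‖∫ z, mollifier ε (w - z) * g z‖ₑ ≤ eLpNorm g ∞ volume := by
  refine (enorm_integral_le_lintegral_enorm _).trans ?_
  calc ∫⁻ z, ‖mollifier ε (w - z) * g z‖ₑ ≤ ∫⁻ z, ‖mollifier ε (w - z)‖ₑ * eLpNorm g ∞ volume := by
        refine lintegral_mono_ae ?_
        filter_upwards [ae_le_eLpNormEssSup (f := g) (μ := volume)] with z hz
        rw [enorm_mul]
        exact mul_le_mul' le_rfl hz
    _ = eLpNorm g ∞ volume := by
        rw [lintegral_mul_const _ (by
          exact ((contDiff_mollifier ε).continuous.comp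
            (continuous_const.sub continuous_id)).enorm.measurable), lintegral_sub_left_eq_self (fun z => ‖mollifier ε z‖ₑ) w,
          lintegral_enorm_mollifier hε, one_mul]

/-- The mollification of a function. -/
def mollify (ε : ℝ) (u : Phase → ℝ) (w : Phase) : ℝ := ∫ z, mollifier ε (w - z) * u z

lemma hasFDerivAt_mollify {ε : ℝ} (hε : 0 < ε) {u : Phase → ℝ} (hu : LocallyIntegrable u)
    (w : Phase) : DifferentiableAt ℝ (mollify ε u) w := by
  obtain ⟨L, hL, -⟩ := hasFDerivAt_integral_kernel ((contDiff_mollifier ε).of_le (by simp))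
    (hasCompactSupport_mollifier hε) hu w
  exact hL.differentiableAt

lemma fderiv_mollify {ε : ℝ} (hε : 0 < ε) {u : Phase → ℝ} {d : Phase} {g : Phase → ℝ}
    (h : IsWeakDeriv [d] u g) (w : Phase) : fderiv ℝ (mollify ε u) w d = mollify ε g w := by
  obtain ⟨L, hL, hL2⟩ := hasFDerivAt_integral_kernel ((contDiff_mollifier ε).of_le (by simp))
    (hasCompactSupport_mollifier hε) h.1 w
  have e1 : fderiv ℝ (mollify ε u) w = L := hL.fderiv
  rw [e1, hL2, mollify]
  have h3 := h.2.2 (fun z => mollifier ε (w - z))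
    ((contDiff_mollifier ε).comp (contDiff_const.sub contDiff_id))
    ((hasCompactSupport_mollifier hε).comp_homeomorph (Homeomorph.subLeft w))
  have e2 : ∀ z, dirDeriv [d] (fun z => mollifier ε (w - z)) z = - fderiv ℝ (mollifier ε) (w - z) d := by
    intro z
    have hd : HasFDerivAt (mollifier ε) (fderiv ℝ (mollifier ε) (w - z)) (w - z) :=
      (((contDiff_mollifier ε).differentiable (by simp)) _).hasFDerivAt
    have := (hd.comp z ((hasFDerivAt_id z).const_sub w)).fderiv
    simp only [dirDeriv]
    change (fderiv ℝ (mollifier ε ∘ HSub.hSub w) z) d = _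
    rw [this]
    simp
  simp only [e2, smul_eq_mul, List.length_singleton, pow_one, neg_mul, one_mul, integral_neg,
    neg_inj] at h3
  exact h3

lemma continuous_mollify {ε : ℝ} (hε : 0 < ε) {u : Phase → ℝ} (hu : LocallyIntegrable u) :
    Continuous (mollify ε u) :=
  continuous_iff_continuousAt.2 fun w => (hasFDerivAt_mollify hε hu w).continuousAt

lemma contDiff_mollify {ε : ℝ} (hε : 0 < ε) {u : Phase → ℝ} (hu : LocallyIntegrable u) :
    ContDiff ℝ 1 (mollify ε u) := by
  have h := (hasCompactSupport_mollifier hε).contDiff_convolution_left (ContinuousLinearMap.mul ℝ ℝ)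
    (n := 1) (μ := volume) ((contDiff_mollifier ε).of_le (by simp)) hu
  have e1 : mollify ε u =
      convolution (mollifier ε) u (ContinuousLinearMap.mul ℝ ℝ) volume := by
    ext w
    rw [convolution_eq_swap]
    rfl
  rwa [e1]

/-- The coordinate directions of phase space. -/
def dir : Fin 3 ⊕ Fin 3 → Phase
  | Sum.inl i => (e i, 0)
  | Sum.inr i => (0, e i)

lemma eq_sum_smul_e (x : R3) : x = ∑ i, x i • e i := by
  ext j
  simp [e, Fin.sum_univ_three]
  fin_cases j <;> simp

lemma enorm_le_sum_dir (A : Phase →L[ℝ] ℝ) : ‖A‖ₑ ≤ ∑ d, ‖A (dir d)‖ₑ := by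
  have h : ‖A‖ ≤ ∑ d, ‖A (dir d)‖ := by
    refine A.opNorm_le_bound (by positivity) fun z => ?_
    have e1 : A z = (∑ i, z.1 i * A (dir (Sum.inl i))) + ∑ i, z.2 i * A (dir (Sum.inr i)) := by
      have : z = (∑ i, z.1 i • dir (Sum.inl i)) + ∑ i, z.2 i • dir (Sum.inr i) := by
        refine Prod.ext ?_ ?_
        · simpa [dir, Prod.fst_sum] using eq_sum_smul_e z.1
        · simpa [dir, Prod.snd_sum] using eq_sum_smul_e z.2
      nth_rw 1 [this]
      simp
    have hx : ∀ i, ‖z.1 i‖ ≤ ‖z‖ := fun i => (PiLp.norm_apply_le z.1 i).trans (norm_fst_le z)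
    have hv : ∀ i, ‖z.2 i‖ ≤ ‖z‖ := fun i => (PiLp.norm_apply_le z.2 i).trans (norm_snd_le z)
    rw [e1, Fintype.sum_sum_type, add_mul, Finset.sum_mul, Finset.sum_mul]
    refine (norm_add_le _ _).trans (add_le_add ?_ ?_)
    · refine (norm_sum_le _ _).trans (Finset.sum_le_sum fun i _ => ?_)
      rw [norm_mul, mul_comm]
      gcongr
      exact hx i
    · refine (norm_sum_le _ _).trans (Finset.sum_le_sum fun i _ => ?_)
      rw [norm_mul, mul_comm]
      gcongr
      exact hv i
  simp only [← ofReal_norm]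
  rw [← ENNReal.ofReal_sum_of_nonneg fun _ _ => norm_nonneg _]
  exact ENNReal.ofReal_le_ofReal h

/-- The properties of the initial data used in the sequel: it is nonnegative and Lipschitz, and a
limit of smooth functions which, as well as their derivatives, are bounded by `D` in mixed norms. -/
structure IsData (F : Phase → ℝ) (L : ℝ≥0) (D : ℝ) : Prop where
  nonneg : ∀ z, 0 ≤ F z
  lip : LipschitzWith L F
  mass : ∫⁻ z, ‖F z‖ₑ ≤ ENNReal.ofReal D
  supV : ∫⁻ x : R3, ⨆ v : R3, ‖F (x, v)‖ₑ ≤ ENNReal.ofReal D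
  supX : ∫⁻ v : R3, ⨆ x : R3, ‖F (x, v)‖ₑ ≤ ENNReal.ofReal D
  approx : ∀ ε : ℝ, 0 < ε → ∃ G : Phase → ℝ, ContDiff ℝ 1 G ∧ (∀ z, |G z - F z| ≤ ε) ∧
    ∫⁻ x : R3, ⨆ v : R3, ‖fderiv ℝ G (x, v)‖ₑ ≤ ENNReal.ofReal D ∧
    ∫⁻ v : R3, ⨆ x : R3, ‖fderiv ℝ G (x, v)‖ₑ ≤ ENNReal.ofReal D

/-- The infimum in `weakNorm` is not shown to be attained. Since `η > 0`, doubling the bound makes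
it strict and produces an actual weak derivative. -/
lemma exists_isWeakDeriv {l : List Phase} {N : (Phase → ℝ) → ℝ≥0∞} {u : Phase → ℝ} {η : ℝ}
    (hη : 0 < η) (h : weakNorm l N u ≤ ENNReal.ofReal η) :
    ∃ g, IsWeakDeriv l u g ∧ N g ≤ ENNReal.ofReal (2 * η) := by
  have h2 : weakNorm l N u < ENNReal.ofReal (2 * η) :=
    h.trans_lt ((ENNReal.ofReal_lt_ofReal_iff (by positivity)).2 (by linarith))
  simp only [weakNorm, iInf_lt_iff] at h2
  obtain ⟨g, hg, hN⟩ := h2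
  exact ⟨g, hg, hN.le⟩

lemma IsWeakDeriv.ae_eq {u g : Phase → ℝ} (h : IsWeakDeriv [] u g) : u =ᵐ[volume] g :=
  ae_eq_of_integral_contDiff_smul_eq h.1 h.2.1 fun φ hφ hc => by
    simpa [dirDeriv] using h.2.2 φ hφ hc

lemma weakNorm_le_dataNorm (u : Phase → ℝ) :
    (∀ m, weakNorm (dirsXV m) (fun g => eLpNorm g 1 volume) u ≤ dataNorm u) ∧
    (∀ m, weakNorm (dirsXV m) (fun g => eLpNorm g ∞ volume) u ≤ dataNorm u) ∧
    (∀ m m', weakNorm (dirsX m ++ dirsV m') (normLxLv 1 ∞) u ≤ dataNorm u) ∧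
    (∀ m m', weakNorm (dirsV m ++ dirsX m') (normLvLx 1 ∞) u ≤ dataNorm u) := by
  refine ⟨fun m => ?_, fun m => ?_, fun m m' => ?_, fun m m' => ?_⟩
  · refine le_trans ?_ (le_self_add.trans le_self_add)
    exact Finset.single_le_sum (f := fun m => weakNorm (dirsXV m) (fun g => eLpNorm g 1 volume) u)
      (fun _ _ => zero_le) (Finset.mem_univ m)
  · refine le_trans ?_ (le_add_self.trans le_self_add)
    exact Finset.single_le_sum (f := fun m => weakNorm (dirsXV m) (fun g => eLpNorm g ∞ volume) u)
      (fun _ _ => zero_le) (Finset.mem_univ m)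
  · refine le_trans ?_ (le_self_add.trans le_add_self)
    refine le_trans ?_ (Finset.single_le_sum
      (f := fun m => ∑ m' : Option (Fin 3), weakNorm (dirsX m ++ dirsV m') (normLxLv 1 ∞) u)
      (fun _ _ => zero_le) (Finset.mem_univ m))
    exact Finset.single_le_sum (f := fun m' => weakNorm (dirsX m ++ dirsV m') (normLxLv 1 ∞) u)
      (fun _ _ => zero_le) (Finset.mem_univ m')
  · refine le_trans ?_ (le_add_self.trans le_add_self)
    refine le_trans ?_ (Finset.single_le_sum
      (f := fun m => ∑ m' : Option (Fin 3), weakNorm (dirsV m ++ dirsX m') (normLvLx 1 ∞) u)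
      (fun _ _ => zero_le) (Finset.mem_univ m))
    exact Finset.single_le_sum (f := fun m' => weakNorm (dirsV m ++ dirsX m') (normLvLx 1 ∞) u)
      (fun _ _ => zero_le) (Finset.mem_univ m')

/-- The derivative of a mollification is the mollification of a weak derivative, which does not
increase the mixed norm. The constant is six directions times the factor `2` of
`exists_isWeakDeriv`. -/
lemma lintegral_iSup_fderiv_mollify_le {u : Phase → ℝ} {g : Fin 3 ⊕ Fin 3 → Phase → ℝ}
    (hg : ∀ d, IsWeakDeriv [dir d] u (g d)) {η ε : ℝ} (hε : 0 < ε)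
    (hN : ∀ d, normLxLv 1 ∞ (g d) ≤ ENNReal.ofReal (2 * η)) :
    ∫⁻ x : R3, ⨆ v : R3, ‖fderiv ℝ (mollify ε u) (x, v)‖ₑ ≤ ENNReal.ofReal (12 * η) := by
  calc ∫⁻ x : R3, ⨆ v : R3, ‖fderiv ℝ (mollify ε u) (x, v)‖ₑ
      ≤ ∫⁻ x : R3, ∑ d, ⨆ v : R3, ‖mollify ε (g d) (x, v)‖ₑ := by
        refine lintegral_mono fun x => iSup_le fun v => (enorm_le_sum_dir _).trans ?_
        refine Finset.sum_le_sum fun d _ => ?_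
        rw [fderiv_mollify hε (hg d)]
        exact le_iSup (fun v => ‖mollify ε (g d) (x, v)‖ₑ) v
    _ = ∑ d, ∫⁻ x : R3, ⨆ v : R3, ‖mollify ε (g d) (x, v)‖ₑ :=
        lintegral_finsetSum _ fun d _ => measurable_iSup_slice (continuous_mollify hε (hg d).2.1)
    _ ≤ ∑ _d : Fin 3 ⊕ Fin 3, ENNReal.ofReal (2 * η) := by
        refine Finset.sum_le_sum fun d _ => (lintegral_iSup_mollify_le
          (hg d).2.1.aestronglyMeasurable (contDiff_mollifier ε).continuous.measurable
          (lintegral_enorm_mollifier hε)).trans (hN d)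
    _ = ENNReal.ofReal (12 * η) := by
        rw [Finset.sum_const, nsmul_eq_mul, ← ENNReal.ofReal_natCast, ← ENNReal.ofReal_mul (by simp)]
        congr 1
        simp
        ring

lemma lintegral_iSup_fderiv_mollify_le' {u : Phase → ℝ} {g : Fin 3 ⊕ Fin 3 → Phase → ℝ}
    (hg : ∀ d, IsWeakDeriv [dir d] u (g d)) {η ε : ℝ} (hε : 0 < ε)
    (hN : ∀ d, normLvLx 1 ∞ (g d) ≤ ENNReal.ofReal (2 * η)) :
    ∫⁻ v : R3, ⨆ x : R3, ‖fderiv ℝ (mollify ε u) (x, v)‖ₑ ≤ ENNReal.ofReal (12 * η) := by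
  calc ∫⁻ v : R3, ⨆ x : R3, ‖fderiv ℝ (mollify ε u) (x, v)‖ₑ
      ≤ ∫⁻ v : R3, ∑ d, ⨆ x : R3, ‖mollify ε (g d) (x, v)‖ₑ := by
        refine lintegral_mono fun v => iSup_le fun x => (enorm_le_sum_dir _).trans ?_
        refine Finset.sum_le_sum fun d _ => ?_
        rw [fderiv_mollify hε (hg d)]
        exact le_iSup (fun x => ‖mollify ε (g d) (x, v)‖ₑ) x
    _ = ∑ d, ∫⁻ v : R3, ⨆ x : R3, ‖mollify ε (g d) (x, v)‖ₑ :=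
        lintegral_finsetSum _ fun d _ => measurable_iSup_slice' (continuous_mollify hε (hg d).2.1)
    _ ≤ ∑ _d : Fin 3 ⊕ Fin 3, ENNReal.ofReal (2 * η) := by
        refine Finset.sum_le_sum fun d _ => (lintegral_iSup_mollify_le'
          (hg d).2.1.aestronglyMeasurable (contDiff_mollifier ε).continuous.measurable
          (lintegral_enorm_mollifier hε)).trans (hN d)
    _ = ENNReal.ofReal (12 * η) := by
        rw [Finset.sum_const, nsmul_eq_mul, ← ENNReal.ofReal_natCast, ← ENNReal.ofReal_mul (by simp)]
        congr 1
        simp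
        ring

lemma lipschitzWith_mollify {u : Phase → ℝ} {g : Fin 3 ⊕ Fin 3 → Phase → ℝ}
    (hg : ∀ d, IsWeakDeriv [dir d] u (g d)) {η ε : ℝ} (hε : 0 < ε)
    (hN : ∀ d, eLpNorm (g d) ∞ volume ≤ ENNReal.ofReal (2 * η)) :
    LipschitzWith (12 * η).toNNReal (mollify ε u) := by
  have hu : LocallyIntegrable u := (hg (Sum.inl 0)).1
  refine lipschitzWith_of_nnnorm_fderiv_le
    (contDiff_mollify hε hu).differentiable_one fun w => ?_
  have h1 : ‖fderiv ℝ (mollify ε u) w‖ₑ ≤ ENNReal.ofReal (12 * η) := by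
    refine (enorm_le_sum_dir _).trans ?_
    calc ∑ d, ‖fderiv ℝ (mollify ε u) w (dir d)‖ₑ ≤ ∑ _d : Fin 3 ⊕ Fin 3, ENNReal.ofReal (2 * η) := by
          refine Finset.sum_le_sum fun d _ => ?_
          rw [fderiv_mollify hε (hg d)]
          exact (norm_mollify_le hε w).trans (hN d)
      _ = ENNReal.ofReal (12 * η) := by
          rw [Finset.sum_const, nsmul_eq_mul, ← ENNReal.ofReal_natCast,
            ← ENNReal.ofReal_mul (by simp)]
          congr 1
          simp
          ring
  rw [enorm_eq_nnnorm, ENNReal.ofReal, ENNReal.coe_le_coe] at h1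
  exact h1

lemma integral_mollifier_sub {ε : ℝ} (hε : 0 < ε) (w : Phase) : ∫ z, mollifier ε (w - z) = 1 := by
  rw [integral_sub_left_eq_self (fun z => mollifier ε z), integral_mollifier hε]

lemma mollify_sub {ε : ℝ} (hε : 0 < ε) {u : Phase → ℝ} (hu : LocallyIntegrable u) (w : Phase)
    (c : ℝ) : mollify ε u w - c = ∫ z, mollifier ε (w - z) * (u z - c) := by
  have hc : HasCompactSupport fun z => mollifier ε (w - z) :=
    (hasCompactSupport_mollifier hε).comp_homeomorph (Homeomorph.subLeft w)
  have hcont : Continuous fun z => mollifier ε (w - z) :=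
    (contDiff_mollifier ε).continuous.comp (continuous_const.sub continuous_id)
  have i1 : Integrable fun z => mollifier ε (w - z) * u z := by
    simpa using hu.integrable_smul_left_of_hasCompactSupport hcont hc
  have i2 : Integrable fun z => mollifier ε (w - z) * c :=
    (hcont.integrable_of_hasCompactSupport hc).mul_const c
  simp only [mul_sub]
  rw [integral_sub i1 i2, integral_mul_const, integral_mollifier_sub hε, one_mul]
  rfl

lemma ae_tendsto_mollify {u : Phase → ℝ} (hu : LocallyIntegrable u) :
    ∀ᵐ w, Tendsto (fun n : ℕ => mollify (1 / ((n : ℝ) + 1)) u w) atTop (𝓝 (u w)) := by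
  obtain ⟨A, hA, hA2⟩ := exists_mollifier_bound
  filter_upwards [ae_tendsto_integral_kernel hu] with w hw
  have hpos : ∀ n : ℕ, (0 : ℝ) < 1 / ((n : ℝ) + 1) := fun n => by positivity
  have := hw (fun n => 1 / ((n : ℝ) + 1)) (fun n z => mollifier (1 / ((n : ℝ) + 1)) (w - z)) A hpos
    tendsto_one_div_add_atTop_nhds_zero_nat (fun n z => (hA2 _ (hpos n) _).1)
    (fun n z hz => mollifier_eq_zero (hpos n) hz)
  simp only [← mollify_sub (hpos _) hu w (u w)] at this
  simpa using this.add_const (u w)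

lemma abs_mollify_sub_le {F : Phase → ℝ} {L : ℝ≥0} (hF : LipschitzWith L F) {ε : ℝ} (hε : 0 < ε)
    (w : Phase) : |mollify ε F w - F w| ≤ L * ε := by
  rw [mollify_sub hε hF.continuous.locallyIntegrable w (F w), ← Real.norm_eq_abs]
  have hcont : Continuous fun z => mollifier ε (w - z) :=
    (contDiff_mollifier ε).continuous.comp (continuous_const.sub continuous_id)
  have hi : Integrable fun z => mollifier ε (w - z) :=
    hcont.integrable_of_hasCompactSupport
      ((hasCompactSupport_mollifier hε).comp_homeomorph (Homeomorph.subLeft w))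
  calc ‖∫ z, mollifier ε (w - z) * (F z - F w)‖ ≤ ∫ z, mollifier ε (w - z) * (L * ε) := by
        refine norm_integral_le_of_norm_le (hi.mul_const _) (Eventually.of_forall fun z => ?_)
        rw [norm_mul, Real.norm_of_nonneg (mollifier_nonneg hε _)]
        rcases le_or_gt ‖w - z‖ ε with h | h
        · refine mul_le_mul_of_nonneg_left ?_ (mollifier_nonneg hε _)
          have := hF.dist_le_mul z w
          rw [dist_eq_norm, dist_eq_norm, norm_sub_rev z w] at this
          exact this.trans (by gcongr)
        · simp [mollifier_eq_zero hε h]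
    _ = L * ε := by rw [integral_mul_const, integral_mollifier_sub hε, one_mul]

/-- Only derivatives of total order at most one are extracted from the data norm. Weak derivatives
are chosen separately for each of the three norms, and each family is used only with its own norm,
so their agreement is never needed. -/
theorem exists_isData {f₀ : Phase → ℝ} (h0 : ∀ᵐ z, 0 ≤ f₀ z) {η : ℝ} (hη : 0 < η)
    (h : dataNorm f₀ ≤ ENNReal.ofReal η) :
    ∃ F L, f₀ =ᵐ[volume] F ∧ IsData F L (12 * η) := by
  obtain ⟨w1, w2, w3, w4⟩ := weakNorm_le_dataNorm f₀
  obtain ⟨a, ha, haN⟩ := exists_isWeakDeriv hη ((w1 none).trans h)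
  obtain ⟨b, hb, hbN⟩ := exists_isWeakDeriv hη ((w3 none none).trans h)
  obtain ⟨c, hc, hcN⟩ := exists_isWeakDeriv hη ((w4 none none).trans h)
  have hinf : ∀ d, ∃ g, IsWeakDeriv [dir d] f₀ g ∧ eLpNorm g ∞ volume ≤ ENNReal.ofReal (2 * η) := by
    rintro (i | i)
    · exact exists_isWeakDeriv hη ((w2 (some (Sum.inl i))).trans h)
    · exact exists_isWeakDeriv hη ((w2 (some (Sum.inr i))).trans h)
  have hxv : ∀ d, ∃ g, IsWeakDeriv [dir d] f₀ g ∧ normLxLv 1 ∞ g ≤ ENNReal.ofReal (2 * η) := by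
    rintro (i | i)
    · exact exists_isWeakDeriv hη ((w3 (some i) none).trans h)
    · exact exists_isWeakDeriv hη ((w3 none (some i)).trans h)
  have hvx : ∀ d, ∃ g, IsWeakDeriv [dir d] f₀ g ∧ normLvLx 1 ∞ g ≤ ENNReal.ofReal (2 * η) := by
    rintro (i | i)
    · exact exists_isWeakDeriv hη ((w4 none (some i)).trans h)
    · exact exists_isWeakDeriv hη ((w4 (some i) none).trans h)
  choose p hp hpN using hinf
  choose q hq hqN using hxv
  choose r hr hrN using hvx
  have hu : LocallyIntegrable f₀ := ha.1
  set L : ℝ≥0 := (12 * η).toNNReal with hL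
  obtain ⟨F1, hF1, hF1e⟩ : ∃ F1, LipschitzWith L F1 ∧ f₀ =ᵐ[volume] F1 := by
    -- The mollifications are uniformly Lipschitz, so `f₀` is Lipschitz on the set where they
    -- converge to it. That set has full measure, and the restriction extends to a Lipschitz
    -- function on the whole space; the negative part is cut off afterwards.
    let s : Set Phase :=
      {w | Tendsto (fun n : ℕ => mollify (1 / ((n : ℝ) + 1)) f₀ w) atTop (𝓝 (f₀ w))}
    have hs : LipschitzOnWith L f₀ s := by
      refine LipschitzOnWith.of_dist_le_mul fun x hx y hy => ?_
      refine le_of_tendsto (hx.dist hy) (Eventually.of_forall fun n => ?_)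
      exact (lipschitzWith_mollify hp (by positivity) hpN).dist_le_mul x y
    obtain ⟨F1, h1, h2⟩ := hs.extend_real
    exact ⟨F1, h1, (ae_tendsto_mollify hu).mono fun w hw => h2 hw⟩
  have hFe : f₀ =ᵐ[volume] fun z => max (F1 z) 0 := by
    filter_upwards [hF1e, h0] with z hz h0z
    rw [← hz, max_eq_left h0z]
  have hF : LipschitzWith L fun z => max (F1 z) 0 := hF1.max_const 0
  refine ⟨fun z => max (F1 z) 0, L, hFe, fun z => le_max_right _ _, hF, ?_, ?_, ?_, fun ε hε => ?_⟩
  · rw [← eLpNorm_one_eq_lintegral_enorm, ← eLpNorm_congr_ae hFe, eLpNorm_congr_ae ha.ae_eq]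
    exact haN.trans (ENNReal.ofReal_le_ofReal (by linarith))
  · have e1 := normLxLv_one_top fun z => max (F1 z) 0
    have e2 : ∀ x : R3, eLpNorm (fun v : R3 => max (F1 (x, v)) 0) ∞ volume =
        ⨆ v : R3, ‖max (F1 (x, v)) 0‖ₑ := fun x =>
      eLpNorm_top_of_continuous (hF.continuous.comp (by fun_prop : Continuous fun v : R3 => (x, v)))
    simp only [e2] at e1
    rw [← e1, ← normLxLv_congr hFe, normLxLv_congr hb.ae_eq]
    exact hbN.trans (ENNReal.ofReal_le_ofReal (by linarith))
  · have hs : MeasurePreserving (Prod.swap : Phase → Phase) volume volume :=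
      Measure.measurePreserving_swap
    have e1 := normLxLv_one_top fun z => max (F1 z.swap) 0
    have e2 : ∀ v : R3, eLpNorm (fun x : R3 => max (F1 (x, v)) 0) ∞ volume =
        ⨆ x : R3, ‖max (F1 (x, v)) 0‖ₑ := fun v =>
      eLpNorm_top_of_continuous (hF.continuous.comp (by fun_prop : Continuous fun x : R3 => (x, v)))
    simp only [Prod.swap_prod_mk, e2] at e1
    rw [← e1]
    have e3 : (fun z : Phase => max (F1 z.swap) 0) =ᵐ[volume] fun z => c z.swap :=
      hs.quasiMeasurePreserving.ae_eq (hFe.symm.trans hc.ae_eq)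
    rw [normLxLv_congr e3, ← normLvLx_eq]
    exact hcN.trans (ENNReal.ofReal_le_ofReal (by linarith))
  · have hδ : 0 < ε / (L + 1) := by positivity
    refine ⟨mollify (ε / (L + 1)) f₀, contDiff_mollify hδ hu, fun z => ?_,
      lintegral_iSup_fderiv_mollify_le hq hδ hqN, lintegral_iSup_fderiv_mollify_le' hr hδ hrN⟩
    have e1 : mollify (ε / (L + 1)) f₀ z = mollify (ε / (L + 1)) (fun z => max (F1 z) 0) z :=
      integral_congr_ae (hFe.mono fun w hw => by simp only [hw])
    rw [e1]
    refine (abs_mollify_sub_le hF hδ z).trans ?_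
    rw [mul_div_assoc', div_le_iff₀ (by positivity)]
    nlinarith

end

section

/-! ### Bounds for the force field of a measure with bounded density -/

lemma field_map {α lam : ℝ} {Z : Type*} [MeasurableSpace Z] {μ : Measure Z} {X : Z → R3}
    (hX : Measurable X) (x : R3) :
    field α lam (μ.map X) x = -∫ z, kernel α lam (x - X z) ∂μ := by
  rw [field, integral_map hX.aemeasurable]
  exact ((measurable_kernel α lam).comp (measurable_const.sub measurable_id)).aestronglyMeasurable

lemma exists_riesz_bound {q : ℝ} (hq0 : 0 ≤ q) (hq3 : q < 3) :
    ∃ c : ℝ, 0 ≤ c ∧ ∀ (ν : Measure R3) (D M : ℝ), 0 ≤ D → 0 ≤ M → ν ≤ ENNReal.ofReal D • volume →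
      ν univ ≤ ENNReal.ofReal M → ∀ R : ℝ, 0 < R → ∀ x : R3,
        ∫⁻ y, riesz q (x - y) ∂ν ≤ ENNReal.ofReal (c * (D * R ^ (3 - q) + M * R ^ (-q))) := by
  obtain ⟨c, hc, h⟩ := exists_lintegral_riesz_le hq0 hq3
  refine ⟨max c 1, by positivity, fun ν D M hD hM hν hνM R hR x => (h ν D hD hν R hR x).trans ?_⟩
  have hRq : 0 ≤ R ^ (-q) := by positivity
  have hRq' : 0 ≤ R ^ (3 - q) := by positivity
  calc _ ≤ ENNReal.ofReal (D * c * R ^ (3 - q)) + ENNReal.ofReal (R ^ (-q)) * ENNReal.ofReal M := by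
        gcongr
    _ = ENNReal.ofReal (D * c * R ^ (3 - q) + R ^ (-q) * M) := by
        rw [← ENNReal.ofReal_mul hRq, ← ENNReal.ofReal_add (by positivity) (by positivity)]
    _ ≤ _ := by
        refine ENNReal.ofReal_le_ofReal ?_
        have h1 : D * c * R ^ (3 - q) ≤ max c 1 * (D * R ^ (3 - q)) := by
          rw [mul_comm D c, mul_assoc]
          gcongr
          exact le_max_left _ _
        have h2 : R ^ (-q) * M ≤ max c 1 * (M * R ^ (-q)) := by
          rw [mul_comm]
          exact le_mul_of_one_le_left (by positivity) (le_max_right _ _)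
        linarith

lemma measurable_riesz_sub (q : ℝ) (x : R3) : Measurable fun y => riesz q (x - y) :=
  (measurable_riesz q).comp (measurable_const.sub measurable_id)

lemma integrable_kernel_comp {α lam : ℝ} (hα0 : 0 < α) (hα1 : α < 1) {Z : Type*}
    [MeasurableSpace Z] {μ : Measure Z} {X : Z → R3} (hX : Measurable X) {D M : ℝ} (hD : 0 ≤ D)
    (hM : 0 ≤ M) (hν : μ.map X ≤ ENNReal.ofReal D • volume) (hμ : μ univ ≤ ENNReal.ofReal M)
    (x : R3) : Integrable (fun z => kernel α lam (x - X z)) μ := by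
  obtain ⟨C, hC⟩ := exists_homLip_kernel α lam hα0
  obtain ⟨c, -, h⟩ := exists_riesz_bound (q := 1 + α) (by linarith) (by linarith)
  have h1 := h (μ.map X) D M hD hM hν (by rwa [Measure.map_apply hX .univ]) 1 one_pos x
  rw [lintegral_map (measurable_riesz_sub _ x) hX] at h1
  exact hC.integrable_comp (kernel_zero α lam) (measurable_kernel α lam)
    (measurable_const.sub hX).aemeasurable h1

/-- In the second estimate the same source measure is carried by two different maps and the field is
evaluated at two different points. It thereby serves as the spatial Lipschitz bound, as the
contraction estimate for the flow and as the stability estimate for uniqueness. -/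
lemma exists_field_bounds (α lam : ℝ) (hα0 : 0 < α) (hα1 : α < 1) :
    ∃ C : ℝ, 0 ≤ C ∧ ∀ (D M : ℝ), 0 ≤ D → 0 ≤ M → ∀ R : ℝ, 0 < R →
      (∀ ν : Measure R3, ν ≤ ENNReal.ofReal D • volume → ν univ ≤ ENNReal.ofReal M →
        ∀ x, ‖field α lam ν x‖ ≤ C * (D * R ^ (2 - α) + M * R ^ (-(1 + α)))) ∧
      (∀ (Z : Type) [MeasurableSpace Z] (μ : Measure Z), μ univ ≤ ENNReal.ofReal M →
        ∀ X₁ X₂ : Z → R3, Measurable X₁ → Measurable X₂ → μ.map X₁ ≤ ENNReal.ofReal D • volume →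
        μ.map X₂ ≤ ENNReal.ofReal D • volume → ∀ (x₁ x₂ : R3) (d : ℝ), 0 ≤ d →
        (∀ z, ‖(x₁ - X₁ z) - (x₂ - X₂ z)‖ ≤ d) →
        ‖field α lam (μ.map X₁) x₁ - field α lam (μ.map X₂) x₂‖
          ≤ C * d * (D * R ^ (1 - α) + M * R ^ (-(2 + α)))) := by
  obtain ⟨C, hC⟩ := exists_homLip_kernel α lam hα0
  have hC0 := hC.nonneg
  obtain ⟨c, hc, h⟩ := exists_riesz_bound (q := 1 + α) (by linarith) (by linarith)
  obtain ⟨c', hc', h'⟩ := exists_riesz_bound (q := 2 + α) (by linarith) (by linarith)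
  refine ⟨C * c + 2 * (C * c'), by positivity, fun D M hD hM R hR => ⟨fun ν hν hνM x => ?_, ?_⟩⟩
  · have h1 := h ν D M hD hM hν hνM R hR x
    rw [show 3 - (1 + α) = 2 - α by ring] at h1
    have hS : 0 ≤ D * R ^ (2 - α) + M * R ^ (-(1 + α)) := by positivity
    have := hC.norm_integral_comp_le (kernel_zero α lam) (mul_nonneg hc hS) h1
    rw [field, norm_neg]
    refine this.trans ?_
    rw [← mul_assoc]
    gcongr
    nlinarith [mul_nonneg hC0 hc']
  · intro Z _ μ hμ X₁ X₂ hX₁ hX₂ hν₁ hν₂ x₁ x₂ d hd hdist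
    have hS : 0 ≤ D * R ^ (1 - α) + M * R ^ (-(2 + α)) := by positivity
    have hb : ∀ (X : Z → R3) (_ : Measurable X) (_ : μ.map X ≤ ENNReal.ofReal D • volume) (x : R3),
        ∫⁻ z, riesz (1 + α + 1) (x - X z) ∂μ ≤
          ENNReal.ofReal (c' * (D * R ^ (1 - α) + M * R ^ (-(2 + α)))) := by
      intro X hX hν x
      have h1 := h' (μ.map X) D M hD hM hν (by rwa [Measure.map_apply hX .univ]) R hR x
      rw [lintegral_map (measurable_riesz_sub _ x) hX,
        show 3 - (2 + α) = 1 - α by ring] at h1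
      rwa [show 1 + α + 1 = 2 + α by ring]
    rw [field_map hX₁, field_map hX₂, neg_sub_neg, norm_sub_rev]
    refine (hC.norm_integral_sub_le (kernel_zero α lam)
      (integrable_kernel_comp hα0 hα1 hX₁ hD hM hν₁ hμ x₁)
      (integrable_kernel_comp hα0 hα1 hX₂ hD hM hν₂ hμ x₂) hd hdist (mul_nonneg hc' hS)
      (mul_nonneg hc' hS) (measurable_const.sub hX₁).aemeasurable (hb X₁ hX₁ hν₁ x₁)
      (hb X₂ hX₂ hν₂ x₂)).trans ?_
    have h3 := mul_nonneg (mul_nonneg (mul_nonneg hC0 hc) hd) hS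
    nlinarith

lemma isForce_field {α lam : ℝ} (hα0 : 0 < α) (hα1 : α < 1) {ν : ℝ → Measure R3} {D M : ℝ}
    (hD : 0 ≤ D) (hM0 : 0 ≤ M) (hν : ∀ t, ν t ≤ ENNReal.ofReal D • volume)
    (hM : ∀ t, ν t univ ≤ ENNReal.ofReal M)
    (hw : ∀ φ : R3 → R3, Continuous φ → (∃ B, ∀ y, ‖φ y‖ ≤ B) →
      Continuous fun t => ∫ y, φ y ∂ν t) :
    ∃ B K, IsForce (fun t => field α lam (ν t)) B K := by
  obtain ⟨C, hC, h⟩ := exists_field_bounds α lam hα0 hα1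
  obtain ⟨h1, h2⟩ := h D M hD hM0 1 one_pos
  simp only [Real.one_rpow, mul_one] at h1 h2
  have hlip : ∀ t, LipschitzWith (C * (D + M)).toNNReal (field α lam (ν t)) := fun t => by
    refine LipschitzWith.of_dist_le_mul fun x y => ?_
    rw [dist_eq_norm, dist_eq_norm, Real.coe_toNNReal _ (by positivity)]
    have := h2 R3 (ν t) (hM t) id id measurable_id measurable_id (by simpa using hν t)
      (by simpa using hν t) x y ‖x - y‖ (norm_nonneg _) (fun z => by simp)
    simp only [Measure.map_id] at this
    linarith
  refine ⟨(C * (D + M)).toNNReal, (C * (D + M)).toNNReal, ?_, fun t x => ?_, hlip⟩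
  · refine (continuous_prod_of_continuous_lipschitzWith' _ _ hlip fun x => ?_)
    exact continuous_field_of_weak hα0 hα1 hD hν hM hw x
  · rw [Real.coe_toNNReal _ (by positivity)]
    exact h1 (ν t) (hν t) (hM t) x

lemma continuous_integral_map {Z : Type*} [MeasurableSpace Z] {μ : Measure Z} [IsFiniteMeasure μ]
    {X : ℝ → Z → R3} (hX : ∀ t, Measurable (X t)) (hXt : ∀ z, Continuous fun t => X t z)
    {φ : R3 → R3} (hφ : Continuous φ) (hB : ∃ B, ∀ y, ‖φ y‖ ≤ B) :
    Continuous fun t => ∫ y, φ y ∂(μ.map (X t)) := by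
  obtain ⟨B, hB⟩ := hB
  have e1 : ∀ t, ∫ y, φ y ∂(μ.map (X t)) = ∫ z, φ (X t z) ∂μ := fun t =>
    integral_map (hX t).aemeasurable hφ.aestronglyMeasurable
  simp only [e1]
  refine continuous_of_dominated (bound := fun _ => B)
    (fun t => (hφ.measurable.comp (hX t)).aestronglyMeasurable)
    (fun t => Eventually.of_forall fun z => hB _) (integrable_const B)
    (Eventually.of_forall fun z => hφ.comp (hXt z))

/-! ### The measure of the initial data and its images -/

/-- The measure with density `F`. -/
def dataMeasure (F : Phase → ℝ) : Measure Phase := volume.withDensity fun z => ‖F z‖ₑ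

variable {F : Phase → ℝ} {L : ℝ≥0} {D : ℝ}

lemma IsData.dataMeasure_univ_le (hF : IsData F L D) :
    dataMeasure F univ ≤ ENNReal.ofReal D := by
  rw [dataMeasure, withDensity_apply _ .univ, setLIntegral_univ]
  exact hF.mass

lemma IsData.isFiniteMeasure (hF : IsData F L D) : IsFiniteMeasure (dataMeasure F) :=
  ⟨hF.dataMeasure_univ_le.trans_lt ENNReal.ofReal_lt_top⟩

/-- For fixed `x` the data are replaced by their supremum over `v`, and the volume of the preimage
under `v ↦ X (x, v)` is controlled by the antilipschitz constant; integrating in `x` leaves the norm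
of `L¹_x L^∞_v`. The companion lemma exchanges the two variables. -/
lemma IsData.map_le_of_velocity (hF : IsData F L D) {X : Phase → R3} (hX : Continuous X) {c : ℝ≥0}
    (h : ∀ x : R3, AntilipschitzWith c fun v : R3 => X (x, v)) :
    (dataMeasure F).map X ≤ (ENNReal.ofReal D * (c : ℝ≥0∞) ^ 3) • volume := by
  refine Measure.le_iff.2 fun s hs => ?_
  have hs' : MeasurableSet (X ⁻¹' s) := hX.measurable hs
  have hFm : Measurable fun z => ‖F z‖ₑ := hF.lip.continuous.enorm.measurable
  rw [Measure.map_apply hX.measurable hs, dataMeasure, withDensity_apply _ hs',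
    ← lintegral_indicator hs', Measure.volume_eq_prod,
    lintegral_prod _ (hFm.indicator hs').aemeasurable, Measure.smul_apply, smul_eq_mul]
  calc ∫⁻ x : R3, ∫⁻ v : R3, (X ⁻¹' s).indicator (fun z => ‖F z‖ₑ) (x, v)
      ≤ ∫⁻ x : R3, (⨆ v : R3, ‖F (x, v)‖ₑ) * ((c : ℝ≥0∞) ^ 3 * volume s) := by
        refine lintegral_mono fun x => ?_
        have hsx : MeasurableSet ((fun v : R3 => X (x, v)) ⁻¹' s) :=
          (hX.comp (by fun_prop : Continuous fun v : R3 => (x, v))).measurable hs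
        calc ∫⁻ v : R3, (X ⁻¹' s).indicator (fun z => ‖F z‖ₑ) (x, v)
            ≤ ∫⁻ v : R3, ((fun v : R3 => X (x, v)) ⁻¹' s).indicator
                (fun _ => ⨆ v : R3, ‖F (x, v)‖ₑ) v := by
              refine lintegral_mono fun v => ?_
              by_cases hv : X (x, v) ∈ s
              · simp only [indicator, mem_preimage, hv, if_true]
                exact le_iSup (fun v => ‖F (x, v)‖ₑ) v
              · simp [indicator, hv]
          _ = (⨆ v : R3, ‖F (x, v)‖ₑ) * volume ((fun v : R3 => X (x, v)) ⁻¹' s) := by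
              rw [lintegral_indicator hsx, setLIntegral_const]
          _ ≤ _ := by
              gcongr
              have := measure_preimage_le_of_antilipschitz volume (h x) s
              rwa [finrank_R3] at this
    _ = (∫⁻ x : R3, ⨆ v : R3, ‖F (x, v)‖ₑ) * ((c : ℝ≥0∞) ^ 3 * volume s) :=
        lintegral_mul_const _ (measurable_iSup_slice hF.lip.continuous)
    _ ≤ ENNReal.ofReal D * (c : ℝ≥0∞) ^ 3 * volume s := by
        rw [mul_assoc]
        gcongr
        exact hF.supV

lemma IsData.map_le_of_position (hF : IsData F L D) {X : Phase → R3} (hX : Continuous X) {c : ℝ≥0}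
    (h : ∀ v : R3, AntilipschitzWith c fun x : R3 => X (x, v)) :
    (dataMeasure F).map X ≤ (ENNReal.ofReal D * (c : ℝ≥0∞) ^ 3) • volume := by
  refine Measure.le_iff.2 fun s hs => ?_
  have hs' : MeasurableSet (X ⁻¹' s) := hX.measurable hs
  have hFm : Measurable fun z => ‖F z‖ₑ := hF.lip.continuous.enorm.measurable
  rw [Measure.map_apply hX.measurable hs, dataMeasure, withDensity_apply _ hs',
    ← lintegral_indicator hs', Measure.volume_eq_prod,
    lintegral_prod_symm _ (hFm.indicator hs').aemeasurable, Measure.smul_apply, smul_eq_mul]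
  calc ∫⁻ v : R3, ∫⁻ x : R3, (X ⁻¹' s).indicator (fun z => ‖F z‖ₑ) (x, v)
      ≤ ∫⁻ v : R3, (⨆ x : R3, ‖F (x, v)‖ₑ) * ((c : ℝ≥0∞) ^ 3 * volume s) := by
        refine lintegral_mono fun v => ?_
        have hsx : MeasurableSet ((fun x : R3 => X (x, v)) ⁻¹' s) :=
          (hX.comp (by fun_prop : Continuous fun x : R3 => (x, v))).measurable hs
        calc ∫⁻ x : R3, (X ⁻¹' s).indicator (fun z => ‖F z‖ₑ) (x, v)
            ≤ ∫⁻ x : R3, ((fun x : R3 => X (x, v)) ⁻¹' s).indicator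
                (fun _ => ⨆ x : R3, ‖F (x, v)‖ₑ) x := by
              refine lintegral_mono fun x => ?_
              by_cases hv : X (x, v) ∈ s
              · simp only [indicator, mem_preimage, hv, if_true]
                exact le_iSup (fun x => ‖F (x, v)‖ₑ) x
              · simp [indicator, hv]
          _ = (⨆ x : R3, ‖F (x, v)‖ₑ) * volume ((fun x : R3 => X (x, v)) ⁻¹' s) := by
              rw [lintegral_indicator hsx, setLIntegral_const]
          _ ≤ _ := by
              gcongr
              have := measure_preimage_le_of_antilipschitz volume (h v) s
              rwa [finrank_R3] at this
    _ = (∫⁻ v : R3, ⨆ x : R3, ‖F (x, v)‖ₑ) * ((c : ℝ≥0∞) ^ 3 * volume s) :=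
        lintegral_mul_const _ (measurable_iSup_slice' hF.lip.continuous)
    _ ≤ ENNReal.ofReal D * (c : ℝ≥0∞) ^ 3 * volume s := by
        rw [mul_assoc]
        gcongr
        exact hF.supX

/-- Dispersion: the density of the image of the data under a map which is close to the free flow. -/
lemma IsData.map_le (hF : IsData F L D) (hD : 0 ≤ D) {t : ℝ} (ht : 0 ≤ t) {X : Phase → R3}
    (hX : Continuous X)
    (h : ∀ z w, ‖(X z - z.1 - t • z.2) - (X w - w.1 - t • w.2)‖ ≤ 1 / 4 * t * ‖z - w‖) :
    (dataMeasure F).map X ≤ ENNReal.ofReal (19 * D * (1 + t) ^ (-3 : ℝ)) • volume := by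
  have e3 : (1 + t) ^ (-3 : ℝ) = ((1 + t) ^ 3)⁻¹ := by
    rw [Real.rpow_neg (by positivity)]
    norm_cast
  have hbound : ∀ c : ℝ≥0, (c : ℝ) ≤ 8 / 3 / (1 + t) →
      (ENNReal.ofReal D * (c : ℝ≥0∞) ^ 3) • (volume : Measure R3) ≤
        ENNReal.ofReal (19 * D * (1 + t) ^ (-3 : ℝ)) • volume := fun c hc => by
    have h1 : ENNReal.ofReal D * (c : ℝ≥0∞) ^ 3 ≤ ENNReal.ofReal (19 * D * (1 + t) ^ (-3 : ℝ)) := by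
      rw [← ENNReal.ofReal_coe_nnreal, ← ENNReal.ofReal_pow c.coe_nonneg, ← ENNReal.ofReal_mul hD]
      refine ENNReal.ofReal_le_ofReal ?_
      have h2 : (c : ℝ) ^ 3 ≤ (8 / 3 / (1 + t)) ^ 3 := by gcongr
      have h3 : (8 / 3 / (1 + t)) ^ 3 ≤ 19 * (1 + t) ^ (-3 : ℝ) := by
        rw [e3, div_pow, div_eq_mul_inv]
        gcongr
        norm_num
      calc D * (c : ℝ) ^ 3 ≤ D * (19 * (1 + t) ^ (-3 : ℝ)) := by
            gcongr; exact h2.trans h3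
        _ = _ := by ring
    exact Measure.le_iff.2 fun s _ => by
      simp only [Measure.smul_apply, smul_eq_mul]
      gcongr
  -- For `t ≤ 1` the map is close to the identity in `x`, for `t ≥ 1` close to multiplication by `t`
  -- in `v`; a quarter is lost, which gives the constants `4 / 3` and `4 / (3 * t)`. Both are at
  -- most `8 / 3 / (1 + t)`, and `(8 / 3) ^ 3 ≤ 19`.
  rcases le_total t 1 with h1 | h1
  · refine (hF.map_le_of_position hX (c := 4 / 3) fun v => ?_).trans (hbound _ ?_)
    · refine AntilipschitzWith.of_le_mul_dist fun x y => ?_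
      have h2 := h (x, v) (y, v)
      have e1 : X (x, v) - x - t • v - (X (y, v) - y - t • v) =
          (X (x, v) - X (y, v)) - (x - y) := by abel
      have e2 : ‖((x, v) : Phase) - (y, v)‖ = ‖x - y‖ := by simp [Prod.norm_def]
      simp only [e1, e2] at h2
      have h3 := norm_sub_norm_le (x - y) (X (x, v) - X (y, v))
      rw [norm_sub_rev (x - y) (X (x, v) - X (y, v))] at h3
      rw [dist_eq_norm, dist_eq_norm]
      have h4 : t * ‖x - y‖ ≤ 1 * ‖x - y‖ := by gcongr
      push_cast
      linarith
    · push_cast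
      rw [le_div_iff₀ (by positivity)]
      linarith
  · have htp : 0 < t := by linarith
    refine (hF.map_le_of_velocity hX (c := (4 / 3 / t).toNNReal) fun x => ?_).trans (hbound _ ?_)
    · refine AntilipschitzWith.of_le_mul_dist fun v w => ?_
      have h2 := h (x, v) (x, w)
      have e1 : X (x, v) - x - t • v - (X (x, w) - x - t • w) =
          (X (x, v) - X (x, w)) - t • (v - w) := by rw [smul_sub]; abel
      have e2 : ‖((x, v) : Phase) - (x, w)‖ = ‖v - w‖ := by simp [Prod.norm_def]
      simp only [e1, e2] at h2
      have h3 := norm_sub_norm_le (t • (v - w)) (X (x, v) - X (x, w))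
      rw [norm_sub_rev (t • (v - w)) (X (x, v) - X (x, w)), norm_smul, Real.norm_of_nonneg ht] at h3
      rw [dist_eq_norm, dist_eq_norm, Real.coe_toNNReal _ (by positivity), div_mul_eq_mul_div,
        le_div_iff₀ htp]
      nlinarith [norm_nonneg (v - w)]
    · rw [Real.coe_toNNReal _ (by positivity), div_le_div_iff₀ htp (by positivity)]
      linarith

end

section

/-! ### Global existence of the flow, by a contraction argument -/

/-- The bound is independent of `t`: forces which decay at this rate transfer only a bounded total
momentum. The factor `1 / α` is what the smallness of the data has to beat. -/
lemma integral_one_add_rpow_le {α t : ℝ} (hα : 0 < α) (ht : 0 ≤ t) :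
    ∫ s in (0 : ℝ)..t, (1 + s) ^ (-(1 + α)) ≤ 1 / α := by
  have h1 : ∀ s ∈ uIcc 0 t, HasDerivAt (fun s : ℝ => -(1 / α) * (1 + s) ^ (-α))
      ((1 + s) ^ (-(1 + α))) s := fun s hs => by
    rw [uIcc_of_le ht] at hs
    have h0 : 0 < 1 + s := by linarith [hs.1]
    have h2 := ((hasDerivAt_id s).const_add 1).rpow_const (p := -α) (Or.inl h0.ne')
    have h3 := h2.const_mul (-(1 / α))
    refine h3.congr_deriv ?_
    rw [show -α - 1 = -(1 + α) by ring]
    simp only [id]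
    field_simp
  have hc : ContinuousOn (fun s : ℝ => (1 + s) ^ (-(1 + α))) (uIcc 0 t) := by
    rw [uIcc_of_le ht]
    refine ContinuousOn.rpow_const (by fun_prop) fun s hs => Or.inl ?_
    linarith [hs.1]
  rw [intervalIntegral.integral_eq_sub_of_hasDerivAt h1 hc.intervalIntegrable]
  simp only [add_zero, Real.one_rpow, mul_one]
  have : 0 ≤ (1 / α) * (1 + t) ^ (-α) := by positivity
  linarith

lemma norm_integral_le_of_decay {α t c : ℝ} (hα : 0 < α) (ht : 0 ≤ t) (hc : 0 ≤ c) {g : ℝ → R3}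
    (h : ∀ s ∈ Icc 0 t, ‖g s‖ ≤ c * (1 + s) ^ (-(1 + α))) :
    ‖∫ s in (0 : ℝ)..t, g s‖ ≤ c / α := by
  have hcont : ContinuousOn (fun s : ℝ => c * (1 + s) ^ (-(1 + α))) (uIcc 0 t) := by
    rw [uIcc_of_le ht]
    refine continuousOn_const.mul (ContinuousOn.rpow_const (by fun_prop) fun s hs => Or.inl ?_)
    linarith [hs.1]
  have h1 := intervalIntegral.norm_integral_le_of_norm_le (μ := volume) (f := g) ht
    (Eventually.of_forall fun s hs => h s ⟨hs.1.le, hs.2⟩) hcont.intervalIntegrable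
  rw [intervalIntegral.integral_const_mul] at h1
  refine h1.trans ?_
  have := integral_one_add_rpow_le hα ht
  calc _ ≤ c * (1 / α) := by gcongr
    _ = c / α := by ring

lemma norm_integral_smul_le_of_decay {α t c : ℝ} (hα : 0 < α) (ht : 0 ≤ t) (hc : 0 ≤ c)
    {g : ℝ → R3} (h : ∀ s ∈ Icc 0 t, ‖g s‖ ≤ c * (1 + s) ^ (-(1 + α))) :
    ‖∫ s in (0 : ℝ)..t, (t - s) • g s‖ ≤ t * (c / α) := by
  have := norm_integral_le_of_decay (g := fun s => (t - s) • g s) hα ht (mul_nonneg ht hc)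
    fun s hs => by
      rw [norm_smul, Real.norm_of_nonneg (by linarith [hs.2]), mul_assoc]
      have h1 := h s hs
      have h2 : t - s ≤ t := by linarith [hs.1]
      gcongr
  rwa [mul_div_assoc] at this

open BoundedContinuousFunction

/-- The trajectory with relative displacement `U`. -/
def position (U : ℝ × Phase →ᵇ R3) (t : ℝ) (z : Phase) : R3 :=
  z.1 + max t 0 • z.2 + (1 + max t 0) • U (t, z)

/-- The displacements whose trajectories are close to free ones. -/
def displacements : Set (ℝ × Phase →ᵇ R3) :=
  {U | ∀ t z w, (1 + max t 0) * ‖U (t, z) - U (t, w)‖ ≤ 1 / 4 * max t 0 * ‖z - w‖}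

lemma isClosed_displacements : IsClosed displacements := by
  simp only [displacements, ofPred_forall]
  refine isClosed_iInter fun t => isClosed_iInter fun z => isClosed_iInter fun w => ?_
  have h1 : Continuous fun U : ℝ × Phase →ᵇ R3 => U (t, z) := continuous_eval_const _
  have h2 : Continuous fun U : ℝ × Phase →ᵇ R3 => U (t, w) := continuous_eval_const _
  exact isClosed_le (by fun_prop) continuous_const

lemma continuous_position (U : ℝ × Phase →ᵇ R3) :
    Continuous fun p : ℝ × Phase => position U p.1 p.2 := by
  have := U.continuous
  unfold position
  fun_prop

lemma continuous_position_left (U : ℝ × Phase →ᵇ R3) (z : Phase) :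
    Continuous fun t => position U t z :=
  (continuous_position U).comp (by fun_prop : Continuous fun t : ℝ => (t, z))

lemma continuous_position_right (U : ℝ × Phase →ᵇ R3) (t : ℝ) : Continuous (position U t) :=
  (continuous_position U).comp (by fun_prop : Continuous fun z : Phase => (t, z))

lemma norm_position_sub_le {U : ℝ × Phase →ᵇ R3} (hU : U ∈ displacements) (t : ℝ) (z w : Phase) :
    ‖position U t z - position U t w‖ ≤ 2 * (1 + max t 0) * ‖z - w‖ := by
  have h0 : 0 ≤ max t 0 := le_max_right _ _
  have h1 := hU t z w
  have e1 : position U t z - position U t w =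
      (z - w).1 + max t 0 • (z - w).2 + (1 + max t 0) • (U (t, z) - U (t, w)) := by
    simp only [position, Prod.fst_sub, Prod.snd_sub, smul_sub]; abel
  rw [e1]
  refine (norm_add₃_le).trans ?_
  rw [norm_smul, norm_smul, Real.norm_of_nonneg h0, Real.norm_of_nonneg (by linarith)]
  have h2 := norm_fst_le (z - w)
  have h3 : max t 0 * ‖(z - w).2‖ ≤ max t 0 * ‖z - w‖ := by gcongr; exact norm_snd_le (z - w)
  nlinarith [norm_nonneg (z - w), mul_nonneg h0 (norm_nonneg (z - w))]

lemma norm_position_sub_position_le (U U' : ℝ × Phase →ᵇ R3) (t : ℝ) (z w : Phase) :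
    ‖(position U t z - position U t w) - (position U' t z - position U' t w)‖
      ≤ 2 * (1 + max t 0) * dist U U' := by
  have h0 : 0 ≤ max t 0 := le_max_right _ _
  have e1 : (position U t z - position U t w) - (position U' t z - position U' t w) =
      (1 + max t 0) • ((U (t, z) - U' (t, z)) - (U (t, w) - U' (t, w))) := by
    simp only [position, smul_sub]; abel
  rw [e1, norm_smul, Real.norm_of_nonneg (by linarith)]
  have h1 := dist_coe_le_dist (f := U) (g := U') (t, z)
  have h2 := dist_coe_le_dist (f := U) (g := U') (t, w)
  rw [dist_eq_norm] at h1 h2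
  have h3 := norm_sub_le (U (t, z) - U' (t, z)) (U (t, w) - U' (t, w))
  nlinarith

/-- The force field generated by the trajectories with displacement `U`. -/
def displacementForce (α lam : ℝ) (F : Phase → ℝ) (U : ℝ × Phase →ᵇ R3) (t : ℝ) : R3 → R3 :=
  field α lam ((dataMeasure F).map (position U t))

variable {F : Phase → ℝ} {L : ℝ≥0} {D : ℝ}

lemma IsData.map_position_le (hF : IsData F L D) (hD : 0 ≤ D) {U : ℝ × Phase →ᵇ R3}
    (hU : U ∈ displacements) (t : ℝ) : (dataMeasure F).map (position U t) ≤
      ENNReal.ofReal (19 * D * (1 + max t 0) ^ (-3 : ℝ)) • volume := by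
  have h0 : 0 ≤ max t 0 := le_max_right _ _
  refine hF.map_le hD h0 (continuous_position_right U t) fun z w => ?_
  have e1 : position U t z - z.1 - max t 0 • z.2 - (position U t w - w.1 - max t 0 • w.2) =
      (1 + max t 0) • (U (t, z) - U (t, w)) := by simp only [position, smul_sub]; abel
  rw [e1, norm_smul, Real.norm_of_nonneg (by linarith)]
  exact hU t z w

/-- With density `19 * D * (1 + s)⁻³` and mass `D`, the choice of the radius `1 + s` in the
potential estimate gives the near and the far part the same decay rate. -/
lemma rpow_mul_decay {D s a b : ℝ} (hs : 0 ≤ s) (hab : -3 + a = b) :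
    19 * D * (1 + s) ^ (-3 : ℝ) * (1 + s) ^ a + D * (1 + s) ^ b = 20 * D * (1 + s) ^ b := by
  rw [mul_assoc (19 * D), ← Real.rpow_add (by linarith), hab]
  ring

lemma smul_measure_mono {Z : Type*} [MeasurableSpace Z] {μ : Measure Z} {a b : ℝ≥0∞} (h : a ≤ b) :
    a • μ ≤ b • μ :=
  Measure.le_iff.2 fun s _ => by
    simp only [Measure.smul_apply, smul_eq_mul]
    exact mul_le_mul' h le_rfl

/-- A flow whose force field is generated by its own density and which disperses like the free
flow. -/
structure IsDispersiveFlow (α lam : ℝ) (F : Phase → ℝ) (D κ : ℝ) (E : ℝ → R3 → R3)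
    (Z : ℝ → Phase → Phase) : Prop where
  flow : IsFlow E Z
  force : ∀ t, 0 ≤ t → E t = field α lam ((dataMeasure F).map fun z => (Z t z).1)
  density : ∀ t, 0 ≤ t → (dataMeasure F).map (fun z => (Z t z).1) ≤
    ENNReal.ofReal (19 * D * (1 + t) ^ (-3 : ℝ)) • volume
  bound : ∀ t, 0 ≤ t → ∀ x, ‖E t x‖ ≤ κ * (1 + t) ^ (-(1 + α))
  lip : ∀ t, 0 ≤ t → ∀ x y, ‖E t x - E t y‖ ≤ κ * (1 + t) ^ (-(2 + α)) * ‖x - y‖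

/-- Bounds for the forces generated by trajectories which are close to free ones. -/
structure ForceBounds (α lam : ℝ) (F : Phase → ℝ) (κ : ℝ) : Prop where
  bound : ∀ U ∈ displacements, ∀ t x, ‖displacementForce α lam F U t x‖ ≤
      κ * (1 + max t 0) ^ (-(1 + α))
  lip : ∀ U ∈ displacements, ∀ U' ∈ displacements, ∀ t x x' d, 0 ≤ d →
      (∀ z, ‖(x - position U t z) - (x' - position U' t z)‖ ≤ d) →
      ‖displacementForce α lam F U t x - displacementForce α lam F U' t x'‖ ≤
      κ * d * (1 + max t 0) ^ (-(2 + α))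
  isForce : ∀ U ∈ displacements, ∃ B K, IsForce (displacementForce α lam F U) B K

lemma exists_forceBounds (α lam : ℝ) (hα0 : 0 < α) (hα1 : α < 1) :
    ∃ C : ℝ, 0 ≤ C ∧ ∀ (F : Phase → ℝ) (L : ℝ≥0) (D : ℝ), 0 ≤ D → IsData F L D →
      ForceBounds α lam F (C * D) := by
  obtain ⟨C, hC, hfb⟩ := exists_field_bounds α lam hα0 hα1
  refine ⟨C * 20, by positivity, fun F L D hD hF => ?_⟩
  have hfin : IsFiniteMeasure (dataMeasure F) := hF.isFiniteMeasure
  have hpos : ∀ t : ℝ, 0 ≤ max t 0 := fun t => le_max_right _ _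
  have hDt : ∀ t : ℝ, 0 ≤ 19 * D * (1 + max t 0) ^ (-3 : ℝ) := fun t => by
    have := hpos t
    positivity
  refine ⟨fun U hU t x => ?_, fun U hU U' hU' t x x' d hd hdist => ?_, fun U hU => ?_⟩
  · have h := (hfb _ D (hDt t) hD (1 + max t 0) (by linarith [hpos t])).1 _
      (hF.map_position_le hD hU t) (by
        rw [Measure.map_apply (continuous_position_right U t).measurable .univ]
        exact hF.dataMeasure_univ_le) x
    rw [rpow_mul_decay (hpos t) (by ring)] at h
    exact h.trans (le_of_eq (by ring))
  · have h := (hfb _ D (hDt t) hD (1 + max t 0) (by linarith [hpos t])).2 Phase (dataMeasure F)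
      hF.dataMeasure_univ_le (position U t) (position U' t)
      (continuous_position_right U t).measurable (continuous_position_right U' t).measurable
      (hF.map_position_le hD hU t) (hF.map_position_le hD hU' t) x x' d hd hdist
    rw [rpow_mul_decay (hpos t) (by ring)] at h
    exact h.trans (le_of_eq (by ring))
  · refine isForce_field (D := 19 * D) (M := D) hα0 hα1 (by positivity) hD (fun t => ?_)
      (fun t => ?_) fun φ hφ hB => continuous_integral_map
        (fun t => (continuous_position_right U t).measurable) (continuous_position_left U) hφ hB
    · refine (hF.map_position_le hD hU t).trans ?_
      have h1 : (1 + max t 0) ^ (-3 : ℝ) ≤ 1 :=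
        Real.rpow_le_one_of_one_le_of_nonpos (by linarith [hpos t]) (by norm_num)
      have h2 : ENNReal.ofReal (19 * D * (1 + max t 0) ^ (-3 : ℝ)) ≤ ENNReal.ofReal (19 * D) :=
        ENNReal.ofReal_le_ofReal (mul_le_of_le_one_right (by positivity) h1)
      exact smul_measure_mono h2
    · rw [Measure.map_apply (continuous_position_right U t).measurable .univ]
      exact hF.dataMeasure_univ_le

lemma IsForce.continuous_comp {E : ℝ → R3 → R3} {B K : ℝ≥0} (hE : IsForce E B K) {Y : Type*}
    [TopologicalSpace Y] {τ : Y → ℝ} {X : Y → R3} (hτ : Continuous τ) (hX : Continuous X) :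
    Continuous fun y => E (τ y) (X y) :=
  hE.cont.comp (hτ.prodMk hX)

section Contraction

variable {α lam κ : ℝ} {U U' : ℝ × Phase →ᵇ R3}

lemma ForceBounds.continuous_force (h : ForceBounds α lam F κ) (hU : U ∈ displacements) :
    Continuous fun p : ℝ × Phase => displacementForce α lam F U p.1 (position U p.1 p.2) := by
  obtain ⟨B, K, hE⟩ := h.isForce U hU
  exact hE.continuous_comp continuous_fst (continuous_position U)

lemma ForceBounds.continuous_force_left (h : ForceBounds α lam F κ) (hU : U ∈ displacements)
    (z : Phase) : Continuous fun s => displacementForce α lam F U s (position U s z) := by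
  obtain ⟨B, K, hE⟩ := h.isForce U hU
  exact hE.continuous_comp continuous_id (continuous_position_left U z)

/-- The relative displacement of the trajectories in the force field generated by `U`. -/
def newDisplacement (α lam : ℝ) (F : Phase → ℝ) (U : ℝ × Phase →ᵇ R3) (p : ℝ × Phase) : R3 :=
  (1 + max p.1 0)⁻¹ • ∫ s in (0 : ℝ)..(max p.1 0),
      (max p.1 0 - s) • displacementForce α lam F U s (position U s p.2)

lemma ForceBounds.norm_newDisplacement_le (h : ForceBounds α lam F κ) (hα : 0 < α) (hκ : 0 ≤ κ)
    (hU : U ∈ displacements) (p : ℝ × Phase) : ‖newDisplacement α lam F U p‖ ≤ κ / α := by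
  have hp : 0 ≤ max p.1 0 := le_max_right _ _
  have h1 := norm_integral_smul_le_of_decay hα hp hκ
    (g := fun s => displacementForce α lam F U s (position U s p.2)) fun s hs => by
      have := h.bound U hU s (position U s p.2)
      rwa [max_eq_left hs.1] at this
  rw [newDisplacement, norm_smul, norm_inv, Real.norm_of_nonneg (by linarith), inv_mul_le_iff₀
    (by linarith)]
  refine h1.trans ?_
  have : 0 ≤ κ / α := by positivity
  nlinarith

lemma ForceBounds.continuous_newDisplacement (h : ForceBounds α lam F κ)
    (hU : U ∈ displacements) : Continuous (newDisplacement α lam F U) := by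
  have h1 : Continuous fun p : ℝ × Phase => ∫ s in (0 : ℝ)..(max p.1 0),
      (max p.1 0 - s) • displacementForce α lam F U s (position U s p.2) := by
    refine intervalIntegral.continuous_parametric_intervalIntegral_of_continuous
      (f := fun (p : ℝ × Phase) s =>
        (max p.1 0 - s) • displacementForce α lam F U s (position U s p.2)) ?_ (by fun_prop)
    have h2 := (h.continuous_force hU).comp
      (by fun_prop : Continuous fun q : (ℝ × Phase) × ℝ => (q.2, q.1.2))
    exact Continuous.smul (f := fun q : (ℝ × Phase) × ℝ => max q.1.1 0 - q.2) (by fun_prop) h2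
  have h3 : Continuous fun p : ℝ × Phase => (1 + max p.1 0)⁻¹ :=
    Continuous.inv₀ (by fun_prop) fun p => by
      have : 0 ≤ max p.1 0 := le_max_right _ _
      linarith
  exact h3.smul h1

/-- The factor `1 + max t 0` cancels the normalisation and leaves the double time integral of the
difference of the forces. The case `U = U'` shows that the new displacement is admissible, the case
`z = w` that the map contracts. -/
lemma ForceBounds.norm_newDisplacement_sub_le (h : ForceBounds α lam F κ) (hα : 0 < α)
    (hU : U ∈ displacements) (hU' : U' ∈ displacements) {t : ℝ} {z w : Phase} {c : ℝ} (hc : 0 ≤ c)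
    (hle : ∀ s ∈ Icc 0 (max t 0), ‖displacementForce α lam F U s (position U s z) -
        displacementForce α lam F U' s (position U' s w)‖ ≤ c * (1 + s) ^ (-(1 + α))) :
    (1 + max t 0) * ‖newDisplacement α lam F U (t, z) - newDisplacement α lam F U' (t, w)‖
      ≤ max t 0 * (c / α) := by
  have hp0 : 0 ≤ max t 0 := le_max_right _ _
  have h1 := norm_integral_smul_le_of_decay hα hp0 hc hle
  have i1 : IntervalIntegrable (fun s => (max t 0 - s) • displacementForce α lam F U s
      (position U s z)) volume 0 (max t 0) :=
    Continuous.intervalIntegrable (Continuous.smul (f := fun s => max t 0 - s) (by fun_prop)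
      (h.continuous_force_left hU z)) _ _
  have i2 : IntervalIntegrable (fun s => (max t 0 - s) • displacementForce α lam F U' s
      (position U' s w)) volume 0 (max t 0) :=
    Continuous.intervalIntegrable (Continuous.smul (f := fun s => max t 0 - s) (by fun_prop)
      (h.continuous_force_left hU' w)) _ _
  have hp : 0 < 1 + max t 0 := by linarith
  simp only [newDisplacement]
  rw [← smul_sub, ← intervalIntegral.integral_sub i1 i2, norm_smul, norm_inv,
    Real.norm_of_nonneg hp.le, mul_inv_cancel_left₀ hp.ne']
  simpa only [smul_sub] using h1

/-- Trajectories separate at most linearly in time, which costs one power against the Lipschitz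
constant of the force; the remaining rate is still integrable. -/
lemma one_add_mul_rpow {s : ℝ} (hs : 0 ≤ s) (α : ℝ) :
    (1 + s) * (1 + s) ^ (-(2 + α)) = (1 + s) ^ (-(1 + α)) := by
  nth_rw 1 [← Real.rpow_one (1 + s)]
  rw [← Real.rpow_add (by linarith)]
  congr 1
  ring

/-- Points at distance `d` are carried to points at distance at most `2 * (1 + s) * d`, so the
forces differ by `2 * κ * d * (1 + s) ^ (-(1 + α))`. Integrated twice this is `t * d * (2 * κ / α)`,
and `κ ≤ α / 8` is the condition for the factor `1 / 4`. -/
lemma ForceBounds.newDisplacement_mem (h : ForceBounds α lam F κ) (hα : 0 < α) (hκ : 0 ≤ κ)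
    (hκα : κ ≤ α / 8) (hU : U ∈ displacements) (t : ℝ) (z w : Phase) :
    (1 + max t 0) * ‖newDisplacement α lam F U (t, z) - newDisplacement α lam F U (t, w)‖
      ≤ 1 / 4 * max t 0 * ‖z - w‖ := by
  have hpos : ∀ t : ℝ, 0 ≤ max t 0 := fun t => le_max_right _ _
  refine (h.norm_newDisplacement_sub_le hα hU hU (c := 2 * κ * ‖z - w‖) (by positivity)
    fun s hs => ?_).trans ?_
  · have h := h.lip U hU U hU s (position U s z) (position U s w)
      (2 * (1 + max s 0) * ‖z - w‖) (by have := hpos s; positivity) fun z' => by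
        rw [sub_sub_sub_cancel_right]
        exact norm_position_sub_le hU s z w
    rw [max_eq_left hs.1] at h
    refine h.trans (le_of_eq ?_)
    rw [← one_add_mul_rpow hs.1]
    ring
  · have h1 : 2 * κ * ‖z - w‖ / α ≤ 1 / 4 * ‖z - w‖ := by
      rw [div_le_iff₀ hα]
      nlinarith [norm_nonneg (z - w)]
    calc _ ≤ max t 0 * (1 / 4 * ‖z - w‖) := mul_le_mul_of_nonneg_left h1 (hpos t)
      _ = _ := by ring

lemma ForceBounds.newDisplacement_contracting (h : ForceBounds α lam F κ) (hα : 0 < α)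
    (hκ : 0 ≤ κ) (hκα : κ ≤ α / 8) (hU : U ∈ displacements) (hU' : U' ∈ displacements)
    (p : ℝ × Phase) :
    ‖newDisplacement α lam F U p - newDisplacement α lam F U' p‖ ≤ 1 / 2 * dist U U' := by
  obtain ⟨t, z⟩ := p
  have hpos : ∀ t : ℝ, 0 ≤ max t 0 := fun t => le_max_right _ _
  have h := h.norm_newDisplacement_sub_le hα hU hU' (t := t) (z := z) (w := z)
    (c := 2 * κ * dist U U') (by positivity)
    fun s hs => by
      have h := h.lip U hU U' hU' s (position U s z) (position U' s z)
        (2 * (1 + max s 0) * dist U U') (by have := hpos s; positivity)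
        -- Both the point where the force is evaluated and the sources which generate it move with
        -- the displacement, whence the factor `2`.
        fun z' => by
          have := norm_position_sub_position_le U U' s z z'
          exact this
      rw [max_eq_left hs.1] at h
      refine h.trans (le_of_eq ?_)
      rw [← one_add_mul_rpow hs.1]
      ring
  have h1 : 2 * κ * dist U U' / α ≤ 1 / 2 * dist U U' := by
    rw [div_le_iff₀ hα]
    nlinarith [dist_nonneg (x := U) (y := U')]
  have h2 := hpos t
  have h4 : 0 ≤ 1 / 2 * dist U U' := by positivity
  have h3 : (1 + max t 0) * ‖newDisplacement α lam F U (t, z) - newDisplacement α lam F U' (t, z)‖ ≤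
      (1 + max t 0) * (1 / 2 * dist U U') := by
    refine h.trans ?_
    calc max t 0 * (2 * κ * dist U U' / α) ≤ max t 0 * (1 / 2 * dist U U') :=
          mul_le_mul_of_nonneg_left h1 h2
      _ ≤ _ := by linarith
  exact le_of_mul_le_mul_left h3 (by linarith)

lemma ForceBounds.exists_fixedPoint (h : ForceBounds α lam F κ) (hα : 0 < α) (hκ : 0 ≤ κ)
    (hκα : κ ≤ α / 8) : ∃ U ∈ displacements, ∀ p, U p = newDisplacement α lam F U p := by
  let Φ : displacements → displacements := fun U =>
    ⟨ofNormedAddCommGroup (newDisplacement α lam F U) (h.continuous_newDisplacement U.2) (κ / α)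
      (h.norm_newDisplacement_le hα hκ U.2), h.newDisplacement_mem hα hκ hκα U.2⟩
  have hΦ : ContractingWith (1 / 2) Φ := by
    refine ⟨by norm_num, LipschitzWith.of_dist_le_mul fun U U' => ?_⟩
    rw [Subtype.dist_eq, Subtype.dist_eq, BoundedContinuousFunction.dist_le (by positivity)]
    intro p
    rw [dist_eq_norm]
    push_cast
    exact h.newDisplacement_contracting hα hκ hκα U.2 U'.2 p
  have : CompleteSpace displacements := isClosed_displacements.completeSpace_coe
  -- The zero displacement is the free flow.
  have : Nonempty displacements := ⟨⟨0, fun t z w => by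
    have : 0 ≤ max t 0 := le_max_right _ _
    simp
    positivity⟩⟩
  obtain ⟨U, hU⟩ : ∃ U : displacements, Φ U = U := ⟨_, hΦ.fixedPoint_isFixedPt⟩
  refine ⟨U, U.2, fun p => ?_⟩
  have : ((Φ U : displacements) : ℝ × Phase →ᵇ R3) p = (U : ℝ × Phase →ᵇ R3) p := by rw [hU]
  rw [← this]
  rfl

end Contraction

/-- The fixed point only provides positions, as a solution of a second-order equation in integrated
form. The velocity is recovered as the first primitive of the force, and the position is
differentiated as a double primitive. -/
lemma exists_isFlow_of_position {E : ℝ → R3 → R3} {B K : ℝ≥0} (hE : IsForce E B K)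
    {X : ℝ → Phase → R3} (hX : ∀ z, Continuous fun t => X t z)
    (h : ∀ t, 0 ≤ t → ∀ z, X t z = z.1 + t • z.2 + ∫ s in (0 : ℝ)..t, (t - s) • E s (X s z)) :
    ∃ Z, IsFlow E Z ∧ ∀ t, 0 ≤ t → (fun z => (Z t z).1) = X t := by
  have hAc : ∀ z, Continuous fun s => E s (X s z) := fun z =>
    hE.cont.comp (continuous_id.prodMk (hX z))
  let Z : ℝ → Phase → Phase := fun t z =>
    (z.1 + t • z.2 + ∫ s in (0 : ℝ)..t, (t - s) • E s (X s z),
      z.2 + ∫ s in (0 : ℝ)..t, E s (X s z))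
  have hZ1 : ∀ t, 0 ≤ t → (fun z => (Z t z).1) = X t := fun t ht => by
    ext1 z
    rw [h t ht z]
  refine ⟨Z, ⟨fun z => by simp [Z], fun z t ht => ?_⟩, hZ1⟩
  have e1 : phaseField E t (Z t z) = (z.2 + ∫ s in (0 : ℝ)..t, E s (X s z), E t (X t z)) := by
    have : (Z t z).1 = X t z := congrFun (hZ1 t ht) z
    rw [phaseField, this]
  rw [e1]
  refine HasDerivAt.prodMk ?_ ?_
  · have h1 := (((hasDerivAt_id t).smul_const z.2).const_add z.1).add
      (hasDerivAt_integral_sub_smul (hAc z) t)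
    rw [one_smul] at h1
    exact h1
  · exact ((intervalIntegral.integral_hasDerivAt_right ((hAc z).intervalIntegrable _ _)
      ((hAc z).stronglyMeasurableAtFilter _ _) (hAc z).continuousAt)).const_add z.2

theorem exists_dispersiveFlow (α lam : ℝ) (hα0 : 0 < α) (hα1 : α < 1) :
    ∃ C : ℝ, 0 ≤ C ∧ ∀ (F : Phase → ℝ) (L : ℝ≥0) (D : ℝ), 0 ≤ D → IsData F L D →
      C * D ≤ α / 8 → ∃ E Z B K, IsForce E B K ∧ IsDispersiveFlow α lam F D (C * D) E Z := by
  obtain ⟨C, hC, hfb⟩ := exists_forceBounds α lam hα0 hα1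
  refine ⟨C, hC, fun F L D hD hF hκ => ?_⟩
  have hb := hfb F L D hD hF
  obtain ⟨U, hU, hfix⟩ := hb.exists_fixedPoint hα0 (by positivity) hκ
  obtain ⟨B, K, hE⟩ := hb.isForce U hU
  obtain ⟨Z, hflow, hZ1⟩ := exists_isFlow_of_position hE (X := position U)
    (continuous_position_left U) fun t ht z => by
      have h1 : (1 + t) ≠ 0 := by linarith
      nth_rw 1 [position]
      rw [hfix, newDisplacement, max_eq_left ht, smul_inv_smul₀ h1]
  refine ⟨displacementForce α lam F U, Z, B, K, hE, hflow, fun t ht => ?_, fun t ht => ?_,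
    fun t ht x => ?_, fun t ht x y => ?_⟩
  · rw [hZ1 t ht]; rfl
  · have := hF.map_position_le hD hU t
    rw [max_eq_left ht] at this
    rwa [hZ1 t ht]
  · simpa only [max_eq_left ht] using hb.bound U hU t x
  · have := hb.lip U hU U hU t x y ‖x - y‖ (norm_nonneg _) fun z => by simp
    rw [max_eq_left ht] at this
    exact this.trans (le_of_eq (by ring))

end

section

/-! ### The force field of a function on phase space -/

lemma map_fst_withDensity {h : Phase → ℝ} (hi : Integrable h) (h0 : ∀ᵐ z, 0 ≤ h z) :
    ((volume : Measure Phase).withDensity fun z => ‖h z‖ₑ).map Prod.fst =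
      volume.withDensity fun x => ENNReal.ofReal (density h x) := by
  ext s hs
  have hs' : MeasurableSet (Prod.fst ⁻¹' s : Set Phase) := measurable_fst hs
  rw [Measure.map_apply measurable_fst hs, withDensity_apply _ hs', withDensity_apply _ hs]
  have e1 : (Prod.fst ⁻¹' s : Set Phase) = s ×ˢ univ := by ext; simp
  have hm := hi.aestronglyMeasurable.enorm
  rw [Measure.volume_eq_prod] at hm ⊢
  rw [e1, ← Measure.prod_restrict, Measure.restrict_univ, lintegral_prod _
    (hm.mono_measure (Measure.prod_mono Measure.restrict_le_self le_rfl))]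
  refine lintegral_congr_ae (ae_restrict_of_ae ?_)
  filter_upwards [Measure.ae_ae_of_ae_prod h0, hi.prod_right_ae] with x hx hix
  rw [density, ofReal_integral_eq_lintegral_ofReal hix hx]
  refine lintegral_congr_ae (hx.mono fun v hv => ?_)
  exact (Real.enorm_of_nonneg hv)

/-- This passes from the force defined by a density function to the field of a measure.
Nonnegativity is needed because measures carry the density `‖h‖ₑ`. -/
lemma force_eq_field {α lam : ℝ} (hα : 0 < α) {h : Phase → ℝ} (hi : Integrable h)
    (h0 : ∀ᵐ z, 0 ≤ h z) (x : R3) : force α lam h x =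
      field α lam (((volume : Measure Phase).withDensity fun z => ‖h z‖ₑ).map Prod.fst) x := by
  rw [map_fst_withDensity hi h0, field, force, gradient_potential _ _ hα]
  have hm : AEMeasurable (fun x => ENNReal.ofReal (density h x)) volume :=
    (hi.aestronglyMeasurable.integral_prod_right').aemeasurable.ennreal_ofReal
  rw [integral_withDensity_eq_integral_toReal_smul₀ hm
    (Eventually.of_forall fun _ => ENNReal.ofReal_lt_top)]
  congr 1
  refine integral_congr_ae ?_
  filter_upwards [Measure.ae_ae_of_ae_prod h0] with y hy
  rw [ENNReal.toReal_ofReal (show 0 ≤ density h y from integral_nonneg_of_ae hy)]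

/-! ### Nonnegative integrable Lipschitz functions vanish at infinity -/

variable {F : Phase → ℝ} {L : ℝ≥0} {D : ℝ}

/-- If `F` reached `δ` arbitrarily far out, the Lipschitz bound would keep it above `δ / 2` on balls
of a fixed radius `r`. The complement of every large ball would then have mass bounded below,
against integrability. The cap `r ≤ 1` keeps such a ball, centred beyond radius `R + 1`, outside the
ball of radius `R`. -/
lemma IsData.exists_radius (hF : IsData F L D) {δ : ℝ} (hδ : 0 < δ) :
    ∃ R : ℝ, ∀ z, R < ‖z‖ → F z < δ := by
  by_contra! hcon
  set r : ℝ := min 1 (δ / (2 * (L + 1))) with hr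
  have hr0 : 0 < r := by positivity
  have hr1 : r ≤ 1 := min_le_left _ _
  have hrL : L * r ≤ δ / 2 := by
    have h1 : r ≤ δ / (2 * (L + 1)) := min_le_right _ _
    rw [le_div_iff₀ (by positivity)] at h1
    nlinarith [L.coe_nonneg]
  let v : ℝ≥0∞ := volume (Metric.ball (0 : Phase) r)
  have hv : 0 < v := Metric.measure_ball_pos _ _ hr0
  have hball : ∀ R : ℝ, ENNReal.ofReal (δ / 2) * v ≤
      ∫⁻ z in (Metric.ball (0 : Phase) R)ᶜ, ‖F z‖ₑ := fun R => by
    obtain ⟨z, hz, hzF⟩ := hcon (R + 1)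
    have hsub : Metric.ball z r ⊆ (Metric.ball (0 : Phase) R)ᶜ := fun w hw => by
      rw [mem_compl_iff, mem_ball_zero_iff, not_lt]
      rw [mem_ball_iff_norm] at hw
      have := norm_sub_norm_le z w
      rw [norm_sub_rev] at this
      linarith
    refine le_trans ?_ (lintegral_mono_set hsub)
    have e1 : v = volume (Metric.ball z r) := by
      simp only [v, Measure.addHaar_ball_center]
    rw [e1, ← setLIntegral_const]
    refine setLIntegral_mono' Metric.isOpen_ball.measurableSet fun w hw => ?_
    rw [Real.enorm_of_nonneg (hF.nonneg w)]
    refine ENNReal.ofReal_le_ofReal ?_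
    have h1 := hF.lip.dist_le_mul z w
    rw [Metric.mem_ball, dist_comm] at hw
    have h2 : (L : ℝ) * dist z w ≤ L * r := by gcongr
    have h3 := le_abs_self (F z - F w)
    rw [← Real.dist_eq] at h3
    linarith
  have hlim : Tendsto (fun n : ℕ => ∫⁻ z in (Metric.ball (0 : Phase) n)ᶜ, ‖F z‖ₑ) atTop (𝓝 0) := by
    have h1 := tendsto_setLIntegral_zero (μ := (volume : Measure Phase)) (f := fun z => ‖F z‖ₑ)
      (hF.mass.trans_lt ENNReal.ofReal_lt_top).ne (l := atTop)
      (s := fun n : ℕ => (Metric.ball (0 : Phase) n)ᶜ)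
    have e1 : ∀ n : ℕ, ∫⁻ z in (Metric.ball (0 : Phase) n)ᶜ, ‖F z‖ₑ =
        dataMeasure F (Metric.ball (0 : Phase) n)ᶜ := fun n => by
      rw [dataMeasure, withDensity_apply _ Metric.isOpen_ball.measurableSet.compl]
    simp only [e1]
    have := hF.isFiniteMeasure
    have h2 := tendsto_measure_iInter_atTop (μ := dataMeasure F)
      (s := fun n : ℕ => (Metric.ball (0 : Phase) n)ᶜ)
      (fun n => Metric.isOpen_ball.measurableSet.compl.nullMeasurableSet)
      (fun m n hmn => compl_subset_compl.2 (Metric.ball_subset_ball (by exact_mod_cast hmn)))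
      ⟨0, measure_ne_top _ _⟩
    have e2 : ⋂ n : ℕ, (Metric.ball (0 : Phase) n)ᶜ = ∅ := by
      rw [← compl_iUnion, Metric.iUnion_ball_nat, compl_univ]
    rwa [e2, measure_empty] at h2
  have h3 : ENNReal.ofReal (δ / 2) * v ≤ 0 := ge_of_tendsto hlim
    (Eventually.of_forall fun n => hball n)
  have h4 : 0 < ENNReal.ofReal (δ / 2) * v :=
    ENNReal.mul_pos (by simpa using hδ) hv.ne'
  exact absurd h3 (not_le.2 h4)

lemma IsData.exists_bound (hF : IsData F L D) : ∃ A : ℝ, ∀ z, ‖F z‖ ≤ A := by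
  obtain ⟨R, hR⟩ := hF.exists_radius one_pos
  obtain ⟨A, hA⟩ := (isCompact_closedBall (0 : Phase) R).exists_bound_of_continuousOn
    hF.lip.continuous.continuousOn
  refine ⟨max A 1, fun z => ?_⟩
  rcases le_or_gt ‖z‖ R with h | h
  · exact (hA z (by simpa using h)).trans (le_max_left _ _)
  · rw [Real.norm_of_nonneg (hF.nonneg z)]
    exact (hR z h).le.trans (le_max_right _ _)

/-! ### The solution transported by the flow -/

/-- The inverse of the flow at time `t`. -/
def flowInv (Z : ℝ → Phase → Phase) (t : ℝ) : Phase → Phase := Function.invFun (Z t)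

section

variable {E : ℝ → R3 → R3} {B K : ℝ≥0} {Z : ℝ → Phase → Phase}

lemma IsFlow.flow_flowInv (hZ : IsFlow E Z) (hE : IsForce E B K) {t : ℝ} (ht : 0 ≤ t) (z : Phase) :
    Z t (flowInv Z t z) = z :=
  Function.rightInverse_invFun (hZ.surjective hE ht) z

lemma IsFlow.flowInv_flow (hZ : IsFlow E Z) (hE : IsForce E B K) {t : ℝ} (ht : 0 ≤ t) (z : Phase) :
    flowInv Z t (Z t z) = z :=
  Function.leftInverse_invFun (hZ.injective hE ht) z

lemma IsFlow.lipschitz_flowInv (hZ : IsFlow E Z) (hE : IsForce E B K) {t : ℝ} (ht : 0 ≤ t) :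
    LipschitzWith (Real.exp (max 1 K * t)).toNNReal (flowInv Z t) :=
  (hZ.antilipschitz hE ht).to_rightInverse (hZ.flow_flowInv hE ht)

lemma IsFlow.measurableEmbedding (hZ : IsFlow E Z) (hE : IsForce E B K) {t : ℝ} (ht : 0 ≤ t) :
    MeasurableEmbedding (Z t) :=
  (hZ.lipschitz hE ht).continuous.measurableEmbedding (hZ.injective hE ht)

lemma IsFlow.integral_comp_flowInv (hZ : IsFlow E Z) (hE : IsForce E B K) {t : ℝ} (ht : 0 ≤ t)
    (φ h : Phase → ℝ) : ∫ z, φ z * h (flowInv Z t z) = ∫ z, φ (Z t z) * h z := by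
  have h1 := (hZ.measurePreserving hE ht).integral_comp (hZ.measurableEmbedding hE ht)
    (fun z => φ z * h (flowInv Z t z))
  rw [← h1]
  simp only [hZ.flowInv_flow hE ht]

lemma IsFlow.lintegral_comp_flowInv (hZ : IsFlow E Z) (hE : IsForce E B K) {t : ℝ} (ht : 0 ≤ t)
    (h : Phase → ℝ≥0∞) : ∫⁻ z, h (flowInv Z t z) = ∫⁻ z, h z := by
  have h1 := (hZ.measurePreserving hE ht).lintegral_comp_emb (hZ.measurableEmbedding hE ht)
    (fun z => h (flowInv Z t z))
  rw [← h1]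
  simp only [hZ.flowInv_flow hE ht]

lemma IsFlow.withDensity_comp_flowInv (hZ : IsFlow E Z) (hE : IsForce E B K) {t : ℝ} (ht : 0 ≤ t)
    (F : Phase → ℝ) : ((volume : Measure Phase).withDensity fun z => ‖F (flowInv Z t z)‖ₑ) =
      (dataMeasure F).map (Z t) := by
  ext s hs
  have hm := (hZ.lipschitz hE ht).continuous.measurable
  rw [Measure.map_apply hm hs, dataMeasure, withDensity_apply _ hs, withDensity_apply _ (hm hs),
    ← lintegral_indicator hs, ← lintegral_indicator (hm hs),
    ← hZ.lintegral_comp_flowInv hE ht ((Z t ⁻¹' s).indicator fun a => ‖F a‖ₑ)]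
  refine lintegral_congr fun z => ?_
  by_cases hz : z ∈ s
  · rw [indicator_of_mem hz, indicator_of_mem (by rwa [mem_preimage, hZ.flow_flowInv hE ht])]
  · rw [indicator_of_notMem hz, indicator_of_notMem (by rwa [mem_preimage, hZ.flow_flowInv hE ht])]

lemma IsFlow.dist_time_le (hZ : IsFlow E Z) (hE : IsForce E B K) {T s t : ℝ} (hs : s ∈ Icc 0 T)
    (ht : t ∈ Icc 0 T) (z : Phase) :
    dist (Z t z) (Z s z) ≤ (‖z‖ + B * T + B) * |t - s| := by
  have h1 : ∀ r ∈ Icc 0 T, ‖phaseField E r (Z r z)‖ ≤ ‖z‖ + B * T + B := fun r hr => by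
    have h2 := hZ.norm_velocity_sub_le hE hr.1 z
    have h3 : ‖(Z r z).2‖ ≤ ‖z‖ + B * T := by
      have h4 := norm_sub_norm_le (Z r z).2 z.2
      have h5 := norm_snd_le z
      have h6 : (B : ℝ) * r ≤ B * T := by gcongr; exact hr.2
      linarith
    have h7 := hE.bound r (Z r z).1
    have h8 : 0 ≤ (B : ℝ) := B.coe_nonneg
    simp only [phaseField]
    refine norm_prod_le_iff.2 ⟨by simpa using h3.trans (by linarith), ?_⟩
    refine h7.trans ?_
    have : 0 ≤ ‖z‖ + B * T := (norm_nonneg _).trans h3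
    linarith
  have h2 := (convex_Icc (0 : ℝ) T).norm_image_sub_le_of_norm_hasDerivWithin_le
    (f := fun r => Z r z) (f' := fun r => phaseField E r (Z r z))
    (fun r hr => (hZ.deriv z r hr.1).hasDerivWithinAt) h1 hs ht
  rwa [dist_eq_norm, ← Real.norm_eq_abs]

/-- The speed of a trajectory grows with its initial velocity, so the flow is not uniformly
continuous in time over phase space. If one of the two preimages lies in the ball of radius `R`, the
Lipschitz bounds on that ball apply; if both lie outside, both values are in `[0, δ)`. This gives
continuity in time with values in `L^∞`. -/
lemma IsData.abs_sub_comp_flowInv_le (hF : IsData F L D) (hZ : IsFlow E Z) (hE : IsForce E B K)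
    {T s t δ R : ℝ} (hs : s ∈ Icc 0 T) (ht : t ∈ Icc 0 T)
    (hR : ∀ z, R < ‖z‖ → F z < δ) (z : Phase) :
    |F (flowInv Z t z) - F (flowInv Z s z)| ≤
      max δ (L * (Real.exp (max 1 K * T) * ((R + B * T + B) * |t - s|))) := by
  have key : ∀ s' ∈ Icc 0 T, ∀ t' ∈ Icc 0 T, |t' - s'| = |t - s| → ‖flowInv Z s' z‖ ≤ R →
      dist (F (flowInv Z t' z)) (F (flowInv Z s' z)) ≤
        L * (Real.exp (max 1 K * T) * ((R + B * T + B) * |t - s|)) := by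
    intro s' hs' t' ht' e1 hRs
    have h1 := hZ.dist_time_le hE hs' ht' (flowInv Z s' z)
    have h2 := (hZ.lipschitz_flowInv hE ht'.1).dist_le_mul z (Z t' (flowInv Z s' z))
    rw [hZ.flowInv_flow hE ht'.1, Real.coe_toNNReal _ (Real.exp_pos _).le] at h2
    rw [hZ.flow_flowInv hE hs'.1, dist_comm, e1] at h1
    refine (hF.lip.dist_le_mul _ _).trans ?_
    refine mul_le_mul_of_nonneg_left (h2.trans ?_) L.coe_nonneg
    have h3 : Real.exp (max 1 K * t') ≤ Real.exp (max 1 K * T) := by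
      gcongr
      exact ht'.2
    refine mul_le_mul h3 (h1.trans ?_) dist_nonneg (Real.exp_pos _).le
    gcongr
  rw [← Real.dist_eq]
  rcases le_or_gt ‖flowInv Z s z‖ R with h | h
  · exact (key s hs t ht rfl h).trans (le_max_right _ _)
  · rcases le_or_gt ‖flowInv Z t z‖ R with h' | h'
    · rw [dist_comm]
      exact (key t ht s hs (abs_sub_comm _ _) h').trans (le_max_right _ _)
    · refine le_trans ?_ (le_max_left _ _)
      have h1 := hR _ h
      have h2 := hR _ h'
      have h3 := hF.nonneg (flowInv Z s z)
      have h4 := hF.nonneg (flowInv Z t z)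
      rw [Real.dist_eq, abs_le]
      constructor <;> linarith

/-- The transported data, as an element of `L^∞`. -/
lemma IsData.exists_lp (hF : IsData F L D) (hZ : IsFlow E Z) (hE : IsForce E B K) :
    ∃ f : ℝ → Lp ℝ ∞ (volume : Measure Phase),
      (∀ t, 0 ≤ t → f t =ᵐ[volume] fun z => F (flowInv Z t z)) ∧ ContinuousOn f (Ici 0) := by
  obtain ⟨A, hA⟩ := hF.exists_bound
  have hmem : ∀ t, 0 ≤ t → MemLp (fun z => F (flowInv Z t z)) ∞ (volume : Measure Phase) :=
    fun t ht => memLp_top_of_bound (hF.lip.continuous.comp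
      (hZ.lipschitz_flowInv hE ht).continuous).aestronglyMeasurable A
      (Eventually.of_forall fun z => hA _)
  let f : ℝ → Lp ℝ ∞ (volume : Measure Phase) := fun t =>
    (hmem (max t 0) (le_max_right _ _)).toLp _
  have hf : ∀ t, 0 ≤ t → f t =ᵐ[volume] fun z => F (flowInv Z t z) := fun t ht => by
    have := (hmem (max t 0) (le_max_right _ _)).coeFn_toLp
    refine this.trans (Eventually.of_forall fun z => ?_)
    simp only [max_eq_left ht]
  refine ⟨f, hf, fun s hs => ?_⟩
  rw [mem_Ici] at hs
  rw [ContinuousWithinAt, Metric.tendsto_nhds]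
  intro ε hε
  obtain ⟨R, hR⟩ := hF.exists_radius (half_pos hε)
  have hR' : ∀ z, max R 0 < ‖z‖ → F z < ε / 2 := fun z hz => hR z ((le_max_left _ _).trans_lt hz)
  let b : ℝ → ℝ := fun t => max (ε / 2)
    (L * (Real.exp (max 1 K * (s + 1)) * ((max R 0 + B * (s + 1) + B) * |t - s|)))
  have hb : Tendsto b (𝓝 s) (𝓝 (b s)) := by
    refine Continuous.tendsto ?_ s
    fun_prop
  have hbs : b s < ε := by simp [b, hε]
  have h1 : ∀ᶠ t in 𝓝[Ici 0] s, b t < ε := nhdsWithin_le_nhds (hb.eventually (gt_mem_nhds hbs))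
  have h2 : ∀ᶠ t in 𝓝[Ici 0] s, t < s + 1 :=
    nhdsWithin_le_nhds (gt_mem_nhds (lt_add_one s))
  filter_upwards [h1, h2, self_mem_nhdsWithin] with t ht1 ht2 ht0
  rw [mem_Ici] at ht0
  refine lt_of_le_of_lt ?_ ht1
  rw [dist_eq_norm, Lp.norm_def]
  refine ENNReal.toReal_le_of_le_ofReal ((half_pos hε).le.trans (le_max_left _ _)) ?_
  rw [eLpNorm_exponent_top]
  refine eLpNormEssSup_le_of_ae_bound ?_
  filter_upwards [hf t ht0, hf s hs, Lp.coeFn_sub (f t) (f s)] with z h3 h4 h5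
  rw [h5, Pi.sub_apply, h3, h4, Real.norm_eq_abs]
  exact hF.abs_sub_comp_flowInv_le hZ hE ⟨hs, by linarith⟩ ⟨ht0, ht2.le⟩ hR' z

/-- By volume preservation, testing `F ∘ flowInv Z t` against `φ` is testing `F` against `φ ∘ Z t`,
so the weak equation is the transport identity along the flow. The same change of variables
identifies the image of the data measure with the measure of the solution, and hence `E` with its
force. -/
theorem IsData.exists_solution {α lam : ℝ} (hα : 0 < α) (hF : IsData F L D) (hZ : IsFlow E Z)
    (hE : IsForce E B K)
    (hforce : ∀ t, 0 ≤ t → E t = field α lam ((dataMeasure F).map fun z => (Z t z).1))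
    {f₀ : Phase → ℝ} (h0 : f₀ =ᵐ[volume] F) :
    ∃ f : ℝ → Lp ℝ ∞ (volume : Measure Phase), IsGlobalSolution α lam f₀ f ∧
      ∀ t, 0 ≤ t → f t =ᵐ[volume] (fun z => F (flowInv Z t z)) ∧ force α lam (f t) = E t := by
  obtain ⟨A, hA⟩ := hF.exists_bound
  obtain ⟨f, hf, hcont⟩ := hF.exists_lp hZ hE
  have hL1 : ∀ t, 0 ≤ t → eLpNorm (f t) 1 volume ≤ ENNReal.ofReal D := fun t ht => by
    rw [eLpNorm_congr_ae (hf t ht), eLpNorm_one_eq_lintegral_enorm,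
      hZ.lintegral_comp_flowInv hE ht (fun z => ‖F z‖ₑ)]
    exact hF.mass
  have hnn : ∀ t, 0 ≤ t → ∀ᵐ z, 0 ≤ f t z := fun t ht => (hf t ht).mono fun z hz => by
    rw [hz]; exact hF.nonneg _
  have hint : ∀ t, 0 ≤ t → Integrable (f t) := fun t ht =>
    memLp_one_iff_integrable.1 ⟨(Lp.aestronglyMeasurable (f t)),
      (hL1 t ht).trans_lt ENNReal.ofReal_lt_top⟩
  have hEf : ∀ t, 0 ≤ t → force α lam (f t) = E t := fun t ht => by
    ext1 x
    have e1 : ((volume : Measure Phase).withDensity fun z => ‖f t z‖ₑ) =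
        (dataMeasure F).map (Z t) := by
      rw [← hZ.withDensity_comp_flowInv hE ht]
      exact withDensity_congr_ae ((hf t ht).mono fun z hz => by simp only [hz])
    rw [force_eq_field hα (hint t ht) (hnn t ht), hforce t ht, e1,
      Measure.map_map measurable_fst (hZ.lipschitz hE ht).continuous.measurable]
    rfl
  have hFm := hF.lip.continuous.aestronglyMeasurable (μ := (volume : Measure Phase))
  have hFb : ∀ᵐ z, ‖F z‖ ≤ A := Eventually.of_forall hA
  have hφt : ∀ t, 0 ≤ t → ∀ φ : Phase → ℝ, ∫ z, φ z * f t z = ∫ z, φ (Z t z) * F z :=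
    fun t ht φ => by
    rw [← hZ.integral_comp_flowInv hE ht φ F]
    exact integral_congr_ae ((hf t ht).mono fun z hz => by simp only [hz])
  refine ⟨f, ⟨hcont, hnn, fun T hT => ⟨D.toNNReal, fun t ht _ => hL1 t ht⟩, ?_, ?_⟩,
    fun t ht => ⟨hf t ht, hEf t ht⟩⟩
  · have e1 : (fun z => F (flowInv Z 0 z)) = F := by
      ext1 z
      have := hZ.flow_flowInv hE le_rfl z
      rw [hZ.zero] at this
      rw [this]
    have := hf 0 le_rfl
    rw [e1] at this
    exact this.trans h0.symm
  · intro φ hφ hc t ht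
    have hφ1 : ContDiff ℝ 1 φ := hφ.of_le (by simp)
    have e1 : ∀ s ∈ Icc 0 t, ∫ z, fderiv ℝ φ z (z.2, force α lam (f s) z.1) * f s z =
        ∫ z, fderiv ℝ φ (Z s z) (phaseField E s (Z s z)) * F z := fun s hs => by
      rw [hφt s hs.1 (fun z => fderiv ℝ φ z (z.2, force α lam (f s) z.1)), hEf s hs.1]
      rfl
    have e2 : ∫ z, φ z * f₀ z = ∫ z, φ z * F z :=
      integral_congr_ae (h0.mono fun z hz => by simp only [hz])
    have e3 := hZ.transport hE ht hφ1 hc hFm hFb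
    refine ⟨?_, ?_⟩
    · have h1 := (hZ.continuous_transport_deriv hE ht hφ1 hc hFm hFb).intervalIntegrable
        (μ := volume) 0 t
      refine h1.congr fun s hs => ?_
      rw [uIoc_of_le ht] at hs
      have hs' : s ∈ Icc 0 t := ⟨hs.1.le, hs.2⟩
      rw [clamp_eq hs', e1 s hs']
    · rw [hφt t ht, e3, e2]
      congr 1
      refine intervalIntegral.integral_congr fun s hs => ?_
      rw [uIcc_of_le ht] at hs
      exact (e1 s hs).symm

end

end

section

/-! ### Stability of the characteristic flow -/

lemma norm_integral_le_exp {k l t : ℝ} (hk : 0 ≤ k) (hl : 0 < l) (ht : 0 ≤ t) {g : ℝ → R3}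
    (h : ∀ s ∈ Icc 0 t, ‖g s‖ ≤ k * Real.exp (l * s)) :
    ‖∫ s in (0 : ℝ)..t, g s‖ ≤ k * Real.exp (l * t) / l := by
  have h1 := intervalIntegral.norm_integral_le_of_norm_le (μ := volume) (f := g) ht
    (Eventually.of_forall fun s hs => h s ⟨hs.1.le, hs.2⟩)
    (Continuous.intervalIntegrable (by fun_prop) _ _)
  rw [intervalIntegral.integral_const_mul,
    intervalIntegral.integral_comp_mul_left (fun x => Real.exp x) hl.ne', integral_exp] at h1
  refine h1.trans ?_
  simp only [mul_zero, Real.exp_zero, smul_eq_mul]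
  rw [mul_div_assoc, inv_mul_eq_div]
  gcongr
  linarith

variable {E E' : ℝ → R3 → R3} {B K B' K' : ℝ≥0} {Z Z' : ℝ → Phase → Phase}

lemma IsFlow.continuous_position_max (hZ : IsFlow E Z) (hE : IsForce E B K) (z : Phase) :
    Continuous fun s => (Z (max s 0) z).1 :=
  continuous_fst.comp ((hZ.continuous_max hE).comp (by fun_prop : Continuous fun s : ℝ => (s, z)))

lemma IsFlow.continuous_velocity_max (hZ : IsFlow E Z) (hE : IsForce E B K) (z : Phase) :
    Continuous fun s => (Z (max s 0) z).2 :=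
  continuous_snd.comp ((hZ.continuous_max hE).comp (by fun_prop : Continuous fun s : ℝ => (s, z)))

lemma intervalIntegrable_of_max {g : ℝ → R3} (hg : Continuous fun s => g (max s 0)) {a b : ℝ}
    (ha : 0 ≤ a) (hb : 0 ≤ b) : IntervalIntegrable g volume a b := by
  refine (hg.intervalIntegrable a b).congr fun s hs => ?_
  have : 0 ≤ s := by
    rcases le_total a b with h | h
    · rw [uIoc_of_le h] at hs; linarith [hs.1]
    · rw [uIoc_of_ge h] at hs; linarith [hs.1]
  simp only [max_eq_left this]

lemma IsFlow.intervalIntegrable_force (hZ : IsFlow E Z) (hE : IsForce E B K) (z : Phase) {a b : ℝ}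
    (ha : 0 ≤ a) (hb : 0 ≤ b) : IntervalIntegrable (fun s => E s (Z s z).1) volume a b := by
  refine intervalIntegrable_of_max ?_ ha hb
  exact hE.continuous_comp (by fun_prop) (hZ.continuous_position_max hE z)

lemma IsFlow.intervalIntegrable_velocity (hZ : IsFlow E Z) (hE : IsForce E B K) (z : Phase)
    {a b : ℝ} (ha : 0 ≤ a) (hb : 0 ≤ b) : IntervalIntegrable (fun s => (Z s z).2) volume a b :=
  intervalIntegrable_of_max (hZ.continuous_velocity_max hE z) ha hb

lemma IsFlow.position_eq (hZ : IsFlow E Z) (hE : IsForce E B K) {t : ℝ} (ht : 0 ≤ t) (z : Phase) :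
    (Z t z).1 = z.1 + ∫ s in (0 : ℝ)..t, (Z s z).2 := by
  rw [intervalIntegral.integral_eq_sub_of_hasDerivAt (f := fun s => (Z s z).1) (fun s hs => ?_)
    (hZ.intervalIntegrable_velocity hE z le_rfl ht), hZ.zero]
  · abel
  · rw [uIcc_of_le ht] at hs
    exact (hasFDerivAt_fst (𝕜 := ℝ) (E := R3) (F := R3)).comp_hasDerivAt s (hZ.deriv z s hs.1)

/-- Two flows which are driven by the force fields that they generate coincide. -/
theorem IsFlow.eq_of_field {α lam : ℝ} (hα0 : 0 < α) (hα1 : α < 1) (hZ : IsFlow E Z)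
    (hE : IsForce E B K) (hZ' : IsFlow E' Z') (hE' : IsForce E' B' K') {μ : Measure Phase}
    {D M T : ℝ} (hD : 0 ≤ D) (hM : 0 ≤ M) (hμ : μ univ ≤ ENNReal.ofReal M)
    (hf : ∀ t ∈ Icc 0 T, E t = field α lam (μ.map fun z => (Z t z).1))
    (hf' : ∀ t ∈ Icc 0 T, E' t = field α lam (μ.map fun z => (Z' t z).1))
    (hd : ∀ t ∈ Icc 0 T, μ.map (fun z => (Z t z).1) ≤ ENNReal.ofReal D • volume)
    (hd' : ∀ t ∈ Icc 0 T, μ.map (fun z => (Z' t z).1) ≤ ENNReal.ofReal D • volume) {t : ℝ}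
    (ht : t ∈ Icc 0 T) : Z t = Z' t := by
  obtain ⟨C, hC, hfb⟩ := exists_field_bounds α lam hα0 hα1
  have hb := (hfb D M hD hM 1 one_pos).2 Phase μ hμ
  simp only [Real.one_rpow, mul_one] at hb
  set c : ℝ := 2 * (C * (D + M)) with hc
  have hc0 : 0 ≤ c := by positivity
  -- The force difference along one trajectory depends on all the others, so the bound `a` on the
  -- distance has to be uniform in `z`.
  have hforce : ∀ s ∈ Icc 0 T, ∀ a : ℝ, (∀ z, ‖(Z s z).1 - (Z' s z).1‖ ≤ a) →
      ∀ z, ‖E s (Z s z).1 - E' s (Z' s z).1‖ ≤ c * a := fun s hs a ha z => by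
    have ha0 : 0 ≤ a := (norm_nonneg _).trans (ha z)
    rw [hf s hs, hf' s hs]
    refine (hb (fun z => (Z s z).1) (fun z => (Z' s z).1)
      (hZ.lipschitz hE hs.1).continuous.fst.measurable
      (hZ'.lipschitz hE' hs.1).continuous.fst.measurable (hd s hs) (hd' s hs) _ _ (2 * a)
      (by positivity) fun w => ?_).trans (le_of_eq (by rw [hc]; ring))
    rw [sub_sub_sub_comm]
    refine (norm_sub_le _ _).trans ?_
    linarith [ha z, ha w]
  have hvel : ∀ s ∈ Icc 0 T, ∀ z, (Z s z).2 - (Z' s z).2 =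
      ∫ r in (0 : ℝ)..s, (E r (Z r z).1 - E' r (Z' r z).1) := fun s hs z => by
    rw [hZ.velocity_eq hE hs.1, hZ'.velocity_eq hE' hs.1,
      intervalIntegral.integral_sub (hZ.intervalIntegrable_force hE z le_rfl hs.1)
        (hZ'.intervalIntegrable_force hE' z le_rfl hs.1)]
    abel
  have hposn : ∀ s ∈ Icc 0 T, ∀ z, (Z s z).1 - (Z' s z).1 =
      ∫ r in (0 : ℝ)..s, ((Z r z).2 - (Z' r z).2) := fun s hs z => by
    rw [hZ.position_eq hE hs.1, hZ'.position_eq hE' hs.1,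
      intervalIntegral.integral_sub (hZ.intervalIntegrable_velocity hE z le_rfl hs.1)
        (hZ'.intervalIntegrable_velocity hE' z le_rfl hs.1)]
    abel
  have hT : 0 ≤ T := ht.1.trans ht.2
  -- Two time integrations against `exp (l * s)` gain `c / l²`, which is at most `1 / 2` for this
  -- rate.
  set l : ℝ := 2 * c + 1 with hl
  have hl0 : 0 < l := by positivity
  set a₀ : ℝ := (B + B') * T * T with ha₀
  have ha0 : 0 ≤ a₀ := by positivity
  -- A uniform bound valid for the bounded forces starts the iteration, and each pass halves the
  -- constant. This replaces a Gronwall argument for the supremum over `z`.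
  have hiter : ∀ n : ℕ, ∀ s ∈ Icc 0 T, ∀ z,
      ‖(Z s z).1 - (Z' s z).1‖ ≤ a₀ * (1 / 2) ^ n * Real.exp (l * s) := by
    intro n
    induction n with
    | zero =>
      intro s hs z
      have h1 : ‖(Z s z).1 - (Z' s z).1‖ ≤ (B + B') * T * |s - 0| := by
        rw [hposn s hs z]
        refine intervalIntegral.norm_integral_le_of_norm_le_const fun r hr => ?_
        rw [uIoc_of_le hs.1] at hr
        have hr' : r ∈ Icc 0 T := ⟨hr.1.le, hr.2.trans hs.2⟩
        have h2 := hZ.norm_velocity_sub_le hE hr'.1 z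
        have h3 := hZ'.norm_velocity_sub_le hE' hr'.1 z
        have h4 := norm_sub_le ((Z r z).2 - z.2) ((Z' r z).2 - z.2)
        rw [sub_sub_sub_cancel_right] at h4
        have h5 : (B + B' : ℝ) * r ≤ (B + B') * T := by gcongr; exact hr'.2
        linarith
      rw [sub_zero, abs_of_nonneg hs.1] at h1
      have h2 : (B + B' : ℝ) * T * s ≤ a₀ := by rw [ha₀]; gcongr; exact hs.2
      have h3 : 1 ≤ Real.exp (l * s) := Real.one_le_exp (mul_nonneg hl0.le hs.1)
      rw [pow_zero, mul_one]
      nlinarith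
    | succ n ih =>
      intro s hs z
      have hk : 0 ≤ a₀ * (1 / 2) ^ n := by positivity
      have h1 : ∀ r ∈ Icc 0 s, ‖(Z r z).2 - (Z' r z).2‖ ≤
          (c * (a₀ * (1 / 2) ^ n)) / l * Real.exp (l * r) := fun r hr => by
        have hr' : r ∈ Icc 0 T := ⟨hr.1, hr.2.trans hs.2⟩
        rw [hvel r hr' z]
        refine (norm_integral_le_exp (mul_nonneg hc0 hk) hl0 hr.1 fun q hq => ?_).trans
          (le_of_eq (by ring))
        have hq' : q ∈ Icc 0 T := ⟨hq.1, hq.2.trans hr'.2⟩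
        exact (hforce q hq' _ (ih q hq') z).trans (le_of_eq (by ring))
      rw [hposn s hs z]
      refine (norm_integral_le_exp (by positivity) hl0 hs.1 h1).trans ?_
      have h2 : c / l / l ≤ 1 / 2 := by
        rw [div_div, div_le_iff₀ (by positivity)]
        nlinarith
      calc c * (a₀ * (1 / 2) ^ n) / l * Real.exp (l * s) / l
          = c / l / l * (a₀ * (1 / 2) ^ n * Real.exp (l * s)) := by ring
        _ ≤ 1 / 2 * (a₀ * (1 / 2) ^ n * Real.exp (l * s)) := by gcongr
        _ = a₀ * (1 / 2) ^ (n + 1) * Real.exp (l * s) := by ring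
  have hX : ∀ s ∈ Icc 0 T, ∀ z, (Z s z).1 = (Z' s z).1 := fun s hs z => by
    have h1 : Tendsto (fun n : ℕ => a₀ * (1 / 2) ^ n * Real.exp (l * s)) atTop (𝓝 0) := by
      have := ((tendsto_pow_atTop_nhds_zero_of_lt_one (r := (1 / 2 : ℝ)) (by norm_num)
        (by norm_num)).const_mul a₀).mul_const (Real.exp (l * s))
      simpa using this
    have h2 := ge_of_tendsto' h1 fun n => hiter n s hs z
    exact sub_eq_zero.1 (norm_le_zero_iff.1 h2)
  ext1 z
  refine Prod.ext (hX t ht z) (sub_eq_zero.1 ?_)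
  rw [hvel t ht z]
  have h1 : ∀ r ∈ uIcc 0 t, E r (Z r z).1 - E' r (Z' r z).1 = 0 := fun r hr => by
    rw [uIcc_of_le ht.1] at hr
    have hr' : r ∈ Icc 0 T := ⟨hr.1, hr.2.trans ht.2⟩
    have := hforce r hr' 0 (fun w => by rw [hX r hr' w]; simp) z
    rw [mul_zero] at this
    exact norm_le_zero_iff.1 this
  rw [intervalIntegral.integral_congr (g := fun _ => 0) h1]
  simp

end

section

/-! ### Global solutions with locally bounded density -/

lemma map_fst_dataMeasure_le {h : Phase → ℝ} (hi : Integrable h) (h0 : ∀ᵐ z, 0 ≤ h z) {M : ℝ≥0}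
    (hM : eLpNorm (density h) ∞ volume ≤ M) :
    (dataMeasure h).map Prod.fst ≤ ENNReal.ofReal M • volume := by
  rw [dataMeasure, map_fst_withDensity hi h0, ENNReal.ofReal_coe_nnreal, ← withDensity_const]
  refine withDensity_mono ?_
  filter_upwards [ae_le_eLpNormEssSup (f := density h) (μ := volume)] with x hx
  rw [← eLpNorm_exponent_top] at hx
  exact (ENNReal.ofReal_le_ofReal (le_abs_self _)).trans
    ((Real.enorm_eq_ofReal_abs (density h x)).symm.le.trans (hx.trans hM))

/-- A quantitative form of Scheffé's argument: `|h - k|` is `h - k`, which integrates to zero, plus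
twice the negative part of `h - k`. That negative part is bounded both by `k` and by `|δ|`. -/
lemma integral_abs_sub_le {Y : Type*} [MeasurableSpace Y] {μ : Measure Y} {h k : Y → ℝ}
    (hh : Integrable h μ) (hk : Integrable k μ) (hh0 : ∀ᵐ z ∂μ, 0 ≤ h z) (hk0 : ∀ᵐ z ∂μ, 0 ≤ k z)
    (heq : ∫ z, h z ∂μ = ∫ z, k z ∂μ) {δ : ℝ} (hδ : ∀ᵐ z ∂μ, |h z - k z| ≤ δ) :
    ∫ z, |h z - k z| ∂μ ≤ 2 * ∫ z, min (k z) |δ| ∂μ := by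
  have hmin : Integrable (fun z => min (k z) |δ|) μ := by
    refine hk.mono (hk.aestronglyMeasurable.inf aestronglyMeasurable_const) ?_
    filter_upwards [hk0] with z hz
    rw [Real.norm_of_nonneg (le_min hz (abs_nonneg δ)), Real.norm_of_nonneg hz]
    exact min_le_left _ _
  have h1 : ∫ z, |h z - k z| ∂μ ≤ ∫ z, ((h z - k z) + 2 * min (k z) |δ|) ∂μ := by
    refine integral_mono_ae (hh.sub hk).abs ((hh.sub hk).add (hmin.const_mul 2)) ?_
    filter_upwards [hh0, hk0, hδ] with z h1 h2 h3
    rcases le_total (h z) (k z) with h4 | h4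
    · have h5 : k z - h z ≤ min (k z) |δ| := by
        refine le_min (by linarith) ((le_trans ?_ h3).trans (le_abs_self δ))
        rw [abs_sub_comm]
        exact le_abs_self _
      rw [abs_of_nonpos (by linarith)]
      linarith
    · rw [abs_of_nonneg (by linarith)]
      have : 0 ≤ min (k z) |δ| := le_min h2 (abs_nonneg δ)
      linarith
  have h2 : ∫ z, ((h z - k z) + 2 * min (k z) |δ|) ∂μ =
      ∫ z, (h z - k z) ∂μ + ∫ z, 2 * min (k z) |δ| ∂μ :=
    integral_add (hh.sub hk) (hmin.const_mul 2)
  rwa [h2, integral_sub hh hk, heq, sub_self, zero_add, integral_const_mul] at h1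

lemma tendsto_integral_min {Y : Type*} [MeasurableSpace Y] {μ : Measure Y} {k : Y → ℝ}
    (hk : Integrable k μ) (hk0 : ∀ᵐ z ∂μ, 0 ≤ k z) :
    Tendsto (fun δ : ℝ => ∫ z, min (k z) |δ| ∂μ) (𝓝 0) (𝓝 0) := by
  have h := tendsto_integral_filter_of_dominated_convergence (μ := μ) (l := 𝓝 (0 : ℝ))
    (F := fun δ z => min (k z) |δ|) (f := fun z => min (k z) |(0 : ℝ)|) k
    (Eventually.of_forall fun δ => hk.aestronglyMeasurable.inf aestronglyMeasurable_const)
    (Eventually.of_forall fun δ => by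
      filter_upwards [hk0] with z hz
      rw [Real.norm_of_nonneg (le_min hz (abs_nonneg δ))]
      exact min_le_left _ _) hk
    (Eventually.of_forall fun z => Continuous.tendsto (by fun_prop) 0)
  have e1 : ∫ z, min (k z) |(0 : ℝ)| ∂μ = 0 := by
    rw [integral_eq_zero_of_ae]
    filter_upwards [hk0] with z hz
    simpa using hz
  rwa [e1] at h

section

variable {α lam : ℝ} {f₀ : Phase → ℝ} {g : ℝ → Lp ℝ ∞ (volume : Measure Phase)}

lemma IsGlobalSolution.integrable_apply (hg : IsGlobalSolution α lam f₀ g) {t : ℝ} (ht : 0 ≤ t) :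
    Integrable (g t) := by
  obtain ⟨M, hM⟩ := hg.integrable t ht
  exact memLp_one_iff_integrable.1 ⟨Lp.aestronglyMeasurable (g t),
    (hM t ht le_rfl).trans_lt ENNReal.coe_lt_top⟩

/-- A smooth cutoff function. -/
def cutoff : ContDiffBump (0 : Phase) := ⟨1, 2, one_pos, one_lt_two⟩

/-- The rescaled cutoff functions. -/
def cutoffScaled (n : ℕ) (z : Phase) : ℝ := cutoff (((n : ℝ) + 1)⁻¹ • z)

lemma contDiff_cutoffScaled (n : ℕ) : ContDiff ℝ (⊤ : ℕ∞) (cutoffScaled n) :=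
  cutoff.contDiff.comp (contDiff_const_smul _)

lemma hasCompactSupport_cutoffScaled (n : ℕ) : HasCompactSupport (cutoffScaled n) :=
  cutoff.hasCompactSupport.comp_smul (by positivity)

lemma norm_cutoffScaled_le (n : ℕ) (z : Phase) : ‖cutoffScaled n z‖ ≤ 1 := by
  rw [cutoffScaled, Real.norm_of_nonneg cutoff.nonneg]
  exact cutoff.le_one

lemma tendsto_inv_add_one : Tendsto (fun n : ℕ => ((n : ℝ) + 1)⁻¹) atTop (𝓝 0) := by
  simpa using tendsto_one_div_add_atTop_nhds_zero_nat (𝕜 := ℝ)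

lemma tendsto_cutoffScaled (z : Phase) :
    Tendsto (fun n => cutoffScaled n z) atTop (𝓝 1) := by
  have h1 : Tendsto (fun n : ℕ => ((n : ℝ) + 1)⁻¹ • z) atTop (𝓝 0) := by
    simpa using tendsto_inv_add_one.smul_const z
  have h2 := (cutoff.continuous.tendsto 0).comp h1
  have h3 : cutoff (0 : Phase) = 1 := cutoff.one_of_mem_closedBall (by simp [cutoff])
  rw [h3] at h2
  exact h2

lemma fderiv_cutoffScaled (n : ℕ) (z : Phase) :
    fderiv ℝ (cutoffScaled n) z = ((n : ℝ) + 1)⁻¹ • fderiv ℝ cutoff (((n : ℝ) + 1)⁻¹ • z) := by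
  have h1 : HasFDerivAt cutoff (fderiv ℝ cutoff (((n : ℝ) + 1)⁻¹ • z)) (((n : ℝ) + 1)⁻¹ • z) :=
    (cutoff.contDiff.differentiable (n := 1) (by simp) _).hasFDerivAt
  have h2 := h1.comp z ((hasFDerivAt_id z).const_smul (((n : ℝ) + 1)⁻¹))
  refine (HasFDerivAt.fderiv h2).trans ?_
  ext <;> simp

/-- The transport field grows linearly in `v`, but the cutoff lives on `‖z‖ ≤ 2 * (n + 1)` and its
derivative carries the factor `1 / (n + 1)`. The first bound provides domination, the second
convergence to zero at each point. -/
lemma exists_fderiv_cutoffScaled_bound : ∃ A : ℝ, 0 ≤ A ∧ ∀ n (z : Phase) (w : R3),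
    ‖fderiv ℝ (cutoffScaled n) z (z.2, w)‖ ≤ A * (2 + ‖w‖) ∧
    ‖fderiv ℝ (cutoffScaled n) z (z.2, w)‖ ≤ ((n : ℝ) + 1)⁻¹ * (A * (‖z‖ + ‖w‖)) := by
  have hcont : Continuous (fderiv ℝ (cutoff : Phase → ℝ)) :=
    cutoff.contDiff.continuous_fderiv (n := 1) (by simp)
  obtain ⟨A, hA⟩ := (cutoff.hasCompactSupport.fderiv (𝕜 := ℝ)).exists_bound_of_continuous hcont
  have hA0 : 0 ≤ A := (norm_nonneg _).trans (hA 0)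
  have hzw : ∀ (z : Phase) (w : R3), ‖((z.2, w) : Phase)‖ ≤ ‖z‖ + ‖w‖ := fun z w =>
    norm_prod_le_iff.2 ⟨(norm_snd_le z).trans (by simp), by simp⟩
  refine ⟨A, hA0, fun n z w => ?_⟩
  have hn : (0 : ℝ) < (n : ℝ) + 1 := by positivity
  have hn1 : ((n : ℝ) + 1)⁻¹ ≤ 1 := inv_le_one_of_one_le₀ (by linarith [n.cast_nonneg (α := ℝ)])
  rw [fderiv_cutoffScaled, smul_apply, norm_smul, norm_inv,
    Real.norm_of_nonneg hn.le]
  have h1 := (fderiv ℝ cutoff (((n : ℝ) + 1)⁻¹ • z)).le_opNorm (z.2, w)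
  have h2 : ‖fderiv ℝ cutoff (((n : ℝ) + 1)⁻¹ • z) (z.2, w)‖ ≤ A * (‖z‖ + ‖w‖) :=
    h1.trans (mul_le_mul (hA _) (hzw z w) (norm_nonneg _) hA0)
  refine ⟨?_, by gcongr⟩
  rcases le_or_gt ‖((n : ℝ) + 1)⁻¹ • z‖ 2 with h | h
  · rw [norm_smul, norm_inv, Real.norm_of_nonneg hn.le] at h
    calc _ ≤ ((n : ℝ) + 1)⁻¹ * (A * (‖z‖ + ‖w‖)) := by gcongr
      _ = A * (((n : ℝ) + 1)⁻¹ * ‖z‖ + ((n : ℝ) + 1)⁻¹ * ‖w‖) := by ring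
      _ ≤ A * (2 + 1 * ‖w‖) := by gcongr
      _ = _ := by ring
  · have h0 : fderiv ℝ cutoff (((n : ℝ) + 1)⁻¹ • z) = 0 := by
      refine image_eq_zero_of_notMem_tsupport fun hmem => ?_
      have := tsupport_fderiv_subset ℝ hmem
      rw [cutoff.tsupport_eq] at this
      simp only [cutoff, mem_closedBall_zero_iff] at this
      linarith
    rw [h0]
    simp
    positivity

/-- Conservation of mass. -/
lemma IsGlobalSolution.integral_eq (hg : IsGlobalSolution α lam f₀ g) {t B : ℝ} (ht : 0 ≤ t)
    (hB : ∀ s ∈ Icc 0 t, ∀ x, ‖force α lam (g s) x‖ ≤ B)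
    (hc : ∀ s ∈ Icc 0 t, Continuous (force α lam (g s))) : ∫ z, g t z = ∫ z, f₀ z := by
  obtain ⟨A, hA0, hA⟩ := exists_fderiv_cutoffScaled_bound
  obtain ⟨M, hM⟩ := hg.integrable t ht
  have hlim : ∀ h : Phase → ℝ, Integrable h →
      Tendsto (fun n => ∫ z, cutoffScaled n z * h z) atTop (𝓝 (∫ z, h z)) := fun h hh => by
    refine tendsto_integral_of_dominated_convergence (fun z => ‖h z‖)
      (fun n => (contDiff_cutoffScaled n).continuous.aestronglyMeasurable.mul
        hh.aestronglyMeasurable) hh.norm (fun n => Eventually.of_forall fun z => ?_)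
      (Eventually.of_forall fun z => ?_)
    · rw [norm_mul]
      exact mul_le_of_le_one_left (norm_nonneg _) (norm_cutoffScaled_le n z)
    · simpa using (tendsto_cutoffScaled z).mul_const (h z)
  have h0 : Integrable f₀ := (hg.integrable_apply le_rfl).congr hg.initial
  have hmass : ∀ s ∈ Icc 0 t, ∫ z, ‖g s z‖ ≤ M := fun s hs => by
    rw [integral_norm_eq_lintegral_enorm (Lp.aestronglyMeasurable (g s)),
      ← eLpNorm_one_eq_lintegral_enorm]
    exact ENNReal.toReal_le_coe_of_le_coe (hM s hs.1 hs.2)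
  have hBs : ∀ s ∈ Icc 0 t, ∀ n z, ‖fderiv ℝ (cutoffScaled n) z (z.2, force α lam (g s) z.1) * g s z‖
      ≤ A * (2 + B) * ‖g s z‖ := fun s hs n z => by
    rw [norm_mul]
    refine mul_le_mul_of_nonneg_right ((hA n z _).1.trans ?_) (norm_nonneg _)
    have := hB s hs z.1
    gcongr
  -- The flux through the cutoff vanishes in the limit. Dominated convergence is used twice, in
  -- phase space with the majorant proportional to `|g s|` and then in time with the bound `M` on
  -- the mass.
  have hzero : Tendsto (fun n : ℕ => ∫ s in (0 : ℝ)..t,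
      ∫ z, fderiv ℝ (cutoffScaled n) z (z.2, force α lam (g s) z.1) * g s z) atTop (𝓝 0) := by
    have h1 := intervalIntegral.tendsto_integral_filter_of_dominated_convergence (μ := volume)
      (a := 0) (b := t) (l := atTop) (F := fun (n : ℕ) s =>
        ∫ z, fderiv ℝ (cutoffScaled n) z (z.2, force α lam (g s) z.1) * g s z) (f := fun _ => 0)
      (fun _ => A * (2 + B) * M)
      (Eventually.of_forall fun n => by
        have := (hg.equation _ (contDiff_cutoffScaled n) (hasCompactSupport_cutoffScaled n) t
          ht).1.aestronglyMeasurable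
        rwa [uIoc_of_le ht])
      (Eventually.of_forall fun n => Eventually.of_forall fun s hs => ?_)
      (by simp) (Eventually.of_forall fun s hs => ?_)
    · simpa using h1
    · rw [uIoc_of_le ht] at hs
      have hs' : s ∈ Icc 0 t := ⟨hs.1.le, hs.2⟩
      have hB0 : 0 ≤ B := (norm_nonneg _).trans (hB s hs' 0)
      have hi := (hg.integrable_apply hs'.1).norm.const_mul (A * (2 + B))
      refine (norm_integral_le_of_norm_le hi (Eventually.of_forall (hBs s hs' n))).trans ?_
      rw [integral_const_mul]
      have := hmass s hs'
      gcongr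
    · rw [uIoc_of_le ht] at hs
      have hs' : s ∈ Icc 0 t := ⟨hs.1.le, hs.2⟩
      have hi := (hg.integrable_apply hs'.1).norm.const_mul (A * (2 + B))
      have e0 : (0 : ℝ) = ∫ z : Phase, (0 : ℝ) := by simp
      rw [e0]
      refine tendsto_integral_of_dominated_convergence (fun z => A * (2 + B) * ‖g s z‖)
        (fun n => ?_) hi (fun n => Eventually.of_forall (hBs s hs' n))
        (Eventually.of_forall fun z => ?_)
      · have h4 : Continuous fun z : Phase =>
            fderiv ℝ (cutoffScaled n) z (z.2, force α lam (g s) z.1) :=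
          ((contDiff_cutoffScaled n).continuous_fderiv (by simp)).clm_apply
            (continuous_snd.prodMk ((hc s hs').comp continuous_fst))
        exact h4.aestronglyMeasurable.mul (Lp.aestronglyMeasurable (g s))
      · have h3 : Tendsto (fun n : ℕ => ((n : ℝ) + 1)⁻¹ *
            (A * (‖z‖ + ‖force α lam (g s) z.1‖)) * ‖g s z‖) atTop (𝓝 0) := by
          simpa using (tendsto_inv_add_one.mul_const
            (A * (‖z‖ + ‖force α lam (g s) z.1‖))).mul_const ‖g s z‖
        refine squeeze_zero_norm (fun n => ?_) h3
        rw [norm_mul]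
        exact mul_le_mul_of_nonneg_right (hA n z _).2 (norm_nonneg _)
  have h3 : Tendsto (fun n => ∫ z, cutoffScaled n z * g t z) atTop (𝓝 ((∫ z, f₀ z) + 0)) := by
    refine ((hlim f₀ h0).add hzero).congr fun n => ?_
    exact (hg.equation _ (contDiff_cutoffScaled n) (hasCompactSupport_cutoffScaled n) t ht).2.symm
  rw [add_zero] at h3
  exact tendsto_nhds_unique (hlim _ (hg.integrable_apply ht)) h3

lemma IsGlobalSolution.dataMeasure_univ (hg : IsGlobalSolution α lam f₀ g) {T : ℝ} (hT : 0 ≤ T) :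
    ∃ M : ℝ≥0, ∀ t ∈ Icc 0 T, (dataMeasure (g t)).map Prod.fst univ ≤ ENNReal.ofReal M := by
  obtain ⟨M, hM⟩ := hg.integrable T hT
  refine ⟨M, fun t ht => ?_⟩
  rw [Measure.map_apply measurable_fst .univ, preimage_univ, dataMeasure,
    withDensity_apply _ .univ, setLIntegral_univ, ← eLpNorm_one_eq_lintegral_enorm,
    ENNReal.ofReal_coe_nnreal]
  exact hM t ht.1 ht.2

variable {T : ℝ} {N : ℝ≥0}

lemma IsGlobalSolution.exists_force_bound (hα0 : 0 < α) (hα1 : α < 1)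
    (hg : IsGlobalSolution α lam f₀ g) (hT : 0 ≤ T)
    (hN : ∀ t ∈ Icc 0 T, eLpNorm (density (g t)) ∞ volume ≤ N) :
    ∃ B : ℝ, ∀ t ∈ Icc 0 T, (∀ x, ‖force α lam (g t) x‖ ≤ B) ∧ Continuous (force α lam (g t)) := by
  obtain ⟨M, hM⟩ := hg.dataMeasure_univ hT
  obtain ⟨C, hC, h⟩ := exists_field_bounds α lam hα0 hα1
  obtain ⟨h1, h2⟩ := h N M N.coe_nonneg M.coe_nonneg 1 one_pos
  simp only [Real.one_rpow, mul_one] at h1 h2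
  refine ⟨C * (N + M), fun t ht => ?_⟩
  have e1 : force α lam (g t) = field α lam ((dataMeasure (g t)).map Prod.fst) :=
    funext fun x => force_eq_field hα0 (hg.integrable_apply ht.1) (hg.nonneg t ht.1) x
  have hν := map_fst_dataMeasure_le (hg.integrable_apply ht.1) (hg.nonneg t ht.1) (hN t ht)
  rw [e1]
  refine ⟨h1 _ hν (hM t ht), LipschitzWith.continuous (K := (C * (N + M)).toNNReal)
    (LipschitzWith.of_dist_le_mul fun x y => ?_)⟩
  rw [dist_eq_norm, dist_eq_norm, Real.coe_toNNReal _ (by positivity)]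
  have := h2 R3 _ (hM t ht) id id measurable_id measurable_id (by simpa using hν)
    (by simpa using hν) x y ‖x - y‖ (norm_nonneg _) (fun z => by simp)
  simp only [Measure.map_id] at this
  linarith

/-- A global solution with locally bounded density is continuous in time with values in `L^1`. -/
lemma IsGlobalSolution.continuousOn_integral {G : Type*} [NormedAddCommGroup G] [NormedSpace ℝ G]
    (hα0 : 0 < α) (hα1 : α < 1) (hg : IsGlobalSolution α lam f₀ g) (hT : 0 ≤ T)
    (hN : ∀ t ∈ Icc 0 T, eLpNorm (density (g t)) ∞ volume ≤ N) {ψ : Phase → G} (hψ : Continuous ψ)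
    {b : ℝ} (hb : ∀ z, ‖ψ z‖ ≤ b) : ContinuousOn (fun t => ∫ z, g t z • ψ z) (Icc 0 T) := by
  obtain ⟨B, hB⟩ := hg.exists_force_bound hα0 hα1 hT hN
  have hmass : ∀ t ∈ Icc 0 T, ∫ z, g t z = ∫ z, f₀ z := fun t ht =>
    hg.integral_eq ht.1 (fun s hs => (hB s ⟨hs.1, hs.2.trans ht.2⟩).1)
      (fun s hs => (hB s ⟨hs.1, hs.2.trans ht.2⟩).2)
  have hb0 : 0 ≤ b := (norm_nonneg _).trans (hb 0)
  have hi : ∀ t ∈ Icc 0 T, Integrable fun z => g t z • ψ z := fun t ht =>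
    (hg.integrable_apply ht.1).smul_bdd b hψ.aestronglyMeasurable (Eventually.of_forall hb)
  intro t₀ ht₀
  rw [ContinuousWithinAt, tendsto_iff_norm_sub_tendsto_zero]
  have h1 : Tendsto (fun t => ‖g t - g t₀‖) (𝓝[Icc 0 T] t₀) (𝓝 0) := by
    have := (hg.continuousOn t₀ ht₀.1).mono (fun t ht => ht.1 : Icc 0 T ⊆ Ici 0)
    exact tendsto_iff_norm_sub_tendsto_zero.1 this
  have h2 := ((tendsto_integral_min (hg.integrable_apply ht₀.1) (hg.nonneg t₀ ht₀.1)).comp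
    h1).const_mul (b * 2)
  rw [mul_zero] at h2
  refine squeeze_zero' (Eventually.of_forall fun _ => norm_nonneg _) ?_ h2
  filter_upwards [self_mem_nhdsWithin] with t ht
  have h3 : ∀ᵐ z, |g t z - g t₀ z| ≤ ‖g t - g t₀‖ := by
    filter_upwards [ae_le_eLpNormEssSup (f := g t - g t₀) (μ := volume),
      Lp.coeFn_sub (g t) (g t₀)] with z hz hz2
    rw [← Real.norm_eq_abs, ← toReal_enorm, Lp.norm_def]
    rw [← Pi.sub_apply, ← hz2]
    exact ENNReal.toReal_mono (Lp.eLpNorm_ne_top _) (by rwa [eLpNorm_exponent_top])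
  -- Continuity in `L^∞` gives no control of mass at infinity. Together with conservation of mass it
  -- yields continuity in `L¹`, through the truncated integrals of `g t₀`.
  have h4 := integral_abs_sub_le (hg.integrable_apply ht.1) (hg.integrable_apply ht₀.1)
    (hg.nonneg t ht.1) (hg.nonneg t₀ ht₀.1) ((hmass t ht).trans (hmass t₀ ht₀).symm) h3
  have h5 : ‖(∫ z, g t z • ψ z) - ∫ z, g t₀ z • ψ z‖ ≤ ∫ z, b * |g t z - g t₀ z| := by
    rw [← integral_sub (hi t ht) (hi t₀ ht₀)]
    refine norm_integral_le_of_norm_le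
      (((hg.integrable_apply ht.1).sub (hg.integrable_apply ht₀.1)).abs.const_mul b)
      (Eventually.of_forall fun z => ?_)
    rw [← sub_smul, norm_smul, mul_comm, Real.norm_eq_abs]
    exact mul_le_mul_of_nonneg_right (hb z) (abs_nonneg _)
  rw [integral_const_mul] at h5
  refine h5.trans ?_
  simp only [Function.comp_apply]
  nlinarith

/-- Continuity in `L¹` makes the spatial densities weakly continuous in time, and the bound on the
density supplies the rest. The force of an arbitrary competitor therefore has a characteristic flow
on `[0, T]`. -/
lemma IsGlobalSolution.exists_isForce (hα0 : 0 < α) (hα1 : α < 1)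
    (hg : IsGlobalSolution α lam f₀ g) (hT : 0 ≤ T)
    (hN : ∀ t ∈ Icc 0 T, eLpNorm (density (g t)) ∞ volume ≤ N) :
    ∃ B K, IsForce (fun t => force α lam (g (clamp T t))) B K := by
  have hcl : ∀ t, clamp T t ∈ Icc 0 T := fun t => ⟨clamp_nonneg T t, clamp_le hT t⟩
  obtain ⟨M, hM⟩ := hg.dataMeasure_univ hT
  have e1 : (fun t => force α lam (g (clamp T t))) = fun t =>
      field α lam ((dataMeasure (g (clamp T t))).map Prod.fst) := by
    ext1 t
    exact funext fun x =>
      force_eq_field hα0 (hg.integrable_apply (hcl t).1) (hg.nonneg _ (hcl t).1) x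
  rw [e1]
  refine isForce_field (D := N) (M := M) hα0 hα1 N.coe_nonneg M.coe_nonneg (fun t =>
    map_fst_dataMeasure_le (hg.integrable_apply (hcl t).1) (hg.nonneg _ (hcl t).1) (hN _ (hcl t)))
    (fun t => hM _ (hcl t)) fun φ hφ hB => ?_
  obtain ⟨b, hb⟩ := hB
  have h1 := (hg.continuousOn_integral hα0 hα1 hT hN (hφ.comp continuous_fst)
    (fun z => hb z.1)).comp_continuous (continuous_clamp T) hcl
  refine h1.congr fun t => ?_
  rw [integral_map measurable_fst.aemeasurable hφ.aestronglyMeasurable, dataMeasure,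
    integral_withDensity_eq_integral_toReal_smul₀ (Lp.aestronglyMeasurable _).enorm
      (Eventually.of_forall fun _ => enorm_lt_top)]
  refine integral_congr_ae ?_
  filter_upwards [hg.nonneg _ (hcl t).1] with z hz
  rw [toReal_enorm, Real.norm_of_nonneg hz]
  rfl

/-- With its own force regarded as given, `g` solves a linear continuity equation, and so does `F`
transported by the flow of that force. The difference is a bounded weak solution with zero initial
data, hence vanishes. -/
theorem IsGlobalSolution.exists_flow {F : Phase → ℝ} {L : ℝ≥0} {D : ℝ} (hα0 : 0 < α) (hα1 : α < 1)
    (hg : IsGlobalSolution α lam f₀ g) (hF : IsData F L D) (h0 : f₀ =ᵐ[volume] F) (hT : 0 ≤ T)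
    (hN : ∀ t ∈ Icc 0 T, eLpNorm (density (g t)) ∞ volume ≤ N) :
    ∃ E Y B K, IsForce E B K ∧ IsFlow E Y ∧
      (∀ t ∈ Icc 0 T, g t =ᵐ[volume] fun z => F (flowInv Y t z)) ∧
      (∀ t ∈ Icc 0 T, E t = field α lam ((dataMeasure F).map fun z => (Y t z).1)) ∧
      ∀ t ∈ Icc 0 T, (dataMeasure F).map (fun z => (Y t z).1) ≤ ENNReal.ofReal N • volume := by
  obtain ⟨B, K, hE⟩ := hg.exists_isForce hα0 hα1 hT hN
  obtain ⟨Y, hY⟩ := hE.exists_flow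
  set E : ℝ → R3 → R3 := fun t => force α lam (g (clamp T t)) with hEdef
  have hcl : ∀ t, clamp T t ∈ Icc 0 T := fun t => ⟨clamp_nonneg T t, clamp_le hT t⟩
  have hEt : ∀ t ∈ Icc 0 T, E t = force α lam (g t) := fun t ht => by
    simp only [hEdef, clamp_eq ht]
  obtain ⟨A, hA⟩ := hF.exists_bound
  obtain ⟨G, hG⟩ := isCompact_Icc.exists_bound_of_continuousOn
    (hg.continuousOn.mono (fun t ht => ht.1 : Icc 0 T ⊆ Ici 0))
  have hFm := hF.lip.continuous.aestronglyMeasurable (μ := (volume : Measure Phase))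
  have hFb : ∀ᵐ z, ‖F z‖ ≤ A := Eventually.of_forall hA
  have hgb : ∀ t ∈ Icc 0 T, ∀ᵐ z, ‖g t z‖ ≤ G := fun t ht => by
    filter_upwards [ae_le_eLpNormEssSup (f := g t) (μ := volume)] with z hz
    refine le_trans ?_ (hG t ht)
    rw [← toReal_enorm, Lp.norm_def]
    exact ENNReal.toReal_mono (Lp.eLpNorm_ne_top _) (by rwa [eLpNorm_exponent_top])
  have hFW : ∀ t ∈ Icc 0 T, Continuous fun z => F (flowInv Y t z) := fun t ht =>
    hF.lip.continuous.comp (hY.lipschitz_flowInv hE ht.1).continuous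
  let n : ℝ → Phase → ℝ := fun t z => g (clamp T t) z - F (flowInv Y (clamp T t) z)
  have hsub : ∀ t ∈ Icc 0 T, ∀ φ : Phase → ℝ, Integrable φ →
      ∫ z, φ z * n t z = (∫ z, φ z * g t z) - ∫ z, φ (Y t z) * F z := fun t ht φ hφ => by
    simp only [n, clamp_eq ht, mul_sub]
    rw [integral_sub (hφ.mul_bdd (Lp.aestronglyMeasurable _) (hgb t ht))
      (hφ.mul_bdd (hFW t ht).aestronglyMeasurable (Eventually.of_forall fun z => hA _)),
      hY.integral_comp_flowInv hE ht.1]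
  have hsol : ∀ T' ∈ Icc 0 T, IsNullWeakSol E T' (G + A) n := by
    intro T' hT'
    refine ⟨fun t => (Lp.aestronglyMeasurable _).sub (hFW _ (hcl t)).aestronglyMeasurable,
      fun t => ?_, fun φ hφ hc => ?_, fun φ hφ hc t ht => ?_⟩
    · filter_upwards [hgb _ (hcl t)] with z hz
      exact (norm_sub_le _ _).trans (add_le_add hz (hA _))
    · obtain ⟨b, hb⟩ := hc.exists_bound_of_continuous hφ
      have h1 := (hg.continuousOn_integral hα0 hα1 hT hN hφ hb).comp_continuous
        (continuous_clamp T) hcl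
      have h2 := hY.continuous_transport hE hT hφ hc hFm hFb
      refine (h1.sub h2).congr fun t => ?_
      have h3 := hsub _ (hcl t) φ (hφ.integrable_of_hasCompactSupport hc)
      have h4 : clamp T (clamp T t) = clamp T t := clamp_eq (hcl t)
      have h5 : ∫ z, g (clamp T t) z • φ z = ∫ z, φ z * g (clamp T t) z := by
        simp only [smul_eq_mul, mul_comm]
      simp only [n, h4] at h3 ⊢
      rw [h3, ← h5]
      rfl
    · have htT : t ∈ Icc 0 T := ⟨ht.1, ht.2.trans hT'.2⟩
      have hφ1 : ContDiff ℝ 1 φ := hφ.of_le (by simp)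
      obtain ⟨hi, heq⟩ := hg.equation φ hφ hc t ht.1
      have e2 : ∫ z, φ z * f₀ z = ∫ z, φ z * F z :=
        integral_congr_ae (h0.mono fun z hz => by simp only [hz])
      have hi2 : IntervalIntegrable
          (fun s => ∫ z, fderiv ℝ φ (Y s z) (phaseField E s (Y s z)) * F z) volume 0 t := by
        refine ((hY.continuous_transport_deriv hE ht.1 hφ1 hc hFm hFb).intervalIntegrable
          (μ := volume) 0 t).congr fun s hs => ?_
        rw [uIoc_of_le ht.1] at hs
        simp only [clamp_eq (show s ∈ Icc 0 t from ⟨hs.1.le, hs.2⟩)]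
      rw [hsub t htT φ (hφ.continuous.integrable_of_hasCompactSupport hc), heq,
        hY.transport hE ht.1 hφ1 hc hFm hFb, e2, add_sub_add_left_eq_sub,
        ← intervalIntegral.integral_sub hi hi2]
      refine intervalIntegral.integral_congr fun s hs => ?_
      rw [uIcc_of_le ht.1] at hs
      have hs' : s ∈ Icc 0 T := ⟨hs.1, hs.2.trans htT.2⟩
      have hcs : Continuous fun z => fderiv ℝ φ z (phaseField E s z) :=
        (continuous_fderiv_phaseField hE hφ1).comp
          (by fun_prop : Continuous fun z : Phase => (s, z))
      have his : Integrable fun z => fderiv ℝ φ z (phaseField E s z) :=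
        integrable_of_continuous_of_eq_zero hcs (hc.fderiv (𝕜 := ℝ)).isCompact fun z hz => by
          rw [image_eq_zero_of_notMem_tsupport hz]; simp
      have h5 := hsub s hs' _ his
      simp only [phaseField, hEt s hs'] at h5 ⊢
      exact h5.symm
  have hgF : ∀ t ∈ Icc 0 T, g t =ᵐ[volume] fun z => F (flowInv Y t z) := fun t ht => by
    filter_upwards [(hsol t ht).ae_eq_zero hE ht.1] with z hz
    simp only [n, clamp_eq ht] at hz
    linarith
  have hmap : ∀ t ∈ Icc 0 T, (dataMeasure (g t)).map Prod.fst =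
      (dataMeasure F).map fun z => (Y t z).1 := fun t ht => by
    have e1 : dataMeasure (g t) = (dataMeasure F).map (Y t) := by
      rw [← hY.withDensity_comp_flowInv hE ht.1]
      exact withDensity_congr_ae ((hgF t ht).mono fun z hz => by simp only [hz])
    rw [e1, Measure.map_map measurable_fst (hY.lipschitz hE ht.1).continuous.measurable]
    rfl
  refine ⟨E, Y, B, K, hE, hY, hgF, fun t ht => ?_, fun t ht => ?_⟩
  · rw [hEt t ht, ← hmap t ht]
    exact funext fun x =>
      force_eq_field hα0 (hg.integrable_apply ht.1) (hg.nonneg t ht.1) x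
  · rw [← hmap t ht]
    exact map_fst_dataMeasure_le (hg.integrable_apply ht.1) (hg.nonneg t ht.1) (hN t ht)

end

end

section

/-! ### Backward estimates for dispersive flows -/

lemma integral_one_add_rpow_le' {α a t : ℝ} (hα : 0 < α) (ha : 0 ≤ a) (hat : a ≤ t) :
    ∫ s in a..t, (1 + s) ^ (-(1 + α)) ≤ 1 / α := by
  refine le_trans ?_ (integral_one_add_rpow_le hα (ha.trans hat))
  have hc : ∀ b : ℝ, 0 ≤ b → ContinuousOn (fun s : ℝ => (1 + s) ^ (-(1 + α))) (uIcc 0 b) := by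
    intro b hb
    rw [uIcc_of_le hb]
    refine ContinuousOn.rpow_const (by fun_prop) fun s hs => Or.inl ?_
    linarith [hs.1]
  refine intervalIntegral.integral_mono_interval ha hat le_rfl ?_
    (hc t (ha.trans hat)).intervalIntegrable
  refine (ae_restrict_iff' measurableSet_Ioc).2 (Eventually.of_forall fun s hs => ?_)
  have : 0 < 1 + s := by linarith [hs.1]
  simp only [Pi.zero_apply]
  positivity

lemma norm_integral_le_of_decay' {α a t c : ℝ} (hα : 0 < α) (ha : 0 ≤ a) (hat : a ≤ t) (hc : 0 ≤ c)
    {g : ℝ → R3} (h : ∀ s ∈ Icc a t, ‖g s‖ ≤ c * (1 + s) ^ (-(1 + α))) :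
    ‖∫ s in a..t, g s‖ ≤ c / α := by
  have hcont : ContinuousOn (fun s : ℝ => c * (1 + s) ^ (-(1 + α))) (uIcc a t) := by
    rw [uIcc_of_le hat]
    refine continuousOn_const.mul (ContinuousOn.rpow_const (by fun_prop) fun s hs => Or.inl ?_)
    linarith [hs.1]
  have h1 := intervalIntegral.norm_integral_le_of_norm_le (μ := volume) (f := g) hat
    (Eventually.of_forall fun s hs => h s ⟨hs.1.le, hs.2⟩) hcont.intervalIntegrable
  rw [intervalIntegral.integral_const_mul] at h1
  refine h1.trans ?_
  have := integral_one_add_rpow_le' hα ha hat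
  calc _ ≤ c * (1 / α) := by gcongr
    _ = c / α := by ring

/-- A Gronwall-type estimate, backwards in time. -/
lemma norm_le_of_backward {α κ t c m : ℝ} (hα : 0 < α) (hκ : 0 ≤ κ) (hκα : κ ≤ α / 8) (hc : 0 ≤ c)
    (hm : 0 ≤ m) {p : ℝ → ℝ} (hp : AntitoneOn p (Icc 0 t)) (hp0 : ∀ s ∈ Icc 0 t, 0 ≤ p s)
    {x A : ℝ → R3} (hx : ∀ s ∈ Icc 0 t, ‖x s‖ ≤ c * p s + ‖∫ r in s..t, (r - s) • A r‖)
    (hA : ∀ s ∈ Icc 0 t, ‖A s‖ ≤ κ * (1 + s) ^ (-(2 + α)) * ‖x s‖)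
    (hxm : ∀ s ∈ Icc 0 t, ‖x s‖ ≤ m * p s) : ∀ s ∈ Icc 0 t, ‖x s‖ ≤ 8 / 7 * c * p s := by
  -- One pass turns a bound `M * p s` into `(c + M / 8) * p s`, because `κ / α ≤ 1 / 8` and the
  -- weight at later times is at most `p s`. The fixed point of `M ↦ c + M / 8` is `8 / 7 * c`; the
  -- a priori bound `m` only starts the iteration.
  have hiter : ∀ n : ℕ, ∀ s ∈ Icc 0 t, ‖x s‖ ≤ (8 / 7 * c + m * (1 / 8) ^ n) * p s := by
    intro n
    induction n with
    | zero =>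
      intro s hs
      refine (hxm s hs).trans (mul_le_mul_of_nonneg_right ?_ (hp0 s hs))
      simp only [pow_zero, mul_one]
      linarith
    | succ n ih =>
      intro s hs
      have hM : 0 ≤ 8 / 7 * c + m * (1 / 8) ^ n := by positivity
      have hps := hp0 s hs
      have h1 : ‖∫ r in s..t, (r - s) • A r‖ ≤
          (κ * ((8 / 7 * c + m * (1 / 8) ^ n) * p s)) / α := by
        refine norm_integral_le_of_decay' hα hs.1 hs.2 (by positivity) fun r hr => ?_
        have hr' : r ∈ Icc 0 t := ⟨hs.1.trans hr.1, hr.2⟩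
        have hr1 : 0 < 1 + r := by linarith [hr'.1]
        rw [norm_smul, Real.norm_of_nonneg (by linarith [hr.1])]
        calc (r - s) * ‖A r‖ ≤ (1 + r) * (κ * (1 + r) ^ (-(2 + α)) * ((8 / 7 * c +
              m * (1 / 8) ^ n) * p s)) := by
              have h2 : ‖x r‖ ≤ (8 / 7 * c + m * (1 / 8) ^ n) * p s :=
                (ih r hr').trans (mul_le_mul_of_nonneg_left (hp hs hr' hr.1) hM)
              have h3 := hA r hr'
              refine mul_le_mul (by linarith [hs.1]) (h3.trans ?_) (norm_nonneg _) hr1.le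
              gcongr
          _ = _ := by
              rw [← one_add_mul_rpow hr'.1 α]
              ring
      refine (hx s hs).trans ?_
      have h4 : (κ * ((8 / 7 * c + m * (1 / 8) ^ n) * p s)) / α ≤
          1 / 8 * ((8 / 7 * c + m * (1 / 8) ^ n) * p s) := by
        rw [div_le_iff₀ hα]
        have : 0 ≤ (8 / 7 * c + m * (1 / 8) ^ n) * p s := by positivity
        nlinarith
      calc _ ≤ c * p s + 1 / 8 * ((8 / 7 * c + m * (1 / 8) ^ n) * p s) := by linarith
        _ = _ := by rw [pow_succ]; ring
  intro s hs
  have h1 : Tendsto (fun n : ℕ => (8 / 7 * c + m * (1 / 8) ^ n) * p s) atTop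
      (𝓝 ((8 / 7 * c + m * 0) * p s)) :=
    (((tendsto_pow_atTop_nhds_zero_of_lt_one (r := (1 / 8 : ℝ)) (by norm_num)
      (by norm_num)).const_mul m).const_add _).mul_const _
  rw [mul_zero, add_zero] at h1
  exact ge_of_tendsto' h1 fun n => hiter n s hs

variable {E : ℝ → R3 → R3} {B K : ℝ≥0} {Z : ℝ → Phase → Phase}

lemma IsFlow.continuous_force_max (hZ : IsFlow E Z) (hE : IsForce E B K) (z : Phase) :
    Continuous fun s => E (max s 0) (Z (max s 0) z).1 :=
  hE.continuous_comp (by fun_prop) (hZ.continuous_position_max hE z)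

lemma IsFlow.intervalIntegrable_smul_force (hZ : IsFlow E Z) (hE : IsForce E B K) (z : Phase)
    (c : ℝ) {a b : ℝ} (ha : 0 ≤ a) (hb : 0 ≤ b) :
    IntervalIntegrable (fun r => (r - c) • E r (Z r z).1) volume a b := by
  refine intervalIntegrable_of_max (g := fun r => (r - c) • E r (Z r z).1) ?_ ha hb
  exact Continuous.smul (f := fun s => max s 0 - c) (by fun_prop) (hZ.continuous_force_max hE z)

/-- Taylor's formula at the final time with integral remainder: the derivative of `X(r) - (r - s)
V(r)` is minus the integrand. -/
lemma IsFlow.position_backward (hZ : IsFlow E Z) (hE : IsForce E B K) {s t : ℝ} (hs : s ∈ Icc 0 t)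
    (z : Phase) : (Z s z).1 = (Z t z).1 - (t - s) • (Z t z).2 +
      ∫ r in s..t, (r - s) • E r (Z r z).1 := by
  have h1 : ∀ r ∈ uIcc s t, HasDerivAt (fun r => (Z r z).1 - (r - s) • (Z r z).2)
      (-((r - s) • E r (Z r z).1)) r := fun r hr => by
    rw [uIcc_of_le hs.2] at hr
    have hd := hZ.deriv z r (hs.1.trans hr.1)
    have d1 : HasDerivAt (fun r => (Z r z).1) (Z r z).2 r :=
      (hasFDerivAt_fst (𝕜 := ℝ) (E := R3) (F := R3)).comp_hasDerivAt r hd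
    have d2 : HasDerivAt (fun r => (Z r z).2) (E r (Z r z).1) r :=
      (hasFDerivAt_snd (𝕜 := ℝ) (E := R3) (F := R3)).comp_hasDerivAt r hd
    refine (d1.sub (((hasDerivAt_id r).sub_const s).smul d2)).congr_deriv ?_
    simp
  have h2 := intervalIntegral.integral_eq_sub_of_hasDerivAt h1
    (hZ.intervalIntegrable_smul_force hE z s hs.1 (hs.1.trans hs.2)).neg
  rw [intervalIntegral.integral_neg, sub_self, zero_smul, sub_zero] at h2
  rw [neg_eq_iff_eq_neg] at h2
  rw [h2]
  abel

lemma IsFlow.position_sub_backward (hZ : IsFlow E Z) (hE : IsForce E B K) {s t : ℝ} (hs : s ∈ Icc 0 t) (a b : Phase) :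
    (Z s a).1 - (Z s b).1 = (Z t a).1 - (Z t b).1 - (t - s) • ((Z t a).2 - (Z t b).2) +
      ∫ r in s..t, (r - s) • (E r (Z r a).1 - E r (Z r b).1) := by
  have h0 := hs.1.trans hs.2
  have e1 : ∫ r in s..t, (r - s) • (E r (Z r a).1 - E r (Z r b).1) =
      (∫ r in s..t, (r - s) • E r (Z r a).1) - ∫ r in s..t, (r - s) • E r (Z r b).1 := by
    rw [← intervalIntegral.integral_sub (hZ.intervalIntegrable_smul_force hE a s hs.1 h0)
      (hZ.intervalIntegrable_smul_force hE b s hs.1 h0)]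
    simp only [smul_sub]
  rw [hZ.position_backward hE hs a, hZ.position_backward hE hs b, e1, smul_sub]
  abel
/-- The force differences along two trajectories, as seen backwards in time. -/
lemma IsFlow.norm_position_sub_backward_le {α κ t : ℝ} (hα : 0 < α) (hκ : 0 ≤ κ) (hκα : κ ≤ α / 8)
    (hZ : IsFlow E Z) (hE : IsForce E B K)
    (hlip : ∀ t, 0 ≤ t → ∀ x y, ‖E t x - E t y‖ ≤ κ * (1 + t) ^ (-(2 + α)) * ‖x - y‖)
    {a b : Phase} {c m : ℝ} (hc : 0 ≤ c) (hm : 0 ≤ m) {p : ℝ → ℝ} (hp : AntitoneOn p (Icc 0 t))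
    (hp0 : ∀ s ∈ Icc 0 t, 0 ≤ p s)
    (hend : ∀ s ∈ Icc 0 t,
      ‖(Z t a).1 - (Z t b).1 - (t - s) • ((Z t a).2 - (Z t b).2)‖ ≤ c * p s)
    (hmp : ∀ s ∈ Icc 0 t, (t - s) * (2 * B * t) ≤ m * p s) :
    ∀ s ∈ Icc 0 t, ‖(Z s a).1 - (Z s b).1‖ ≤ 8 / 7 * c * p s := by
  refine norm_le_of_backward (m := c + m) hα hκ hκα hc (by positivity) hp hp0
    (A := fun r => E r (Z r a).1 - E r (Z r b).1) (fun s hs => ?_)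
    (fun s hs => hlip s hs.1 _ _) fun s hs => ?_
  · rw [hZ.position_sub_backward hE hs a b]
    exact (norm_add_le _ _).trans (by linarith [hend s hs])
  · rw [hZ.position_sub_backward hE hs a b]
    refine (norm_add_le _ _).trans ?_
    have h1 : ‖∫ r in s..t, (r - s) • (E r (Z r a).1 - E r (Z r b).1)‖ ≤ (t * (2 * B)) * |t - s| := by
      refine intervalIntegral.norm_integral_le_of_norm_le_const fun r hr => ?_
      rw [uIoc_of_le hs.2] at hr
      rw [norm_smul, Real.norm_of_nonneg (by linarith [hr.1])]
      have h2 := hE.bound r (Z r a).1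
      have h3 := hE.bound r (Z r b).1
      have h4 := norm_sub_le (E r (Z r a).1) (E r (Z r b).1)
      exact mul_le_mul (by linarith [hr.2, hs.1]) (by linarith) (norm_nonneg _) (hs.1.trans hs.2)
    rw [abs_of_nonneg (by linarith [hs.2])] at h1
    have := hend s hs
    have := hmp s hs
    nlinarith

/-! ### Separation of trajectories with a common final velocity or a common final position -/

section

variable {α κ t : ℝ}

lemma rpow_neg_two_le {s : ℝ} (hs : 0 ≤ s) : (1 + s) ^ (-(2 + α)) ≤ (1 + s) ^ (-(1 + α)) :=
  Real.rpow_le_rpow_of_exponent_le (by linarith) (by linarith)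

lemma IsFlow.norm_velocity_sub_backward_le (hα : 0 < α) (hκ : 0 ≤ κ) (hκα : κ ≤ α / 8)
    (hZ : IsFlow E Z) (hE : IsForce E B K)
    (hlip : ∀ t, 0 ≤ t → ∀ x y, ‖E t x - E t y‖ ≤ κ * (1 + t) ^ (-(2 + α)) * ‖x - y‖)
    (ht : 0 ≤ t) {a b : Phase} {c : ℝ} (hc : 0 ≤ c)
    (h : ∀ s ∈ Icc 0 t, ‖(Z s a).1 - (Z s b).1‖ ≤ c) :
    ‖(a.2 - b.2) - ((Z t a).2 - (Z t b).2)‖ ≤ c / 8 := by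
  have e1 : (a.2 - b.2) - ((Z t a).2 - (Z t b).2) =
      -∫ r in (0 : ℝ)..t, (E r (Z r a).1 - E r (Z r b).1) := by
    rw [hZ.velocity_eq hE ht a, hZ.velocity_eq hE ht b, intervalIntegral.integral_sub
      (hZ.intervalIntegrable_force hE a le_rfl ht) (hZ.intervalIntegrable_force hE b le_rfl ht)]
    abel
  rw [e1, norm_neg]
  refine (norm_integral_le_of_decay hα ht (mul_nonneg hκ hc) fun r hr => ?_).trans ?_
  · have hr0 : 0 < 1 + r := by linarith [hr.1]
    calc _ ≤ κ * (1 + r) ^ (-(2 + α)) * ‖(Z r a).1 - (Z r b).1‖ := hlip r hr.1 _ _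
      _ ≤ κ * (1 + r) ^ (-(1 + α)) * c := by
          have := h r hr
          have := rpow_neg_two_le (α := α) hr.1
          gcongr
      _ = _ := by ring
  · rw [div_le_iff₀ hα]
    nlinarith

/-- With equal final velocities the free flow backwards keeps distances constant, so the weight is
`1`. Positions stay within `8 / 7` and velocities within `1 / 7` of the final distance. The constant
does not depend on `t`, which is what keeps the gradient of the density at the same rate as the
density. -/
lemma IsFlow.norm_sub_le_of_position (hα : 0 < α) (hκ : 0 ≤ κ) (hκα : κ ≤ α / 8)
    (hZ : IsFlow E Z) (hE : IsForce E B K)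
    (hlip : ∀ t, 0 ≤ t → ∀ x y, ‖E t x - E t y‖ ≤ κ * (1 + t) ^ (-(2 + α)) * ‖x - y‖)
    (ht : 0 ≤ t) {a b : Phase} (hab : (Z t a).2 = (Z t b).2) :
    ‖a - b‖ ≤ 2 * ‖(Z t a).1 - (Z t b).1‖ := by
  set d := ‖(Z t a).1 - (Z t b).1‖ with hd
  have hd0 : 0 ≤ d := norm_nonneg _
  have h1 := hZ.norm_position_sub_backward_le (t := t) (a := a) (b := b) (c := d)
    (m := t * (2 * B * t)) (p := fun _ => 1) hα hκ hκα hE hlip hd0 (by positivity)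
    (antitone_const.antitoneOn _) (by simp) (fun s hs => by simp [hab, hd]) (fun s hs => by
      rw [mul_one]
      have : t - s ≤ t := by linarith [hs.1]
      gcongr)
  have h2 := hZ.norm_velocity_sub_backward_le hα hκ hκα hE hlip ht (a := a) (b := b)
    (c := 8 / 7 * d) (by positivity) (fun s hs => by simpa using h1 s hs)
  rw [hab, sub_self, sub_zero] at h2
  have h3 := h1 0 ⟨le_rfl, ht⟩
  rw [hZ.zero, hZ.zero, mul_one] at h3
  refine norm_prod_le_iff.2 ⟨?_, ?_⟩
  · rw [Prod.fst_sub]; linarith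
  · rw [Prod.snd_sub]; linarith

/-- With equal final positions the free flow backwards separates linearly, hence the weight `t - s`,
which vanishes at the final time. -/
lemma IsFlow.norm_position_sub_of_velocity (hα : 0 < α) (hκ : 0 ≤ κ) (hκα : κ ≤ α / 8)
    (hZ : IsFlow E Z) (hE : IsForce E B K)
    (hlip : ∀ t, 0 ≤ t → ∀ x y, ‖E t x - E t y‖ ≤ κ * (1 + t) ^ (-(2 + α)) * ‖x - y‖)
    {a b : Phase} (hab : (Z t a).1 = (Z t b).1) : ∀ s ∈ Icc 0 t,
    ‖(Z s a).1 - (Z s b).1‖ ≤ 8 / 7 * ‖(Z t a).2 - (Z t b).2‖ * (t - s) := by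
  intro s hs
  have ht : 0 ≤ t := hs.1.trans hs.2
  refine hZ.norm_position_sub_backward_le (t := t) (a := a) (b := b)
    (m := 2 * B * t) (p := fun s => t - s) hα hκ hκα hE hlip (norm_nonneg _) (by positivity)
    (fun x _ y _ hxy => by dsimp only; linarith) (fun s hs => by linarith [hs.2]) (fun s hs => ?_)
    (fun s hs => by rw [mul_comm]) s hs
  rw [hab, sub_self, zero_sub, norm_neg, norm_smul, Real.norm_of_nonneg (by linarith [hs.2]),
    mul_comm]

/-- The initial positions differ by `t` times the final velocity difference, up to an error from the
force of at most `1 / 7` of this amount. So the velocity difference can be read off from the initial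
positions, which is the dispersive estimate for the inverse flow. -/
lemma IsFlow.mul_norm_velocity_sub_le (hα : 0 < α) (hκ : 0 ≤ κ) (hκα : κ ≤ α / 8)
    (hZ : IsFlow E Z) (hE : IsForce E B K)
    (hlip : ∀ t, 0 ≤ t → ∀ x y, ‖E t x - E t y‖ ≤ κ * (1 + t) ^ (-(2 + α)) * ‖x - y‖)
    (ht : 0 ≤ t) {a b : Phase} (hab : (Z t a).1 = (Z t b).1) :
    t * ‖(Z t a).2 - (Z t b).2‖ ≤ 2 * ‖a.1 - b.1‖ := by
  set d := ‖(Z t a).2 - (Z t b).2‖ with hd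
  have hd0 : 0 ≤ d := norm_nonneg _
  have h1 := hZ.norm_position_sub_of_velocity hα hκ hκα hE hlip hab
  have h2 := hZ.position_sub_backward hE (s := 0) (t := t) ⟨le_rfl, ht⟩ a b
  rw [hab, sub_self, zero_sub, hZ.zero, hZ.zero, sub_zero] at h2
  have h3 : ‖∫ r in (0 : ℝ)..t, (r - 0) • (E r (Z r a).1 - E r (Z r b).1)‖ ≤
      (κ * (8 / 7 * d * t)) / α := by
    refine norm_integral_le_of_decay hα ht (by positivity) fun r hr => ?_
    have hr0 : 0 < 1 + r := by linarith [hr.1]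
    rw [sub_zero, norm_smul, Real.norm_of_nonneg hr.1]
    calc r * ‖E r (Z r a).1 - E r (Z r b).1‖
        ≤ (1 + r) * (κ * (1 + r) ^ (-(2 + α)) * (8 / 7 * d * t)) := by
          refine mul_le_mul (by linarith) ((hlip r hr.1 _ _).trans ?_) (norm_nonneg _) hr0.le
          have h4 := h1 r hr
          have h5 : 8 / 7 * d * (t - r) ≤ 8 / 7 * d * t := by
            have : t - r ≤ t := by linarith [hr.1]
            gcongr
          have := h4.trans h5
          gcongr
      _ = _ := by
          rw [← one_add_mul_rpow hr.1 α]
          ring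
  have h4 : (κ * (8 / 7 * d * t)) / α ≤ 1 / 7 * (t * d) := by
    rw [div_le_iff₀ hα]
    have : 0 ≤ d * t := by positivity
    nlinarith
  have h5 : t * d = ‖t • ((Z t a).2 - (Z t b).2)‖ := by
    rw [norm_smul, Real.norm_of_nonneg ht]
  have h6 : t • ((Z t a).2 - (Z t b).2) = -(a.1 - b.1) +
      ∫ r in (0 : ℝ)..t, (r - 0) • (E r (Z r a).1 - E r (Z r b).1) := by
    rw [h2]; abel
  have h7 := norm_add_le (-(a.1 - b.1))
    (∫ r in (0 : ℝ)..t, (r - 0) • (E r (Z r a).1 - E r (Z r b).1))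
  rw [← h6, ← h5, norm_neg] at h7
  have : 0 ≤ t * d := by positivity
  linarith

/-- For short times the velocity difference is almost conserved, so it can be read off from the
initial velocities, where the estimate by positions degenerates. -/
lemma IsFlow.norm_velocity_sub_le_of_le_one (hα : 0 < α) (hκ : 0 ≤ κ) (hκα : κ ≤ α / 8)
    (hZ : IsFlow E Z) (hE : IsForce E B K)
    (hlip : ∀ t, 0 ≤ t → ∀ x y, ‖E t x - E t y‖ ≤ κ * (1 + t) ^ (-(2 + α)) * ‖x - y‖)
    (ht : 0 ≤ t) (ht1 : t ≤ 1) {a b : Phase} (hab : (Z t a).1 = (Z t b).1) :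
    ‖(Z t a).2 - (Z t b).2‖ ≤ 2 * ‖a.2 - b.2‖ := by
  set d := ‖(Z t a).2 - (Z t b).2‖ with hd
  have hd0 : 0 ≤ d := norm_nonneg _
  have h1 := hZ.norm_position_sub_of_velocity hα hκ hκα hE hlip hab
  have h2 := hZ.norm_velocity_sub_backward_le hα hκ hκα hE hlip ht (a := a) (b := b)
    (c := 8 / 7 * d) (by positivity) (fun s hs => by
      refine (h1 s hs).trans (mul_le_of_le_one_right (by positivity) (by linarith [hs.1])))
  have h3 := norm_sub_norm_le ((Z t a).2 - (Z t b).2) (a.2 - b.2)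
  rw [norm_sub_rev ((Z t a).2 - (Z t b).2) (a.2 - b.2)] at h3
  linarith

end

end

section

/-! ### Bounds for the density and its gradient -/

/-- The curve is only Lipschitz, so there is no chain rule. Instead the right slopes of `G ∘ γ` at
`θ` are compared with the derivative of the integral: near `γ θ` the function `G` is Lipschitz with
any constant larger than the norm of its derivative. -/
lemma sub_le_integral_fderiv {G : Phase → ℝ} (hG : ContDiff ℝ 1 G) {γ : ℝ → Phase} {l : ℝ≥0}
    (hγ : LipschitzWith l γ) :
    G (γ 1) - G (γ 0) ≤ ∫ θ in (0 : ℝ)..1, l * ‖fderiv ℝ G (γ θ)‖ := by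
  have hc : Continuous fun θ => (l : ℝ) * ‖fderiv ℝ G (γ θ)‖ :=
    continuous_const.mul ((hG.continuous_fderiv one_ne_zero).comp hγ.continuous).norm
  have h := image_le_of_liminf_slope_right_le_deriv_boundary (f := fun θ => G (γ θ)) (a := 0) (b := 1)
    (hG.continuous.comp hγ.continuous).continuousOn
    (B := fun θ => G (γ 0) + ∫ s in (0 : ℝ)..θ, l * ‖fderiv ℝ G (γ s)‖)
    (B' := fun θ => l * ‖fderiv ℝ G (γ θ)‖) (by simp)
    (continuous_const.add (intervalIntegral.continuous_primitive
      (fun a b => hc.intervalIntegrable a b) 0)).continuousOn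
    (fun θ _ => ((intervalIntegral.integral_hasDerivAt_right (hc.intervalIntegrable _ _)
      (hc.stronglyMeasurableAtFilter _ _) hc.continuousAt).const_add _).hasDerivWithinAt)
    (fun θ _ r hr => ?_) (right_mem_Icc.2 zero_le_one)
  · linarith
  · refine Eventually.frequently ?_
    set N := ‖fderiv ℝ G (γ θ)‖ with hN
    set δ : ℝ := (r - l * N) / (l + 1) with hδ
    have hδ0 : 0 < δ := div_pos (by linarith) (by positivity)
    have hlδ : l * (N + δ) < r := by
      have h1 : δ * (l + 1) = r - l * N := by rw [hδ]; field_simp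
      nlinarith
    have hK : ‖fderiv ℝ G (γ θ)‖₊ < (N + δ).toNNReal := by
      rw [← NNReal.coe_lt_coe, coe_nnnorm, Real.coe_toNNReal _ (by positivity)]
      linarith
    obtain ⟨s, hs, hL⟩ := (hG.contDiffAt.hasStrictFDerivAt
      one_ne_zero).exists_lipschitzOnWith_of_nnnorm_lt _ hK
    have h1 : ∀ᶠ z in 𝓝[>] θ, γ z ∈ s := nhdsWithin_le_nhds (hγ.continuous.continuousAt.eventually hs)
    filter_upwards [h1, self_mem_nhdsWithin] with z hz hzθ
    have hzθ' : 0 < z - θ := sub_pos.2 hzθ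
    rw [slope_def_field, div_lt_iff₀ hzθ']
    have h2 := hL.dist_le_mul _ hz _ (mem_of_mem_nhds hs)
    have h3 := hγ.dist_le_mul z θ
    rw [Real.dist_eq, Real.coe_toNNReal _ (by positivity)] at h2
    rw [Real.dist_eq z θ, abs_of_pos hzθ'] at h3
    have h4 : (N + δ) * dist (γ z) (γ θ) ≤ (N + δ) * (l * (z - θ)) := by gcongr
    have h5 := le_abs_self (G (γ z) - G (γ θ))
    nlinarith

lemma enorm_sub_le_lintegral_fderiv {G : Phase → ℝ} (hG : ContDiff ℝ 1 G) {γ : ℝ → Phase} {l : ℝ≥0}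
    (hγ : LipschitzWith l γ) :
    ‖G (γ 1) - G (γ 0)‖ₑ ≤ ∫⁻ θ in Ioc (0 : ℝ) 1, l * ‖fderiv ℝ G (γ θ)‖ₑ := by
  have h1 := sub_le_integral_fderiv hG hγ
  have h2 := sub_le_integral_fderiv hG.neg hγ
  have e1 : ∀ z, fderiv ℝ (fun x => -G x) z = -fderiv ℝ G z := fun z => fderiv_neg
  simp only [e1, norm_neg] at h2
  have h3 : ‖G (γ 1) - G (γ 0)‖ ≤ ∫ θ in (0 : ℝ)..1, l * ‖fderiv ℝ G (γ θ)‖ := by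
    rw [Real.norm_eq_abs, abs_le]
    constructor <;> linarith
  have hc : Continuous fun θ => (l : ℝ) * ‖fderiv ℝ G (γ θ)‖ :=
    continuous_const.mul ((hG.continuous_fderiv one_ne_zero).comp hγ.continuous).norm
  rw [← ofReal_norm]
  refine (ENNReal.ofReal_le_ofReal h3).trans ?_
  rw [intervalIntegral.integral_of_le zero_le_one, ofReal_integral_eq_lintegral_ofReal
    ((hc.intervalIntegrable 0 1).1) (Eventually.of_forall fun θ => by positivity)]
  refine lintegral_mono fun θ => ?_
  rw [ENNReal.ofReal_mul l.coe_nonneg, ENNReal.ofReal_coe_nnreal, ofReal_norm]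

lemma lintegral_comp_le_of_antilipschitz {S : R3 → ℝ≥0∞} (hS : Measurable S) {φ : R3 → R3}
    (hφ : Measurable φ) {c : ℝ≥0} (h : AntilipschitzWith c φ) :
    ∫⁻ v, S (φ v) ≤ (c : ℝ≥0∞) ^ 3 * ∫⁻ y, S y := by
  rw [← lintegral_map hS hφ]
  have h1 := map_le_of_antilipschitz volume h hφ
  rw [finrank_R3] at h1
  refine (lintegral_mono' h1 le_rfl).trans ?_
  rw [lintegral_smul_measure, smul_eq_mul]

/-- The geometric properties of the inverse at time `t` of a flow which is close to the free
flow. -/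
structure IsBackwardMap (t : ℝ) (W : Phase → Phase) : Prop where
  cont : Continuous W
  lip : ∀ x x' v : R3, ‖W (x, v) - W (x', v)‖ ≤ 2 * ‖x - x'‖
  position : ∀ x v v' : R3, t * ‖v - v'‖ ≤ 2 * ‖(W (x, v)).1 - (W (x, v')).1‖
  velocity : t ≤ 1 → ∀ x v v' : R3, ‖v - v'‖ ≤ 2 * ‖(W (x, v)).2 - (W (x, v')).2‖

variable {F : Phase → ℝ} {L : ℝ≥0} {D κ α lam t : ℝ} {E : ℝ → R3 → R3} {B K : ℝ≥0}
  {Z : ℝ → Phase → Phase} {W : Phase → Phase}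

lemma IsDispersiveFlow.isBackwardMap (hα : 0 < α) (hκ : 0 ≤ κ) (hκα : κ ≤ α / 8)
    (hE : IsForce E B K) (h : IsDispersiveFlow α lam F D κ E Z) (ht : 0 ≤ t) :
    IsBackwardMap t (flowInv Z t) := by
  have hZ := h.flow
  refine ⟨(hZ.lipschitz_flowInv hE ht).continuous, fun x x' v => ?_, fun x v v' => ?_,
    fun ht1 x v v' => ?_⟩
  · have := hZ.norm_sub_le_of_position hα hκ hκα hE h.lip ht (a := flowInv Z t (x, v))
      (b := flowInv Z t (x', v)) (by simp only [hZ.flow_flowInv hE ht])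
    simpa only [hZ.flow_flowInv hE ht] using this
  · have := hZ.mul_norm_velocity_sub_le hα hκ hκα hE h.lip ht (a := flowInv Z t (x, v))
      (b := flowInv Z t (x, v')) (by simp only [hZ.flow_flowInv hE ht])
    simpa only [hZ.flow_flowInv hE ht] using this
  · have := hZ.norm_velocity_sub_le_of_le_one hα hκ hκα hE h.lip ht ht1
      (a := flowInv Z t (x, v)) (b := flowInv Z t (x, v')) (by simp only [hZ.flow_flowInv hE ht])
    simpa only [hZ.flow_flowInv hE ht] using this

/-- For `t ≤ 1` the integrand is bounded by the supremum over positions and `v` is exchanged for the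
initial velocity; for `t ≥ 1` the roles are swapped. The antilipschitz constants `2` and `2 / t` are
both at most `4 / (1 + t)`, whose cube gives `64`. The lemma is used for the data and for the
derivatives of their approximations. -/
lemma IsBackwardMap.lintegral_le {V : Type*} [NormedAddCommGroup V] (hW : IsBackwardMap t W)
    (ht : 0 ≤ t) {H : Phase → V} (hH : Continuous H)
    (hV : ∫⁻ x : R3, ⨆ v : R3, ‖H (x, v)‖ₑ ≤ ENNReal.ofReal D)
    (hX : ∫⁻ v : R3, ⨆ x : R3, ‖H (x, v)‖ₑ ≤ ENNReal.ofReal D) (x : R3) :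
    ∫⁻ v, ‖H (W (x, v))‖ₑ ≤ ENNReal.ofReal (64 * (1 + t) ^ (-3 : ℝ)) * ENNReal.ofReal D := by
  have hWx : Continuous fun v : R3 => W (x, v) := hW.cont.comp (by fun_prop)
  have e3 : (1 + t) ^ (-3 : ℝ) = ((1 + t) ^ 3)⁻¹ := by
    rw [Real.rpow_neg (by positivity)]
    norm_cast
  have hbound : ∀ c : ℝ≥0, (c : ℝ) ≤ 4 / (1 + t) →
      (c : ℝ≥0∞) ^ 3 ≤ ENNReal.ofReal (64 * (1 + t) ^ (-3 : ℝ)) := fun c hc => by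
    rw [← ENNReal.ofReal_coe_nnreal, ← ENNReal.ofReal_pow c.coe_nonneg]
    refine ENNReal.ofReal_le_ofReal ?_
    calc (c : ℝ) ^ 3 ≤ (4 / (1 + t)) ^ 3 := by gcongr
      _ = _ := by rw [e3, div_pow, div_eq_mul_inv]; norm_num
  rcases le_total t 1 with h1 | h1
  · have ha : AntilipschitzWith 2 fun v : R3 => (W (x, v)).2 :=
      AntilipschitzWith.of_le_mul_dist fun v w => by
        rw [dist_eq_norm, dist_eq_norm]
        exact_mod_cast hW.velocity h1 x v w
    calc ∫⁻ v, ‖H (W (x, v))‖ₑ ≤ ∫⁻ v, (fun v' => ⨆ x' : R3, ‖H (x', v')‖ₑ) (W (x, v)).2 :=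
          lintegral_mono fun v => le_iSup (fun x' => ‖H (x', (W (x, v)).2)‖ₑ) (W (x, v)).1
      _ ≤ (2 : ℝ≥0) ^ 3 * ∫⁻ v', ⨆ x' : R3, ‖H (x', v')‖ₑ :=
          lintegral_comp_le_of_antilipschitz (measurable_iSup_slice' hH) hWx.snd.measurable ha
      _ ≤ _ := mul_le_mul' (hbound 2 (by
          rw [le_div_iff₀ (by positivity)]; push_cast; linarith)) hX
  · have htp : 0 < t := by linarith
    have ha : AntilipschitzWith (2 / t).toNNReal fun v : R3 => (W (x, v)).1 :=
      AntilipschitzWith.of_le_mul_dist fun v w => by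
        rw [dist_eq_norm, dist_eq_norm, Real.coe_toNNReal _ (by positivity), div_mul_eq_mul_div,
          le_div_iff₀ htp, mul_comm]
        exact hW.position x v w
    calc ∫⁻ v, ‖H (W (x, v))‖ₑ ≤ ∫⁻ v, (fun x' => ⨆ v' : R3, ‖H (x', v')‖ₑ) (W (x, v)).1 :=
          lintegral_mono fun v => le_iSup (fun v' => ‖H ((W (x, v)).1, v')‖ₑ) (W (x, v)).2
      _ ≤ ((2 / t).toNNReal : ℝ≥0∞) ^ 3 * ∫⁻ x', ⨆ v' : R3, ‖H (x', v')‖ₑ :=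
          lintegral_comp_le_of_antilipschitz (measurable_iSup_slice hH) hWx.fst.measurable ha
      _ ≤ _ := mul_le_mul' (hbound _ (by
          rw [Real.coe_toNNReal _ (by positivity), div_le_div_iff₀ htp (by positivity)]
          linarith)) hV

/-- The two points are joined by the image under `W` of the segment from `x'` to `x` at fixed `v`, a
curve of speed at most `2 * ‖x - x'‖`. After exchanging the integrals, `IsBackwardMap.lintegral_le`
applies at each point of the segment. -/
lemma IsBackwardMap.lintegral_sub_le_of_contDiff (hW : IsBackwardMap t W) (ht : 0 ≤ t)
    {G : Phase → ℝ} (hG : ContDiff ℝ 1 G)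
    (hV : ∫⁻ x : R3, ⨆ v : R3, ‖fderiv ℝ G (x, v)‖ₑ ≤ ENNReal.ofReal D)
    (hX : ∫⁻ v : R3, ⨆ x : R3, ‖fderiv ℝ G (x, v)‖ₑ ≤ ENNReal.ofReal D) (x x' : R3) :
    ∫⁻ v, ‖G (W (x, v)) - G (W (x', v))‖ₑ ≤
      ENNReal.ofReal (2 * ‖x - x'‖) *
        (ENNReal.ofReal (64 * (1 + t) ^ (-3 : ℝ)) * ENNReal.ofReal D) := by
  have hGc : Continuous (fderiv ℝ G) := hG.continuous_fderiv one_ne_zero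
  let l : ℝ≥0 := (2 * ‖x - x'‖).toNNReal
  let γ : R3 → ℝ → Phase := fun v θ => W (x' + θ • (x - x'), v)
  have hγ : ∀ v, LipschitzWith l (γ v) := fun v => LipschitzWith.of_dist_le_mul fun θ θ' => by
    rw [dist_eq_norm, dist_eq_norm, Real.coe_toNNReal _ (by positivity)]
    refine (hW.lip _ _ v).trans (le_of_eq ?_)
    rw [add_sub_add_left_eq_sub, ← sub_smul, norm_smul]
    ring
  have hm : Measurable fun p : R3 × ℝ => (l : ℝ≥0∞) * ‖fderiv ℝ G (γ p.1 p.2)‖ₑ := by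
    have : Continuous fun p : R3 × ℝ => fderiv ℝ G (γ p.1 p.2) :=
      hGc.comp (hW.cont.comp (by fun_prop))
    exact this.enorm.measurable.const_mul _
  calc ∫⁻ v, ‖G (W (x, v)) - G (W (x', v))‖ₑ
      ≤ ∫⁻ v, ∫⁻ θ in Ioc (0 : ℝ) 1, l * ‖fderiv ℝ G (γ v θ)‖ₑ := by
        refine lintegral_mono fun v => ?_
        have := enorm_sub_le_lintegral_fderiv hG (hγ v)
        simpa only [γ, one_smul, zero_smul, add_zero, add_sub_cancel] using this
    _ = ∫⁻ θ in Ioc (0 : ℝ) 1, ∫⁻ v, l * ‖fderiv ℝ G (γ v θ)‖ₑ :=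
        lintegral_lintegral_swap hm.aemeasurable
    _ ≤ ∫⁻ _θ in Ioc (0 : ℝ) 1, l * (ENNReal.ofReal (64 * (1 + t) ^ (-3 : ℝ)) *
          ENNReal.ofReal D) := by
        refine lintegral_mono fun θ => ?_
        rw [lintegral_const_mul' _ _ ENNReal.coe_ne_top]
        exact mul_le_mul' le_rfl (hW.lintegral_le ht hGc hV hX _)
    _ = _ := by
        rw [setLIntegral_const]
        simp [l, ENNReal.ofReal]

/-- The smooth approximations of `F` are only uniformly close, and a uniform error is not integrable
in `v`. Hence the limit is taken on balls, with error `2 * ε` times the volume, and the balls are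
exhausted afterwards. -/
lemma IsBackwardMap.lintegral_sub_le (hW : IsBackwardMap t W) (ht : 0 ≤ t) (hF : IsData F L D)
    (x x' : R3) : ∫⁻ v, ‖F (W (x, v)) - F (W (x', v))‖ₑ ≤
      ENNReal.ofReal (2 * ‖x - x'‖) *
        (ENNReal.ofReal (64 * (1 + t) ^ (-3 : ℝ)) * ENNReal.ofReal D) := by
  set Q := ENNReal.ofReal (2 * ‖x - x'‖) *
        (ENNReal.ofReal (64 * (1 + t) ^ (-3 : ℝ)) * ENNReal.ofReal D) with hQ
  have hball : ∀ R : ℕ, ∫⁻ v in Metric.ball (0 : R3) R, ‖F (W (x, v)) - F (W (x', v))‖ₑ ≤ Q := by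
    intro R
    have hfin : volume (Metric.ball (0 : R3) R) < ∞ := measure_ball_lt_top
    have h1 : ∀ ε : ℝ, 0 < ε → ∫⁻ v in Metric.ball (0 : R3) R, ‖F (W (x, v)) - F (W (x', v))‖ₑ ≤
        Q + ENNReal.ofReal (2 * ε) * volume (Metric.ball (0 : R3) R) := fun ε hε => by
      obtain ⟨G, hG, hGF, hV, hX⟩ := hF.approx ε hε
      have hGm : Continuous fun v : R3 => G (W (x, v)) - G (W (x', v)) :=
        (hG.continuous.comp (hW.cont.comp (by fun_prop))).sub
          (hG.continuous.comp (hW.cont.comp (by fun_prop)))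
      calc ∫⁻ v in Metric.ball (0 : R3) R, ‖F (W (x, v)) - F (W (x', v))‖ₑ
          ≤ ∫⁻ v in Metric.ball (0 : R3) R,
              (‖G (W (x, v)) - G (W (x', v))‖ₑ + ENNReal.ofReal (2 * ε)) := by
            refine lintegral_mono fun v => ?_
            simp only [← ofReal_norm]
            rw [← ENNReal.ofReal_add (norm_nonneg _) (by positivity)]
            refine ENNReal.ofReal_le_ofReal ?_
            have h2 := abs_le.1 (hGF (W (x, v)))
            have h3 := abs_le.1 (hGF (W (x', v)))
            have h4 := abs_le.1 (le_refl |G (W (x, v)) - G (W (x', v))|)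
            rw [Real.norm_eq_abs, Real.norm_eq_abs, abs_le]
            constructor <;> linarith [h2.1, h2.2, h3.1, h3.2, h4.1, h4.2]
        _ = (∫⁻ v in Metric.ball (0 : R3) R, ‖G (W (x, v)) - G (W (x', v))‖ₑ) +
              ENNReal.ofReal (2 * ε) * volume (Metric.ball (0 : R3) R) := by
            rw [lintegral_add_left hGm.enorm.measurable, setLIntegral_const]
        _ ≤ _ := by
            gcongr
            exact (setLIntegral_le_lintegral _ _).trans
              (hW.lintegral_sub_le_of_contDiff ht hG hV hX x x')
    have h2 : Tendsto (fun ε : ℝ => Q + ENNReal.ofReal (2 * ε) * volume (Metric.ball (0 : R3) R))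
        (𝓝[>] 0) (𝓝 (Q + 0)) := by
      refine Tendsto.const_add Q ?_
      have h3 : Tendsto (fun ε : ℝ => ENNReal.ofReal (2 * ε)) (𝓝[>] 0) (𝓝 0) := by
        have : Continuous fun ε : ℝ => ENNReal.ofReal (2 * ε) :=
          ENNReal.continuous_ofReal.comp (by fun_prop)
        have := this.tendsto 0
        simp only [mul_zero, ENNReal.ofReal_zero] at this
        exact this.mono_left nhdsWithin_le_nhds
      have := ENNReal.Tendsto.mul_const h3 (b := volume (Metric.ball (0 : R3) R)) (Or.inr hfin.ne)
      rwa [zero_mul] at this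
    rw [add_zero] at h2
    exact ge_of_tendsto h2 (eventually_mem_nhdsWithin.mono fun ε hε => h1 ε hε)
  rw [← setLIntegral_univ, ← Metric.iUnion_ball_nat (0 : R3), setLIntegral_iUnion_of_directed]
  · exact iSup_le hball
  · exact directed_of_isDirected_le fun m n hmn => Metric.ball_subset_ball (by exact_mod_cast hmn)

lemma IsBackwardMap.lintegral_data_le (hW : IsBackwardMap t W) (ht : 0 ≤ t) (hF : IsData F L D)
    (x : R3) : ∫⁻ v, ‖F (W (x, v))‖ₑ ≤
      ENNReal.ofReal (64 * (1 + t) ^ (-3 : ℝ)) * ENNReal.ofReal D :=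
  hW.lintegral_le ht hF.lip.continuous hF.supV hF.supX x

lemma IsBackwardMap.integrable_data (hW : IsBackwardMap t W) (ht : 0 ≤ t) (hF : IsData F L D)
    (x : R3) : Integrable fun v => F (W (x, v)) :=
  ⟨(hF.lip.continuous.comp (hW.cont.comp (by fun_prop))).aestronglyMeasurable,
    (hW.lintegral_data_le ht hF x).trans_lt (by finiteness)⟩

lemma IsBackwardMap.norm_integral_le (hW : IsBackwardMap t W) (ht : 0 ≤ t) (hF : IsData F L D)
    (hD : 0 ≤ D) (x : R3) : ‖∫ v, F (W (x, v))‖ ≤ 64 * D * (1 + t) ^ (-3 : ℝ) := by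
  have h := (enorm_integral_le_lintegral_enorm _).trans (hW.lintegral_data_le ht hF x)
  rw [← ENNReal.ofReal_mul (by positivity), ← ofReal_norm,
    ENNReal.ofReal_le_ofReal_iff (by positivity)] at h
  linarith

lemma IsBackwardMap.norm_integral_sub_le (hW : IsBackwardMap t W) (ht : 0 ≤ t) (hF : IsData F L D)
    (hD : 0 ≤ D) (x x' : R3) : ‖(∫ v, F (W (x, v))) - ∫ v, F (W (x', v))‖ ≤
      128 * D * (1 + t) ^ (-3 : ℝ) * ‖x - x'‖ := by
  rw [← integral_sub (hW.integrable_data ht hF x) (hW.integrable_data ht hF x')]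
  have h := (enorm_integral_le_lintegral_enorm _).trans (hW.lintegral_sub_le ht hF x x')
  rw [← ENNReal.ofReal_mul (by positivity), ← ENNReal.ofReal_mul (by positivity), ← ofReal_norm,
    ENNReal.ofReal_le_ofReal_iff (by positivity)] at h
  linarith

end

section

/-! ### Weak derivatives of Lipschitz functions -/

lemma locallyIntegrable_congr_ae {V G : Type*} [TopologicalSpace V] [MeasureSpace V]
    [NormedAddCommGroup G] {u u' : V → G} (hu : LocallyIntegrable u)
    (h : u =ᵐ[volume] u') : LocallyIntegrable u' := fun x => by
  obtain ⟨s, hs, hi⟩ := hu x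
  exact ⟨s, hs, hi.congr (ae_restrict_of_ae h)⟩

lemma locallyIntegrable_of_bound {V G : Type*} [NormedAddCommGroup V] [NormedSpace ℝ V]
    [FiniteDimensional ℝ V] [MeasureSpace V] [BorelSpace V]
    [(volume : Measure V).IsAddHaarMeasure] [NormedAddCommGroup G] {g : V → G} (hg : AEStronglyMeasurable g) {c : ℝ}
    (hc : ∀ x, ‖g x‖ ≤ c) : LocallyIntegrable g :=
  (memLp_top_of_bound hg c (Eventually.of_forall hc)).locallyIntegrable le_top

lemma eLpNorm_top_le_of_bound {V G : Type*} [MeasureSpace V] [NormedAddCommGroup G] {g : V → G} {c : ℝ} (hc : ∀ x, ‖g x‖ ≤ c) :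
    eLpNorm g ∞ volume ≤ ENNReal.ofReal c := by
  rw [eLpNorm_exponent_top]
  refine essSup_le_of_ae_le _ (Eventually.of_forall fun x => ?_)
  simp only [← ofReal_norm]
  exact ENNReal.ofReal_le_ofReal (hc x)

lemma contDiff_dirDeriv_singleton {V : Type*} [NormedAddCommGroup V] [NormedSpace ℝ V]
    {φ : V → ℝ} (hφ : ContDiff ℝ (⊤ : ℕ∞) φ) (w : V) :
    ContDiff ℝ (⊤ : ℕ∞) (dirDeriv [w] φ) :=
  (hφ.fderiv_right (m := (⊤ : ℕ∞)) (by simp)).clm_apply contDiff_const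

lemma hasCompactSupport_dirDeriv_singleton {V : Type*} [NormedAddCommGroup V] [NormedSpace ℝ V]
    {φ : V → ℝ} (hc : HasCompactSupport φ) (w : V) :
    HasCompactSupport (dirDeriv [w] φ) :=
  hc.fderiv_apply ℝ w

section WeakDeriv

variable {V : Type*} [NormedAddCommGroup V] [NormedSpace ℝ V] [MeasureSpace V]
  {G : Type*} [NormedAddCommGroup G] [NormedSpace ℝ G] {l : List V} {u u' g g' : V → G}

lemma weakNorm_le (h : IsWeakDeriv l u g) (N : (V → G) → ℝ≥0∞) : weakNorm l N u ≤ N g :=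
  iInf₂_le g h

lemma isWeakDeriv_nil (hu : LocallyIntegrable u) (h : u =ᵐ[volume] g) :
    IsWeakDeriv [] u g :=
  ⟨hu, locallyIntegrable_congr_ae hu h, fun φ _ _ => by
    simp only [dirDeriv, List.length_nil, pow_zero, one_smul]
    exact integral_congr_ae (h.mono fun x hx => by simp only [hx])⟩

lemma IsWeakDeriv.congr_left (h : IsWeakDeriv l u g)
    (hu : u =ᵐ[volume] u') : IsWeakDeriv l u' g :=
  ⟨locallyIntegrable_congr_ae h.1 hu, h.2.1, fun φ hφ hc => by
    rw [← h.2.2 φ hφ hc]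
    exact integral_congr_ae (hu.mono fun x hx => by simp only [hx])⟩

/-- Iterated weak derivatives. -/
lemma IsWeakDeriv.cons {w w' : V} {k : V → G} (h : IsWeakDeriv [w] u g)
    (h' : IsWeakDeriv [w'] g k) : IsWeakDeriv [w, w'] u k :=
  ⟨h.1, h'.2.1, fun φ hφ hc => by
    have h1 := h.2.2 _ (contDiff_dirDeriv_singleton hφ w') (hasCompactSupport_dirDeriv_singleton hc w')
    have h2 := h'.2.2 φ hφ hc
    have e1 : dirDeriv [w, w'] φ = dirDeriv [w] (dirDeriv [w'] φ) := rfl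
    rw [e1, h1, h2]
    simp⟩

end WeakDeriv

section Lipschitz

variable {V : Type*} [NormedAddCommGroup V] [NormedSpace ℝ V] [FiniteDimensional ℝ V]
  [MeasureSpace V] [BorelSpace V] [(volume : Measure V).IsAddHaarMeasure]
  {G : Type*} [NormedAddCommGroup G] [NormedSpace ℝ G] [FiniteDimensional ℝ G]
  {u : V → G} {K : ℝ≥0}

/-- The directional derivatives of a Lipschitz function are weak derivatives. -/
lemma isWeakDeriv_lineDeriv (hu : LipschitzWith K u) (w : V) :
    IsWeakDeriv [w] u (fun x => lineDeriv ℝ u x w) := by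
  have hli : LocallyIntegrable (fun x => lineDeriv ℝ u x w) :=
    locallyIntegrable_of_bound (aestronglyMeasurable_lineDeriv hu.continuous _)
      fun x => norm_lineDeriv_le_of_lipschitz ℝ hu
  refine ⟨hu.continuous.locallyIntegrable, hli, fun φ hφ hc => ?_⟩
  have hd : ContDiff ℝ (⊤ : ℕ∞) (dirDeriv [w] φ) := contDiff_dirDeriv_singleton hφ w
  have i1 : Integrable fun x => dirDeriv [w] φ x • u x :=
    (hd.continuous.smul hu.continuous).integrable_of_hasCompactSupport
      (hasCompactSupport_dirDeriv_singleton hc w).smul_right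
  have i2 : Integrable fun x => φ x • lineDeriv ℝ u x w :=
    hli.integrable_smul_left_of_hasCompactSupport hφ.continuous hc
  -- Testing with continuous functionals reduces the claim to scalar functions, for which
  -- integration by parts of Lipschitz functions applies. The functional commutes with the line
  -- derivative almost everywhere by Rademacher's theorem.
  refine (SeparatingDual.eq_iff_forall_dual_eq (R := ℝ)).2 fun ℓ => ?_
  obtain ⟨c, hcφ⟩ := hφ.lipschitzWith_of_hasCompactSupport hc (by simp)
  have hℓ : LipschitzWith (‖ℓ‖₊ * K) fun x => ℓ (u x) := ℓ.lipschitz.comp hu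
  have key := hℓ.integral_lineDeriv_mul_eq (μ := volume) hcφ hc w
  have e1 : ∀ x, lineDeriv ℝ φ x (-w) = -dirDeriv [w] φ x := fun x => by
    rw [(hφ.differentiable (by simp)).differentiableAt.lineDeriv_eq_fderiv, map_neg]
    rfl
  have e2 : ∀ᵐ x, lineDeriv ℝ (fun x => ℓ (u x)) x w = ℓ (lineDeriv ℝ u x w) := by
    filter_upwards [hu.ae_differentiableAt (μ := volume)] with x hx
    have h2 : DifferentiableAt ℝ (fun x => ℓ (u x)) x := ℓ.differentiableAt.comp x hx
    rw [h2.lineDeriv_eq_fderiv, hx.lineDeriv_eq_fderiv]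
    have := (ℓ.hasFDerivAt.comp x hx.hasFDerivAt).fderiv
    exact congrArg (fun T : V →L[ℝ] ℝ => T w) this
  rw [List.length_singleton, pow_one, neg_one_smul, map_neg, ← ℓ.integral_comp_comm i1,
    ← ℓ.integral_comp_comm i2]
  simp only [map_smul, smul_eq_mul]
  have k1 : ∫ x, φ x * ℓ (lineDeriv ℝ u x w) = ∫ x, lineDeriv ℝ (fun x => ℓ (u x)) x w * φ x :=
    integral_congr_ae (e2.mono fun x hx => by simp only [hx, mul_comm])
  rw [k1, key]
  simp only [e1, neg_mul, integral_neg, neg_neg]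

lemma weakNorm_singleton_le (hu : LipschitzWith K u) {w : V} (hw : ‖w‖ = 1) :
    weakNorm [w] (fun g => eLpNorm g ∞ volume) u ≤ K := by
  refine (weakNorm_le (isWeakDeriv_lineDeriv hu w) _).trans ?_
  have h : ∀ x, ‖lineDeriv ℝ u x w‖ ≤ K := fun x => by
    simpa [hw] using norm_lineDeriv_le_of_lipschitz ℝ hu (x₀ := x) (v := w)
  simpa using eLpNorm_top_le_of_bound h

end Lipschitz

lemma norm_e (i : Fin 3) : ‖e i‖ = 1 := by simp [e]

lemma normW1_le {u r : R3 → ℝ} {K : ℝ≥0} (h : u =ᵐ[volume] r) (hr : LipschitzWith K r)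
    (hb : ∀ x, ‖r x‖ ≤ K) : normW1 ∞ u ≤ 4 * K := by
  have h0 : weakNorm [] (fun g => eLpNorm g ∞ volume) u ≤ K := by
    have h1 : IsWeakDeriv [] u r :=
      isWeakDeriv_nil (locallyIntegrable_congr_ae hr.continuous.locallyIntegrable h.symm) h
    refine (weakNorm_le h1 _).trans ?_
    simpa using eLpNorm_top_le_of_bound hb
  have h2 : ∀ i, weakNorm [e i] (fun g => eLpNorm g ∞ volume) u ≤ K := fun i => by
    have h1 := (isWeakDeriv_lineDeriv hr (e i)).congr_left h.symm
    refine (weakNorm_le h1 _).trans ?_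
    have h : ∀ x, ‖lineDeriv ℝ r x (e i)‖ ≤ K := fun x => by
      simpa [norm_e] using norm_lineDeriv_le_of_lipschitz ℝ hr (x₀ := x) (v := e i)
    simpa using eLpNorm_top_le_of_bound h
  rw [normW1, Fintype.sum_option]
  refine (add_le_add h0 (Finset.sum_le_sum fun i _ => h2 i)).trans (le_of_eq ?_)
  rw [Finset.sum_const, Finset.card_univ, Fintype.card_fin, nsmul_eq_mul]
  push_cast
  ring

lemma normSupGrad_le {E : R3 → R3} {K : ℝ≥0} (hE : LipschitzWith K E) : normSupGrad E ≤ 3 * K := by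
  refine (Finset.sum_le_sum fun i _ => weakNorm_singleton_le hE (norm_e i)).trans (le_of_eq ?_)
  simp

lemma normSupHess_le {E : R3 → R3} {H : Fin 3 → R3 → R3} {K : ℝ≥0}
    (hE : ∀ i, IsWeakDeriv [e i] E (H i)) (hH : ∀ i, LipschitzWith K (H i)) :
    normSupHess E ≤ 9 * K := by
  have h : ∀ i j : Fin 3, weakNorm [e i, e j] normSup E ≤ K := fun i j => by
    refine (weakNorm_le ((hE i).cons (isWeakDeriv_lineDeriv (hH i) (e j))) _).trans ?_
    have h : ∀ x, ‖lineDeriv ℝ (H i) x (e j)‖ ≤ K := fun x => by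
      simpa [norm_e] using norm_lineDeriv_le_of_lipschitz ℝ (hH i) (x₀ := x) (v := e j)
    exact (eLpNorm_top_le_of_bound h).trans (by simp)
  refine (Finset.sum_le_sum fun i _ => Finset.sum_le_sum fun j _ => h i j).trans (le_of_eq ?_)
  simp only [Finset.sum_const, Finset.card_univ, Fintype.card_fin, nsmul_eq_mul]
  push_cast
  ring

end

section

/-! ### Convolution of the derivative of the kernel with a Lipschitz density -/

section Splitting

variable {q C : ℝ} {T : R3 → R3}

/-- A factor which makes the singular part of a kernel integrable at infinity. -/
def taper (a : R3) : ℝ := (max 1 ‖a‖)⁻¹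

/-- The Riesz kernel `|a|^{-q}` away from the unit ball. -/
def rieszTail (q : ℝ) : R3 → ℝ≥0∞ := (Metric.ball (0 : R3) 1)ᶜ.indicator (riesz q)

lemma taper_of_lt {a : R3} (h : ‖a‖ < 1) : taper a = 1 := by
  rw [taper, max_eq_left h.le, inv_one]

lemma taper_of_le {a : R3} (h : 1 ≤ ‖a‖) : taper a = ‖a‖⁻¹ := by rw [taper, max_eq_right h]

lemma taper_nonneg (a : R3) : 0 ≤ taper a := by unfold taper; positivity

lemma taper_le_one (a : R3) : taper a ≤ 1 := inv_le_one_of_one_le₀ (le_max_left _ _)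

lemma measurable_taper : Measurable taper := by unfold taper; fun_prop

lemma measurable_rieszTail (q : ℝ) : Measurable (rieszTail q) :=
  (measurable_riesz q).indicator measurableSet_ball.compl

lemma rieszTail_of_le {a : R3} (h : 1 ≤ ‖a‖) : rieszTail q a = ENNReal.ofReal (‖a‖ ^ (-q)) :=
  indicator_of_mem (by simpa using h) _

lemma lintegral_rieszTail_lt_top (hq : 3 < q) : ∫⁻ a, rieszTail q a < ∞ := by
  rw [rieszTail, lintegral_indicator measurableSet_ball.compl]
  exact lintegral_riesz_compl_ball_lt_top hq

/-- In the unit ball the degree `-q` is integrable because `q < 3`; outside it the taper lowers the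
degree to `-(q + 1)`, which is integrable because `q > 2`. -/
lemma exists_lintegral_near_le (hq3 : q < 3) (hq2 : 2 < q) : ∃ c : ℝ≥0, ∀ (C : ℝ) (T : R3 → R3),
    HomLip q C T → T 0 = 0 → ∫⁻ a, ‖taper a • T a‖ₑ ≤ ENNReal.ofReal C * c := by
  obtain ⟨c, -, hc⟩ := exists_lintegral_riesz_ball hq3
  have hfin := lintegral_riesz_compl_ball_lt_top (q := q + 1) (by linarith)
  refine ⟨(ENNReal.ofReal (c * 1 ^ (3 - q)) +
    ∫⁻ u in (Metric.ball (0 : R3) 1)ᶜ, riesz (q + 1) u).toNNReal, fun C T hT h0 => ?_⟩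
  rw [ENNReal.coe_toNNReal (by finiteness), ← hc 1 one_pos,
    ← lintegral_add_compl _ (measurableSet_ball (x := (0 : R3)) (ε := 1)), mul_add,
    ← lintegral_const_mul' _ _ ENNReal.ofReal_ne_top, ← lintegral_const_mul' _ _ ENNReal.ofReal_ne_top]
  refine add_le_add (lintegral_mono fun a => ?_) (setLIntegral_mono' measurableSet_ball.compl
    fun a ha => ?_)
  · refine le_trans ?_ (hT.enorm_le_riesz h0 a)
    simp only [← ofReal_norm]
    refine ENNReal.ofReal_le_ofReal ?_
    rw [norm_smul, Real.norm_of_nonneg (taper_nonneg a)]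
    exact mul_le_of_le_one_left (norm_nonneg _) (taper_le_one a)
  · have ha' : 1 ≤ ‖a‖ := by simpa using ha
    have ha0 : a ≠ 0 := norm_pos_iff.1 (by linarith)
    rw [riesz, ← ENNReal.ofReal_mul hT.nonneg, ← ofReal_norm]
    refine ENNReal.ofReal_le_ofReal ?_
    rw [norm_smul, Real.norm_of_nonneg (taper_nonneg a), taper_of_le ha', norm_rpow_neg_add_one ha0]
    have := mul_le_mul_of_nonneg_left (hT.bound a ha0) (inv_nonneg.2 (norm_nonneg a))
    linarith

/-- The far part vanishes in the unit ball. Outside it, by the Leibniz rule, the increments of the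
taper have size `‖a - b‖ * ‖b‖⁻¹` and match those of the kernel, so the total is of degree `-(q +
1)`; this is integrable at infinity and no singularity is left at the origin. -/
lemma HomLip.enorm_far_sub_le_of_le (hT : HomLip q C T) {a b : R3} (hab : ‖b‖ ≤ ‖a‖) :
    ‖(1 - taper a) • T a - (1 - taper b) • T b‖ₑ ≤
      ENNReal.ofReal (2 * C * ‖a - b‖) * (rieszTail (q + 1) a + rieszTail (q + 1) b) := by
  have hC := hT.nonneg
  have htri := norm_sub_norm_le a b
  rcases lt_or_ge ‖a‖ 1 with ha | ha
  · rw [taper_of_lt ha, taper_of_lt (hab.trans_lt ha)]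
    simp
  have hap : 0 < ‖a‖ := by linarith
  have ha0 : a ≠ 0 := norm_pos_iff.1 hap
  rcases lt_or_ge ‖b‖ 1 with hb | hb
  · rw [taper_of_lt hb, taper_of_le ha, sub_self, zero_smul, sub_zero]
    refine le_trans ?_ (mul_le_mul' le_rfl le_self_add)
    rw [rieszTail_of_le ha, ← ENNReal.ofReal_mul (by positivity), ← ofReal_norm]
    refine ENNReal.ofReal_le_ofReal ?_
    have h1 : 1 - ‖a‖⁻¹ ≤ ‖a - b‖ * ‖a‖⁻¹ := by
      rw [← div_eq_mul_inv, le_div_iff₀ hap, sub_mul, inv_mul_cancel₀ hap.ne']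
      linarith
    have h2 : 0 ≤ 1 - ‖a‖⁻¹ := sub_nonneg.2 (inv_le_one_of_one_le₀ ha)
    rw [norm_smul, Real.norm_of_nonneg h2, norm_rpow_neg_add_one ha0]
    calc (1 - ‖a‖⁻¹) * ‖T a‖ ≤ (‖a - b‖ * ‖a‖⁻¹) * (C * ‖a‖ ^ (-q)) := by
          gcongr
          exact hT.bound a ha0
      _ ≤ 2 * ((‖a - b‖ * ‖a‖⁻¹) * (C * ‖a‖ ^ (-q))) := by
          have : 0 ≤ (‖a - b‖ * ‖a‖⁻¹) * (C * ‖a‖ ^ (-q)) := by positivity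
          linarith
      _ = _ := by ring
  · have hbp : 0 < ‖b‖ := by linarith
    have hb0 : b ≠ 0 := norm_pos_iff.1 hbp
    refine le_trans ?_ (mul_le_mul' le_rfl le_add_self)
    rw [rieszTail_of_le hb, ← ENNReal.ofReal_mul (by positivity), ← ofReal_norm]
    refine ENNReal.ofReal_le_ofReal ?_
    have e1 : (1 - taper a) • T a - (1 - taper b) • T b =
        (1 - taper a) • (T a - T b) + (taper b - taper a) • T b := by module
    have h1 : ‖1 - taper a‖ ≤ 1 := by
      rw [Real.norm_of_nonneg (sub_nonneg.2 (taper_le_one a))]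
      linarith [taper_nonneg a]
    have h2 : ‖taper b - taper a‖ ≤ ‖a - b‖ * ‖b‖⁻¹ := by
      rw [taper_of_le ha, taper_of_le hb, Real.norm_of_nonneg
        (sub_nonneg.2 (inv_anti₀ hbp hab)), ← div_eq_mul_inv, le_div_iff₀ hbp, sub_mul,
        inv_mul_cancel₀ hbp.ne', ← div_eq_inv_mul, sub_le_iff_le_add]
      have h3 : (‖a‖ - ‖b‖) / ‖a‖ ≤ ‖a‖ - ‖b‖ := div_le_self (by linarith) ha
      rw [sub_div, div_self hap.ne'] at h3
      linarith
    rw [e1]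
    refine (norm_add_le _ _).trans ?_
    rw [norm_smul, norm_smul]
    calc ‖1 - taper a‖ * ‖T a - T b‖ + ‖taper b - taper a‖ * ‖T b‖
        ≤ 1 * (C * ‖a - b‖ * ‖b‖ ^ (-(q + 1))) + (‖a - b‖ * ‖b‖⁻¹) * (C * ‖b‖ ^ (-q)) := by
          gcongr
          · exact hT.lip a b hb0 hab
          · exact hT.bound b hb0
      _ = _ := by rw [norm_rpow_neg_add_one hb0]; ring

lemma HomLip.enorm_far_sub_le (hT : HomLip q C T) (a b : R3) :
    ‖(1 - taper a) • T a - (1 - taper b) • T b‖ₑ ≤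
      ENNReal.ofReal (2 * C * ‖a - b‖) * (rieszTail (q + 1) a + rieszTail (q + 1) b) := by
  rcases le_total ‖b‖ ‖a‖ with h | h
  · exact hT.enorm_far_sub_le_of_le h
  · rw [← enorm_neg, neg_sub, norm_sub_rev a b, add_comm (rieszTail (q + 1) a)]
    exact hT.enorm_far_sub_le_of_le h

lemma HomLip.norm_far_le (hT : HomLip q C T) (hq : 0 ≤ q) (a : R3) :
    ‖(1 - taper a) • T a‖ ≤ C := by
  rcases lt_or_ge ‖a‖ 1 with ha | ha
  · rw [taper_of_lt ha, sub_self, zero_smul, norm_zero]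
    exact hT.nonneg
  · rw [norm_smul, Real.norm_of_nonneg (sub_nonneg.2 (taper_le_one a))]
    have h1 := hT.bound a (norm_pos_iff.1 (by linarith))
    have h2 : ‖a‖ ^ (-q) ≤ 1 := Real.rpow_le_one_of_one_le_of_nonpos ha (by linarith)
    have h3 := hT.nonneg
    calc (1 - taper a) * ‖T a‖ ≤ 1 * (C * 1) := by
          gcongr
          · linarith [taper_nonneg a]
          · exact h1.trans (by gcongr)
      _ = C := by ring

/-- The convolution of a kernel of degree between `-3` and `-2` with a bounded Lipschitz density is
Lipschitz. -/
lemma exists_norm_convolution_sub_le (hq3 : q < 3) (hq2 : 2 < q) : ∃ c : ℝ≥0,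
    ∀ (C : ℝ) (T : R3 → R3), HomLip q C T → T 0 = 0 → Measurable T →
      ∀ (ρ : R3 → ℝ) (A : ℝ), 0 ≤ A → Integrable ρ → (∀ x, ‖ρ x‖ ≤ A) →
        (∀ x y, ‖ρ x - ρ y‖ ≤ A * ‖x - y‖) →
        ∀ x x', ‖(∫ y, ρ y • T (x - y)) - ∫ y, ρ y • T (x' - y)‖ ≤ c * C * A * ‖x - x'‖ := by
  obtain ⟨c, hc⟩ := exists_lintegral_near_le hq3 hq2
  have hfin := lintegral_rieszTail_lt_top (q := q + 1) (by linarith)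
  set d : ℝ≥0 := (∫⁻ a, rieszTail (q + 1) a).toNNReal with hd
  have hdc : ∫⁻ a, rieszTail (q + 1) a = d := (ENNReal.coe_toNNReal hfin.ne).symm
  refine ⟨c + 4 * d, fun C T hT h0 hTm ρ A hA hρ hb hl x x' => ?_⟩
  have hC := hT.nonneg
  have hnear := hc C T hT h0
  have hni : Integrable fun a => taper a • T a :=
    ⟨(measurable_taper.smul hTm).aestronglyMeasurable, hnear.trans_lt (by finiteness)⟩
  have hfm : Measurable fun a => (1 - taper a) • T a :=
    (measurable_const.sub measurable_taper).smul hTm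
  have hρc : Continuous ρ := LipschitzWith.continuous (K := A.toNNReal)
    (LipschitzWith.of_dist_le_mul fun x y => by
      rw [dist_eq_norm, dist_eq_norm, Real.coe_toNNReal _ hA]; exact hl x y)
  have hn : ∀ z, Integrable fun y => ρ y • taper (z - y) • T (z - y) := fun z =>
    (hni.comp_sub_left z).bdd_smul A hρc.aestronglyMeasurable (Eventually.of_forall hb)
  have hf : ∀ z, Integrable fun y => ρ y • (1 - taper (z - y)) • T (z - y) := fun z =>
    hρ.smul_bdd C (hfm.comp (measurable_const.sub measurable_id)).aestronglyMeasurable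
      (Eventually.of_forall fun y => hT.norm_far_le (by linarith) _)
  -- The near part is translated so that `z` occurs in the density, whose Lipschitz bound is then
  -- used; in the far part `z` stays in the kernel and only the size of the density matters.
  have hsplit : ∀ z, ∫ y, ρ y • T (z - y) = (∫ a, ρ (z - a) • taper a • T a) +
      ∫ y, ρ y • (1 - taper (z - y)) • T (z - y) := fun z => by
    have e1 : ∫ a, ρ (z - a) • taper a • T a = ∫ y, ρ y • taper (z - y) • T (z - y) := by
      rw [← integral_sub_left_eq_self _ volume z]
      simp only [sub_sub_cancel]
    rw [e1, ← integral_add (hn z) (hf z)]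
    refine integral_congr_ae (Eventually.of_forall fun y => ?_)
    simp only
    module
  have hn' : ∀ z, Integrable fun a => ρ (z - a) • taper a • T a := fun z =>
    hni.bdd_smul A (hρc.comp (by fun_prop)).aestronglyMeasurable
      (Eventually.of_forall fun a => hb _)
  have k1 : ‖(∫ a, ρ (x - a) • taper a • T a) - ∫ a, ρ (x' - a) • taper a • T a‖ ≤
      A * ‖x - x'‖ * (C * c) := by
    rw [← integral_sub (hn' x) (hn' x')]
    refine norm_integral_le_of_lintegral (by positivity) ?_
    calc ∫⁻ a, ‖ρ (x - a) • taper a • T a - ρ (x' - a) • taper a • T a‖ₑ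
        ≤ ∫⁻ a, ENNReal.ofReal (A * ‖x - x'‖) * ‖taper a • T a‖ₑ := by
          refine lintegral_mono fun a => ?_
          rw [← sub_smul, enorm_smul]
          refine mul_le_mul' ?_ le_rfl
          rw [← ofReal_norm]
          refine ENNReal.ofReal_le_ofReal ((hl _ _).trans (le_of_eq ?_))
          rw [sub_sub_sub_cancel_right]
      _ ≤ ENNReal.ofReal (A * ‖x - x'‖) * (ENNReal.ofReal C * c) := by
          rw [lintegral_const_mul' _ _ ENNReal.ofReal_ne_top]
          gcongr
      _ = _ := by
          rw [ENNReal.ofReal_mul (p := A * ‖x - x'‖) (by positivity), ENNReal.ofReal_mul hC,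
            ENNReal.ofReal_coe_nnreal]
  have k2 : ‖(∫ y, ρ y • (1 - taper (x - y)) • T (x - y)) -
      ∫ y, ρ y • (1 - taper (x' - y)) • T (x' - y)‖ ≤ A * (2 * C * ‖x - x'‖ * (2 * d)) := by
    rw [← integral_sub (hf x) (hf x')]
    refine norm_integral_le_of_lintegral (by positivity) ?_
    calc ∫⁻ y, ‖ρ y • (1 - taper (x - y)) • T (x - y) - ρ y • (1 - taper (x' - y)) • T (x' - y)‖ₑ
        ≤ ∫⁻ y, ENNReal.ofReal A * (ENNReal.ofReal (2 * C * ‖x - x'‖) *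
            (rieszTail (q + 1) (x - y) + rieszTail (q + 1) (x' - y))) := by
          refine lintegral_mono fun y => ?_
          rw [← smul_sub, enorm_smul]
          have := hT.enorm_far_sub_le (x - y) (x' - y)
          rw [sub_sub_sub_cancel_right] at this
          refine mul_le_mul' ?_ this
          rw [← ofReal_norm]
          exact ENNReal.ofReal_le_ofReal (hb y)
      _ = ENNReal.ofReal A * (ENNReal.ofReal (2 * C * ‖x - x'‖) * (d + d)) := by
          rw [lintegral_const_mul' _ _ ENNReal.ofReal_ne_top,
            lintegral_const_mul' _ _ ENNReal.ofReal_ne_top, lintegral_add_left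
            (f := fun y => rieszTail (q + 1) (x - y))
            ((measurable_rieszTail _).comp (measurable_const.sub measurable_id)),
            lintegral_sub_left_eq_self (rieszTail (q + 1)) x,
            lintegral_sub_left_eq_self (rieszTail (q + 1)) x', hdc]
      _ = _ := by
          rw [ENNReal.ofReal_mul hA, ENNReal.ofReal_mul (p := 2 * C * ‖x - x'‖) (by positivity),
            two_mul (d : ℝ), ENNReal.ofReal_add (by positivity) (by positivity), ENNReal.ofReal_coe_nnreal]
  rw [hsplit x, hsplit x', add_sub_add_comm]
  refine (norm_add_le _ _).trans ((add_le_add k1 k2).trans (le_of_eq ?_))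
  push_cast
  ring

end Splitting

/-! ### The first derivative of the force field -/

section Derivative

variable {α lam : ℝ} {ρ : R3 → ℝ} {A : ℝ}

/-- A line is a null set in dimension three, so for almost every source `y` the kernel is
differentiable along the whole line through `x` in direction `w`. -/
lemma ae_notMem_line (x w : R3) : ∀ᵐ y : R3, ∀ θ : ℝ, x - y + θ • w ≠ 0 := by
  have hne : (ℝ ∙ w) ≠ ⊤ := fun h => by
    have h1 := finrank_span_le_card (R := ℝ) ({w} : Set R3)
    rw [h, finrank_top, finrank_R3, Set.toFinset_singleton, Finset.card_singleton] at h1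
    omega
  have h0 : volume ((ℝ ∙ w : Submodule ℝ R3) : Set R3) = 0 := Measure.addHaar_submodule _ _ hne
  have h1 : ∀ᵐ a : R3, a ∉ (ℝ ∙ w) := by
    rw [ae_iff]; simpa using h0
  have h2 : ∀ᵐ y : R3, x - y ∉ (ℝ ∙ w) :=
    (Measure.measurePreserving_sub_left volume x).quasiMeasurePreserving.ae h1
  filter_upwards [h2] with y hy θ h
  exact hy (Submodule.mem_span_singleton.2 ⟨-θ, by rw [neg_smul, neg_eq_iff_add_eq_zero, add_comm]; exact h⟩)

/-- The convolution of a locally integrable homogeneous kernel with a bounded density. -/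
lemma exists_lintegral_convolution_le {q C : ℝ} {T : R3 → R3} (hq0 : 0 ≤ q) (hq3 : q < 3)
    (hT : HomLip q C T) (h0 : T 0 = 0) (hA : 0 ≤ A) (hρ : Integrable ρ)
    (hb : ∀ x, ‖ρ x‖ ≤ A) : ∃ S : ℝ, ∀ x, ∫⁻ y, ‖ρ y • T (x - y)‖ₑ ≤ ENNReal.ofReal S := by
  obtain ⟨c, hc, h⟩ := exists_riesz_bound hq0 hq3
  set ν : Measure R3 := volume.withDensity fun y => ‖ρ y‖ₑ with hν
  have h1 : ν ≤ ENNReal.ofReal A • volume := by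
    rw [hν, ← withDensity_const]
    refine withDensity_mono (Eventually.of_forall fun y => ?_)
    simp only [← ofReal_norm]
    exact ENNReal.ofReal_le_ofReal (hb y)
  have h2 : ν univ ≤ ENNReal.ofReal (∫⁻ y, ‖ρ y‖ₑ).toReal := by
    rw [ENNReal.ofReal_toReal hρ.2.ne, hν, withDensity_apply _ .univ, setLIntegral_univ]
  refine ⟨C * (c * (A * 1 ^ (3 - q) + (∫⁻ y, ‖ρ y‖ₑ).toReal * 1 ^ (-q))), fun x => ?_⟩
  have h3 := h ν A _ hA ENNReal.toReal_nonneg h1 h2 1 one_pos x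
  rw [ENNReal.ofReal_mul hT.nonneg]
  refine le_trans ?_ (mul_le_mul' le_rfl h3)
  rw [hν, lintegral_withDensity_eq_lintegral_mul₀ hρ.aestronglyMeasurable.enorm
    (measurable_riesz_sub q x).aemeasurable, ← lintegral_const_mul' _ _ ENNReal.ofReal_ne_top]
  refine lintegral_mono fun y => ?_
  simp only [Pi.mul_apply, enorm_smul]
  rw [mul_left_comm]
  exact mul_le_mul' le_rfl (hT.enorm_le_riesz h0 _)

lemma integrable_convolution {T : R3 → R3} (hTm : Measurable T) (hρ : Integrable ρ) {S : ℝ}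
    {x : R3} (h : ∫⁻ y, ‖ρ y • T (x - y)‖ₑ ≤ ENNReal.ofReal S) :
    Integrable fun y => ρ y • T (x - y) :=
  ⟨hρ.aestronglyMeasurable.smul
    (hTm.comp (measurable_const.sub measurable_id)).aestronglyMeasurable,
    h.trans_lt ENNReal.ofReal_lt_top⟩

/-- For almost every source the fundamental theorem of calculus holds along the line, and Fubini's
theorem exchanges the integrals because the differentiated kernel has degree `-(2 + α) > -3`. The
singularity therefore leaves no extra term in the first derivative of the field. -/
lemma convolution_kernel_sub (hα0 : 0 < α) (hα1 : α < 1) (hA : 0 ≤ A) (hρ : Integrable ρ)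
    (hρm : Measurable ρ) (hb : ∀ x, ‖ρ x‖ ≤ A) (j : Fin 3) (x : R3) (s : ℝ) :
    (∫ y, ρ y • kernel α lam (x + s • e j - y)) - ∫ y, ρ y • kernel α lam (x - y) =
      ∫ θ in (0 : ℝ)..s, ∫ y, ρ y • kernelDeriv α lam j (x + θ • e j - y) := by
  obtain ⟨C, hC⟩ := exists_homLip_kernel α lam hα0
  obtain ⟨C', hC'⟩ := exists_homLip_kernelDeriv α lam hα0
  obtain ⟨S, hS⟩ := exists_lintegral_convolution_le (by linarith) (by linarith) hC
    (kernel_zero α lam) hA hρ hb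
  obtain ⟨S', hS'⟩ := exists_lintegral_convolution_le (by linarith) (by linarith) (hC' j)
    (kernelDeriv_zero α lam j) hA hρ hb
  have hi := fun z => integrable_convolution (measurable_kernel α lam) hρ (hS z)
  have hm : Measurable fun p : R3 × ℝ => ρ p.1 • kernelDeriv α lam j (x + p.2 • e j - p.1) :=
    (hρm.comp measurable_fst).smul ((measurable_kernelDeriv α lam j).comp (by fun_prop))
  have hfub : Integrable (fun p : R3 × ℝ => ρ p.1 • kernelDeriv α lam j (x + p.2 • e j - p.1))
      (volume.prod (volume.restrict (uIoc 0 s))) := by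
    refine ⟨hm.aestronglyMeasurable, ?_⟩
    rw [hasFiniteIntegral_iff_enorm, lintegral_prod_symm _ hm.enorm.aemeasurable]
    refine (lintegral_mono fun θ => hS' (x + θ • e j)).trans_lt ?_
    rw [lintegral_const]
    exact ENNReal.mul_lt_top ENNReal.ofReal_lt_top (by simp [uIoc])
  have hline : ∀ᵐ y : R3, ρ y • kernel α lam (x + s • e j - y) - ρ y • kernel α lam (x - y) =
      ∫ θ in (0 : ℝ)..s, ρ y • kernelDeriv α lam j (x + θ • e j - y) := by
    filter_upwards [ae_notMem_line x (e j), hfub.prod_right_ae] with y hy hyi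
    have hd : ∀ θ ∈ uIcc 0 s, HasDerivAt (fun θ : ℝ => ρ y • kernel α lam (x - y + θ • e j))
        (ρ y • kernelDeriv α lam j (x - y + θ • e j)) θ := fun θ _ =>
      (hasDerivAt_kernel α lam j (hy θ)).const_smul (ρ y)
    have hyi' : IntervalIntegrable (fun θ => ρ y • kernelDeriv α lam j (x - y + θ • e j))
        volume 0 s := by
      rw [intervalIntegrable_iff, IntegrableOn]
      simpa only [add_sub_right_comm] using hyi
    have := intervalIntegral.integral_eq_sub_of_hasDerivAt hd hyi'
    simp only [zero_smul, add_zero] at this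
    simp only [add_sub_right_comm]
    exact this.symm
  rw [← integral_sub (hi _) (hi _), integral_congr_ae hline]
  simp only [intervalIntegral.intervalIntegral_eq_integral_uIoc]
  rw [integral_smul, integral_integral_swap hfub]

/-- The convolution with `kernelDeriv` is Lipschitz, hence continuous, so the integrated identity
`convolution_kernel_sub` can be differentiated at every point. The first weak derivatives are these
convolutions, and their Lipschitz constants bound the second ones. -/
lemma exists_normSupHess_le (α lam : ℝ) (hα0 : 0 < α) (hα1 : α < 1) :
    ∃ c : ℝ≥0, ∀ (ρ : R3 → ℝ) (A K : ℝ≥0), Integrable ρ → (∀ x, ‖ρ x‖ ≤ A) → LipschitzWith A ρ →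
      LipschitzWith K (fun x => -∫ y, ρ y • kernel α lam (x - y)) →
      normSupHess (fun x => -∫ y, ρ y • kernel α lam (x - y)) ≤ 9 * (c * A : ℝ≥0) := by
  obtain ⟨C, hC⟩ := exists_homLip_kernelDeriv α lam hα0
  obtain ⟨c, hc⟩ := exists_norm_convolution_sub_le (q := 2 + α) (by linarith) (by linarith)
  have hC0 := (hC 0).nonneg
  refine ⟨c * C.toNNReal, fun ρ A K hρ hb hl hE => ?_⟩
  have hlip : ∀ j, LipschitzWith (c * C.toNNReal * A)
      fun x => -∫ y, ρ y • kernelDeriv α lam j (x - y) := fun j =>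
    (LipschitzWith.of_dist_le_mul fun x x' => by
      rw [dist_eq_norm, dist_eq_norm, NNReal.coe_mul, NNReal.coe_mul, Real.coe_toNNReal _ hC0]
      exact hc C _ (hC j) (kernelDeriv_zero α lam j) (measurable_kernelDeriv α lam j) ρ A
        A.coe_nonneg hρ hb (fun x y => by simpa only [dist_eq_norm] using hl.dist_le_mul x y)
        x x').neg
  refine normSupHess_le (fun j => ?_) hlip
  have hcont : Continuous fun x => ∫ y, ρ y • kernelDeriv α lam j (x - y) := by
    have := (hlip j).continuous.neg
    exact continuous_neg_iff.1 (continuous_neg_iff.1 this)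
  have hd : ∀ x, HasLineDerivAt ℝ (fun x => -∫ y, ρ y • kernel α lam (x - y))
      (-∫ y, ρ y • kernelDeriv α lam j (x - y)) x (e j) := fun x => by
    have hcx : Continuous fun θ : ℝ => ∫ y, ρ y • kernelDeriv α lam j (x + θ • e j - y) :=
      hcont.comp (by fun_prop : Continuous fun θ : ℝ => x + θ • e j)
    have h1 : HasDerivAt (fun s => ∫ θ in (0 : ℝ)..s,
        ∫ y, ρ y • kernelDeriv α lam j (x + θ • e j - y))
        (∫ y, ρ y • kernelDeriv α lam j (x + (0 : ℝ) • e j - y)) 0 :=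
      intervalIntegral.integral_hasDerivAt_right (hcx.intervalIntegrable _ _)
        (hcx.stronglyMeasurableAtFilter _ _) hcx.continuousAt
    simp only [← convolution_kernel_sub hα0 hα1 A.coe_nonneg hρ hl.continuous.measurable hb j x,
      zero_smul, add_zero] at h1
    have h2 := (h1.add_const (∫ y, ρ y • kernel α lam (x - y))).neg
    simp only [sub_add_cancel] at h2
    exact h2
  have := isWeakDeriv_lineDeriv hE (e j)
  simpa only [(hd _).lineDeriv] using this

end Derivative

end

section

/-! ### Decay of the density and of the force field -/

lemma one_le_bracket (t : ℝ) : 1 ≤ bracket t :=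
  Real.one_le_sqrt.2 (by nlinarith [sq_nonneg t])

lemma bracket_le {t : ℝ} (ht : 0 ≤ t) : bracket t ≤ 1 + t := by
  rw [bracket, Real.sqrt_le_left (by linarith)]
  nlinarith

lemma ofReal_bracket_rpow_mul_le {t p c : ℝ} {X : ℝ≥0∞} (ht : 0 ≤ t) (hp : 0 ≤ p) (hc : 0 ≤ c)
    (hX : X ≤ ENNReal.ofReal (c * (1 + t) ^ (-p))) :
    ENNReal.ofReal (bracket t ^ p) * X ≤ ENNReal.ofReal c := by
  have hb : 0 ≤ bracket t := zero_le_one.trans (one_le_bracket t)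
  refine (mul_le_mul' le_rfl hX).trans ?_
  rw [← ENNReal.ofReal_mul (by positivity)]
  refine ENNReal.ofReal_le_ofReal ?_
  have h1 : bracket t ^ p ≤ (1 + t) ^ p := Real.rpow_le_rpow hb (bracket_le ht) hp
  have h2 : (1 + t) ^ p * (1 + t) ^ (-p) = 1 := by
    rw [← Real.rpow_add (by linarith), add_neg_cancel, Real.rpow_zero]
  calc bracket t ^ p * (c * (1 + t) ^ (-p)) ≤ (1 + t) ^ p * (c * (1 + t) ^ (-p)) := by gcongr
    _ = c := by rw [mul_left_comm, h2, mul_one]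

lemma ofReal_bracket_pow_mul_le {t c : ℝ} {X : ℝ≥0∞} (ht : 0 ≤ t) (hc : 0 ≤ c)
    (hX : X ≤ ENNReal.ofReal (c * (1 + t) ^ (-3 : ℝ))) :
    ENNReal.ofReal (bracket t ^ 3) * X ≤ ENNReal.ofReal c := by
  have := ofReal_bracket_rpow_mul_le ht (by norm_num) hc hX
  exact_mod_cast this

variable {F : Phase → ℝ} {L : ℝ≥0} {D κ α lam t : ℝ} {E : ℝ → R3 → R3} {B K : ℝ≥0}
  {Z : ℝ → Phase → Phase} {W : Phase → Phase}

lemma IsBackwardMap.exists_density (hW : IsBackwardMap t W) (ht : 0 ≤ t) (hF : IsData F L D)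
    (hD : 0 ≤ D) {h : Phase → ℝ} (hi : Integrable h) (hh : h =ᵐ[volume] fun z => F (W z)) :
    ∃ r : R3 → ℝ, density h =ᵐ[volume] r ∧ Integrable r ∧
      (∀ x, ‖r x‖ ≤ (128 * D * (1 + t) ^ (-3 : ℝ)).toNNReal) ∧
      LipschitzWith (128 * D * (1 + t) ^ (-3 : ℝ)).toNNReal r := by
  have hA : 0 ≤ 128 * D * (1 + t) ^ (-3 : ℝ) := by positivity
  have hae : density h =ᵐ[volume] fun x => ∫ v, F (W (x, v)) := by
    filter_upwards [Measure.ae_ae_of_ae_prod hh] with x hx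
    exact integral_congr_ae hx
  refine ⟨_, hae, (Integrable.integral_prod_left hi).congr hae, fun x => ?_,
    LipschitzWith.of_dist_le_mul fun x y => ?_⟩
  · rw [Real.coe_toNNReal _ hA]
    have h1 := hW.norm_integral_le ht hF hD x
    have h2 : 0 ≤ D * (1 + t) ^ (-3 : ℝ) := by positivity
    linarith
  · rw [dist_eq_norm, dist_eq_norm, Real.coe_toNNReal _ hA]
    exact hW.norm_integral_sub_le ht hF hD x y

lemma IsBackwardMap.normW1_density_le (hW : IsBackwardMap t W) (ht : 0 ≤ t) (hF : IsData F L D)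
    (hD : 0 ≤ D) {h : Phase → ℝ} (hi : Integrable h) (hh : h =ᵐ[volume] fun z => F (W z)) :
    ENNReal.ofReal (bracket t ^ 3) * normW1 ∞ (density h) ≤ ENNReal.ofReal (512 * D) := by
  obtain ⟨r, hr, -, hb, hl⟩ := hW.exists_density ht hF hD hi hh
  refine ofReal_bracket_pow_mul_le ht (by positivity) ((normW1_le hr hl hb).trans (le_of_eq ?_))
  rw [← ENNReal.ofReal_ofNat 4, ENNReal.ofNNReal_toNNReal, ← ENNReal.ofReal_mul (by norm_num)]
  congr 1
  ring

lemma IsDispersiveFlow.normSup_le (h : IsDispersiveFlow α lam F D κ E Z) (hα : 0 < α) (hκ : 0 ≤ κ)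
    (ht : 0 ≤ t) : ENNReal.ofReal (bracket t ^ (1 + α)) * normSup (E t) ≤ ENNReal.ofReal κ :=
  ofReal_bracket_rpow_mul_le ht (by linarith) hκ (eLpNorm_top_le_of_bound (h.bound t ht))

lemma IsDispersiveFlow.lipschitz (h : IsDispersiveFlow α lam F D κ E Z) (hκ : 0 ≤ κ) (ht : 0 ≤ t) :
    LipschitzWith (κ * (1 + t) ^ (-(2 + α))).toNNReal (E t) :=
  LipschitzWith.of_dist_le_mul fun x y => by
    rw [dist_eq_norm, dist_eq_norm, Real.coe_toNNReal _ (by positivity)]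
    exact h.lip t ht x y

lemma IsDispersiveFlow.normSupGrad_le (h : IsDispersiveFlow α lam F D κ E Z) (hα : 0 < α)
    (hκ : 0 ≤ κ) (ht : 0 ≤ t) :
    ENNReal.ofReal (bracket t ^ (2 + α)) * normSupGrad (E t) ≤ ENNReal.ofReal (3 * κ) := by
  refine ofReal_bracket_rpow_mul_le ht (by linarith) (by positivity)
    ((VlasovRiesz.normSupGrad_le (h.lipschitz hκ ht)).trans (le_of_eq ?_))
  rw [← ENNReal.ofReal_ofNat 3, ENNReal.ofNNReal_toNNReal, ← ENNReal.ofReal_mul (by norm_num)]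
  congr 1
  ring

/-- Decay of the second derivatives of the force field. -/
lemma exists_normSupHess_force_le (α lam : ℝ) (hα0 : 0 < α) (hα1 : α < 1) :
    ∃ c : ℝ≥0, ∀ (t : ℝ) (W : Phase → Phase) (F : Phase → ℝ) (L K : ℝ≥0) (D : ℝ) (h : Phase → ℝ),
      IsBackwardMap t W → 0 ≤ t → IsData F L D → 0 ≤ D → Integrable h →
      (h =ᵐ[volume] fun z => F (W z)) → LipschitzWith K (force α lam h) →
      ENNReal.ofReal (bracket t ^ 3) * normSupHess (force α lam h) ≤
        ENNReal.ofReal (1152 * c * D) := by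
  obtain ⟨c, hc⟩ := exists_normSupHess_le α lam hα0 hα1
  refine ⟨c, fun t W F L K D h hW ht hF hD hi hh hK => ?_⟩
  obtain ⟨r, hr, hri, hb, hl⟩ := hW.exists_density ht hF hD hi hh
  have hforce : force α lam h = fun x => -∫ y, r y • kernel α lam (x - y) := by
    funext x
    rw [force, gradient_potential _ _ hα0]
    congr 1
    exact integral_congr_ae (hr.mono fun y hy => by simp only [hy])
  rw [hforce] at hK ⊢
  refine ofReal_bracket_pow_mul_le ht (by positivity) ((hc r _ K hri hb hl hK).trans (le_of_eq ?_))
  rw [ENNReal.coe_mul, ENNReal.ofNNReal_toNNReal, ← ENNReal.ofReal_ofNat 9,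
    ← ENNReal.ofReal_coe_nnreal (p := c), ← ENNReal.ofReal_mul (by positivity),
    ← ENNReal.ofReal_mul (by norm_num)]
  congr 1
  ring

/-! ### Uniqueness -/

/-- The competitor is transported by the flow of its own force. Both flows generate their own force
from the same data measure, and `max N (19 * D)` bounds both densities on `[0, t]`, so the flows
coincide. -/
theorem IsGlobalSolution.ae_eq_of_dispersiveFlow {f₀ : Phase → ℝ}
    {g : ℝ → Lp ℝ ∞ (volume : Measure Phase)} (hα0 : 0 < α) (hα1 : α < 1)
    (hg : IsGlobalSolution α lam f₀ g) (hF : IsData F L D) (hD : 0 ≤ D) (h0 : f₀ =ᵐ[volume] F)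
    (hE : IsForce E B K) (hZ : IsDispersiveFlow α lam F D κ E Z) (ht : 0 ≤ t) {N : ℝ≥0}
    (hN : ∀ s, 0 ≤ s → s ≤ t → eLpNorm (density (g s)) ∞ volume ≤ N) :
    g t =ᵐ[volume] fun z => F (flowInv Z t z) := by
  obtain ⟨E', Y, B', K', hE', hY, hgY, hEY, hdY⟩ :=
    hg.exists_flow hα0 hα1 hF h0 ht fun s hs => hN s hs.1 hs.2
  have htt : t ∈ Icc 0 t := right_mem_Icc.2 ht
  have hmono : ∀ a b : ℝ, a ≤ b →
      (ENNReal.ofReal a • volume : Measure R3) ≤ ENNReal.ofReal b • volume := fun a b hab =>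
    smul_measure_mono (ENNReal.ofReal_le_ofReal hab)
  have heq : Y t = Z t := hY.eq_of_field hα0 hα1 hE' hZ.flow hE
    (D := max N (19 * D)) (by positivity) hD hF.dataMeasure_univ_le hEY
    (fun s hs => hZ.force s hs.1)
    (fun s hs => (hdY s hs).trans (hmono _ _ (le_max_left _ _)))
    (fun s hs => (hZ.density s hs.1).trans (hmono _ _ ((le_max_right _ _).trans' ?_))) htt
  · have := hgY t htt
    rwa [flowInv, heq] at this
  · have : (1 + s) ^ (-3 : ℝ) ≤ 1 :=
      Real.rpow_le_one_of_one_le_of_nonpos (by linarith [hs.1]) (by norm_num)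
    exact mul_le_of_le_one_right (by positivity) this

/-- Global existence, dispersion and uniqueness for small data. -/
theorem exists_dispersive_solution (α lam : ℝ) (hα0 : 0 < α) (hα1 : α < 1) :
    ∃ η₀ : ℝ, 0 < η₀ ∧ ∃ C : ℝ, 0 < C ∧ ∀ η : ℝ, 0 < η → η ≤ η₀ →
      ∀ f₀ : Phase → ℝ, (∀ᵐ z, 0 ≤ f₀ z) → dataNorm f₀ ≤ ENNReal.ofReal η →
        ∃ f : ℝ → Lp ℝ ∞ (volume : Measure Phase), IsGlobalSolution α lam f₀ f ∧
          (∀ t : ℝ, 0 ≤ t →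
            ENNReal.ofReal (bracket t ^ 3) * normW1 ∞ (density (f t)) ≤ ENNReal.ofReal (C * η)) ∧
          (∀ t : ℝ, 0 ≤ t →
            ENNReal.ofReal (bracket t ^ (1 + α)) * normSup (force α lam (f t)) +
              ENNReal.ofReal (bracket t ^ (2 + α)) * normSupGrad (force α lam (f t)) +
              ENNReal.ofReal (bracket t ^ 3) * normSupHess (force α lam (f t))
              ≤ ENNReal.ofReal (C * η)) ∧
          (∀ g : ℝ → Lp ℝ ∞ (volume : Measure Phase), IsGlobalSolution α lam f₀ g →
            (∀ T : ℝ, 0 ≤ T → ∃ M : ℝ≥0, ∀ t : ℝ, 0 ≤ t → t ≤ T →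
              eLpNorm (density (g t)) ∞ volume ≤ M) → ∀ t : ℝ, 0 ≤ t → g t = f t) := by
  obtain ⟨C, hC, hflow⟩ := exists_dispersiveFlow α lam hα0 hα1
  obtain ⟨c, hc⟩ := exists_normSupHess_force_le α lam hα0 hα1
  -- The data satisfy `IsData` with `D = 12 * η`. The contraction needs `C * (12 * η) ≤ α / 8`,
  -- which explains `96`. The final constant adds `512 * 12` for the density, `(1 + 3) * 12 * C` for
  -- the force and its gradient, and `1152 * 12 * c` for its second derivatives.
  refine ⟨α / (96 * (C + 1)), by positivity, 6144 + 48 * C + 13824 * c, by positivity,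
    fun η hη hη0 f₀ h0 hdata => ?_⟩
  obtain ⟨F, L, hfF, hF⟩ := exists_isData h0 hη hdata
  have hD : 0 ≤ 12 * η := by positivity
  have hκ : 0 ≤ C * (12 * η) := by positivity
  have hκα : C * (12 * η) ≤ α / 8 := by
    rw [le_div_iff₀ (by positivity)] at hη0
    nlinarith
  obtain ⟨E, Z, B, K, hE, hZ⟩ := hflow F L (12 * η) hD hF hκα
  obtain ⟨f, hf, hft⟩ := hF.exists_solution hα0 hZ.flow hE hZ.force hfF
  have hW := fun t (ht : 0 ≤ t) => hZ.isBackwardMap hα0 hκ hκα hE ht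
  have hCη : 0 ≤ C * η := by positivity
  have hcη : 0 ≤ c * η := by positivity
  refine ⟨f, hf, fun t ht => ?_, fun t ht => ?_, fun g hg hgd t ht => ?_⟩
  · refine ((hW t ht).normW1_density_le ht hF hD (hf.integrable_apply ht) (hft t ht).1).trans
      (ENNReal.ofReal_le_ofReal ?_)
    linarith
  · have h1 := hZ.normSup_le hα0 hκ ht
    have h2 := hZ.normSupGrad_le hα0 hκ ht
    have h3 := hc t _ F L (C * (12 * η) * (1 + t) ^ (-(2 + α))).toNNReal _ _ (hW t ht) ht hF hD
      (hf.integrable_apply ht) (hft t ht).1 ((hft t ht).2 ▸ hZ.lipschitz hκ ht)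
    rw [(hft t ht).2] at h3 ⊢
    refine (add_le_add (add_le_add h1 h2) h3).trans ?_
    rw [← ENNReal.ofReal_add (by positivity) (by positivity),
      ← ENNReal.ofReal_add (by positivity) (by positivity)]
    refine ENNReal.ofReal_le_ofReal ?_
    linarith
  · obtain ⟨N, hN⟩ := hgd t ht
    refine Lp.ext ?_
    exact (hg.ae_eq_of_dispersiveFlow hα0 hα1 hF hD hfF hE hZ ht hN).trans (hft t ht).1.symm

end

end VlasovRiesz

end

theorem theorem2p1 (α lam : ℝ) (hα0 : 0 < α) (hα1 : α < 1) (hlam : lam = 1 ∨ lam = -1) :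
    ∃ η₀ : ℝ, 0 < η₀ ∧ ∃ C : ℝ, 0 < C ∧
      ∀ η : ℝ, 0 < η → η ≤ η₀ →
      ∀ f₀ : VlasovRiesz.Phase → ℝ, (∀ᵐ z, 0 ≤ f₀ z) →
        VlasovRiesz.dataNorm f₀ ≤ ENNReal.ofReal η →
        ∃ f : ℝ → Lp ℝ ∞ (volume : Measure VlasovRiesz.Phase),
          -- global existence
          VlasovRiesz.IsGlobalSolution α lam f₀ f ∧
          -- dispersion of the density
          (∀ t : ℝ, 0 ≤ t →
            ENNReal.ofReal (VlasovRiesz.bracket t ^ 3) *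
                VlasovRiesz.normW1 ∞ (VlasovRiesz.density (f t))
              ≤ ENNReal.ofReal (C * η)) ∧
          -- decay of the force field and of its first two derivatives
          (∀ t : ℝ, 0 ≤ t →
            ENNReal.ofReal (VlasovRiesz.bracket t ^ (1 + α)) *
                VlasovRiesz.normSup (VlasovRiesz.force α lam (f t)) +
              ENNReal.ofReal (VlasovRiesz.bracket t ^ (2 + α)) *
                VlasovRiesz.normSupGrad (VlasovRiesz.force α lam (f t)) +
              ENNReal.ofReal (VlasovRiesz.bracket t ^ 3) *
                VlasovRiesz.normSupHess (VlasovRiesz.force α lam (f t))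
              ≤ ENNReal.ofReal (C * η)) ∧
          -- uniqueness among all global solutions with locally bounded density
          (∀ g : ℝ → Lp ℝ ∞ (volume : Measure VlasovRiesz.Phase),
            VlasovRiesz.IsGlobalSolution α lam f₀ g →
            (∀ T : ℝ, 0 ≤ T → ∃ M : ℝ≥0, ∀ t : ℝ, 0 ≤ t → t ≤ T →
              eLpNorm (VlasovRiesz.density (g t)) ∞ volume ≤ M) →
            ∀ t : ℝ, 0 ≤ t → g t = f t) := by
  exact VlasovRiesz.exists_dispersive_solution α lam hα0 hα1
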